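/- Let $\Lambda$ be a connected complex manifold and let $f:\Lambda\times\mathbb{P}^1\to\mathbb{P}^1$ be a holomorphic family of rational functions of degree $d>1$, that is, $f$ is holomorphic and every $f_\lambda=f(\lambda,\cdot)$ is a rational function of degree $d$. Assume that there are holomorphic maps $c_1,\dots,c_{2d-2}:\Lambda\to\mathbb{P}^1$ such that, for every $\lambda\in\Lambda$, $c_1(\lambda),\dots,c_{2d-2}(\lambda)$ are all the critical points of $f_\lambda$, taking into account their multiplicities. *Notation.* For holomorphic functions on $\Lambda$, or holomorphic maps from $\Lambda$ to $\mathbb{P}^1$, $\phi\not\equiv\psi$, let $[\phi=\psi]$ be the current of integration over the divisor defined by $\phi=\psi$; by convention $[\phi=\psi]:=0$ if $\phi\equiv\psi$ on $\Lambda$. For $n\ge 1$ and $c=c_j$ let $F_n(\lambda):=f_\lambda^n(c(\lambda))$ and $\operatorname{Per}_c(n):=[F_n=c]$; let $X_n$ be the closure in $\Lambda$ of $\operatorname{supp}[F_n=c]\setminus\bigcup_{m\mid n,\,m<n}\operatorname{supp}[F_m=c]$, and put $$\operatorname{Per}_c^*(n):=\sum_V \operatorname{ord}_V(\operatorname{Per}_c(n))\cdot[V],$$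 where $V$ ranges over the irreducible components of $X_n$ and $[V]$ is the current of integration over $V$. For $\lambda\in\Lambda$ let $\tilde f_\lambda:\mathbb{C}^2\to\mathbb{C}^2$ be a homogeneous polynomial lift of $f_\lambda$, let $(z_0,z_1)\wedge(w_0,w_1):=z_0w_1-z_1w_0$, and let $z^{(n)}_1(\lambda),\dots,z^{(n)}_{\nu(n)}(\lambda)\in\mathbb{P}^1$ be the zeros, with multiplicity, of the dynatomic polynomial $$\Phi^*_{\tilde f_\lambda,n}(p)=\prod_{m\mid n}\bigl(\tilde f_\lambda^m(p)\wedge p\bigr)^{\mu(n/m)},$$ a homogeneous polynomial on $\mathbb{C}^2$ of degree $\nu(n)=\sum_{m\mid n}\mu(n/m)(d^m+1)$; these zeros do not depend on the lift. Let $\sigma^*_j(n,\lambda)$ be the $j$-th elementary symmetric function of $(f_\lambda^n)'(z_k^{(n)}(\lambda))$, $1\le k\le\nu(n)$. The multiplier polynomial $p_n^*$ is the holomorphic function on $\Lambda\times\mathbb{C}$, unique up to multiplication by $n$-th roots of unity, such that $$p_n^*(\lambda,w)^n=\sum_{j=0}^{\nu(n)}\sigma^*_j(n,\lambda)(-w)^{\nu(n)-j}\quad\text{on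 }\Lambda\times\mathbb{C},$$ and $\operatorname{Per}_f^*(n,0):=[p_n^*(\cdot,0)=0]$ on $\Lambda$. *Statement.* For every $\lambda_0\in\Lambda$ there are an open neighborhood $U$ of $\lambda_0$ in $\Lambda$ and an integer $N_0\ge 0$ such that for every $n>N_0$, $$\operatorname{Per}_f^*(n,0)=\sum_{j=1}^{2d-2}\operatorname{Per}_{c_j}^*(n)\quad\text{as currents on }U.$$ -/

import Mathlib

open Set Filter Topology MeasureTheory
open scoped Manifold ContDiff Distributions

noncomputable section

namespace HolDyn

/-! ## The Riemann sphere

The projective line over `ℂ` is `OnePoint ℂ`, with the charts `z` on `ℂ` and `1 / z` near `∞`. -/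

/-- The inversion `z ↦ 1 / z` of the Riemann sphere. -/
def sphereInv (z : OnePoint ℂ) : OnePoint ℂ :=
  z.elim ((0 : ℂ) : OnePoint ℂ)
    (fun w => if w = 0 then OnePoint.infty else ((w⁻¹ : ℂ) : OnePoint ℂ))

theorem sphereInv_infty : sphereInv OnePoint.infty = ((0 : ℂ) : OnePoint ℂ) := rfl

theorem sphereInv_zero : sphereInv ((0 : ℂ) : OnePoint ℂ) = OnePoint.infty := by
  simp [sphereInv]

theorem sphereInv_coe {w : ℂ} (hw : w ≠ 0) :
    sphereInv (w : OnePoint ℂ) = ((w⁻¹ : ℂ) : OnePoint ℂ) := by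
  simp [sphereInv, hw]

theorem sphereInv_involutive : Function.Involutive sphereInv := by
  intro z
  induction z using OnePoint.rec with
  | infty => rw [sphereInv_infty, sphereInv_zero]
  | coe w =>
    by_cases hw : w = 0
    · subst hw; rw [sphereInv_zero, sphereInv_infty]
    · rw [sphereInv_coe hw, sphereInv_coe (inv_ne_zero hw), inv_inv]

theorem continuous_sphereInv : Continuous sphereInv := by
  rw [OnePoint.continuous_iff]
  constructor
  · have h : Tendsto (fun w : ℂ => ((w⁻¹ : ℂ) : OnePoint ℂ)) (coclosedCompact ℂ)
        (𝓝 ((0 : ℂ) : OnePoint ℂ)) := by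
      rw [coclosedCompact_eq_cocompact]
      exact (OnePoint.continuous_coe.tendsto 0).comp (Filter.tendsto_inv₀_cobounded.mono_left
        (Metric.cobounded_eq_cocompact (α := ℂ)).ge)
    refine h.congr' ?_
    have hne : ∀ᶠ w : ℂ in coclosedCompact ℂ, w ≠ 0 := by
      have := (isCompact_singleton (x := (0 : ℂ))).compl_mem_cocompact
      rw [coclosedCompact_eq_cocompact]
      filter_upwards [this] with w hw using hw
    filter_upwards [hne] with w hw using (sphereInv_coe hw).symm
  · rw [continuous_iff_continuousAt]
    intro w
    by_cases hw : w = 0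
    · subst hw
      rw [ContinuousAt, sphereInv_zero, ← pure_sup_nhdsNE, tendsto_sup]
      constructor
      · rw [tendsto_pure_left]
        intro s hs
        rw [sphereInv_zero]
        exact mem_of_mem_nhds hs
      · have h : Tendsto (fun w : ℂ => ((w⁻¹ : ℂ) : OnePoint ℂ)) (𝓝[≠] 0)
            (𝓝 OnePoint.infty) := by
          refine OnePoint.tendsto_coe_infty.comp ?_
          rw [coclosedCompact_eq_cocompact, ← Metric.cobounded_eq_cocompact]
          exact Filter.tendsto_inv₀_nhdsNE_zero
        refine h.congr' ?_
        filter_upwards [self_mem_nhdsWithin] with v hv using (sphereInv_coe hv).symm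
    · have h : ContinuousAt (fun w : ℂ => ((w⁻¹ : ℂ) : OnePoint ℂ)) w :=
        OnePoint.continuous_coe.continuousAt.comp (continuousAt_inv₀ hw)
      refine h.congr ?_
      filter_upwards [isOpen_ne.mem_nhds hw] with v hv using (sphereInv_coe hv).symm

/-- The inversion as a homeomorphism. -/
def sphereInvHomeo : OnePoint ℂ ≃ₜ OnePoint ℂ where
  toEquiv := sphereInv_involutive.toPerm
  continuous_toFun := continuous_sphereInv
  continuous_invFun := continuous_sphereInv

/-- The affine chart `z` on `ℂ`. -/
def affineChart : OpenPartialHomeomorph (OnePoint ℂ) ℂ :=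
  (OnePoint.isOpenEmbedding_coe.toOpenPartialHomeomorph ((↑) : ℂ → OnePoint ℂ)).symm

/-- The chart `1 / z` on the complement of `0`. -/
def infinityChart : OpenPartialHomeomorph (OnePoint ℂ) ℂ :=
  sphereInvHomeo.toOpenPartialHomeomorph.trans affineChart

open Classical in
instance : ChartedSpace ℂ (OnePoint ℂ) where
  atlas := {affineChart, infinityChart}
  chartAt z := if z = OnePoint.infty then infinityChart else affineChart
  mem_chart_source z := by
    by_cases hz : z = OnePoint.infty
    · subst hz
      simp only [↓reduceIte, infinityChart, affineChart, OpenPartialHomeomorph.trans_source,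
        Homeomorph.toOpenPartialHomeomorph_source, univ_inter,
        OpenPartialHomeomorph.symm_source]
      exact ⟨0, mem_univ _, rfl⟩
    · obtain ⟨w, rfl⟩ := OnePoint.ne_infty_iff_exists.1 hz
      simp [affineChart]
  chart_mem_atlas z := by
    by_cases hz : z = OnePoint.infty <;> simp [hz]

theorem affineChart_coe (w : ℂ) : affineChart (w : OnePoint ℂ) = w :=
  (OnePoint.isOpenEmbedding_coe.toOpenPartialHomeomorph
    ((↑) : ℂ → OnePoint ℂ)).left_inv (mem_univ w)

theorem affineChart_symm (w : ℂ) : affineChart.symm w = (w : OnePoint ℂ) := rfl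

theorem infinityChart_apply (z : OnePoint ℂ) : infinityChart z = affineChart (sphereInv z) := rfl

theorem infinityChart_symm (w : ℂ) : infinityChart.symm w = sphereInv (w : OnePoint ℂ) := rfl

theorem mem_affineChart_source {z : OnePoint ℂ} :
    z ∈ affineChart.source ↔ z ≠ OnePoint.infty := by
  rw [OnePoint.ne_infty_iff_exists]
  simp [affineChart]

theorem mem_infinityChart_source {z : OnePoint ℂ} :
    z ∈ infinityChart.source ↔ sphereInv z ≠ OnePoint.infty := by
  rw [← mem_affineChart_source]
  simp only [infinityChart, OpenPartialHomeomorph.trans_source,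
    Homeomorph.toOpenPartialHomeomorph_source, univ_inter]
  rfl

instance : IsManifold 𝓘(ℂ, ℂ) ω (OnePoint ℂ) := by
  have hinv : ContDiffOn ℂ ω (fun w : ℂ => w⁻¹) {w | w ≠ 0} :=
    fun w hw => (contDiffAt_inv ℂ hw).contDiffWithinAt
  apply isManifold_of_contDiffOn
  rintro e e' (rfl | rfl) (rfl | rfl)
  all_goals
    simp only [modelWithCornersSelf_coe, modelWithCornersSelf_coe_symm, Function.comp_id,
      Function.id_comp, preimage_id, range_id, inter_univ]
  · refine contDiffOn_id.congr fun w hw => ?_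
    exact affineChart_coe w
  · refine (hinv.mono fun w hw => ?_).congr fun w hw => ?_
    all_goals
      have hw0 : w ≠ 0 := by
        rintro rfl
        have h := (mem_infinityChart_source.1 hw.2)
        exact h sphereInv_zero
    · exact hw0
    · change affineChart (sphereInv (w : OnePoint ℂ)) = w⁻¹
      rw [sphereInv_coe hw0, affineChart_coe]
  · refine (hinv.mono fun w hw => ?_).congr fun w hw => ?_
    all_goals
      have hw0 : w ≠ 0 := by
        rintro rfl
        have h := (mem_affineChart_source.1 hw.2)
        exact h sphereInv_zero
    · exact hw0
    · change affineChart (sphereInv (w : OnePoint ℂ)) = w⁻¹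
      rw [sphereInv_coe hw0, affineChart_coe]
  · refine contDiffOn_id.congr fun w hw => ?_
    change affineChart (sphereInv (sphereInv (w : OnePoint ℂ))) = w
    rw [sphereInv_involutive, affineChart_coe]

/-- The canonical projection `ℂ² ∖ {0} → ℙ¹`, `(z₀, z₁) ↦ z₀ / z₁`. -/
def proj (p : Fin 2 → ℂ) : OnePoint ℂ :=
  open Classical in
  if p 1 = 0 then OnePoint.infty else ((p 0 / p 1 : ℂ) : OnePoint ℂ)

/-! ## Rational functions -/

/-- The pair `F = (F₀, F₁)` is a homogeneous lift to `ℂ²` of the self-map `g` of the Riemann sphere: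
both components are homogeneous of degree `d`, the only common zero is the origin, and `F`
induces `g` on the sphere. -/
def IsLift (d : ℕ) (F : Fin 2 → MvPolynomial (Fin 2) ℂ) (g : OnePoint ℂ → OnePoint ℂ) : Prop :=
  (∀ i, (F i).IsHomogeneous d) ∧
  ∀ p : Fin 2 → ℂ, p ≠ 0 →
    (fun i => MvPolynomial.eval p (F i)) ≠ 0 ∧
      g (proj p) = proj (fun i => MvPolynomial.eval p (F i))

/-- `g` is a rational function of degree `d` on the Riemann sphere. -/
def IsRational (d : ℕ) (g : OnePoint ℂ → OnePoint ℂ) : Prop :=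
  ∃ F, IsLift d F g

/-- The derivative of `g` at `z` in the preferred charts at `z` and `g z`. When `g z = z`, this is
the multiplier of the fixed point `z`, which does not depend on the chart. -/
def chartDeriv (g : OnePoint ℂ → OnePoint ℂ) (z : OnePoint ℂ) : ℂ :=
  deriv (writtenInExtChartAt 𝓘(ℂ, ℂ) 𝓘(ℂ, ℂ) z g) (extChartAt 𝓘(ℂ, ℂ) z z)

/-- The multiplicity of `z` as a critical point of `g`: the order of vanishing at `z` of the
derivative of `g` in charts. It is zero if and only if `z` is not a critical point. -/
def criticalMultiplicity (g : OnePoint ℂ → OnePoint ℂ) (z : OnePoint ℂ) : ℕ∞ :=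
  analyticOrderAt (deriv (writtenInExtChartAt 𝓘(ℂ, ℂ) 𝓘(ℂ, ℂ) z g)) (extChartAt 𝓘(ℂ, ℂ) z z)

/-- The homogeneous components of the `m`-th iterate of `F : ℂ² → ℂ²`. -/
def iterLift (F : Fin 2 → MvPolynomial (Fin 2) ℂ) : ℕ → Fin 2 → MvPolynomial (Fin 2) ℂ
  | 0 => MvPolynomial.X
  | m + 1 => fun i => MvPolynomial.bind₁ (iterLift F m) (F i)

/-- The polynomial `p ↦ F^m(p) ∧ p`, where `(z₀, z₁) ∧ (w₀, w₁) = z₀ w₁ - z₁ w₀`. -/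
def periodPoly (F : Fin 2 → MvPolynomial (Fin 2) ℂ) (m : ℕ) : MvPolynomial (Fin 2) ℂ :=
  iterLift F m 0 * MvPolynomial.X 1 - iterLift F m 1 * MvPolynomial.X 0

/-- The dynatomic polynomial `Φ*_{F,n}(p) = ∏_{m ∣ n} (F^m(p) ∧ p)^{μ(n/m)}`, as an element of the
field of fractions of the polynomial ring. -/
def dynatomic (F : Fin 2 → MvPolynomial (Fin 2) ℂ) (n : ℕ) :
    FractionRing (MvPolynomial (Fin 2) ℂ) :=
  ∏ m ∈ n.divisors,
    (algebraMap (MvPolynomial (Fin 2) ℂ) (FractionRing (MvPolynomial (Fin 2) ℂ))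
      (periodPoly F m)) ^ (ArithmeticFunction.moebius (n / m))

/-- The linear form `p ↦ p ∧ q`. -/
def wedgeForm (q : Fin 2 → ℂ) : MvPolynomial (Fin 2) ℂ :=
  MvPolynomial.X 0 * MvPolynomial.C (q 1) - MvPolynomial.X 1 * MvPolynomial.C (q 0)

/-- `Z` is a multiset of nonzero vectors `z̃_k` with `Φ*_{F,n}(p) = ∏_k (p ∧ z̃_k)`. (Its
cardinality is necessarily the degree `∑_{m ∣ n} μ(n/m) (d^m + 1)` of `Φ*_{F,n}`.) -/
def IsDynatomicFactorization (F : Fin 2 → MvPolynomial (Fin 2) ℂ) (n : ℕ)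
    (Z : Multiset (Fin 2 → ℂ)) : Prop :=
  (∀ q ∈ Z, q ≠ 0) ∧
  dynatomic F n = algebraMap (MvPolynomial (Fin 2) ℂ) (FractionRing (MvPolynomial (Fin 2) ℂ))
    (Z.map wedgeForm).prod

/-! ## Holomorphic families

A complex manifold of dimension `k` is modelled on `ℂ^k = EuclideanSpace ℂ (Fin k)`, and
holomorphic maps are the maps of class `C^ω` over `ℂ`. -/

section Family

variable (k : ℕ) {M : Type*} [TopologicalSpace M] [ChartedSpace (EuclideanSpace ℂ (Fin k)) M]

/-- `f` is a holomorphic family of rational functions of degree `d` over `M`. -/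
def IsHolomorphicFamily (d : ℕ) (f : M → OnePoint ℂ → OnePoint ℂ) : Prop :=
  ContMDiff (𝓘(ℂ, EuclideanSpace ℂ (Fin k)).prod 𝓘(ℂ, ℂ)) 𝓘(ℂ, ℂ) ω (Function.uncurry f) ∧
  ∀ t, IsRational d (f t)

/-- The `c j` are holomorphic, and for every parameter `t` the `c j t` are all the critical points of
`f t`, each repeated according to its multiplicity. -/
def MarksCriticalPoints {ι : Type*} (f : M → OnePoint ℂ → OnePoint ℂ)
    (c : ι → M → OnePoint ℂ) : Prop :=
  (∀ j, ContMDiff 𝓘(ℂ, EuclideanSpace ℂ (Fin k)) 𝓘(ℂ, ℂ) ω (c j)) ∧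
  ∀ t z, {j | c j t = z}.encard = criticalMultiplicity (f t) z

/-- The defining property of the multiplier polynomial: `P` is holomorphic on `M × ℂ`, and for every
parameter `t`, `P(t, w)^n = ∑_{j=0}^{ν} σ_j (-w)^{ν - j}`, where the `σ_j` are the elementary symmetric
functions of the multipliers `(f_t^n)'(z_k)` at the `ν = ν(n)` projective roots `z_k` of the
dynatomic polynomial of `f_t`. -/
def IsMultiplierPoly (d : ℕ) (f : M → OnePoint ℂ → OnePoint ℂ) (n : ℕ) (P : M → ℂ → ℂ) : Prop :=
  ContMDiff (𝓘(ℂ, EuclideanSpace ℂ (Fin k)).prod 𝓘(ℂ, ℂ)) 𝓘(ℂ, ℂ) ω (Function.uncurry P) ∧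
  ∀ t, ∃ F Z, IsLift d F (f t) ∧ IsDynatomicFactorization F n Z ∧
    ∀ w, P t w ^ n = ∑ j ∈ Finset.range (Z.card + 1),
      (Z.map fun q => chartDeriv (f t)^[n] (proj q)).esymm j * (-w) ^ (Z.card - j)

open Classical in
/-- The multiplier polynomial `p_n^*`, which its defining property determines up to multiplication
by `n`-th roots of unity (when `M` is connected). -/
def multiplierPoly (d : ℕ) (f : M → OnePoint ℂ → OnePoint ℂ) (n : ℕ) : M → ℂ → ℂ :=
  if h : ∃ P, IsMultiplierPoly k d f n P then h.choose else 0

end Family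

/-! ## Analytic hypersurfaces and currents of integration -/

section Hypersurfaces

variable (k : ℕ) {M : Type*} [TopologicalSpace M] [ChartedSpace (EuclideanSpace ℂ (Fin k)) M]

/-- Near `x`, the set `A` is the zero set of the holomorphic function `h`, and `dh ≠ 0` at `x`. -/
def IsLocalEquation (A : Set M) (x : M) (h : M → ℂ) : Prop :=
  ContMDiffAt 𝓘(ℂ, EuclideanSpace ℂ (Fin k)) 𝓘(ℂ, ℂ) ω h x ∧
  mfderiv 𝓘(ℂ, EuclideanSpace ℂ (Fin k)) 𝓘(ℂ, ℂ) h x ≠ 0 ∧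
  ∀ᶠ y in 𝓝 x, y ∈ A ↔ h y = 0

/-- The points of `A` near which `A` is a complex submanifold of codimension one. -/
def regularPart (A : Set M) : Set M :=
  {x ∈ A | ∃ h : M → ℂ, IsLocalEquation k A x h}

/-- The irreducible components of an analytic hypersurface `A`: the closures of the connected
components of its regular part. -/
def analyticComponents (A : Set M) : Set (Set M) :=
  {V | ∃ x ∈ regularPart k A, V = closure (connectedComponentIn (regularPart k A) x)}

end Hypersurfaces

section Currents

variable {k : ℕ} {M : Type*} [TopologicalSpace M] [ChartedSpace (EuclideanSpace ℂ (Fin k)) M]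

/-- A test form: a smooth complex form of degree `2(k-1)` on `M`, with compact support contained in
the domain of a holomorphic chart, and written in that chart. (Every compactly supported smooth form
is a finite sum of such forms. A current of integration over a hypersurface only sees the component
of bidegree `(k-1, k-1)`.) -/
structure TestForm (k : ℕ) (M : Type*) [TopologicalSpace M]
    [ChartedSpace (EuclideanSpace ℂ (Fin k)) M] where
  chart : OpenPartialHomeomorph M (EuclideanSpace ℂ (Fin k))
  chart_mem : chart ∈ IsManifold.maximalAtlas 𝓘(ℂ, EuclideanSpace ℂ (Fin k)) ω M
  form : 𝓓((⟨chart.target, chart.open_target⟩ :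
      TopologicalSpace.Opens (EuclideanSpace ℂ (Fin k))),
    (EuclideanSpace ℂ (Fin k)) [⋀^Fin (2 * (k - 1))]→L[ℝ] ℂ)

/-- The support on `M` of a test form. -/
def TestForm.support (φ : TestForm k M) : Set M :=
  φ.chart.symm '' tsupport φ.form

/-- A current of degree `2` (for instance, of bidegree `(1, 1)`) is given by its values on the
test forms. -/
abbrev Current (k : ℕ) (M : Type*) [TopologicalSpace M]
    [ChartedSpace (EuclideanSpace ℂ (Fin k)) M] : Type _ :=
  TestForm k M → ℂ

/-- `T = S` on `U`. -/
def Current.EqualOn (U : Set M) (T S : Current k M) : Prop :=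
  ∀ φ : TestForm k M, φ.support ⊆ U → T φ = S φ

/-- `v` is a unitary basis of the tangent hyperplane of `A` at its regular point `y`. -/
def IsTangentBasis (A : Set (EuclideanSpace ℂ (Fin k))) (y : EuclideanSpace ℂ (Fin k))
    (v : Fin (k - 1) → EuclideanSpace ℂ (Fin k)) : Prop :=
  Orthonormal ℂ v ∧ ∃ h, IsLocalEquation k A y h ∧ ∀ i, fderiv ℂ h y (v i) = 0

/-- The real frame `(v₀, i v₀, v₁, i v₁, …)`. -/
def realFrame (v : Fin (k - 1) → EuclideanSpace ℂ (Fin k)) :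
    Fin (2 * (k - 1)) → EuclideanSpace ℂ (Fin k) :=
  fun a => if (a : ℕ) % 2 = 0 then v ⟨a / 2, by omega⟩ else Complex.I • v ⟨a / 2, by omega⟩

open Classical in
/-- A positively oriented real orthonormal basis of the tangent hyperplane of `A` at a regular point
`y`. (The value of an alternating form on it does not depend on the choice of a unitary basis.) -/
def tangentFrame (A : Set (EuclideanSpace ℂ (Fin k))) (y : EuclideanSpace ℂ (Fin k)) :
    Fin (2 * (k - 1)) → EuclideanSpace ℂ (Fin k) :=
  if h : ∃ v, IsTangentBasis A y v then realFrame h.choose else 0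

/-- The integral of the form `φ` over the regular part of the hypersurface `A` of `ℂ^k`, with its
complex orientation: the integral of the value of `φ` on the oriented unit tangent frame, with
respect to the `2(k-1)`-dimensional area. -/
def integralOverRegular (A : Set (EuclideanSpace ℂ (Fin k)))
    (φ : EuclideanSpace ℂ (Fin k) →
      (EuclideanSpace ℂ (Fin k)) [⋀^Fin (2 * (k - 1))]→L[ℝ] ℂ) : ℂ :=
  ∫ y in regularPart k A, φ y (tangentFrame A y)
    ∂(μHE[2 * (k - 1)] : Measure (EuclideanSpace ℂ (Fin k)))

/-- The current of integration `[A]` over the analytic hypersurface `A` of `M`. -/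
def integrationCurrent (A : Set M) : Current k M :=
  fun φ => integralOverRegular (φ.chart.target ∩ φ.chart.symm ⁻¹' A) φ.form

/-- The generic value along `V` of an order of vanishing: its minimum on `V`. -/
def orderAlong (ord : M → ℕ∞) (V : Set M) : ℕ :=
  (⨅ x ∈ V, ord x).toNat

/-- The current `∑_V ord_V [V]`, where `V` ranges over the irreducible components of `A`. -/
def divisorCurrent (A : Set M) (ord : M → ℕ∞) : Current k M :=
  fun φ => ∑' V : analyticComponents k A,
    (orderAlong ord (V : Set M) : ℂ) * integrationCurrent (V : Set M) φ

/-- The order of vanishing of a holomorphic function at a point of `ℂ^k`: the least order of a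
derivative that does not vanish there. -/
def vanishingOrder (h : EuclideanSpace ℂ (Fin k) → ℂ) (y : EuclideanSpace ℂ (Fin k)) : ℕ∞ :=
  ⨅ m ∈ {m : ℕ | iteratedFDeriv ℂ m h y ≠ 0}, (m : ℕ∞)

variable {N : Type*} [TopologicalSpace N] [ChartedSpace ℂ N]

open Classical in
/-- For holomorphic maps `F, G` from `M` to a Riemann surface `N`, the order at `x` of the divisor
defined by the equation `F = G`: the order of vanishing of `F - G`, computed in charts. -/
def coincidenceOrder (k : ℕ) [ChartedSpace (EuclideanSpace ℂ (Fin k)) M]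
    (F G : M → N) (x : M) : ℕ∞ :=
  if F x = G x then
    vanishingOrder
      (fun y => chartAt ℂ (G x) (F ((chartAt (EuclideanSpace ℂ (Fin k)) x).symm y)) -
        chartAt ℂ (G x) (G ((chartAt (EuclideanSpace ℂ (Fin k)) x).symm y)))
      (chartAt (EuclideanSpace ℂ (Fin k)) x x)
  else 0

/-- The support of the current `[F = G]`: the coincidence set, or `∅` when `F` and `G` are
identical, since then `[F = G] = 0` by convention. -/
def coincidenceSupport {X Y : Type*} (F G : X → Y) : Set X :=
  {x | F ≠ G ∧ F x = G x}

/-- The current of integration `[F = G]` over the divisor defined by the equation `F = G`, with the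
convention that `[F = G] = 0` if `F` and `G` are identical. -/
def coincidenceCurrent (F G : M → N) : Current k M :=
  divisorCurrent (coincidenceSupport F G) (coincidenceOrder k F G)

end Currents

/-! ## The currents of periodic parameters -/

section Per

variable {k : ℕ} {M : Type*} [TopologicalSpace M] [ChartedSpace (EuclideanSpace ℂ (Fin k)) M]

/-- `F_n(t) = f_t^n(c(t))`. -/
def orbitMap (f : M → OnePoint ℂ → OnePoint ℂ) (c : M → OnePoint ℂ) (n : ℕ) : M → OnePoint ℂ :=
  fun t => (f t)^[n] (c t)

/-- The closure `X_n` of `supp [F_n = c] ∖ ⋃_{m ∣ n, m < n} supp [F_m = c]`. -/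
def exactPeriodLocus (f : M → OnePoint ℂ → OnePoint ℂ) (c : M → OnePoint ℂ) (n : ℕ) : Set M :=
  closure (coincidenceSupport (orbitMap f c n) c \
    ⋃ m ∈ n.properDivisors, coincidenceSupport (orbitMap f c m) c)

/-- `Per_c^*(n) = ∑_V ord_V(Per_c(n)) [V]`, where `V` ranges over the irreducible components of `X_n`
and `Per_c(n) = [F_n = c]`. -/
def perCritical (f : M → OnePoint ℂ → OnePoint ℂ) (c : M → OnePoint ℂ) (n : ℕ) : Current k M :=
  divisorCurrent (exactPeriodLocus f c n) (coincidenceOrder k (orbitMap f c n) c)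

/-- `Per_f^*(n, w) = [p_n^*(·, w) = 0]`. -/
def perMultiplier (d : ℕ) (f : M → OnePoint ℂ → OnePoint ℂ) (n : ℕ) (w : ℂ) : Current k M :=
  coincidenceCurrent (fun t => multiplierPoly k d f n t w) (fun _ => (0 : ℂ))

end Per

end HolDyn

end

open HolDyn

/-!
The equality of currents holds on all of `Λ`; only the integer `N₀` needs care. If a critical point
`c j` is persistently periodic, that is `f_t^m (c j) = c j` for all `t` and some `m ≥ 1`, then it is
of exact period `n` for no `t` once `n > m`. So for large `n` the set `E j` of the parameters for
which `c j` has exact period `n` is nowhere dense. It is closed, because a critical periodic point is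
a simple fixed point and hence keeps its exact period in the limit
(`MarksCriticalPoints.isClosed_exactPeriodSet`), and therefore it is the locus on which `Per*_{c j}`
is supported (`MarksCriticalPoints.exists_exactPeriodLocus_eq`).

Divisors are compared through the growth of functions. The order of vanishing of a holomorphic
function is a growth exponent, so it depends only on the class of the function modulo `=Θ`. If `g` is
comparable to `∏ j, h j`, where `h j` is a local equation of `E j`, then the divisor of `g` is the sum
of the divisors of the `h j`: this is `divisorCurrent_eq_sum`. Behind it lie the facts that the
zero set of a holomorphic function is, at a regular point, a hyperplane in a suitable chart
(`exists_isHyperplaneAt`), that a component of a hypersurface `E ⊆ A` is a component of `A`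
(`exists_mem_regularPart_of_mem_analyticComponents`), and that components are locally finite
(`IsHypersurface.exists_nhds_finite_components`), so that the sums over components that define the
currents are finite on each test form.

To compare `p_n^*(·, 0)` with the equations of the `E j`, work in the coordinate `1 / (z - a)`, where
`a` is not fixed by `f_t^n` and is not a critical point. There the zeros of the dynatomic polynomial
form a multiset `D_t` of complex numbers (`dynatomicRoots`), which is a union of cycles. By the chain
rule along the cycles, `|p_n^*(t, 0)| = |∏_{ζ ∈ D_t} f_t'(ζ)|` (`IsMultiplierPoly.norm_apply_zero`).
A holomorphic family of functions is comparable to the product of the linear factors given by its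
zeros (`isTheta_prod_roots`), so that `f_t'(ζ)` is comparable to `∏_j (ζ - c_j(t))`. Exchanging the
two products, `p_n^*(t, 0)` is comparable to `∏_j ∏_{ζ ∈ D_t} (c_j(t) - ζ)`
(`MarksCriticalPoints.isTheta_multiplierPoly`). The inner product does not vanish off `E j`, and near
a point of `E j` it is comparable to `f_t^n(c_j(t)) - c_j(t)`, since the other factors of the
dynatomic polynomial do not vanish there
(`IsHolomorphicFamily.isTheta_prod_dynatomicRoots_sub`). Altogether this is
`MarksCriticalPoints.exists_local_equations`.

That a multiplier polynomial exists is part of the proof. The multiplicity of a periodic point as a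
zero of the dynatomic polynomial is governed by the order of its multiplier as a root of unity
(`exists_analyticOrderAt_iterate_sub_id_eq`); hence these multiplicities are nonnegative and the
multipliers come in groups of `n` (`IsLift.exists_nsmul_eq_map_deriv`). The power sums of the
multipliers over `D_t` are holomorphic in `t` by the argument principle
(`exists_analyticAt_sum_roots`), and Newton's identities turn them into the coefficients of `p_n^*`
(`IsHolomorphicFamily.exists_isMultiplierPoly`).
-/

namespace HolDyn

/-! ### Parametric integrals -/

section ParametricIntegral

variable {E : Type*} [NormedAddCommGroup E] [NormedSpace ℂ E]

/-- The case of a path `γ` that stays in a ball of convergence: the power series of `G` is recentred at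
each point `(t₀, γ θ)`, and its coefficients are integrated over `θ`. -/
theorem analyticAt_setIntegral_of_hasFPowerSeriesOnBall {G : E × ℂ → ℂ} {γ w : ℝ → ℂ}
    (hγ : Continuous γ) (hw : Continuous w) {t₀ : E} {ζ₀ : ℂ}
    {p : FormalMultilinearSeries ℂ (E × ℂ) ℂ} {R : ENNReal}
    (hp : HasFPowerSeriesOnBall G p (t₀, ζ₀) R) {r r' : NNReal} (hr' : 0 < r')
    (hr : (r + r' : ENNReal) < R) {K T : Set ℝ} (hK : IsCompact K)
    (hKr : ∀ θ ∈ K, ‖γ θ - ζ₀‖ ≤ r) (hTK : T ⊆ K) (hT : MeasurableSet T) :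
    AnalyticAt ℂ (fun t => ∫ θ in T, w θ * G (t, γ θ)) t₀ := by
  have hrad : (r + r' : ENNReal) < p.radius := hr.trans_le hp.r_le
  have hsum := NNReal.summable_sigma.1 (p.changeOriginSeries_summable_aux₁ hrad)
  set x : ℝ → E × ℂ := fun θ => (0, γ θ - ζ₀) with hx
  have hxc : Continuous x := by fun_prop
  have hxn : ∀ θ ∈ K, ‖x θ‖₊ ≤ r := fun θ hθ => by
    have : ‖x θ‖ ≤ r := by simpa [hx] using hKr θ hθ
    exact_mod_cast this
  have hrp : (r : ENNReal) < p.radius := lt_of_le_of_lt (by simp) hrad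
  -- The numbers `a n` bound the coefficients of all the recentred series at once.
  set a : ℕ → NNReal := fun n => ∑' s : Σ l : ℕ, { s : Finset (Fin (n + l)) // s.card = l },
    ‖p (n + s.1)‖₊ * r ^ s.1 with ha
  have hasum : Summable fun n => (a n : ℝ) * r' ^ n := by
    have := hsum.2
    have h2 : (fun n => a n * r' ^ n) = fun n => ∑' (y : (l : ℕ) × { s : Finset (Fin (n + l)) // s.card = l }), ‖p (n + y.fst)‖₊ * r ^ y.fst * r' ^ n := by
      funext n; rw [ha, NNReal.tsum_mul_right]
    rw [← h2] at this
    exact_mod_cast this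
  set c : ∀ n : ℕ, ℝ → ContinuousMultilinearMap ℂ (fun _ : Fin n => E) ℂ := fun n θ =>
    (p.changeOrigin (x θ) n).compContinuousLinearMap (fun _ => ContinuousLinearMap.inl ℂ E ℂ) with hc
  have hcn : ∀ n, ∀ θ ∈ K, ‖c n θ‖ ≤ a n := by
    intro n θ hθ
    have h1 : ‖p.changeOrigin (x θ) n‖₊ ≤ a n := by
      refine (p.nnnorm_changeOrigin_le n ?_).trans ?_
      · exact lt_of_le_of_lt (by exact_mod_cast hxn θ hθ) hrp
      · refine Summable.tsum_le_tsum (fun s => ?_) ?_ (p.changeOriginSeries_summable_aux₂ hrp n)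
        · gcongr; exact hxn θ hθ
        · exact p.changeOriginSeries_summable_aux₂
            (lt_of_le_of_lt (by exact_mod_cast hxn θ hθ) hrp) n
    refine (ContinuousMultilinearMap.norm_compContinuousLinearMap_le _ _).trans ?_
    have h2 : ‖ContinuousLinearMap.inl ℂ E ℂ‖ ≤ 1 := ContinuousLinearMap.norm_inl_le_one ℂ E ℂ
    calc _ ≤ (a n : ℝ) * 1 := by
          gcongr
          · exact_mod_cast h1
          · exact Finset.prod_le_one (fun _ _ => norm_nonneg _) (fun _ _ => h2)
      _ = a n := mul_one _
  have hcc : ∀ n, ContinuousOn (c n) K := by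
    intro n θ hθ
    have h1 : ContinuousAt (fun y => p.changeOrigin y n) (x θ) :=
      ((p.hasFPowerSeriesOnBall_changeOrigin n (hrp.pos)).analyticOnNhd (x θ)
        (by simpa [enorm] using lt_of_le_of_lt (by exact_mod_cast hxn θ hθ) hrp)).continuousAt
    have h2 : ContinuousAt (fun θ => p.changeOrigin (x θ) n) θ :=
      ContinuousAt.comp (f := x) h1 hxc.continuousAt
    exact ((ContinuousMultilinearMap.compContinuousLinearMapL (𝕜 := ℂ) (F := ℂ)
      (fun _ : Fin n => ContinuousLinearMap.inl ℂ E ℂ)).continuous.continuousAt.comp h2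
      ).continuousWithinAt
  obtain ⟨W, hW⟩ := hK.exists_bound_of_continuousOn hw.continuousOn
  have hTfin : volume T ≠ ⊤ := ((measure_mono hTK).trans_lt hK.measure_lt_top).ne
  have hci : ∀ n, IntegrableOn (fun θ => w θ • c n θ) T := fun n =>
    ((hw.continuousOn.smul (hcc n)).integrableOn_compact hK).mono_set hTK
  set q : FormalMultilinearSeries ℂ E ℂ := fun n => ∫ θ in T, w θ • c n θ with hq
  have hqe : ∀ n (s : E), q n (fun _ => s) = ∫ θ in T, w θ * p.changeOrigin (x θ) n (fun _ => (s, 0)) := by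
    intro n s
    have := (ContinuousMultilinearMap.apply ℂ (fun _ : Fin n => E) ℂ (fun _ => s)).integral_comp_comm (hci n)
    simp only [hq]
    rw [← ContinuousMultilinearMap.apply_apply (𝕜 := ℂ), ← this]
    simp [hc]
  have hbound : ∀ n (s : E), ‖s‖ ≤ r' → ∀ θ ∈ K,
      ‖w θ * p.changeOrigin (x θ) n (fun _ => (s, 0))‖ ≤ W * (a n * r' ^ n) := by
    intro n s hs θ hθ
    rw [norm_mul]
    have h3 : p.changeOrigin (x θ) n (fun _ => (s, 0)) = c n θ (fun _ => s) := by simp [hc]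
    have hW0 : 0 ≤ W := (norm_nonneg _).trans (hW θ hθ)
    gcongr
    · exact hW θ hθ
    · rw [h3]
      refine ((c n θ).le_opNorm _).trans ?_
      simp only [Finset.prod_const, Finset.card_univ, Fintype.card_fin]
      gcongr
      exact hcn n θ hθ
  have hqn : ∀ n, ‖q n‖ ≤ (W * (volume T).toReal) * a n := by
    intro n
    have := norm_setIntegral_le_of_norm_le_const (μ := volume) (f := fun θ => w θ • c n θ) (s := T) (C := W * a n) hTfin.lt_top (fun θ hθ => by
      rw [norm_smul]
      gcongr
      · exact (norm_nonneg _).trans (hW θ (hTK hθ))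
      · exact hW θ (hTK hθ)
      · exact hcn n θ (hTK hθ))
    refine this.trans (le_of_eq ?_)
    simp [Measure.real]; ring
  refine ⟨q, r', ⟨?_, by exact_mod_cast hr', ?_⟩⟩
  · refine FormalMultilinearSeries.le_radius_of_summable _ ?_
    refine Summable.of_nonneg_of_le (fun n => by positivity) (fun n => ?_) (hasum.mul_left (W * (volume T).toReal))
    calc _ ≤ (W * (volume T).toReal) * a n * r' ^ n := by gcongr; exact hqn n
      _ = _ := by ring
  · intro s hs
    have hs' : ‖s‖₊ < r' := by simpa [← NNReal.coe_lt_coe] using hs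
    have hs'' : ‖s‖ ≤ r' := by exact_mod_cast hs'.le
    have key : ∀ θ ∈ T, G (t₀ + s, γ θ) = ∑' n, p.changeOrigin (x θ) n (fun _ => (s, 0)) := by
      intro θ hθ
      have hb := hp.changeOrigin (y := x θ) (by
        calc (‖x θ‖₊ : ENNReal) ≤ r := by exact_mod_cast hxn θ (hTK hθ)
          _ < R := lt_of_le_of_lt (by simp) hr)
      have hm : ((s, 0) : E × ℂ) ∈ Metric.eball (0 : E × ℂ) (R - ‖x θ‖₊) := by
        rw [Metric.mem_eball, edist_zero_right]
        have h1 : ‖((s, 0) : E × ℂ)‖ₑ = ‖s‖ₑ := by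
          simp only [enorm, Prod.nnnorm_mk, nnnorm_zero]; simp
        rw [h1]
        refine lt_of_lt_of_le (b := (r' : ENNReal)) (by simpa [enorm] using hs') ?_
        refine ENNReal.le_sub_of_add_le_left (by simp) (le_trans ?_ hr.le)
        gcongr
        exact_mod_cast hxn θ (hTK hθ)
      have := (hb.hasSum hm).tsum_eq
      rw [this]
      congr 1
      simp [hx]
    have h1 : (fun n => q n fun _ => s) = fun n => ∫ θ in T, w θ * p.changeOrigin (x θ) n (fun _ => (s, 0)) :=
      funext fun n => hqe n s
    rw [h1]
    have h2 : ∫ θ in T, w θ * G (t₀ + s, γ θ) = ∫ θ in T, ∑' n, w θ * p.changeOrigin (x θ) n (fun _ => (s, 0)) := by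
      refine setIntegral_congr_fun hT fun θ hθ => ?_
      rw [key θ hθ, tsum_mul_left]
    rw [h2]
    refine hasSum_integral_of_summable_integral_norm (fun n => ?_) ?_
    · have := (ContinuousMultilinearMap.apply ℂ (fun _ : Fin n => E) ℂ (fun _ => s)).integrable_comp (hci n)
      refine this.congr (Eventually.of_forall fun θ => ?_)
      simp [hc]
    · refine Summable.of_nonneg_of_le (fun n => by positivity) (fun n => ?_) (hasum.mul_left (W * (volume T).toReal))
      have := norm_setIntegral_le_of_norm_le_const (μ := volume) (s := T) (f := fun θ => ‖w θ * p.changeOrigin (x θ) n (fun _ => (s, 0))‖) (C := W * (a n * r' ^ n)) hTfin.lt_top (fun θ hθ => by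
        rw [norm_norm]; exact hbound n s hs'' θ (hTK hθ))
      refine (Real.le_norm_self _).trans (this.trans (le_of_eq ?_))
      simp [Measure.real]; ring

/-- A parametric integral of a jointly analytic function is analytic in the parameter. -/
theorem analyticAt_setIntegral {G : E × ℂ → ℂ} {γ w : ℝ → ℂ}
    (hγ : Continuous γ) (hw : Continuous w) {t₀ : E} {K : Set ℝ} (hK : IsCompact K)
    (hG : ∀ θ ∈ K, AnalyticAt ℂ G (t₀, γ θ)) :
    AnalyticAt ℂ (fun t => ∫ θ in K, w θ * G (t, γ θ)) t₀ ∧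
      ∀ᶠ t in 𝓝 t₀, IntegrableOn (fun θ => w θ * G (t, γ θ)) K := by
  have hint : ∀ᶠ t in 𝓝 t₀, ∀ θ ∈ K, AnalyticAt ℂ G (t, γ θ) := by
    refine hK.eventually_forall_of_forall_eventually fun θ hθ => ?_
    have h1 := (hG θ hθ).eventually_analyticAt
    have h2 : ContinuousAt (fun z : E × ℝ => (z.1, γ z.2)) (t₀, θ) := by fun_prop
    exact h2.eventually h1
  have hint' : ∀ᶠ t in 𝓝 t₀, IntegrableOn (fun θ => w θ * G (t, γ θ)) K := by
    filter_upwards [hint] with t ht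
    refine ContinuousOn.integrableOn_compact hK fun θ hθ => ?_
    have h2 : ContinuousAt (fun θ : ℝ => (t, γ θ)) θ := by fun_prop
    exact (hw.continuousAt.mul (ContinuousAt.comp (f := fun θ : ℝ => (t, γ θ)) (ht θ hθ).continuousAt h2)).continuousWithinAt
  refine ⟨?_, hint'⟩
  -- By compactness, `K` is covered by finitely many sets on which the local case applies.
  have main : ∃ S', K ⊆ S' ∧ MeasurableSet S' ∧ ∀ T ⊆ S', T ⊆ K → MeasurableSet T →
      AnalyticAt ℂ (fun t => ∫ θ in T, w θ * G (t, γ θ)) t₀ := by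
    refine hK.induction_on (p := fun S => ∃ S', S ⊆ S' ∧ MeasurableSet S' ∧ ∀ T ⊆ S', T ⊆ K →
      MeasurableSet T → AnalyticAt ℂ (fun t => ∫ θ in T, w θ * G (t, γ θ)) t₀) ?_ ?_ ?_ ?_
    · refine ⟨∅, subset_rfl, MeasurableSet.empty, fun T hT _ _ => ?_⟩
      simp [subset_empty_iff.1 hT, analyticAt_const]
    · rintro s t hst ⟨S', h1, h2⟩
      exact ⟨S', hst.trans h1, h2⟩
    · rintro s t ⟨S₁, h1, hm1, h2⟩ ⟨S₂, h3, hm2, h4⟩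
      refine ⟨S₁ ∪ S₂, union_subset_union h1 h3, hm1.union hm2, fun T hT hTK hTm => ?_⟩
      have h5 := (h2 (T ∩ S₁) inter_subset_right (inter_subset_left.trans hTK) (hTm.inter hm1)).add
        (h4 (T \ S₁) (fun y hy => (hT hy.1).resolve_left hy.2) (sdiff_subset.trans hTK) (hTm.diff hm1))
      refine h5.congr ?_
      filter_upwards [hint'] with t ht
      simp only [Pi.add_apply]
      exact integral_inter_add_sdiff hm1 (ht.mono_set hTK)
    · intro θ₀ hθ₀
      obtain ⟨p, R, hp⟩ := hG θ₀ hθ₀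
      obtain ⟨ρ, hρ0, hρ⟩ : ∃ ρ : NNReal, 0 < ρ ∧ (ρ + ρ : ENNReal) < R := by
        obtain ⟨ρ, h1, h2⟩ := ENNReal.lt_iff_exists_nnreal_btwn.1 hp.r_pos
        refine ⟨ρ / 2, half_pos (by exact_mod_cast h1), ?_⟩
        rw [← ENNReal.coe_add, add_halves]; exact h2
      have hcl : IsClosed {θ | ‖γ θ - γ θ₀‖ ≤ ρ} := isClosed_le (by fun_prop) continuous_const
      refine ⟨{θ | ‖γ θ - γ θ₀‖ ≤ ρ}, ?_, {θ | ‖γ θ - γ θ₀‖ ≤ ρ}, subset_rfl, hcl.measurableSet, ?_⟩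
      · refine mem_nhdsWithin_of_mem_nhds ?_
        have : ContinuousAt (fun θ => ‖γ θ - γ θ₀‖) θ₀ := by fun_prop
        have h0 : ‖γ θ₀ - γ θ₀‖ < ρ := by simpa using hρ0
        exact (this.eventually_lt_const h0).mono fun θ hθ => hθ.le
      · intro T hT hTK hTm
        exact analyticAt_setIntegral_of_hasFPowerSeriesOnBall hγ hw hp hρ0 hρ (hK.inter_right hcl)
          (fun θ hθ => hθ.2) (subset_inter hTK hT) hTm
  obtain ⟨S', h1, h2, h3⟩ := main
  exact h3 K h1 subset_rfl hK.measurableSet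

end ParametricIntegral

/-! ### Zeros of a holomorphic function in a disc -/

section Roots

/-- `R` is the multiset of zeros of `h` in the open disc of centre `z` and radius `ρ`, repeated
according to their multiplicities. -/
def IsRootMultiset (h : ℂ → ℂ) (z : ℂ) (ρ : ℝ) (R : Multiset ℂ) : Prop :=
  (∀ r ∈ R, r ∈ Metric.ball z ρ) ∧ ∀ r ∈ Metric.ball z ρ, (R.count r : ℕ∞) = analyticOrderAt h r

theorem IsRootMultiset.unique {h : ℂ → ℂ} {z : ℂ} {ρ : ℝ} {R R' : Multiset ℂ}
    (hR : IsRootMultiset h z ρ R) (hR' : IsRootMultiset h z ρ R') : R = R' := by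
  ext r
  by_cases hr : r ∈ Metric.ball z ρ
  · exact_mod_cast (hR.2 r hr).trans (hR'.2 r hr).symm
  · rw [Multiset.count_eq_zero_of_notMem fun h => hr (hR.1 r h),
      Multiset.count_eq_zero_of_notMem fun h => hr (hR'.1 r h)]

theorem analyticAt_multiset_prod_sub (R : Multiset ℂ) (z : ℂ) :
    AnalyticAt ℂ (fun ζ => (R.map (ζ - ·)).prod) z := by
  induction R using Multiset.induction_on with
  | empty => simpa using analyticAt_const
  | cons a s ih =>
    simp only [Multiset.map_cons, Multiset.prod_cons]
    exact (by fun_prop : AnalyticAt ℂ (fun ζ => ζ - a) z).mul ih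

theorem multiset_prod_sub_eq_zero {R : Multiset ℂ} {ζ : ℂ} :
    (R.map (ζ - ·)).prod = 0 ↔ ζ ∈ R := by
  simp [Multiset.prod_eq_zero_iff, sub_eq_zero]

theorem analyticOrderAt_multiset_prod_sub (R : Multiset ℂ) (z : ℂ) :
    analyticOrderAt (fun ζ => (R.map (ζ - ·)).prod) z = R.count z := by
  induction R using Multiset.induction_on with
  | empty => simp [analyticOrderAt_eq_zero]
  | cons a s ih =>
    have h1 : (fun ζ => ((a ::ₘ s).map (ζ - ·)).prod) =
        (fun ζ => ζ - a) * fun ζ => (s.map (ζ - ·)).prod := by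
      funext ζ; simp
    rw [h1, analyticOrderAt_mul (by fun_prop) (analyticAt_multiset_prod_sub s z), ih,
      Multiset.count_cons]
    by_cases hza : z = a
    · subst hza
      have := analyticOrderAt_id_sub_const_self (𝕜 := ℂ) (c := z)
      have h2 : analyticOrderAt (fun ζ : ℂ => ζ - z) z = 1 := this
      rw [h2]; simp [add_comm]
    · have h2 : analyticOrderAt (fun ζ : ℂ => ζ - a) z = 0 := by
        rw [analyticOrderAt_eq_zero]; right; exact sub_ne_zero.2 hza
      rw [h2]; simp [hza]

theorem finite_zeros_closedBall {h : ℂ → ℂ} {z : ℂ} {ρ : ℝ} (hρ : 0 < ρ)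
    (hh : AnalyticOnNhd ℂ h (Metric.closedBall z ρ)) (hs : ∀ ζ ∈ Metric.sphere z ρ, h ζ ≠ 0) :
    {ζ ∈ Metric.closedBall z ρ | h ζ = 0}.Finite := by
  have hx : z + ρ ∈ Metric.sphere z ρ := by simp [hρ.le]
  have h1 := hh.preimage_zero_mem_codiscreteWithin (hs _ hx) (Metric.sphere_subset_closedBall hx)
    ⟨⟨z, Metric.mem_closedBall_self hρ.le⟩, (convex_closedBall z ρ).isPreconnected⟩
  refine (Set.Finite.subset ((isCompact_closedBall z ρ).finite_sdiff_of_mem_codiscreteWithin h1) ?_)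
  rintro ζ ⟨h2, h3⟩
  exact ⟨h2, by simp [h3]⟩

/-- Away from its finitely many zeros in a disc, a holomorphic function is a product of linear
factors and of a function without zeros. -/
theorem exists_factorization_closedBall {h : ℂ → ℂ} {z : ℂ} {ρ : ℝ} (hρ : 0 < ρ)
    (hh : AnalyticOnNhd ℂ h (Metric.closedBall z ρ)) (hs : ∀ ζ ∈ Metric.sphere z ρ, h ζ ≠ 0) :
    ∃ (R : Multiset ℂ) (q : ℂ → ℂ), (∀ r ∈ R, r ∈ Metric.ball z ρ) ∧
      AnalyticOnNhd ℂ q (Metric.closedBall z ρ) ∧ (∀ ζ ∈ Metric.closedBall z ρ, q ζ ≠ 0) ∧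
      ∀ ζ, h ζ = (R.map (ζ - ·)).prod * q ζ := by
  -- Induction on the number of zeros, dividing out one zero at a time.
  suffices H : ∀ n : ℕ, ∀ h : ℂ → ℂ, AnalyticOnNhd ℂ h (Metric.closedBall z ρ) →
      (∀ ζ ∈ Metric.sphere z ρ, h ζ ≠ 0) → {ζ ∈ Metric.closedBall z ρ | h ζ = 0}.ncard = n →
      ∃ (R : Multiset ℂ) (q : ℂ → ℂ), (∀ r ∈ R, r ∈ Metric.ball z ρ) ∧
      AnalyticOnNhd ℂ q (Metric.closedBall z ρ) ∧ (∀ ζ ∈ Metric.closedBall z ρ, q ζ ≠ 0) ∧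
      ∀ ζ, h ζ = (R.map (ζ - ·)).prod * q ζ from H _ h hh hs rfl
  intro n
  induction n with
  | zero =>
    intro h hh hs hn
    rw [Set.ncard_eq_zero (finite_zeros_closedBall hρ hh hs)] at hn
    refine ⟨0, h, by simp, hh, fun ζ hζ h0 => ?_, by simp⟩
    have : ζ ∈ {ζ ∈ Metric.closedBall z ρ | h ζ = 0} := ⟨hζ, h0⟩
    rw [hn] at this; exact this
  | succ n ih =>
    intro h hh hs hn
    have hfin := finite_zeros_closedBall hρ hh hs
    obtain ⟨a, haB, ha0⟩ : {ζ ∈ Metric.closedBall z ρ | h ζ = 0}.Nonempty := by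
      rw [← Set.ncard_pos hfin]; omega
    have hab : a ∈ Metric.ball z ρ := by
      rcases (Metric.mem_closedBall.1 haB).lt_or_eq with h1 | h1
      · exact h1
      · exact absurd ha0 (hs a h1)
    have hx : z + ρ ∈ Metric.sphere z ρ := by simp [hρ.le]
    have htop : analyticOrderAt h a ≠ ⊤ := by
      refine hh.analyticOrderAt_ne_top_of_isPreconnected (convex_closedBall z ρ).isPreconnected
        (Metric.sphere_subset_closedBall hx) haB ?_
      rw [analyticOrderAt_eq_zero.2 (Or.inr (hs _ hx))]
      exact ENat.zero_ne_top
    obtain ⟨g, hg, hga, hgh⟩ := (hh a haB).analyticOrderAt_ne_top.1 htop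
    set m := analyticOrderNatAt h a with hm
    have hm0 : m ≠ 0 := by
      intro h0
      have h2 := hgh.self_of_nhds
      rw [h0] at h2
      simp only [pow_zero, one_smul] at h2
      exact hga (h2 ▸ ha0)
    set q₁ : ℂ → ℂ := Function.update (fun ζ => h ζ / (ζ - a) ^ m) a (g a) with hq₁
    have hq₁a : q₁ =ᶠ[𝓝 a] g := by
      filter_upwards [hgh] with ζ hζ
      by_cases h1 : ζ = a
      · subst h1; simp [hq₁]
      · rw [hq₁, Function.update_of_ne h1, hζ, smul_eq_mul,
          mul_div_cancel_left₀ _ (pow_ne_zero _ (sub_ne_zero.2 h1))]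
    have hq₁e : ∀ ζ, h ζ = (ζ - a) ^ m * q₁ ζ := by
      intro ζ
      by_cases h1 : ζ = a
      · subst h1; simp [hm0, ha0]
      · rw [hq₁, Function.update_of_ne h1, mul_div_cancel₀]
        exact pow_ne_zero _ (sub_ne_zero.2 h1)
    have hq₁an : AnalyticOnNhd ℂ q₁ (Metric.closedBall z ρ) := by
      intro ζ hζ
      by_cases h1 : ζ = a
      · subst h1; exact hg.congr hq₁a.symm
      · have h2 : AnalyticAt ℂ (fun ζ => h ζ / (ζ - a) ^ m) ζ :=
          (hh ζ hζ).div (by fun_prop) (pow_ne_zero _ (sub_ne_zero.2 h1))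
        refine h2.congr ?_
        filter_upwards [isOpen_ne.mem_nhds h1] with w hw
        rw [hq₁, Function.update_of_ne hw]
    have hzero : {ζ ∈ Metric.closedBall z ρ | q₁ ζ = 0} =
        {ζ ∈ Metric.closedBall z ρ | h ζ = 0} \ {a} := by
      ext ζ
      simp only [mem_ofPred_eq, Set.mem_sdiff, mem_singleton_iff]
      constructor
      · rintro ⟨h1, h2⟩
        refine ⟨⟨h1, by rw [hq₁e, h2, mul_zero]⟩, ?_⟩
        rintro rfl
        exact hga (by simpa [hq₁] using h2)
      · rintro ⟨⟨h1, h2⟩, h3⟩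
        rw [hq₁e] at h2
        exact ⟨h1, (mul_eq_zero.1 h2).resolve_left (pow_ne_zero _ (sub_ne_zero.2 h3))⟩
    obtain ⟨R, q, h1, h2, h3, h4⟩ := ih q₁ hq₁an
      (fun ζ hζ h0 => hs ζ hζ (by rw [hq₁e, h0, mul_zero])) (by
        have hmem : a ∈ {ζ ∈ Metric.closedBall z ρ | h ζ = 0} := ⟨haB, ha0⟩
        rw [hzero, Set.ncard_sdiff_singleton_of_mem hmem, hn]; rfl)
    refine ⟨Multiset.replicate m a + R, q, ?_, h2, h3, fun ζ => ?_⟩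
    · intro r hr
      rcases Multiset.mem_add.1 hr with h5 | h5
      · rw [Multiset.eq_of_mem_replicate h5]; exact hab
      · exact h1 r h5
    · rw [hq₁e, h4]; simp [mul_assoc]

theorem isRootMultiset_of_factorization {h q : ℂ → ℂ} {z : ℂ} {ρ : ℝ} {R : Multiset ℂ}
    (hR : ∀ r ∈ R, r ∈ Metric.ball z ρ) (hq : AnalyticOnNhd ℂ q (Metric.closedBall z ρ))
    (hq0 : ∀ ζ ∈ Metric.closedBall z ρ, q ζ ≠ 0) (he : ∀ ζ, h ζ = (R.map (ζ - ·)).prod * q ζ) :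
    IsRootMultiset h z ρ R := by
  refine ⟨hR, fun r hr => ?_⟩
  have h1 : h = (fun ζ => (R.map (ζ - ·)).prod) * q := funext he
  have hr' := Metric.ball_subset_closedBall hr
  rw [h1, analyticOrderAt_mul (analyticAt_multiset_prod_sub R r) (hq r hr'),
    analyticOrderAt_multiset_prod_sub, analyticOrderAt_eq_zero.2 (Or.inr (hq0 r hr')), add_zero]

/-- Cauchy's formula, summed over a multiset of points of the disc. -/
theorem circleIntegral_mul_sum_inv {G : ℂ → ℂ} {z : ℂ} {ρ : ℝ} (hρ : 0 < ρ)
    (hG : AnalyticOnNhd ℂ G (Metric.closedBall z ρ)) (R : Multiset ℂ)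
    (hR : ∀ r ∈ R, r ∈ Metric.ball z ρ) :
    CircleIntegrable (fun ζ => G ζ * (R.map fun r => (ζ - r)⁻¹).sum) z ρ ∧
    (∮ ζ in C(z, ρ), G ζ * (R.map fun r => (ζ - r)⁻¹).sum) =
      2 * Real.pi * Complex.I * (R.map G).sum := by
  induction R using Multiset.induction_on with
  | empty => simp [circleIntegral]
  | cons a s ih =>
    obtain ⟨h1, h2⟩ := ih fun r hr => hR r (Multiset.mem_cons_of_mem hr)
    have ha := hR a (Multiset.mem_cons_self a s)
    have hGd : DiffContOnCl ℂ G (Metric.ball z ρ) :=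
      DifferentiableOn.diffContOnCl fun ζ hζ => by
        rw [closure_ball z hρ.ne'] at hζ
        exact (hG ζ hζ).differentiableAt.differentiableWithinAt
    have h3 := hGd.circleIntegral_sub_inv_smul ha
    have h4 : CircleIntegrable (fun ζ => (ζ - a)⁻¹ • G ζ) z ρ := by
      refine ContinuousOn.circleIntegrable hρ.le fun ζ hζ => ?_
      have hne : ζ - a ≠ 0 := by
        intro h0
        rw [sub_eq_zero.1 h0] at hζ
        exact (Metric.mem_ball.1 ha).ne hζ
      exact ((((continuous_id.sub continuous_const).continuousAt).inv₀ hne).smul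
        (hG ζ (Metric.sphere_subset_closedBall hζ)).continuousAt).continuousWithinAt
    have h5 : (fun ζ => G ζ * ((a ::ₘ s).map fun r => (ζ - r)⁻¹).sum) =
        fun ζ => (ζ - a)⁻¹ • G ζ + G ζ * (s.map fun r => (ζ - r)⁻¹).sum := by
      funext ζ; simp; ring
    rw [h5]
    refine ⟨h4.add h1, ?_⟩
    rw [circleIntegral.integral_add h4 h1, h3, h2]
    simp; ring

/-- The argument principle, weighted by a holomorphic function. -/
theorem circleIntegral_mul_logDeriv {G h : ℂ → ℂ} {z : ℂ} {ρ : ℝ} (hρ : 0 < ρ)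
    (hG : AnalyticOnNhd ℂ G (Metric.closedBall z ρ))
    (hh : AnalyticOnNhd ℂ h (Metric.closedBall z ρ)) (hs : ∀ ζ ∈ Metric.sphere z ρ, h ζ ≠ 0)
    {R : Multiset ℂ} (hR : IsRootMultiset h z ρ R) :
    (∮ ζ in C(z, ρ), G ζ * (deriv h ζ / h ζ)) = 2 * Real.pi * Complex.I * (R.map G).sum := by
  obtain ⟨R', q, h1, hq, hq0, he⟩ := exists_factorization_closedBall hρ hh hs
  obtain rfl := hR.unique (isRootMultiset_of_factorization h1 hq hq0 he)
  have hlog : ∀ (S : Multiset ℂ) ζ, ζ ∉ S →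
      logDeriv (fun ζ => (S.map (ζ - ·)).prod) ζ = (S.map fun r => (ζ - r)⁻¹).sum := by
    intro S
    induction S using Multiset.induction_on with
    | empty => intro ζ _; simp [logDeriv_apply]
    | cons a s ih =>
      intro ζ hζ
      rw [Multiset.mem_cons, not_or] at hζ
      simp only [Multiset.map_cons, Multiset.prod_cons, Multiset.sum_cons]
      rw [logDeriv_mul (f := fun ζ => ζ - a), ih ζ hζ.2]
      · simp [logDeriv_apply]
      · exact sub_ne_zero.2 hζ.1
      · exact fun h0 => hζ.2 (multiset_prod_sub_eq_zero.1 h0)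
      · fun_prop
      · exact (analyticAt_multiset_prod_sub s ζ).differentiableAt
  have hsph : ∀ ζ ∈ Metric.sphere z ρ, G ζ * (deriv h ζ / h ζ) =
      G ζ * (R.map fun r => (ζ - r)⁻¹).sum + G ζ * (deriv q ζ / q ζ) := by
    intro ζ hζ
    have hζ' := Metric.sphere_subset_closedBall hζ
    have hmem : ζ ∉ R := fun h0 => (Metric.mem_ball.1 (h1 ζ h0)).ne hζ
    have h2 : h = fun ζ => (R.map (ζ - ·)).prod * q ζ := funext he
    rw [← mul_add, ← hlog R ζ hmem, ← logDeriv_apply, ← logDeriv_apply q]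
    congr 1
    conv_lhs => rw [h2]
    rw [logDeriv_mul]
    · exact fun h0 => hmem (multiset_prod_sub_eq_zero.1 h0)
    · exact hq0 ζ hζ'
    · exact (analyticAt_multiset_prod_sub R ζ).differentiableAt
    · exact (hq ζ hζ').differentiableAt
  have hqan : AnalyticOnNhd ℂ (fun ζ => G ζ * (deriv q ζ / q ζ)) (Metric.closedBall z ρ) :=
    fun ζ hζ => (hG ζ hζ).mul ((hq ζ hζ).deriv.div (hq ζ hζ) (hq0 ζ hζ))
  have hqd : DiffContOnCl ℂ (fun ζ => G ζ * (deriv q ζ / q ζ)) (Metric.ball z ρ) :=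
    DifferentiableOn.diffContOnCl fun ζ hζ => by
      rw [closure_ball z hρ.ne'] at hζ
      exact (hqan ζ hζ).differentiableAt.differentiableWithinAt
  obtain ⟨h3, h4⟩ := circleIntegral_mul_sum_inv hρ hG R h1
  rw [circleIntegral.integral_congr hρ.le hsph, circleIntegral.integral_add h3, h4,
    hqd.circleIntegral_eq_zero hρ.le, add_zero]
  exact ContinuousOn.circleIntegrable hρ.le fun ζ hζ =>
    (hqan ζ (Metric.sphere_subset_closedBall hζ)).continuousAt.continuousWithinAt

end Roots

/-! ### Zeros of a holomorphic family of functions -/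

section ParametricRoots

variable {E : Type*} [NormedAddCommGroup E] [NormedSpace ℂ E]

theorem analyticAt_deriv_snd {h : E → ℂ → ℂ} {t₀ : E} {z : ℂ}
    (hh : AnalyticAt ℂ (Function.uncurry h) (t₀, z)) :
    AnalyticAt ℂ (Function.uncurry fun t ζ => deriv (h t) ζ) (t₀, z) := by
  have h1 : AnalyticAt ℂ (fun p => fderiv ℂ (Function.uncurry h) p (0, 1)) (t₀, z) :=
    (ContinuousLinearMap.apply ℂ ℂ ((0, 1) : E × ℂ)).analyticAt _ |>.comp hh.fderiv
  refine h1.congr ?_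
  filter_upwards [hh.eventually_analyticAt] with p hp
  have h2 : HasDerivAt (fun ζ : ℂ => ((p.1, ζ) : E × ℂ)) (0, 1) p.2 :=
    (hasDerivAt_const p.2 p.1).prodMk (hasDerivAt_id p.2)
  have h3 := hp.differentiableAt.hasFDerivAt.comp_hasDerivAt_of_eq p.2 h2 rfl
  exact h3.deriv.symm

theorem analyticAt_curry_right {h : E → ℂ → ℂ} {t : E} {z : ℂ}
    (hh : AnalyticAt ℂ (Function.uncurry h) (t, z)) : AnalyticAt ℂ (h t) z :=
  hh.comp_of_eq (f := fun ζ : ℂ => (t, ζ)) (analyticAt_const.prod analyticAt_id) rfl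

/-- Sums of a holomorphic function over the zeros in a disc of a holomorphic family of functions
depend analytically on the parameter. -/
theorem exists_analyticAt_sum_roots {h G : E → ℂ → ℂ} {t₀ : E} {z : ℂ} {ρ : ℝ} (hρ : 0 < ρ)
    (hh : ∀ ζ ∈ Metric.closedBall z ρ, AnalyticAt ℂ (Function.uncurry h) (t₀, ζ))
    (hG : ∀ ζ ∈ Metric.closedBall z ρ, AnalyticAt ℂ (Function.uncurry G) (t₀, ζ))
    (hs : ∀ ζ ∈ Metric.sphere z ρ, h t₀ ζ ≠ 0) :
    ∃ S : E → ℂ, AnalyticAt ℂ S t₀ ∧ ∀ᶠ t in 𝓝 t₀, (∃ R, IsRootMultiset (h t) z ρ R) ∧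
      ∀ R, IsRootMultiset (h t) z ρ R → S t = (R.map (G t)).sum := by
  have hI : ∀ θ, circleMap z ρ θ ∈ Metric.closedBall z ρ := fun θ =>
    circleMap_mem_closedBall z hρ.le θ
  set Φ : E × ℂ → ℂ := fun p => G p.1 p.2 * (deriv (h p.1) p.2 / h p.1 p.2) with hΦ
  refine ⟨fun t => (2 * Real.pi * Complex.I)⁻¹ * ∮ ζ in C(z, ρ), Φ (t, ζ), ?_, ?_⟩
  · have h1 := (analyticAt_setIntegral (G := Φ) (γ := circleMap z ρ) (w := deriv (circleMap z ρ))
      (t₀ := t₀) (K := Icc 0 (2 * Real.pi)) (continuous_circleMap z ρ)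
      (by rw [show deriv (circleMap z ρ) = fun θ => circleMap 0 ρ θ * Complex.I from funext fun θ => deriv_circleMap z ρ θ]; exact (continuous_circleMap 0 ρ).mul continuous_const) isCompact_Icc ?_).1
    · refine analyticAt_const.mul (h1.congr (Eventually.of_forall fun t => ?_))
      simp only [circleIntegral, smul_eq_mul]
      rw [intervalIntegral.integral_of_le Real.two_pi_pos.le, integral_Icc_eq_integral_Ioc]
    · intro θ _
      exact (hG _ (hI θ)).mul ((analyticAt_deriv_snd (hh _ (hI θ))).div (hh _ (hI θ))
        (hs _ (circleMap_mem_sphere z hρ.le θ)))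
  · have e1 : ∀ᶠ t in 𝓝 t₀, ∀ ζ ∈ Metric.closedBall z ρ,
        AnalyticAt ℂ (Function.uncurry h) (t, ζ) :=
      (isCompact_closedBall z ρ).eventually_forall_of_forall_eventually
        fun ζ hζ => (hh ζ hζ).eventually_analyticAt
    have e2 : ∀ᶠ t in 𝓝 t₀, ∀ ζ ∈ Metric.closedBall z ρ,
        AnalyticAt ℂ (Function.uncurry G) (t, ζ) :=
      (isCompact_closedBall z ρ).eventually_forall_of_forall_eventually
        fun ζ hζ => (hG ζ hζ).eventually_analyticAt
    have e3 : ∀ᶠ t in 𝓝 t₀, ∀ ζ ∈ Metric.sphere z ρ, h t ζ ≠ 0 :=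
      (isCompact_sphere z ρ).eventually_forall_of_forall_eventually fun ζ hζ =>
        (hh ζ (Metric.sphere_subset_closedBall hζ)).continuousAt.eventually_ne (hs ζ hζ)
    filter_upwards [e1, e2, e3] with t h1 h2 h3
    have h1' : AnalyticOnNhd ℂ (h t) (Metric.closedBall z ρ) :=
      fun ζ hζ => analyticAt_curry_right (h1 ζ hζ)
    refine ⟨?_, fun R hR => ?_⟩
    · obtain ⟨R, q, a1, a2, a3, a4⟩ := exists_factorization_closedBall hρ h1' h3
      exact ⟨R, isRootMultiset_of_factorization a1 a2 a3 a4⟩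
    · have := circleIntegral_mul_logDeriv hρ (G := G t)
        (fun ζ hζ => analyticAt_curry_right (h2 ζ hζ)) h1' h3 hR
      simp only [hΦ]
      rw [this, inv_mul_cancel_left₀]
      exact Complex.two_pi_I_ne_zero

/-- The number of zeros in a disc is locally constant, as long as no zero reaches the circle. -/
theorem eventually_card_roots_eq {h : E → ℂ → ℂ} {t₀ : E} {z : ℂ} {ρ : ℝ} (hρ : 0 < ρ)
    (hh : ∀ ζ ∈ Metric.closedBall z ρ, AnalyticAt ℂ (Function.uncurry h) (t₀, ζ))
    (hs : ∀ ζ ∈ Metric.sphere z ρ, h t₀ ζ ≠ 0) {R₀ : Multiset ℂ}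
    (hR₀ : IsRootMultiset (h t₀) z ρ R₀) :
    ∀ᶠ t in 𝓝 t₀, ∃ R, IsRootMultiset (h t) z ρ R ∧ R.card = R₀.card := by
  obtain ⟨S, hS, hS'⟩ := exists_analyticAt_sum_roots (G := fun _ _ => 1) hρ hh
    (fun _ _ => analyticAt_const) hs
  have h0 : S t₀ = R₀.card := by rw [hS'.self_of_nhds.2 R₀ hR₀]; simp
  have h1 : ∀ᶠ t in 𝓝 t₀, ‖S t - S t₀‖ < 1 := by
    have : ContinuousAt (fun t => ‖S t - S t₀‖) t₀ :=
      (hS.continuousAt.sub continuousAt_const).norm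
    exact this.eventually_lt_const (by simp)
  filter_upwards [hS', h1] with t ht ht1
  obtain ⟨⟨R, hR⟩, h2⟩ := ht
  refine ⟨R, hR, ?_⟩
  rw [h2 R hR, h0] at ht1
  simp only [Multiset.map_const', Multiset.sum_replicate, nsmul_eq_mul, mul_one] at ht1
  have h3 : ((R.card : ℂ) - R₀.card) = ((R.card - R₀.card : ℤ) : ℂ) := by push_cast; ring
  rw [h3, Complex.norm_intCast] at ht1
  have h4 : |(R.card - R₀.card : ℤ)| < 1 := by exact_mod_cast ht1
  rw [Int.abs_lt_one_iff] at h4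
  omega

end ParametricRoots

/-! ### Newton's identities -/

section Newton

/-- Newton's identities for a multiset of complex numbers. -/
theorem multiset_mul_esymm_eq_sum (s : Multiset ℂ) (k : ℕ) :
    (k : ℂ) * s.esymm k = (-1) ^ (k + 1) * ∑ a ∈ Finset.HasAntidiagonal.antidiagonal k with a.1 < k,
      (-1) ^ a.1 * s.esymm a.1 * (s.map (· ^ a.2)).sum := by
  obtain ⟨n, v, rfl⟩ : ∃ (n : ℕ) (v : Fin n → ℂ), s = (Finset.univ : Finset (Fin n)).val.map v := by
    obtain ⟨l, rfl⟩ := Quot.exists_rep s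
    exact ⟨l.length, l.get, by rw [Fin.univ_val_map, List.ofFn_get]; rfl⟩
  have h := congrArg (MvPolynomial.aeval v) (MvPolynomial.mul_esymm_eq_sum (Fin n) ℂ k)
  simp only [map_mul, map_sum, map_pow, map_neg, map_one, map_natCast,
    MvPolynomial.aeval_esymm_eq_multiset_esymm, MvPolynomial.psum, MvPolynomial.aeval_X] at h
  rw [h]
  refine congrArg _ (Finset.sum_congr rfl fun a _ => ?_)
  rw [Multiset.map_map]; rfl

/-- In a characteristic-zero algebra of functions, elementary symmetric functions are generated by
power sums. -/
theorem esymm_mem_of_psum_mem {X : Type*} (𝒜 : Subalgebra ℂ (X → ℂ)) (R : X → Multiset ℂ)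
    (h : ∀ j, (fun x => ((R x).map (· ^ j)).sum) ∈ 𝒜) (k : ℕ) : (fun x => (R x).esymm k) ∈ 𝒜 := by
  induction k using Nat.strong_induction_on with
  | _ k ih =>
    rcases Nat.eq_zero_or_pos k with rfl | hk
    · have : (fun x => (R x).esymm 0) = fun _ => (1 : ℂ) := by funext x; simp [Multiset.esymm]
      rw [this]; exact 𝒜.one_mem
    · have : (fun x => (R x).esymm k) = (k : ℂ)⁻¹ • ((-1 : ℂ) ^ (k + 1) •
          ∑ a ∈ Finset.HasAntidiagonal.antidiagonal k with a.1 < k,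
            (-1 : ℂ) ^ a.1 • ((fun x => (R x).esymm a.1) * fun x => ((R x).map (· ^ a.2)).sum)) := by
        funext x
        have h1 := multiset_mul_esymm_eq_sum (R x) k
        have hk' : (k : ℂ) ≠ 0 := by exact_mod_cast hk.ne'
        rw [eq_comm, Pi.smul_apply, smul_eq_mul, inv_mul_eq_iff_eq_mul₀ hk', h1]
        simp [Finset.sum_apply, mul_assoc]
      rw [this]
      refine 𝒜.smul_mem (𝒜.smul_mem (𝒜.sum_mem fun a ha => 𝒜.smul_mem (𝒜.mul_mem ?_ (h _)) _) _) _
      exact ih _ (Finset.mem_filter.1 ha).2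

end Newton

/-! ### Comparison with the product of the linear factors -/

section Theta

theorem norm_multiset_prod_mem {α : Type*} (R : Multiset α) (f : α → ℂ) {s b : ℝ} {B : ℕ} (hs : 0 < s)
    (hs1 : s ≤ 1) (hb : 1 ≤ b) (hB : R.card ≤ B) (h : ∀ r ∈ R, s ≤ ‖f r‖ ∧ ‖f r‖ ≤ b) :
    s ^ B ≤ ‖(R.map f).prod‖ ∧ ‖(R.map f).prod‖ ≤ b ^ B := by
  have key : s ^ R.card ≤ ‖(R.map f).prod‖ ∧ ‖(R.map f).prod‖ ≤ b ^ R.card := by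
    clear hB
    induction R using Multiset.induction_on with
    | empty => simp
    | cons a R ih =>
      obtain ⟨h1, h2⟩ := ih fun r hr => h r (Multiset.mem_cons_of_mem hr)
      obtain ⟨h3, h4⟩ := h a (Multiset.mem_cons_self a R)
      simp only [Multiset.map_cons, Multiset.prod_cons, norm_mul, Multiset.card_cons, pow_succ']
      exact ⟨by gcongr, by gcongr⟩
  exact ⟨(pow_le_pow_of_le_one hs.le hs1 hB).trans key.1,
    key.2.trans (pow_le_pow_right₀ hb hB)⟩

/-- A continuous family of holomorphic functions is, locally uniformly, comparable to the product
of the linear factors given by its zeros. -/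
theorem isTheta_prod_roots {X : Type*} [TopologicalSpace X] {h : X → ℂ → ℂ} {R : X → Multiset ℂ}
    {B : ℕ} {K : ℝ} {x₁ : X} {z : ℂ}
    (hcont : ∀ᶠ p in 𝓝 (x₁, z), ContinuousAt (Function.uncurry h) p)
    (han : ∀ᶠ p in 𝓝 (x₁, z), AnalyticAt ℂ (h p.1) p.2)
    (hne : ∃ᶠ ζ in 𝓝 z, h x₁ ζ ≠ 0)
    (hcard : ∀ᶠ x in 𝓝 x₁, (R x).card ≤ B) (hK : ∀ᶠ x in 𝓝 x₁, ∀ r ∈ R x, ‖r‖ ≤ K)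
    (hcount : ∀ᶠ p in 𝓝 (x₁, z), ((R p.1).count p.2 : ℕ∞) = analyticOrderAt (h p.1) p.2) :
    (fun p : X × ℂ => h p.1 p.2) =Θ[𝓝 (x₁, z)] fun p => ((R p.1).map (p.2 - ·)).prod := by
  have hall := hcont.and (han.and hcount)
  rw [nhds_prod_eq] at hall
  obtain ⟨P, hP, Q, hQ, hPQ⟩ := Filter.eventually_prod_iff.1 hall
  have hiso : ∀ᶠ ζ in 𝓝[≠] z, h x₁ ζ ≠ 0 := by
    have h1 : AnalyticAt ℂ (h x₁) z := han.self_of_nhds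
    rcases h1.eventually_eq_zero_or_eventually_ne_zero with h2 | h2
    · exact absurd (h2.mono fun ζ h0 h' => h' h0) hne
    · exact h2
  obtain ⟨ρ, hρ, hρQ⟩ : ∃ ρ > 0, ∀ ζ ∈ Metric.closedBall z ρ, Q ζ ∧ (ζ ≠ z → h x₁ ζ ≠ 0) := by
    have := hQ.and (eventually_nhdsWithin_iff.1 hiso)
    obtain ⟨ρ, hρ, h2⟩ := Metric.nhds_basis_closedBall.eventually_iff.1 this
    exact ⟨ρ, hρ, fun ζ hζ => h2 hζ⟩
  have hx₁P : P x₁ := hP.self_of_nhds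
  -- On the annulus `A` around `z`, the functions `h x`, for `x` close to `x₁`, are bounded by `β`, and
  -- bounded away from zero by `α`.
  set A : Set ℂ := {ζ | ρ / 2 ≤ ‖ζ - z‖ ∧ ‖ζ - z‖ ≤ ρ} with hA
  have hAB : A ⊆ Metric.closedBall z ρ := fun ζ hζ => by
    rw [Metric.mem_closedBall, dist_eq_norm]; exact hζ.2
  have hAc : IsCompact A := by
    refine (isCompact_closedBall z ρ).of_isClosed_subset ?_ hAB
    have hc : Continuous fun ζ : ℂ => ‖ζ - z‖ := by fun_prop
    exact (isClosed_le continuous_const hc).inter (isClosed_le hc continuous_const)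
  have hAne : ∀ ζ ∈ A, h x₁ ζ ≠ 0 := fun ζ hζ => (hρQ ζ (hAB hζ)).2 (by
    rintro rfl
    have := hζ.1
    simp only [sub_self, norm_zero] at this
    linarith)
  have hcA : ∀ ζ ∈ A, ContinuousAt (Function.uncurry h) (x₁, ζ) := fun ζ hζ =>
    (hPQ hx₁P (hρQ ζ (hAB hζ)).1).1
  have hsA : Metric.sphere z ρ ⊆ A := fun ζ hζ => by
    have : ‖ζ - z‖ = ρ := by rwa [mem_sphere_iff_norm] at hζ
    exact ⟨by rw [this]; linarith, this.le⟩
  have hx0 : z + ρ ∈ A := hsA (by simp [hρ.le])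
  have hAcont : ContinuousOn (fun ζ => ‖h x₁ ζ‖) A := fun ζ hζ =>
    (ContinuousAt.comp_of_eq (hcA ζ hζ) (f := fun ζ : ℂ => (x₁, ζ)) (by fun_prop) rfl).norm.continuousWithinAt
  obtain ⟨ζm, hζm, hmin⟩ := hAc.exists_isMinOn ⟨_, hx0⟩ hAcont
  obtain ⟨ζM, hζM, hmax⟩ := hAc.exists_isMaxOn ⟨_, hx0⟩ hAcont
  set α := ‖h x₁ ζm‖ / 2 with hα
  have hα0 : 0 < α := half_pos (norm_pos_iff.2 (hAne ζm hζm))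
  set β := ‖h x₁ ζM‖ + 1 with hβ
  have hβ0 : 0 < β := by positivity
  have hann : ∀ᶠ x in 𝓝 x₁, ∀ ζ ∈ A, α < ‖h x ζ‖ ∧ ‖h x ζ‖ < β := by
    refine hAc.eventually_forall_of_forall_eventually fun ζ hζ => ?_
    have h1 : ContinuousAt (fun p : X × ℂ => ‖h p.1 p.2‖) (x₁, ζ) := (hcA ζ hζ).norm
    refine (h1.eventually_const_lt ?_).and (h1.eventually_lt_const ?_)
    · have : ‖h x₁ ζm‖ ≤ ‖h x₁ ζ‖ := hmin hζ
      have h0 := norm_pos_iff.2 (hAne ζm hζm)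
      simp only [hα]; linarith
    · have : ‖h x₁ ζ‖ ≤ ‖h x₁ ζM‖ := hmax hζ
      simp only [hβ]; linarith
  set s := min 1 (ρ / 2) with hs
  set b := max 1 (max (2 * ρ) (|K| + ‖z‖ + ρ)) with hb
  have hs0 : 0 < s := lt_min one_pos (by positivity)
  have hs1 : s ≤ 1 := min_le_left _ _
  have hsρ : s ≤ ρ / 2 := min_le_right _ _
  have hb1 : 1 ≤ b := le_max_left _ _
  have hbρ : 2 * ρ ≤ b := (le_max_left _ _).trans (le_max_right _ _)
  have hbK : |K| + ‖z‖ + ρ ≤ b := (le_max_right _ _).trans (le_max_right _ _)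
  have hb0 : 0 < b := lt_of_lt_of_le one_pos hb1
  -- Divide `h x` by the factors of its zeros in the disc, and call the quotient `q`; call `r` the
  -- product of the factors of the zeros outside. Both are bounded above and below.
  have key : ∀ᶠ p : X × ℂ in 𝓝 (x₁, z), ∃ q r : ℂ, ((R p.1).map (p.2 - ·)).prod * q = h p.1 p.2 * r ∧
      α / b ^ B ≤ ‖q‖ ∧ ‖q‖ ≤ β / s ^ B ∧ s ^ B ≤ ‖r‖ ∧ ‖r‖ ≤ b ^ B := by
    have hx : ∀ᶠ x in 𝓝 x₁, P x ∧ (R x).card ≤ B ∧ (∀ r ∈ R x, ‖r‖ ≤ K) ∧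
        ∀ ζ ∈ A, α < ‖h x ζ‖ ∧ ‖h x ζ‖ < β := hP.and (hcard.and (hK.and hann))
    have hz : ∀ᶠ ζ in 𝓝 z, ‖ζ - z‖ < ρ / 2 := by
      have : ContinuousAt (fun ζ => ‖ζ - z‖) z := by fun_prop
      exact this.eventually_lt_const (by simpa using hρ)
    rw [nhds_prod_eq]
    refine (hx.prod_mk hz).mono ?_
    rintro ⟨x, ζ⟩ ⟨⟨h1, h2, h3, h4⟩, h5⟩
    simp only at h1 h2 h3 h4 h5 ⊢
    have hB : ∀ w ∈ Metric.closedBall z ρ, AnalyticAt ℂ (h x) w ∧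
        ((R x).count w : ℕ∞) = analyticOrderAt (h x) w := fun w hw =>
      (hPQ h1 (hρQ w hw).1).2
    obtain ⟨R₀, q, hR₀, hqa, hq0, hq⟩ := exists_factorization_closedBall (h := h x) hρ
      (fun w hw => (hB w hw).1) (fun w hw h0 => by
        have := (h4 w (hsA hw)).1; rw [h0, norm_zero] at this; linarith)
    have hroot := isRootMultiset_of_factorization hR₀ hqa hq0 hq
    classical
    have hfil : R₀ = (R x).filter (· ∈ Metric.ball z ρ) := by
      refine hroot.unique ⟨fun r hr => (Multiset.mem_filter.1 hr).2, fun r hr => ?_⟩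
      rw [Multiset.count_filter_of_pos hr]
      exact (hB r (Metric.ball_subset_closedBall hr)).2
    set R₁ := (R x).filter fun r => ¬ r ∈ Metric.ball z ρ with hR₁
    have hsplit : R₀ + R₁ = R x := by rw [hfil, hR₁]; exact Multiset.filter_add_not _ _
    have hc0 : R₀.card ≤ B := by
      rw [← hsplit, Multiset.card_add] at h2; omega
    have hc1 : R₁.card ≤ B := by
      rw [← hsplit, Multiset.card_add] at h2; omega
    refine ⟨q ζ, (R₁.map (ζ - ·)).prod, ?_, ?_⟩
    · rw [← hsplit, Multiset.map_add, Multiset.prod_add, hq]; ring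
    -- The zeros in the disc are away from the circle, as there are none in the annulus.
    have hr0 : ∀ r ∈ R₀, ‖r - z‖ < ρ / 2 := by
      intro r hr
      by_contra hcon
      push Not at hcon
      have hrb : ‖r - z‖ < ρ := by have := hR₀ r hr; rwa [mem_ball_iff_norm] at this
      have h6 := (h4 r ⟨hcon, hrb.le⟩).1
      rw [hq, multiset_prod_sub_eq_zero.2 hr, zero_mul, norm_zero] at h6
      linarith
    have hqs : ∀ w ∈ Metric.sphere z ρ, α / b ^ B ≤ ‖q w‖ ∧ ‖q w‖ ≤ β / s ^ B := by
      intro w hw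
      have hwn : ‖w - z‖ = ρ := by rwa [mem_sphere_iff_norm] at hw
      have h6 := norm_multiset_prod_mem R₀ (w - ·) hs0 hs1 hb1 hc0 (fun r hr => by
        have h7 := hr0 r hr
        have h8 : w - z = (w - r) + (r - z) := by ring
        have h9 : ‖w - z‖ ≤ ‖w - r‖ + ‖r - z‖ := by rw [h8]; exact norm_add_le _ _
        have h10 : ‖w - r‖ ≤ ‖w - z‖ + ‖r - z‖ := by
          rw [show w - r = (w - z) - (r - z) by ring]; exact norm_sub_le _ _
        constructor <;> linarith)
      have h7 := h4 w (hsA hw)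
      rw [hq, norm_mul] at h7
      have hpos : 0 < ‖(R₀.map (w - ·)).prod‖ := lt_of_lt_of_le (by positivity) h6.1
      constructor
      · rw [div_le_iff₀ (by positivity)]
        calc α ≤ ‖(R₀.map (w - ·)).prod‖ * ‖q w‖ := h7.1.le
          _ ≤ b ^ B * ‖q w‖ := by gcongr; exact h6.2
          _ = _ := mul_comm _ _
      · rw [le_div_iff₀ (by positivity)]
        calc ‖q w‖ * s ^ B ≤ ‖q w‖ * ‖(R₀.map (w - ·)).prod‖ := by gcongr; exact h6.1
          _ = _ := mul_comm _ _
          _ ≤ β := h7.2.le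
    have hζB : ζ ∈ closure (Metric.ball z ρ) := by
      refine subset_closure ?_
      rw [mem_ball_iff_norm]; linarith
    have hdq : ∀ g : ℂ → ℂ, AnalyticOnNhd ℂ g (Metric.closedBall z ρ) →
        DiffContOnCl ℂ g (Metric.ball z ρ) := fun g hg =>
      DifferentiableOn.diffContOnCl fun w hw => by
        rw [closure_ball z hρ.ne'] at hw
        exact (hg w hw).differentiableAt.differentiableWithinAt
    have hζB' : ζ ∈ Metric.closedBall z ρ := by rwa [closure_ball z hρ.ne'] at hζB
    refine ⟨?_, ?_, ?_⟩
    -- The bounds on the circle extend to the disc by the maximum principle for `1 / q` and `q`.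
    · have h6 := Complex.norm_le_of_forall_mem_frontier_norm_le Metric.isBounded_ball
        (hdq (fun w => (q w)⁻¹) fun w hw => (hqa w hw).inv (hq0 w hw)) (C := (α / b ^ B)⁻¹)
        (fun w hw => by
          rw [frontier_ball z hρ.ne'] at hw
          rw [norm_inv]
          exact inv_anti₀ (by positivity) (hqs w hw).1) hζB
      rw [norm_inv] at h6
      exact (inv_le_inv₀ (norm_pos_iff.2 (hq0 ζ hζB')) (by positivity)).1 h6
    · exact Complex.norm_le_of_forall_mem_frontier_norm_le Metric.isBounded_ball (hdq q hqa)
        (fun w hw => by rw [frontier_ball z hρ.ne'] at hw; exact (hqs w hw).2) hζB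
    · refine norm_multiset_prod_mem R₁ (ζ - ·) hs0 hs1 hb1 hc1 fun r hr => ?_
      obtain ⟨hr1, hr2⟩ := Multiset.mem_filter.1 hr
      rw [mem_ball_iff_norm, not_lt] at hr2
      have h8 : ‖r - z‖ ≤ ‖ζ - r‖ + ‖ζ - z‖ := by
        rw [show r - z = (ζ - z) - (ζ - r) by ring]
        exact (norm_sub_le _ _).trans (by rw [add_comm])
      have h9 : ‖ζ - r‖ ≤ ‖ζ - z‖ + ‖z‖ + ‖r‖ := by
        rw [show ζ - r = (ζ - z) + z - r by ring]
        exact (norm_sub_le _ _).trans (by gcongr; exact norm_add_le _ _)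
      have h10 := (h3 r hr1).trans (le_abs_self K)
      constructor <;> linarith
  constructor
  · refine Asymptotics.IsBigO.of_bound ((β / s ^ B) / s ^ B) (key.mono ?_)
    rintro p ⟨q, r, h1, h2, h3, h4, h5⟩
    have hr0 : 0 < ‖r‖ := lt_of_lt_of_le (by positivity) h4
    have h6 : ‖h p.1 p.2‖ = ‖((R p.1).map (p.2 - ·)).prod‖ * ‖q‖ / ‖r‖ := by
      rw [← norm_mul, h1, norm_mul, mul_div_cancel_right₀ _ hr0.ne']
    rw [h6, div_le_iff₀ hr0]
    calc _ ≤ ‖((R p.1).map (p.2 - ·)).prod‖ * (β / s ^ B) := by gcongr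
      _ = (β / s ^ B) / s ^ B * ‖((R p.1).map (p.2 - ·)).prod‖ * s ^ B := by
        field_simp
      _ ≤ _ := by gcongr
  · refine Asymptotics.IsBigO.of_bound (b ^ B / (α / b ^ B)) (key.mono ?_)
    rintro p ⟨q, r, h1, h2, h3, h4, h5⟩
    have hq0 : 0 < ‖q‖ := lt_of_lt_of_le (by positivity) h2
    have h6 : ‖((R p.1).map (p.2 - ·)).prod‖ = ‖h p.1 p.2‖ * ‖r‖ / ‖q‖ := by
      rw [← norm_mul, ← h1, norm_mul, mul_div_cancel_right₀ _ hq0.ne']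
    rw [h6, div_le_iff₀ hq0]
    calc _ ≤ ‖h p.1 p.2‖ * b ^ B := by gcongr
      _ = b ^ B / (α / b ^ B) * ‖h p.1 p.2‖ * (α / b ^ B) := by field_simp
      _ ≤ _ := by gcongr

end Theta

/-! ### Orders of vanishing as growth exponents -/

section VanishingOrder

variable {E : Type} [NormedAddCommGroup E] [NormedSpace ℂ E]

/-- Cauchy's estimate: the derivative at `z` in the direction `v` is bounded on the disc of radius
`‖z - y‖ / ‖v‖` of the complex line through `z`. -/
theorem isBigO_fderiv_of_isBigO_pow {F : Type} [NormedAddCommGroup F] [NormedSpace ℂ F]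
    [CompleteSpace F] {h : E → F} {y : E} {m : ℕ} (ha : AnalyticAt ℂ h y)
    (hO : h =O[𝓝 y] fun z => ‖z - y‖ ^ (m + 1)) :
    fderiv ℂ h =O[𝓝 y] fun z => ‖z - y‖ ^ m := by
  obtain ⟨C, hC0, hC'⟩ := hO.exists_pos
  have hC := hC'.bound
  have hy0 : h y = 0 := by
    have := hC.self_of_nhds
    simpa using this
  obtain ⟨r, hr, hball⟩ := Metric.eventually_nhds_iff_ball.1 (hC.and ha.eventually_analyticAt)
  rcases Nat.eq_zero_or_pos m with rfl | hm
  · simpa using (ha.fderiv.continuousAt.norm.isBoundedUnder_le).isBigO_one ℝ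
  have hyd : fderiv ℂ h y = 0 := by
    have h1 : (fun z => h z) =o[𝓝 y] fun z => z - y := by
      refine hO.trans_isLittleO ?_
      have : (fun z : E => ‖z - y‖ ^ (m + 1)) =o[𝓝 y] fun z => ‖z - y‖ ^ 1 := by
        have h2 := (Asymptotics.isLittleO_pow_pow (𝕜 := ℝ) (m := 1) (n := m + 1) (by omega)).comp_tendsto
          (k := fun z : E => ‖z - y‖) (l' := 𝓝 y) (by
            have : ContinuousAt (fun z => ‖z - y‖) y := by fun_prop
            simpa [ContinuousAt] using this)
        exact h2
      simpa using this
    have h2 : HasFDerivAt h (0 : E →L[ℂ] F) y := by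
      rw [hasFDerivAt_iff_isLittleO]
      simpa [hy0] using h1
    exact h2.fderiv
  refine Asymptotics.IsBigO.of_bound (C * 2 ^ (m + 1)) ?_
  filter_upwards [Metric.ball_mem_nhds y (half_pos hr)] with z hz
  rcases eq_or_ne z y with rfl | hzy
  · rw [hyd, norm_zero, sub_self, norm_zero, zero_pow hm.ne', norm_zero, mul_zero]
  have hδ : 0 < ‖z - y‖ := norm_pos_iff.2 (sub_ne_zero.2 hzy)
  have hz' : ‖z - y‖ < r / 2 := by rwa [mem_ball_iff_norm] at hz
  refine ContinuousLinearMap.opNorm_le_bound _ (by positivity) fun v => ?_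
  rcases eq_or_ne v 0 with rfl | hv
  · simp
  have hv' : 0 < ‖v‖ := norm_pos_iff.2 hv
  set R := ‖z - y‖ / ‖v‖ with hR
  have hR0 : 0 < R := by positivity
  have hin : ∀ ζ : ℂ, ‖ζ‖ ≤ R → z + ζ • v ∈ Metric.ball y r ∧ ‖z + ζ • v - y‖ ≤ 2 * ‖z - y‖ := by
    intro ζ hζ
    have h1 : ‖z + ζ • v - y‖ ≤ 2 * ‖z - y‖ := by
      rw [show z + ζ • v - y = (z - y) + ζ • v by abel]
      refine (norm_add_le _ _).trans ?_
      rw [norm_smul]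
      have : ‖ζ‖ * ‖v‖ ≤ ‖z - y‖ := by
        calc ‖ζ‖ * ‖v‖ ≤ R * ‖v‖ := by gcongr
          _ = _ := by rw [hR]; field_simp
      linarith
    refine ⟨?_, h1⟩
    rw [mem_ball_iff_norm]; linarith
  have hd : DiffContOnCl ℂ (fun ζ : ℂ => h (z + ζ • v)) (Metric.ball 0 R) := by
    refine DifferentiableOn.diffContOnCl fun ζ hζ => ?_
    rw [closure_ball _ hR0.ne', mem_closedBall_zero_iff] at hζ
    have := (hball _ (hin ζ hζ).1).2.differentiableAt
    exact (DifferentiableAt.comp ζ this (by fun_prop)).differentiableWithinAt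
  have hbd := Complex.norm_deriv_le_of_forall_mem_sphere_norm_le hR0 hd
    (C := C * (2 * ‖z - y‖) ^ (m + 1)) (fun ζ hζ => by
      rw [mem_sphere_zero_iff_norm] at hζ
      have h1 := (hball _ (hin ζ hζ.le).1).1
      refine h1.trans ?_
      rw [norm_pow, norm_norm]
      gcongr; exact (hin ζ hζ.le).2)
  have hder : deriv (fun ζ : ℂ => h (z + ζ • v)) 0 = fderiv ℂ h z v := by
    have h1 : HasDerivAt (fun ζ : ℂ => z + ζ • v) v 0 := by
      simpa using ((hasDerivAt_id (0 : ℂ)).smul_const v).const_add z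
    have h2 := (hball z (Metric.ball_subset_ball (by linarith) hz)).2.differentiableAt.hasFDerivAt
    exact (h2.comp_hasDerivAt_of_eq 0 h1 (by simp)).deriv
  rw [hder] at hbd
  refine hbd.trans (le_of_eq ?_)
  rw [norm_pow, norm_norm, hR, div_div_eq_mul_div, div_eq_iff hδ.ne']
  ring

theorem iteratedFDeriv_eq_zero_of_isBigO_pow {m : ℕ} : ∀ {F : Type} [NormedAddCommGroup F]
    [NormedSpace ℂ F] [CompleteSpace F] {h : E → F} {y : E}, AnalyticAt ℂ h y →
    h =O[𝓝 y] (fun z => ‖z - y‖ ^ m) → ∀ i < m, iteratedFDeriv ℂ i h y = 0 := by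
  induction m with
  | zero => intro F _ _ _ h y _ _ i hi; omega
  | succ m ih =>
    intro F _ _ _ h y ha hO i hi
    rcases i with - | i
    · obtain ⟨C, hC⟩ := hO.bound
      have hy0 : h y = 0 := by simpa using hC.self_of_nhds
      rw [← norm_eq_zero, norm_iteratedFDeriv_zero, hy0, norm_zero]
    · rw [← norm_eq_zero, ← norm_iteratedFDeriv_fderiv, norm_eq_zero]
      exact ih ha.fderiv (isBigO_fderiv_of_isBigO_pow ha hO) i (by omega)

theorem isBigO_pow_iff_iteratedFDeriv_eq_zero {F : Type} [NormedAddCommGroup F] [NormedSpace ℂ F]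
    [CompleteSpace F] {h : E → F} {y : E} {m : ℕ} (ha : AnalyticAt ℂ h y) :
    h =O[𝓝 y] (fun z => ‖z - y‖ ^ m) ↔ ∀ i < m, iteratedFDeriv ℂ i h y = 0 := by
  refine ⟨iteratedFDeriv_eq_zero_of_isBigO_pow ha, fun h0 => ?_⟩
  obtain ⟨p, r, hp⟩ := ha
  have h1 := hp.hasFPowerSeriesAt.isBigO_sub_partialSum_pow m
  have h2 : ∀ v, p.partialSum m v = 0 := fun v => by
    refine Finset.sum_eq_zero fun i hi => ?_
    have h3 := hp.factorial_smul v i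
    rw [h0 i (Finset.mem_range.1 hi)] at h3
    have h4 : (i.factorial : ℂ) • (p i fun _ => v) = 0 := by
      rw [Nat.cast_smul_eq_nsmul]; simpa using h3
    exact (smul_eq_zero.1 h4).resolve_left (by exact_mod_cast i.factorial_ne_zero)
  simp only [h2, sub_zero] at h1
  have h5 : Tendsto (fun z => z - y) (𝓝 y) (𝓝 0) := by
    have : ContinuousAt (fun z => z - y) y := by fun_prop
    simpa [ContinuousAt] using this
  have h6 := h1.comp_tendsto h5
  simpa [Function.comp_def] using h6

theorem eventually_eq_zero_of_isBigO_pow_analyticAt {h : E → ℂ} {y : E} (ha : AnalyticAt ℂ h y)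
    (hO : ∀ m : ℕ, h =O[𝓝 y] (fun z => ‖z - y‖ ^ m)) : ∀ᶠ z in 𝓝 y, h z = 0 := by
  have h0 : ∀ i, iteratedFDeriv ℂ i h y = 0 := fun i =>
    iteratedFDeriv_eq_zero_of_isBigO_pow ha (hO (i + 1)) i (by omega)
  obtain ⟨p, r, hp⟩ := ha
  have h2 : ∀ i v, (p i fun _ => v) = 0 := fun i v => by
    have h3 := hp.factorial_smul v i
    rw [h0 i] at h3
    have h4 : (i.factorial : ℂ) • (p i fun _ => v) = 0 := by
      rw [Nat.cast_smul_eq_nsmul]; simpa using h3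
    exact (smul_eq_zero.1 h4).resolve_left (by exact_mod_cast i.factorial_ne_zero)
  filter_upwards [hp.eventually_hasSum_sub] with z hz
  simp only [h2] at hz
  exact hz.unique hasSum_zero

end VanishingOrder

/-! ### Division by a linear form -/

section Division

variable {E : Type} [NormedAddCommGroup E] [NormedSpace ℂ E]

/-- A holomorphic function that vanishes on the hyperplane `L = 0` is divisible by `L`. -/
theorem exists_eventuallyEq_mul_of_eq_zero_on_hyperplane {g : E → ℂ} {x₀ v : E} {L : E →L[ℂ] ℂ}
    (hg : AnalyticAt ℂ g x₀) (hv : L v = 1) (hx₀ : L x₀ = 0)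
    (h0 : ∀ᶠ y in 𝓝 x₀, L y = 0 → g y = 0) :
    ∃ u, AnalyticAt ℂ u x₀ ∧ ∀ᶠ y in 𝓝 x₀, g y = L y * u y := by
  -- The path `s ↦ π (y, s)` goes from the projection of `y` to the hyperplane along `v` to `y` itself,
  -- with derivative `L y • v`; the quotient is the integral of the derivative of `g` in the direction
  -- `v` along this path.
  set π : E × ℂ → E := fun p => p.1 - ((1 - p.2) * L p.1) • v with hπ
  have hπa : ∀ p, AnalyticAt ℂ π p := fun p => by
    have h1 : AnalyticAt ℂ (fun p : E × ℂ => L p.1) p := L.analyticAt _ |>.comp analyticAt_fst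
    exact analyticAt_fst.sub (((analyticAt_const.sub analyticAt_snd).mul h1).smul analyticAt_const)
  have hπ0 : ∀ s, π (x₀, s) = x₀ := fun s => by simp [hπ, hx₀]
  have hGa : ∀ s, AnalyticAt ℂ (fun p => fderiv ℂ g (π p) v) (x₀, s) := fun s =>
    ((ContinuousLinearMap.apply ℂ ℂ v).analyticAt _).comp
      ((hg.fderiv).comp_of_eq (hπa _) (hπ0 s))
  refine ⟨_, (analyticAt_setIntegral (G := fun p => fderiv ℂ g (π p) v) (γ := fun s : ℝ => (s : ℂ))
    (w := fun _ => 1) (K := Icc 0 1) Complex.continuous_ofReal continuous_const isCompact_Icc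
    fun s _ => hGa s).1, ?_⟩
  have hev : ∀ᶠ y in 𝓝 x₀, ∀ s ∈ Icc (0 : ℝ) 1, AnalyticAt ℂ g (π (y, s)) := by
    refine isCompact_Icc.eventually_forall_of_forall_eventually fun s _ => ?_
    have h1 : ContinuousAt (fun p : E × ℝ => π (p.1, p.2)) (x₀, s) :=
      ContinuousAt.comp_of_eq (hπa (x₀, s)).continuousAt
        (f := fun p : E × ℝ => ((p.1, (p.2 : ℂ)) : E × ℂ)) (by fun_prop) rfl
    refine h1.eventually ?_
    simp only [hπ0]
    exact hg.eventually_analyticAt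
  have hπc : ContinuousAt (fun y => π (y, 0)) x₀ :=
    ContinuousAt.comp_of_eq (hπa (x₀, 0)).continuousAt (f := fun y : E => (y, (0 : ℂ)))
      (by fun_prop) rfl
  have h0' : ∀ᶠ y in 𝓝 x₀, g (π (y, 0)) = 0 := by
    have := hπc.eventually (p := fun z => L z = 0 → g z = 0) (by simp only [hπ0]; exact h0)
    filter_upwards [this] with y hy
    exact hy (by simp [hπ, hv])
  filter_upwards [hev, h0'] with y hy hy0
  have hd : ∀ s ∈ uIcc (0 : ℝ) 1, HasDerivAt (fun s : ℝ => g (π (y, s)))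
      (L y * fderiv ℂ g (π (y, s)) v) s := by
    intro s hs
    rw [uIcc_of_le zero_le_one] at hs
    have h1 : HasDerivAt (fun s : ℝ => π (y, s)) (L y • v) s := by
      have h2 : HasDerivAt (fun s : ℝ => (s : ℂ)) 1 s := Complex.ofRealCLM.hasDerivAt
      have h3 := ((((h2.const_sub 1).mul_const (L y)).smul_const v).const_sub y)
      simpa [hπ] using h3
    have h4 := ((hy s hs).differentiableAt.hasFDerivAt.restrictScalars ℝ).comp_hasDerivAt s h1
    simpa using! h4
  have hcont : ContinuousOn (fun s : ℝ => L y * fderiv ℂ g (π (y, s)) v) (uIcc 0 1) := by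
    intro s hs
    rw [uIcc_of_le zero_le_one] at hs
    have h1 : AnalyticAt ℂ (fun p => fderiv ℂ g (π p) v) (y, (s : ℂ)) :=
      ((ContinuousLinearMap.apply ℂ ℂ v).analyticAt _).comp ((hy s hs).fderiv.comp_of_eq (hπa _) rfl)
    have h2 : ContinuousAt (fun s : ℝ => fderiv ℂ g (π (y, s)) v) s :=
      ContinuousAt.comp_of_eq h1.continuousAt (f := fun s : ℝ => (y, (s : ℂ))) (by fun_prop) rfl
    exact (continuousAt_const.mul h2).continuousWithinAt
  have h5 := intervalIntegral.integral_eq_sub_of_hasDerivAt hd hcont.intervalIntegrable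
  rw [intervalIntegral.integral_const_mul] at h5
  have h6 : π (y, ((1 : ℝ) : ℂ)) = y := by simp [hπ]
  have h7 : π (y, ((0 : ℝ) : ℂ)) = π (y, 0) := by simp
  rw [h6, h7, hy0, sub_zero] at h5
  rw [← h5, intervalIntegral.integral_of_le zero_le_one, integral_Icc_eq_integral_Ioc]
  simp

/-- A holomorphic function that is not identically zero is `L ^ m` times a holomorphic function that
does not vanish identically on the hyperplane `L = 0`. -/
theorem exists_eventuallyEq_pow_mul {g : E → ℂ} {x₀ v : E} {L : E →L[ℂ] ℂ}
    (hg : AnalyticAt ℂ g x₀) (hv : L v = 1) (hx₀ : L x₀ = 0) (hne : ∃ᶠ y in 𝓝 x₀, g y ≠ 0) :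
    ∃ (m : ℕ) (u : E → ℂ), AnalyticAt ℂ u x₀ ∧ (∀ᶠ y in 𝓝 x₀, g y = L y ^ m * u y) ∧
      ∃ᶠ y in 𝓝 x₀, L y = 0 ∧ u y ≠ 0 := by
  by_contra hcon
  push Not at hcon
  have H : ∀ m : ℕ, ∃ u, AnalyticAt ℂ u x₀ ∧ ∀ᶠ y in 𝓝 x₀, g y = L y ^ m * u y := by
    intro m
    induction m with
    | zero => exact ⟨g, hg, by simp⟩
    | succ m ih =>
      obtain ⟨u, hu, hgu⟩ := ih
      have h1 := hcon m u hu hgu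
      obtain ⟨u', hu', h2⟩ := exists_eventuallyEq_mul_of_eq_zero_on_hyperplane hu hv hx₀ (by
        simpa [Filter.Frequently] using h1)
      refine ⟨u', hu', ?_⟩
      filter_upwards [hgu, h2] with y h3 h4
      rw [h3, h4]; ring
  refine hne (?_ : ∀ᶠ y in 𝓝 x₀, ¬ g y ≠ 0)
  have := eventually_eq_zero_of_isBigO_pow_analyticAt hg fun m => by
    obtain ⟨u, hu, hgu⟩ := H m
    have h1 : g =ᶠ[𝓝 x₀] fun y => L y ^ m * u y := hgu
    refine h1.trans_isBigO ?_
    have h2 : (fun y => L y) =O[𝓝 x₀] fun y => ‖y - x₀‖ := by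
      refine Asymptotics.IsBigO.of_bound ‖L‖ (Eventually.of_forall fun y => ?_)
      have : L y = L (y - x₀) := by simp [hx₀]
      rw [this, norm_norm]; exact L.le_opNorm _
    have h3 := (h2.pow m).mul ((hu.continuousAt.norm.isBoundedUnder_le).isBigO_one ℝ)
    simpa using h3
  simpa using this

end Division

/-! ### Complements of zero sets -/

section Connected

variable {E : Type} [NormedAddCommGroup E] [NormedSpace ℂ E]

theorem frequently_ne_zero_of_exists_ne_zero {u : E → ℂ} {B : Set E} (hB : IsPreconnected B)
    (hu : AnalyticOnNhd ℂ u B) (hne : ∃ x ∈ B, u x ≠ 0) {x : E} (hx : x ∈ B) :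
    ∃ᶠ y in 𝓝 x, u y ≠ 0 := by
  intro h
  obtain ⟨y, hy, hy0⟩ := hne
  exact hy0 (hu.eqOn_zero_of_preconnected_of_eventuallyEq_zero hB hx
    (h.mono fun z hz => not_not.1 hz) hy)

/-- The complement of the zero set of a holomorphic function in a convex open set is connected: two
of its points can be joined inside the complex line through them, where zeros are isolated. -/
theorem isPreconnected_ne_zero {u : E → ℂ} {B : Set E} (hB : Convex ℝ B) (hBo : IsOpen B)
    (hu : AnalyticOnNhd ℂ u B) : IsPreconnected {y ∈ B | u y ≠ 0} := by
  refine isPreconnected_of_forall_pair ?_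
  rintro p ⟨hpB, hp⟩ q ⟨hqB, hq⟩
  set l : ℂ → E := fun s => p + s • (q - p) with hl
  have hlc : Continuous l := by fun_prop
  have hev : ∀ᶠ y : ℝ in 𝓝 0, ∀ x ∈ Icc (0 : ℝ) 1, l ((x : ℂ) + y * Complex.I) ∈ B := by
    refine isCompact_Icc.eventually_forall_of_forall_eventually fun x hx => ?_
    have h1 : Continuous fun z : ℝ × ℝ => l ((z.2 : ℂ) + z.1 * Complex.I) := by fun_prop
    refine h1.continuousAt.eventually_mem (hBo.mem_nhds ?_)
    have := hB.add_smul_sub_mem hpB hqB hx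
    simpa [hl] using this
  obtain ⟨ε, hε, hεB⟩ := Metric.nhds_basis_closedBall.eventually_iff.1 hev
  set K : Set ℂ := Icc 0 1 ×ℂ Icc (-ε) ε with hK
  have hKc : IsCompact K := isCompact_Icc.reProdIm isCompact_Icc
  have hKB : ∀ s ∈ K, l s ∈ B := by
    rintro s ⟨h1, h2⟩
    have := hεB (x := s.im) (by rw [Metric.mem_closedBall, Real.dist_0_eq_abs, abs_le]; exact h2) s.re h1
    rwa [Complex.re_add_im] at this
  have hφ : AnalyticOnNhd ℂ (fun s => u (l s)) K := fun s hs =>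
    (hu _ (hKB s hs)).comp (by fun_prop : AnalyticAt ℂ l s)
  have h0K : (0 : ℂ) ∈ K := ⟨by simp, by simp [hε.le]⟩
  have h1K : (1 : ℂ) ∈ K := ⟨by simp, by simp [hε.le]⟩
  have hKconv : Convex ℝ K := ((convex_Icc 0 1).linear_preimage Complex.reLm).inter
    ((convex_Icc (-ε) ε).linear_preimage Complex.imLm)
  have hfin : {s ∈ K | u (l s) = 0}.Finite := by
    have h1 := hφ.preimage_zero_mem_codiscreteWithin (x := 0) (by simpa [hl] using hp) h0K
      ⟨⟨0, h0K⟩, hKconv.isPreconnected⟩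
    refine (hKc.finite_sdiff_of_mem_codiscreteWithin h1).subset ?_
    rintro s ⟨h2, h3⟩
    exact ⟨h2, by simp [h3]⟩
  -- A parabola through `0` and `1` that avoids the finitely many zeros.
  obtain ⟨y, hyε, hy⟩ : ∃ y ∈ Ioo 0 ε, y ∉ (fun s : ℂ => s.im / (s.re * (1 - s.re))) ''
      {s ∈ K | u (l s) = 0} := by
    by_contra hcon
    push Not at hcon
    exact (Ioo_infinite hε) ((hfin.image _).subset hcon)
  set γ : ℝ → ℂ := fun x => (x : ℂ) + (y * (x * (1 - x)) : ℝ) * Complex.I with hγ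
  have hγre : ∀ x, (γ x).re = x := fun x => by simp [hγ]
  have hγim : ∀ x, (γ x).im = y * (x * (1 - x)) := fun x => by simp [hγ]
  have hγK : ∀ x ∈ Icc (0 : ℝ) 1, γ x ∈ K := by
    rintro x ⟨hx0, hx1⟩
    refine ⟨by simp only [mem_preimage, hγre]; exact ⟨hx0, hx1⟩, ?_⟩
    simp only [mem_preimage, hγim]
    have h2 : 0 ≤ x * (1 - x) := mul_nonneg hx0 (by linarith)
    have h3 : x * (1 - x) ≤ 1 := by nlinarith
    constructor
    · have := mul_nonneg hyε.1.le h2; linarith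
    · calc y * (x * (1 - x)) ≤ y * 1 := by gcongr; exact hyε.1.le
        _ ≤ ε := by linarith [hyε.2]
  refine ⟨(fun x => l (γ x)) '' Icc (0 : ℝ) 1, ?_, ⟨0, by simp, by simp [hγ, hl]⟩,
    ⟨1, by simp, by simp [hγ, hl]⟩, ?_⟩
  · rintro _ ⟨x, hx, rfl⟩
    refine ⟨hKB _ (hγK x hx), fun h0 => ?_⟩
    rcases eq_or_ne x 0 with rfl | hx0
    · exact hp (by simpa [hγ, hl] using h0)
    rcases eq_or_ne x 1 with rfl | hx1
    · exact hq (by simpa [hγ, hl] using h0)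
    refine hy ⟨γ x, ⟨hγK x hx, h0⟩, ?_⟩
    have : x * (1 - x) ≠ 0 := mul_ne_zero hx0 (sub_ne_zero.2 hx1.symm)
    simp only [hγre, hγim]
    field_simp
  · exact isPreconnected_Icc.image _ (by fun_prop)

end Connected

/-! ### Orders of vanishing on a manifold -/

section ManifoldOrder

variable {k : ℕ} {M : Type*} [TopologicalSpace M] [ChartedSpace (EuclideanSpace ℂ (Fin k)) M]
  [IsManifold 𝓘(ℂ, EuclideanSpace ℂ (Fin k)) ω M]

/-- The atlas of all holomorphic charts of `M`. -/
abbrev holAtlas (k : ℕ) (M : Type*) [TopologicalSpace M]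
    [ChartedSpace (EuclideanSpace ℂ (Fin k)) M] :
    Set (OpenPartialHomeomorph M (EuclideanSpace ℂ (Fin k))) :=
  IsManifold.maximalAtlas 𝓘(ℂ, EuclideanSpace ℂ (Fin k)) ω M

theorem eventually_nhds_chart {e : OpenPartialHomeomorph M (EuclideanSpace ℂ (Fin k))} {x : M}
    (hx : x ∈ e.source) {p : M → Prop} :
    (∀ᶠ z in 𝓝 (e x), p (e.symm z)) ↔ ∀ᶠ y in 𝓝 x, p y := by
  rw [← e.symm_map_nhds_eq hx, eventually_map]

theorem contMDiffAt_iff_analyticAt {e : OpenPartialHomeomorph M (EuclideanSpace ℂ (Fin k))}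
    (he : e ∈ holAtlas k M) {x : M} (hx : x ∈ e.source) {h : M → ℂ} :
    ContMDiffAt 𝓘(ℂ, EuclideanSpace ℂ (Fin k)) 𝓘(ℂ, ℂ) ω h x ↔
      AnalyticAt ℂ (fun z => h (e.symm z)) (e x) := by
  constructor
  · intro hh
    have h1 := contMDiffAt_symm_of_mem_maximalAtlas he (e.map_source hx)
    have h2 : ContMDiffAt 𝓘(ℂ, EuclideanSpace ℂ (Fin k)) 𝓘(ℂ, ℂ) ω (h ∘ e.symm) (e x) :=
      ContMDiffAt.comp_of_eq (f := e.symm) hh h1 (e.left_inv hx)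
    exact (contMDiffAt_iff_contDiffAt.1 h2).analyticAt
  · intro hh
    have h1 := contMDiffAt_of_mem_maximalAtlas he hx
    have h2 : ContMDiffAt 𝓘(ℂ, EuclideanSpace ℂ (Fin k)) 𝓘(ℂ, ℂ) ω
        (fun z => h (e.symm z)) (e x) := contMDiffAt_iff_contDiffAt.2 hh.contDiffAt
    refine (ContMDiffAt.comp_of_eq (f := e) h2 h1 rfl).congr_of_eventuallyEq ?_
    filter_upwards [e.open_source.mem_nhds hx] with y hy
    simp [e.left_inv hy]

theorem eventually_contMDiffAt {h : M → ℂ} {x : M}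
    (hh : ContMDiffAt 𝓘(ℂ, EuclideanSpace ℂ (Fin k)) 𝓘(ℂ, ℂ) ω h x) :
    ∀ᶠ y in 𝓝 x, ContMDiffAt 𝓘(ℂ, EuclideanSpace ℂ (Fin k)) 𝓘(ℂ, ℂ) ω h y := by
  set e := chartAt (EuclideanSpace ℂ (Fin k)) x
  have he : e ∈ holAtlas k M := IsManifold.chart_mem_maximalAtlas x
  have hx : x ∈ e.source := mem_chart_source _ x
  have h1 := ((contMDiffAt_iff_analyticAt he hx).1 hh).eventually_analyticAt
  have h2 : ∀ᶠ y in 𝓝 x, AnalyticAt ℂ (fun z => h (e.symm z)) (e y) :=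
    (e.continuousAt hx).eventually h1
  filter_upwards [h2, e.open_source.mem_nhds hx] with y hy hys
  exact (contMDiffAt_iff_analyticAt he hys).2 hy

theorem isBigO_chart_sub {e e' : OpenPartialHomeomorph M (EuclideanSpace ℂ (Fin k))}
    (he : e ∈ holAtlas k M) (he' : e' ∈ holAtlas k M) {x : M} (hx : x ∈ e.source)
    (hx' : x ∈ e'.source) :
    (fun y => e y - e x) =O[𝓝 x] fun y => e' y - e' x := by
  have h1 := contMDiffAt_symm_of_mem_maximalAtlas he' (e'.map_source hx')
  have h2 := contMDiffAt_of_mem_maximalAtlas he hx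
  have h3 : ContMDiffAt 𝓘(ℂ, EuclideanSpace ℂ (Fin k)) 𝓘(ℂ, EuclideanSpace ℂ (Fin k)) ω
      (e ∘ e'.symm) (e' x) := ContMDiffAt.comp_of_eq (f := e'.symm) h2 h1 (e'.left_inv hx')
  have h4 := (contMDiffAt_iff_contDiffAt.1 h3).analyticAt.differentiableAt.isBigO_sub
  have h5 := h4.comp_tendsto (e'.continuousAt hx')
  refine (h5.congr' ?_ (Eventually.of_forall fun _ => rfl))
  filter_upwards [e'.open_source.mem_nhds hx'] with y hy
  simp [e'.left_inv hy, e'.left_inv hx']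

/-- The order of vanishing at a point of a holomorphic function on `M`, in the preferred chart. -/
noncomputable def ordAt (k : ℕ) {M : Type*} [TopologicalSpace M] [ChartedSpace (EuclideanSpace ℂ (Fin k)) M]
    (h : M → ℂ) (x : M) : ℕ∞ :=
  vanishingOrder (fun z => h ((chartAt (EuclideanSpace ℂ (Fin k)) x).symm z))
    (chartAt (EuclideanSpace ℂ (Fin k)) x x)

theorem le_vanishingOrder_iff {h : EuclideanSpace ℂ (Fin k) → ℂ} {y : EuclideanSpace ℂ (Fin k)}
    {m : ℕ} : (m : ℕ∞) ≤ vanishingOrder h y ↔ ∀ i < m, iteratedFDeriv ℂ i h y = 0 := by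
  simp only [vanishingOrder, mem_ofPred_eq, le_iInf_iff, Nat.cast_le]
  constructor
  · intro H i hi
    by_contra h0
    exact absurd (H i h0) (not_le.2 hi)
  · intro H i hi
    by_contra h0
    exact hi (H i (not_le.1 h0))

theorem isBigO_pow_chart_iff {e : OpenPartialHomeomorph M (EuclideanSpace ℂ (Fin k))}
    {x : M} (hx : x ∈ e.source) {h : M → ℂ} {m : ℕ} :
    (h =O[𝓝 x] fun y => ‖e y - e x‖ ^ m) ↔
      (fun z => h (e.symm z)) =O[𝓝 (e x)] fun z => ‖z - e x‖ ^ m := by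
  constructor
  · intro H
    have h1 := H.comp_tendsto (k := e.symm) (l' := 𝓝 (e x)) (by
      have := (e.continuousAt_symm (e.map_source hx)).tendsto
      rwa [e.left_inv hx] at this)
    refine h1.congr' (Eventually.of_forall fun _ => rfl) ?_
    filter_upwards [e.open_target.mem_nhds (e.map_source hx)] with z hz
    simp [e.right_inv hz]
  · intro H
    have h1 := H.comp_tendsto (e.continuousAt hx)
    refine h1.congr' ?_ (Eventually.of_forall fun _ => rfl)
    filter_upwards [e.open_source.mem_nhds hx] with y hy
    simp [e.left_inv hy]

/-- The order of vanishing is a growth exponent, in any holomorphic chart. -/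
theorem le_ordAt_iff_isBigO {e : OpenPartialHomeomorph M (EuclideanSpace ℂ (Fin k))}
    (he : e ∈ holAtlas k M) {x : M} (hx : x ∈ e.source) {h : M → ℂ}
    (hh : ContMDiffAt 𝓘(ℂ, EuclideanSpace ℂ (Fin k)) 𝓘(ℂ, ℂ) ω h x) {m : ℕ} :
    (m : ℕ∞) ≤ ordAt k h x ↔ h =O[𝓝 x] fun y => ‖e y - e x‖ ^ m := by
  have he' : chartAt (EuclideanSpace ℂ (Fin k)) x ∈ holAtlas k M :=
    IsManifold.chart_mem_maximalAtlas x
  have hx' := mem_chart_source (EuclideanSpace ℂ (Fin k)) x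
  rw [ordAt, le_vanishingOrder_iff,
    ← isBigO_pow_iff_iteratedFDeriv_eq_zero ((contMDiffAt_iff_analyticAt he' hx').1 hh),
    ← isBigO_pow_chart_iff hx']
  exact ⟨fun H => H.trans ((isBigO_chart_sub he' he hx' hx).norm_norm.pow m),
    fun H => H.trans ((isBigO_chart_sub he he' hx hx').norm_norm.pow m)⟩

theorem le_ordAt_iff_iteratedFDeriv {e : OpenPartialHomeomorph M (EuclideanSpace ℂ (Fin k))}
    (he : e ∈ holAtlas k M) {x : M} (hx : x ∈ e.source) {h : M → ℂ}
    (hh : ContMDiffAt 𝓘(ℂ, EuclideanSpace ℂ (Fin k)) 𝓘(ℂ, ℂ) ω h x) {m : ℕ} :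
    (m : ℕ∞) ≤ ordAt k h x ↔
      ∀ i < m, iteratedFDeriv ℂ i (fun z => h (e.symm z)) (e x) = 0 := by
  rw [le_ordAt_iff_isBigO he hx hh, isBigO_pow_chart_iff hx,
    isBigO_pow_iff_iteratedFDeriv_eq_zero ((contMDiffAt_iff_analyticAt he hx).1 hh)]

/-- Comparable functions have the same order of vanishing. -/
theorem ordAt_eq_of_isTheta {h₁ h₂ : M → ℂ} {x : M}
    (hh₁ : ContMDiffAt 𝓘(ℂ, EuclideanSpace ℂ (Fin k)) 𝓘(ℂ, ℂ) ω h₁ x)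
    (hh₂ : ContMDiffAt 𝓘(ℂ, EuclideanSpace ℂ (Fin k)) 𝓘(ℂ, ℂ) ω h₂ x)
    (H : h₁ =Θ[𝓝 x] h₂) : ordAt k h₁ x = ordAt k h₂ x := by
  have he' : chartAt (EuclideanSpace ℂ (Fin k)) x ∈ holAtlas k M :=
    IsManifold.chart_mem_maximalAtlas x
  have hx' := mem_chart_source (EuclideanSpace ℂ (Fin k)) x
  refine ENat.eq_of_forall_natCast_le_iff fun m => ?_
  rw [le_ordAt_iff_isBigO he' hx' hh₁, le_ordAt_iff_isBigO he' hx' hh₂]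
  exact H.isBigO_congr_left

end ManifoldOrder

/-! ### Regular points of a hypersurface -/

section RegularPoints

variable {k : ℕ} {M : Type*} [TopologicalSpace M] [ChartedSpace (EuclideanSpace ℂ (Fin k)) M]
  [IsManifold 𝓘(ℂ, EuclideanSpace ℂ (Fin k)) ω M]

/-- In the holomorphic chart `e` at `x`, the set `A` is near `x` the hyperplane `L = 0`; the
vector `v`, on which `L` takes the value `1`, is transverse to it. -/
structure IsHyperplaneAt (A : Set M) (x : M)
    (e : OpenPartialHomeomorph M (EuclideanSpace ℂ (Fin k)))
    (L : EuclideanSpace ℂ (Fin k) →L[ℂ] ℂ) (v : EuclideanSpace ℂ (Fin k)) : Prop where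
  mem_atlas : e ∈ holAtlas k M
  mem_source : x ∈ e.source
  apply_v : L v = 1
  apply_x : L (e x) = 0
  eventually_mem : ∀ᶠ y in 𝓝 x, y ∈ A ↔ L (e y) = 0

theorem mem_regularPart_of_chart {A : Set M} {x : M}
    {e : OpenPartialHomeomorph M (EuclideanSpace ℂ (Fin k))} (he : e ∈ holAtlas k M)
    (hx : x ∈ e.source) (hxA : x ∈ A) {ψ : EuclideanSpace ℂ (Fin k) → ℂ}
    (hψ : AnalyticAt ℂ ψ (e x)) (hψ' : fderiv ℂ ψ (e x) ≠ 0)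
    (hA : ∀ᶠ y in 𝓝 x, y ∈ A ↔ ψ (e y) = 0) : x ∈ regularPart k A := by
  have hev : ((fun y => ψ (e y)) ∘ e.symm) =ᶠ[𝓝 (e x)] ψ := by
    filter_upwards [e.open_target.mem_nhds (e.map_source hx)] with z hz
    simp [e.right_inv hz]
  have h1 : ContMDiffAt 𝓘(ℂ, EuclideanSpace ℂ (Fin k)) 𝓘(ℂ, ℂ) ω (fun y => ψ (e y)) x :=
    (contMDiffAt_iff_analyticAt he hx).2 (hψ.congr hev.symm)
  refine ⟨hxA, fun y => ψ (e y), h1, fun h0 => hψ' ?_, hA⟩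
  have h2 := contMDiffAt_symm_of_mem_maximalAtlas he (e.map_source hx)
  have h3 := h1.mdifferentiableAt (by simp)
  have h4 := h2.mdifferentiableAt (by simp)
  have h5 : mfderiv 𝓘(ℂ, EuclideanSpace ℂ (Fin k)) 𝓘(ℂ, ℂ) (fun y => ψ (e y)) (e.symm (e x)) =
      0 := by
    rw [e.left_inv hx]; exact h0
  have h6 := mfderiv_comp_of_eq (x := e x) (y := x) (f := e.symm) h3 h4 (e.left_inv hx)
  rw [mfderiv_eq_fderiv, hev.fderiv_eq] at h6
  ext w
  rw [h6, h5]; rfl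

theorem IsHyperplaneAt.mem_regularPart {A : Set M} {x : M}
    {e : OpenPartialHomeomorph M (EuclideanSpace ℂ (Fin k))}
    {L : EuclideanSpace ℂ (Fin k) →L[ℂ] ℂ} {v : EuclideanSpace ℂ (Fin k)}
    (H : IsHyperplaneAt A x e L v) : x ∈ regularPart k A := by
  refine mem_regularPart_of_chart H.mem_atlas H.mem_source
    (H.eventually_mem.self_of_nhds.2 H.apply_x) (L.analyticAt _) (fun h0 => ?_) H.eventually_mem
  rw [L.fderiv] at h0
  have := H.apply_v
  simp [h0] at this

/-- A hypersurface is straightened by a suitable chart at each of its regular points. -/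
theorem exists_isHyperplaneAt {A : Set M} {x : M} (hx : x ∈ regularPart k A) :
    ∃ (e : OpenPartialHomeomorph M (EuclideanSpace ℂ (Fin k)))
      (L : EuclideanSpace ℂ (Fin k) →L[ℂ] ℂ) (v : EuclideanSpace ℂ (Fin k)),
      IsHyperplaneAt A x e L v := by
  obtain ⟨hxA, l, hl, hl', hlA⟩ := hx
  set κ := chartAt (EuclideanSpace ℂ (Fin k)) x with hκ
  have hκm : κ ∈ holAtlas k M := IsManifold.chart_mem_maximalAtlas x
  have hxκ : x ∈ κ.source := mem_chart_source _ x
  set lh : EuclideanSpace ℂ (Fin k) → ℂ := fun z => l (κ.symm z) with hlh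
  have hla : AnalyticAt ℂ lh (κ x) := (contMDiffAt_iff_analyticAt hκm hxκ).1 hl
  set D := fderiv ℂ lh (κ x) with hD
  have hlx : lh (κ x) = 0 := by
    simp only [hlh, κ.left_inv hxκ]; exact hlA.self_of_nhds.1 hxA
  have hD0 : D ≠ 0 := by
    intro h0
    apply hl'
    have h1 : MDifferentiableAt 𝓘(ℂ, EuclideanSpace ℂ (Fin k)) 𝓘(ℂ, ℂ) lh (κ x) :=
      hla.differentiableAt.mdifferentiableAt
    have h2 := (contMDiffAt_of_mem_maximalAtlas hκm hxκ).mdifferentiableAt (n := ω) (by simp)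
    have h3 := mfderiv_comp (x := x) (f := κ) (g := lh) h1 h2
    have h4 : l =ᶠ[𝓝 x] lh ∘ κ := by
      filter_upwards [κ.open_source.mem_nhds hxκ] with y hy
      simp [hlh, κ.left_inv hy]
    rw [h4.mfderiv_eq, h3, mfderiv_eq_fderiv]
    have h5 : fderiv ℂ lh (κ x) = 0 := h0
    ext w
    change fderiv ℂ lh (κ x) _ = 0
    rw [h5]; rfl
  obtain ⟨w, hw⟩ : ∃ w, D w ≠ 0 := by
    by_contra hcon
    push Not at hcon
    exact hD0 (ContinuousLinearMap.ext hcon)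
  set v := (D w)⁻¹ • w with hv
  have hDv : D v = 1 := by simp [hv, hw]
  -- The nonlinear part of the equation is absorbed in the direction `v`.
  set Φ : EuclideanSpace ℂ (Fin k) → EuclideanSpace ℂ (Fin k) := fun y =>
    (y - κ x) + (lh y - D (y - κ x)) • v with hΦ
  have hΦa : AnalyticAt ℂ Φ (κ x) := by
    have h1 : AnalyticAt ℂ (fun y => y - κ x) (κ x) := by fun_prop
    exact h1.add ((hla.sub ((D.analyticAt _).comp h1)).smul analyticAt_const)
  have hΦd : HasFDerivAt Φ ((ContinuousLinearEquiv.refl ℂ (EuclideanSpace ℂ (Fin k)) :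
      EuclideanSpace ℂ (Fin k) ≃L[ℂ] _) : EuclideanSpace ℂ (Fin k) →L[ℂ] _) (κ x) := by
    have h1 : HasFDerivAt (fun y => y - κ x) (ContinuousLinearMap.id ℂ _) (κ x) :=
      (hasFDerivAt_id _).sub_const _
    have h2 : HasFDerivAt (fun y => D (y - κ x)) D (κ x) := by
      have := HasFDerivAt.comp (g := D) (f := fun y => y - κ x) (κ x) D.hasFDerivAt h1
      rwa [ContinuousLinearMap.comp_id] at this
    have h3 := h1.add ((hla.differentiableAt.hasFDerivAt.sub h2).smul_const v)
    refine h3.congr_fderiv ?_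
    ext1 y
    simp [hD]
  have hDΦ : ∀ y, D (Φ y) = lh y := fun y => by simp [hΦ, hDv]
  set Ψ := hΦa.contDiffAt (n := ω).toOpenPartialHomeomorph Φ hΦd (by simp) with hΨ
  have hΨc : ∀ y, Ψ y = Φ y := fun _ => rfl
  have hxΨ : κ x ∈ Ψ.source :=
    hΦa.contDiffAt.mem_toOpenPartialHomeomorph_source hΦd (by simp)
  have hΨs : AnalyticAt ℂ Ψ.symm (Ψ (κ x)) := by
    refine ContDiffAt.analyticAt (Ψ.contDiffAt_symm (f₀' := ContinuousLinearEquiv.refl ℂ _)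
      (Ψ.map_source hxΨ) ?_ ?_)
    · rw [Ψ.left_inv hxΨ]; exact hΦd
    · rw [Ψ.left_inv hxΨ]; exact hΦa.contDiffAt
  set U : Set (EuclideanSpace ℂ (Fin k)) := {y | AnalyticAt ℂ Φ y} with hU
  set V : Set (EuclideanSpace ℂ (Fin k)) := {y | AnalyticAt ℂ Ψ.symm y} with hV
  have hUo : IsOpen U := isOpen_analyticAt ℂ Φ
  have hVo : IsOpen V := isOpen_analyticAt ℂ Ψ.symm
  set S : Set (EuclideanSpace ℂ (Fin k)) := U ∩ (Ψ.source ∩ Ψ ⁻¹' V) with hS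
  have hSo : IsOpen S := hUo.inter (Ψ.isOpen_inter_preimage hVo)
  have hxS : κ x ∈ S := ⟨hΦa, hxΨ, hΨs⟩
  set e := κ.trans (Ψ.restrOpen S hSo) with he
  have hec : ∀ y, e y = Φ (κ y) := fun _ => rfl
  have hes : ∀ y, e.symm y = κ.symm (Ψ.symm y) := fun _ => rfl
  have hxe : x ∈ e.source := by
    rw [he, OpenPartialHomeomorph.trans_source, OpenPartialHomeomorph.restrOpen_source]
    exact ⟨hxκ, hxΨ, hxS⟩
  have hem : e ∈ holAtlas k M := by
    refine e.mem_maximalAtlas_of_contMDiffOn ?_ ?_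
    · intro y hy
      rw [he, OpenPartialHomeomorph.trans_source, OpenPartialHomeomorph.restrOpen_source] at hy
      have h1 := contMDiffAt_of_mem_maximalAtlas hκm hy.1
      have h2 : ContMDiffAt 𝓘(ℂ, EuclideanSpace ℂ (Fin k)) 𝓘(ℂ, EuclideanSpace ℂ (Fin k)) ω Φ (κ y) :=
        contMDiffAt_iff_contDiffAt.2 (hy.2.2.1.contDiffAt)
      exact (ContMDiffAt.comp y h2 h1).contMDiffWithinAt
    · intro y hy
      have hy1 : y ∈ Ψ.target ∧ Ψ.symm y ∈ S ∧ Ψ.symm y ∈ κ.target := by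
        have h1 := e.map_target hy
        have h2 := e.right_inv hy
        have hy' := hy
        simp only [he, OpenPartialHomeomorph.trans_target] at hy'
        have h3 : y ∈ (Ψ.restrOpen S hSo).target := hy'.1
        have h4 := (Ψ.restrOpen S hSo).map_target h3
        rw [OpenPartialHomeomorph.restrOpen_source] at h4
        refine ⟨?_, h4.2, hy'.2⟩
        have h5 := (Ψ.restrOpen S hSo).right_inv h3
        have h6 : Ψ (Ψ.symm y) = y := h5
        rw [← h6]; exact Ψ.map_source h4.1
      have h1 : ContMDiffAt 𝓘(ℂ, EuclideanSpace ℂ (Fin k)) 𝓘(ℂ, EuclideanSpace ℂ (Fin k)) ω Ψ.symm y := by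
        have := hy1.2.1.2.2
        simp only [mem_preimage, Ψ.right_inv hy1.1] at this
        exact contMDiffAt_iff_contDiffAt.2 this.contDiffAt
      have h2 := contMDiffAt_symm_of_mem_maximalAtlas hκm hy1.2.2
      exact (ContMDiffAt.comp y h2 h1).contMDiffWithinAt
  refine ⟨e, D, v, hem, hxe, hDv, ?_, ?_⟩
  · rw [hec, hDΦ, hlx]
  · filter_upwards [hlA, κ.open_source.mem_nhds hxκ] with y hy hys
    rw [hy, hec, hDΦ]
    simp only [hlh, κ.left_inv hys]

theorem IsHyperplaneAt.eventually {A : Set M} {x : M}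
    {e : OpenPartialHomeomorph M (EuclideanSpace ℂ (Fin k))}
    {L : EuclideanSpace ℂ (Fin k) →L[ℂ] ℂ} {v : EuclideanSpace ℂ (Fin k)}
    (H : IsHyperplaneAt A x e L v) : ∀ᶠ y in 𝓝 x, y ∈ A → IsHyperplaneAt A y e L v := by
  filter_upwards [H.eventually_mem.eventually_nhds, e.open_source.mem_nhds H.mem_source]
    with y hy hys hyA
  exact ⟨H.mem_atlas, hys, H.apply_v, hy.self_of_nhds.1 hyA, hy⟩

/-- Near a regular point of the hypersurface `A`, a holomorphic function whose zeros lie in `A` is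
comparable to a power of a local equation of `A`. -/
theorem IsHyperplaneAt.exists_isTheta_pow {A : Set M} {x : M}
    {e : OpenPartialHomeomorph M (EuclideanSpace ℂ (Fin k))}
    {L : EuclideanSpace ℂ (Fin k) →L[ℂ] ℂ} {v : EuclideanSpace ℂ (Fin k)}
    (H : IsHyperplaneAt A x e L v) {h : M → ℂ}
    (hh : ContMDiffAt 𝓘(ℂ, EuclideanSpace ℂ (Fin k)) 𝓘(ℂ, ℂ) ω h x)
    (hA : ∀ᶠ y in 𝓝 x, h y = 0 → y ∈ A) (hne : ∃ᶠ y in 𝓝 x, h y ≠ 0) :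
    ∃ m : ℕ, h =Θ[𝓝 x] fun y => L (e y) ^ m := by
  have hga := (contMDiffAt_iff_analyticAt H.mem_atlas H.mem_source).1 hh
  set g : EuclideanSpace ℂ (Fin k) → ℂ := fun z => h (e.symm z) with hg
  have hgA : ∀ᶠ z in 𝓝 (e x), g z = 0 → L z = 0 := by
    have h1 := (eventually_nhds_chart H.mem_source (p := fun y => h y = 0 → L (e y) = 0)).2 (by
      filter_upwards [hA, H.eventually_mem] with y h1 h2 h3 using h2.1 (h1 h3))
    filter_upwards [h1, e.open_target.mem_nhds (e.map_source H.mem_source)] with z h2 h3 h4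
    have := h2 h4
    rwa [e.right_inv h3] at this
  have hgne : ∃ᶠ z in 𝓝 (e x), g z ≠ 0 := fun hcon =>
    hne ((eventually_nhds_chart H.mem_source (p := fun y => ¬ h y ≠ 0)).1 hcon)
  obtain ⟨m, u, hu, hgu, hune⟩ := exists_eventuallyEq_pow_mul hga H.apply_v H.apply_x hgne
  -- If `u` vanished at `e x`, then it would have a zero on each nearby complex line in the direction
  -- `v`, as zeros persist. As such a zero lies on `L = 0`, the function `u` would vanish at all the
  -- points of this hyperplane near `e x`.
  have hux : u (e x) ≠ 0 := by
    intro hu0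
    have hall : ∀ᶠ z in 𝓝 (e x), AnalyticAt ℂ u z ∧ (u z = 0 → L z = 0) := by
      filter_upwards [hu.eventually_analyticAt, hgu, hgA] with z h1 h2 h3
      exact ⟨h1, fun h4 => h3 (by rw [h2, h4, mul_zero])⟩
    have hcont : Continuous fun p : EuclideanSpace ℂ (Fin k) × ℂ => p.1 + p.2 • v := by fun_prop
    have hall' : ∀ᶠ p : EuclideanSpace ℂ (Fin k) × ℂ in 𝓝 (e x, 0),
        AnalyticAt ℂ u (p.1 + p.2 • v) ∧ (u (p.1 + p.2 • v) = 0 → L (p.1 + p.2 • v) = 0) := by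
      have : Tendsto (fun p : EuclideanSpace ℂ (Fin k) × ℂ => p.1 + p.2 • v) (𝓝 (e x, 0))
          (𝓝 (e x)) := by simpa using hcont.tendsto (e x, 0)
      exact this.eventually hall
    rw [nhds_prod_eq] at hall'
    obtain ⟨P, hP, Q, hQ, hPQ⟩ := Filter.eventually_prod_iff.1 hall'
    obtain ⟨ρ, hρ, hρQ⟩ := Metric.nhds_basis_closedBall.eventually_iff.1 hQ
    have hLv : ∀ z (s : ℂ), L (z + s • v) = L z + s := fun z s => by simp [H.apply_v]
    have hHa : ∀ z, P z → ∀ ζ ∈ Metric.closedBall (0 : ℂ) ρ,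
        AnalyticAt ℂ (Function.uncurry fun t (ζ : ℂ) => u (t + ζ • v)) (z, ζ) := by
      intro z hz ζ hζ
      have := (hPQ hz (hρQ hζ)).1
      exact AnalyticAt.comp (g := u) (f := fun p : EuclideanSpace ℂ (Fin k) × ℂ => p.1 + p.2 • v)
        this (analyticAt_fst.add (analyticAt_snd.smul analyticAt_const))
    have hPx := hP.self_of_nhds
    have hs : ∀ ζ ∈ Metric.sphere (0 : ℂ) ρ, u (e x + ζ • v) ≠ 0 := by
      intro ζ hζ h0
      have : L (e x + ζ • v) = 0 := (hPQ hPx (hρQ (Metric.sphere_subset_closedBall hζ))).2 h0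
      rw [hLv, H.apply_x, zero_add] at this
      rw [mem_sphere_zero_iff_norm, this, norm_zero] at hζ
      exact hρ.ne hζ
    obtain ⟨R₀, q, b1, b2, b3, b4⟩ := exists_factorization_closedBall hρ
      (fun ζ hζ => analyticAt_curry_right (hHa _ hPx ζ hζ)) hs
    have hR₀ := isRootMultiset_of_factorization b1 b2 b3 b4
    have h0R : (0 : ℂ) ∈ R₀ := by
      rw [← multiset_prod_sub_eq_zero]
      have h5 := b4 0
      have h6 := b3 0 (Metric.mem_closedBall_self hρ.le)
      rw [zero_smul, add_zero, hu0, eq_comm, mul_eq_zero] at h5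
      exact h5.resolve_right h6
    have hroots := eventually_card_roots_eq hρ (hHa _ hPx) hs hR₀
    refine hune (?_ : ∀ᶠ z in 𝓝 (e x), ¬ (L z = 0 ∧ u z ≠ 0))
    filter_upwards [hroots, hP] with z hz hPz
    rintro ⟨hLz, huz⟩
    obtain ⟨R, hR, hcard⟩ := hz
    have : 0 < R.card := by rw [hcard]; exact Multiset.card_pos_iff_exists_mem.2 ⟨0, h0R⟩
    obtain ⟨r, hr⟩ := Multiset.card_pos_iff_exists_mem.1 this
    have hrb := hR.1 r hr
    have h7 : u (z + r • v) = 0 := by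
      have h8 := hR.2 r hrb
      have h9 : analyticOrderAt (fun ζ : ℂ => u (z + ζ • v)) r ≠ 0 := by
        rw [← h8]
        exact_mod_cast (Multiset.count_pos.2 hr).ne'
      exact apply_eq_zero_of_analyticOrderAt_ne_zero (f := fun ζ : ℂ => u (z + ζ • v)) h9
    have h8 : L (z + r • v) = 0 := (hPQ hPz (hρQ (Metric.ball_subset_closedBall hrb))).2 h7
    rw [hLv, hLz, zero_add] at h8
    rw [h8, zero_smul, add_zero] at h7
    exact huz h7
  refine ⟨m, ?_⟩
  have h1 : g =Θ[𝓝 (e x)] fun z => L z ^ m := by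
    have h2 : g =ᶠ[𝓝 (e x)] fun z => L z ^ m * u z := hgu
    have h3 : u =Θ[𝓝 (e x)] fun _ => (1 : ℂ) := by
      have h5 := (Asymptotics.isEquivalent_const_iff_tendsto hux).2 hu.continuousAt.tendsto
      exact h5.isTheta.trans (Asymptotics.isTheta_const_const hux one_ne_zero)
    have h4 := (Asymptotics.isTheta_refl (fun z => L z ^ m) (𝓝 (e x))).mul h3
    simp only [mul_one] at h4
    exact h2.trans_isTheta h4
  have h2 : (g ∘ e) =Θ[𝓝 x] ((fun z => L z ^ m) ∘ e) :=
    ⟨h1.1.comp_tendsto (e.continuousAt H.mem_source), h1.2.comp_tendsto (e.continuousAt H.mem_source)⟩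
  refine (EventuallyEq.isTheta ?_).trans h2
  filter_upwards [e.open_source.mem_nhds H.mem_source] with y hy
  simp [hg, e.left_inv hy]

/-- The order of a function comparable to `L ^ m` is `m`; that it is not larger is seen on the complex
line in the direction `v`. -/
theorem IsHyperplaneAt.ordAt_eq {A : Set M} {x : M}
    {e : OpenPartialHomeomorph M (EuclideanSpace ℂ (Fin k))}
    {L : EuclideanSpace ℂ (Fin k) →L[ℂ] ℂ} {v : EuclideanSpace ℂ (Fin k)}
    (H : IsHyperplaneAt A x e L v) {h : M → ℂ}
    (hh : ContMDiffAt 𝓘(ℂ, EuclideanSpace ℂ (Fin k)) 𝓘(ℂ, ℂ) ω h x) {m : ℕ}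
    (hm : h =Θ[𝓝 x] fun y => L (e y) ^ m) : ordAt k h x = m := by
  refine le_antisymm ?_ ?_
  · by_contra hcon
    have h1 : ((m + 1 : ℕ) : ℕ∞) ≤ ordAt k h x := by
      push_cast
      exact Order.add_one_le_of_lt (not_le.1 hcon)
    rw [le_ordAt_iff_isBigO H.mem_atlas H.mem_source hh] at h1
    have h2 := hm.2.trans h1
    have h3 : Tendsto (fun s : ℂ => e.symm (e x + s • v)) (𝓝 0) (𝓝 x) := by
      have h4 : Tendsto (fun s : ℂ => e x + s • v) (𝓝 0) (𝓝 (e x)) := by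
        have : Continuous fun s : ℂ => e x + s • v := by fun_prop
        simpa using this.tendsto 0
      have h5 := (e.continuousAt_symm (e.map_source H.mem_source)).tendsto
      rw [e.left_inv H.mem_source] at h5
      exact h5.comp h4
    have h4 := h2.comp_tendsto h3
    have h5 : (fun s : ℂ => s ^ m) =O[𝓝 0] fun s : ℂ => s ^ (m + 1) := by
      have h6 : ∀ᶠ s : ℂ in 𝓝 0, e x + s • v ∈ e.target := by
        have : Continuous fun s : ℂ => e x + s • v := by fun_prop
        refine this.continuousAt.eventually_mem (e.open_target.mem_nhds ?_)
        simpa using e.map_source H.mem_source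
      have h7 : (fun s : ℂ => s ^ m) =O[𝓝 0] fun s : ℂ => ‖s • v‖ ^ (m + 1) := by
        refine h4.congr' ?_ ?_
        · filter_upwards [h6] with s hs
          simp [e.right_inv hs, H.apply_x, H.apply_v]
        · filter_upwards [h6] with s hs
          simp [e.right_inv hs]
      refine h7.trans (Asymptotics.IsBigO.of_bound (‖v‖ ^ (m + 1)) (Eventually.of_forall fun s => ?_))
      simp only [norm_smul, norm_pow, norm_mul, norm_norm, mul_pow]
      exact (mul_comm _ _).le
    have h6 : (fun s : ℂ => s ^ (m + 1)) =o[𝓝[≠] 0] fun s : ℂ => s ^ m :=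
      (Asymptotics.isLittleO_pow_pow (Nat.lt_succ_self m)).mono nhdsWithin_le_nhds
    have h7 := (h5.mono nhdsWithin_le_nhds).trans_isLittleO h6
    have h8 : ∃ᶠ s : ℂ in 𝓝[≠] 0, s ^ m ≠ 0 := by
      refine Eventually.frequently ?_
      filter_upwards [self_mem_nhdsWithin] with s hs
      exact pow_ne_zero _ hs
    exact Asymptotics.isLittleO_irrefl h8 h7
  · rw [le_ordAt_iff_isBigO H.mem_atlas H.mem_source hh]
    refine hm.1.trans ?_
    have : (fun y => L (e y)) =O[𝓝 x] fun y => ‖e y - e x‖ := by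
      refine Asymptotics.IsBigO.of_bound ‖L‖ (Eventually.of_forall fun y => ?_)
      have h1 : L (e y) = L (e y - e x) := by simp [H.apply_x]
      rw [h1, norm_norm]; exact L.le_opNorm _
    exact this.pow m

end RegularPoints

/-! ### Hankel determinants of power sums -/

section Hankel

/-- The bilinear form given by the Hankel matrix of the power sums of `R` is
`(p, q) ↦ ∑ β ∈ R, p(β) q(β)` on polynomials of degree less than `r`. -/
theorem sum_coeff_mul_psum_mul_coeff (R : Multiset ℂ) {r : ℕ} {p q : Polynomial ℂ}
    (hp : p.natDegree < r) (hq : q.natDegree < r) :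
    ∑ i : Fin r, p.coeff i * ∑ j : Fin r, (R.map (· ^ (i + j : ℕ))).sum * q.coeff j =
      ∑ β ∈ R.toFinset, (R.count β : ℂ) * (p.eval β * q.eval β) := by
  have h1 : ∀ n : ℕ, (R.map (· ^ n)).sum = ∑ β ∈ R.toFinset, (R.count β : ℂ) * β ^ n := fun n => by
    rw [Finset.sum_multiset_map_count]
    simp [nsmul_eq_mul]
  simp only [h1, Finset.sum_mul, Finset.mul_sum]
  rw [Finset.sum_congr rfl fun i _ => Finset.sum_comm, Finset.sum_comm]
  refine Finset.sum_congr rfl fun β _ => ?_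
  rw [Polynomial.eval_eq_sum_range' hp, Polynomial.eval_eq_sum_range' hq,
    ← Fin.sum_univ_eq_sum_range (fun i => p.coeff i * β ^ i),
    ← Fin.sum_univ_eq_sum_range (fun i => q.coeff i * β ^ i), Finset.sum_mul_sum, Finset.mul_sum]
  refine Finset.sum_congr rfl fun i _ => ?_
  rw [Finset.mul_sum]
  refine Finset.sum_congr rfl fun j _ => ?_
  ring

/-- The Hankel determinant of the power sums detects the number of distinct elements: it plays the
role of a discriminant for families of multisets whose multiplicities are not generically `1`. -/
theorem det_hankel_psum_ne_zero_iff (R : Multiset ℂ) {r : ℕ} (hr : R.toFinset.card ≤ r) :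
    (Matrix.of fun i j : Fin r => (R.map (· ^ (i + j : ℕ))).sum).det ≠ 0 ↔
      R.toFinset.card = r := by
  set H := Matrix.of fun i j : Fin r => (R.map (· ^ (i + j : ℕ))).sum with hH
  have hpair := fun (p q : Polynomial ℂ) (hp : p.natDegree < r) (hq : q.natDegree < r) =>
    sum_coeff_mul_psum_mul_coeff R hp hq
  rw [← not_iff_not, not_not, ← Matrix.exists_mulVec_eq_zero_iff]
  constructor
  · rintro ⟨c, hc0, hc⟩ hcard
    have hr0 : 1 ≤ r := by
      rcases Nat.eq_zero_or_pos r with rfl | h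
      · exact absurd (Subsingleton.elim c 0) hc0
      · exact h
    set q := Polynomial.ofFn r c with hq
    have hqd : q.natDegree < r := Polynomial.ofFn_natDegree_lt hr0 c
    have hqc : ∀ j : Fin r, q.coeff j = c j := fun j => by
      rw [hq, Polynomial.ofFn_coeff_eq_val_of_lt c j.2]
    have hsum : ∀ p : Polynomial ℂ, p.natDegree < r →
        ∑ β ∈ R.toFinset, (R.count β : ℂ) * (p.eval β * q.eval β) = 0 := by
      intro p hp
      rw [← hpair p q hp hqd]
      refine Finset.sum_eq_zero fun i _ => ?_
      have h2 : ∑ j : Fin r, (R.map (· ^ (i + j : ℕ))).sum * q.coeff j = 0 := by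
        have := congrFun hc i
        simpa [Matrix.mulVec, dotProduct, hH, hqc] using this
      rw [h2, mul_zero]
    -- A polynomial `q` in the kernel vanishes at each `β`: pair it with the product of the `X - γ` over
    -- the elements `γ ≠ β`.
    have hroot : ∀ β ∈ R.toFinset, q.eval β = 0 := by
      intro β hβ
      set p : Polynomial ℂ := ∏ γ ∈ R.toFinset.erase β, (Polynomial.X - Polynomial.C γ) with hp
      have hpd : p.natDegree < r := by
        rw [hp, Polynomial.natDegree_finsetProd_X_sub_C_eq_card,
          Finset.card_erase_of_mem hβ, hcard]
        omega
      have h3 := hsum p hpd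
      rw [Finset.sum_eq_single_of_mem β hβ] at h3
      · have h4 : p.eval β ≠ 0 := by
          rw [hp, Polynomial.eval_prod, Finset.prod_ne_zero_iff]
          intro γ hγ
          simpa [sub_eq_zero] using (Finset.ne_of_mem_erase hγ).symm
        have h5 : (R.count β : ℂ) ≠ 0 := by
          exact_mod_cast (Multiset.count_pos.2 (Multiset.mem_toFinset.1 hβ)).ne'
        simpa [h4, h5] using h3
      · intro γ hγ hne
        have : p.eval γ = 0 := by
          rw [hp, Polynomial.eval_prod]
          exact Finset.prod_eq_zero (Finset.mem_erase.2 ⟨hne, hγ⟩) (by simp)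
        rw [this, zero_mul, mul_zero]
    have hq0 : q = 0 := by
      refine Polynomial.eq_zero_of_natDegree_lt_card_of_eval_eq_zero' q R.toFinset hroot ?_
      rw [hcard]; exact hqd
    apply hc0
    funext j
    rw [← hqc j, hq0]; rfl
  · intro hne
    -- Conversely, if there are fewer than `r` elements, then the product of the `X - γ` over all of them
    -- is in the kernel.
    have hlt := lt_of_le_of_ne hr hne
    set q : Polynomial ℂ := ∏ γ ∈ R.toFinset, (Polynomial.X - Polynomial.C γ) with hq
    have hqd : q.natDegree < r := by
      rw [hq, Polynomial.natDegree_finsetProd_X_sub_C_eq_card]; exact hlt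
    have hqm : q.Monic := Polynomial.monic_prod_of_monic _ _ fun γ _ => Polynomial.monic_X_sub_C γ
    refine ⟨fun j => q.coeff j, fun h0 => ?_, ?_⟩
    · have := congrFun h0 ⟨q.natDegree, hqd⟩
      simp only [Polynomial.coeff_natDegree, hqm.leadingCoeff] at this
      exact one_ne_zero this
    · funext i
      have h1 := hpair (Polynomial.X ^ (i : ℕ)) q (by simp) hqd
      rw [Finset.sum_eq_single i] at h1
      · have h2 : ∑ β ∈ R.toFinset, (R.count β : ℂ) *
            ((Polynomial.X ^ (i : ℕ)).eval β * q.eval β) = 0 := by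
          refine Finset.sum_eq_zero fun β hβ => ?_
          have : q.eval β = 0 := by
            rw [hq, Polynomial.eval_prod]
            exact Finset.prod_eq_zero hβ (by simp)
          rw [this, mul_zero, mul_zero]
        rw [h2] at h1
        simpa [Matrix.mulVec, dotProduct, hH] using h1
      · intro j _ hj
        simp [Polynomial.coeff_X_pow, Fin.val_inj, hj]
      · simp

end Hankel

/-! ### Sheets of the zero set over the parameter space -/

section Sheets

variable {E : Type} [NormedAddCommGroup E] [NormedSpace ℂ E]

theorem eventually_analyticAt_closedBall {h : E → ℂ → ℂ} {t₀ : E} {z : ℂ} {ρ : ℝ}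
    (hh : ∀ ζ ∈ Metric.closedBall z ρ, AnalyticAt ℂ (Function.uncurry h) (t₀, ζ)) :
    ∀ᶠ t in 𝓝 t₀, ∀ ζ ∈ Metric.closedBall z ρ, AnalyticAt ℂ (Function.uncurry h) (t, ζ) :=
  (isCompact_closedBall z ρ).eventually_forall_of_forall_eventually fun ζ hζ =>
    (hh ζ hζ).eventually_analyticAt

theorem eventually_sphere_ne_zero {h : E → ℂ → ℂ} {t₀ : E} {z : ℂ} {ρ : ℝ}
    (hh : ∀ ζ ∈ Metric.closedBall z ρ, AnalyticAt ℂ (Function.uncurry h) (t₀, ζ))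
    (hs : ∀ ζ ∈ Metric.sphere z ρ, h t₀ ζ ≠ 0) :
    ∀ᶠ t in 𝓝 t₀, ∀ ζ ∈ Metric.sphere z ρ, h t ζ ≠ 0 :=
  (isCompact_sphere z ρ).eventually_forall_of_forall_eventually fun ζ hζ =>
    (hh ζ (Metric.sphere_subset_closedBall hζ)).continuousAt.eventually_ne (hs ζ hζ)

theorem IsRootMultiset.mem_iff {h : ℂ → ℂ} {z : ℂ} {ρ : ℝ} {R : Multiset ℂ}
    (hh : AnalyticOnNhd ℂ h (Metric.ball z ρ)) (hR : IsRootMultiset h z ρ R) {ζ : ℂ} :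
    ζ ∈ R ↔ ζ ∈ Metric.ball z ρ ∧ h ζ = 0 := by
  constructor
  · intro hζ
    have hb := hR.1 ζ hζ
    refine ⟨hb, apply_eq_zero_of_analyticOrderAt_ne_zero ?_⟩
    rw [← hR.2 ζ hb]
    exact_mod_cast (Multiset.count_pos.2 hζ).ne'
  · rintro ⟨hb, h0⟩
    have h1 := (hh ζ hb).analyticOrderAt_ne_zero.2 h0
    rw [← hR.2 ζ hb] at h1
    exact Multiset.count_pos.1 (Nat.pos_of_ne_zero (by exact_mod_cast h1))

/-- The parameters for which the number of distinct roots in a disc is maximal are the complement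
of the zero set of a holomorphic function. -/
theorem exists_branch_function {h : E → ℂ → ℂ} {t₀ : E} {z : ℂ} {ρ : ℝ} (hρ : 0 < ρ)
    (hh : ∀ ζ ∈ Metric.closedBall z ρ, AnalyticAt ℂ (Function.uncurry h) (t₀, ζ))
    (hs : ∀ ζ ∈ Metric.sphere z ρ, h t₀ ζ ≠ 0) :
    ∃ ε > 0, ∃ (Δ : E → ℂ) (r : ℕ), AnalyticOnNhd ℂ Δ (Metric.ball t₀ ε) ∧
      (∃ t ∈ Metric.ball t₀ ε, Δ t ≠ 0) ∧ ∀ t ∈ Metric.ball t₀ ε,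
        (∀ ζ ∈ Metric.closedBall z ρ, AnalyticAt ℂ (Function.uncurry h) (t, ζ)) ∧
        (∀ ζ ∈ Metric.sphere z ρ, h t ζ ≠ 0) ∧
        {ζ ∈ Metric.ball z ρ | h t ζ = 0}.encard ≤ r ∧
        (Δ t ≠ 0 ↔ {ζ ∈ Metric.ball z ρ | h t ζ = 0}.encard = r) := by
  obtain ⟨R₀, q, b1, b2, b3, b4⟩ := exists_factorization_closedBall hρ
    (fun ζ hζ => analyticAt_curry_right (hh ζ hζ)) hs
  have hR₀ := isRootMultiset_of_factorization b1 b2 b3 b4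
  choose S hS hSev using fun n : ℕ => exists_analyticAt_sum_roots (G := fun _ ζ => ζ ^ n) hρ hh
    (fun ζ _ => by
      have : Function.uncurry (fun (_ : E) (ζ : ℂ) => ζ ^ n) = fun p : E × ℂ => p.2 ^ n := by
        ext p; rfl
      rw [this]
      exact analyticAt_snd.pow n) hs
  have hfin : ∀ᶠ t in 𝓝 t₀, ∀ n ∈ Finset.range (2 * R₀.card), AnalyticAt ℂ (S n) t ∧
      ∀ R, IsRootMultiset (h t) z ρ R → S n t = (R.map (· ^ n)).sum := by
    rw [Filter.eventually_all_finset]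
    intro n _
    filter_upwards [(hS n).eventually_analyticAt, hSev n] with t h1 h2
    exact ⟨h1, h2.2⟩
  obtain ⟨ε, hε, hball⟩ := Metric.nhds_basis_ball.eventually_iff.1
    (((eventually_analyticAt_closedBall hh).and (eventually_sphere_ne_zero hh hs)).and
      ((eventually_card_roots_eq hρ hh hs hR₀).and hfin))
  choose! R hR using fun t (ht : t ∈ Metric.ball t₀ ε) => (hball ht).2.1
  have hZ : ∀ t ∈ Metric.ball t₀ ε,
      {ζ ∈ Metric.ball z ρ | h t ζ = 0} = ((R t).toFinset : Set ℂ) := by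
    intro t ht
    ext ζ
    rw [Finset.mem_coe, Multiset.mem_toFinset, (hR t ht).1.mem_iff
      (fun ζ hζ => analyticAt_curry_right ((hball ht).1.1 ζ (Metric.ball_subset_closedBall hζ)))]
    rfl
  have hbdd : BddAbove ((fun t => (R t).toFinset.card) '' Metric.ball t₀ ε) := by
    refine ⟨R₀.card, ?_⟩
    rintro _ ⟨t, ht, rfl⟩
    exact (Multiset.toFinset_card_le _).trans (hR t ht).2.le
  have hne : ((fun t => (R t).toFinset.card) '' Metric.ball t₀ ε).Nonempty :=
    ⟨_, mem_image_of_mem _ (Metric.mem_ball_self hε)⟩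
  -- The maximal number of distinct roots.
  set r := sSup ((fun t => (R t).toFinset.card) '' Metric.ball t₀ ε) with hr
  have hrle : r ≤ R₀.card := csSup_le hne (by
    rintro _ ⟨t, ht, rfl⟩
    exact (Multiset.toFinset_card_le _).trans (hR t ht).2.le)
  have hle : ∀ t ∈ Metric.ball t₀ ε, (R t).toFinset.card ≤ r := fun t ht =>
    le_csSup hbdd (mem_image_of_mem _ ht)
  obtain ⟨t₁, ht₁, ht₁r⟩ := Nat.sSup_mem hne hbdd
  have hmem : ∀ i j : Fin r, (i + j : ℕ) ∈ Finset.range (2 * R₀.card) := fun i j => by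
    rw [Finset.mem_range]; omega
  have hdet : ∀ t ∈ Metric.ball t₀ ε, ((Matrix.of fun i j : Fin r => S (i + j) t).det ≠ 0 ↔
      (R t).toFinset.card = r) := by
    intro t ht
    rw [← det_hankel_psum_ne_zero_iff (R t) (hle t ht)]
    have : (Matrix.of fun i j : Fin r => S (i + j) t) =
        Matrix.of fun i j : Fin r => ((R t).map (· ^ (i + j : ℕ))).sum := by
      ext i j
      exact ((hball ht).2.2 _ (hmem i j)).2 _ (hR t ht).1
    rw [this]
  refine ⟨ε, hε, fun t => (Matrix.of fun i j : Fin r => S (i + j) t).det, r, ?_, ?_, ?_⟩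
  · intro t ht
    simp only [Matrix.det_apply]
    refine Finset.analyticAt_fun_sum _ fun σ _ => ?_
    have h1 : AnalyticAt ℂ (fun t => ∏ i, S (σ i + i : ℕ) t) t :=
      Finset.analyticAt_fun_prod _ fun i _ => ((hball ht).2.2 _ (hmem (σ i) i)).1
    rcases Int.units_eq_one_or (Equiv.Perm.sign σ) with hσ | hσ
    · simpa [hσ] using h1
    · simpa only [hσ, Units.neg_smul, one_smul, Matrix.of_apply] using h1.fun_neg
  · exact ⟨t₁, ht₁, (hdet t₁ ht₁).2 ht₁r⟩
  · intro t ht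
    refine ⟨(hball ht).1.1, (hball ht).1.2, ?_, ?_⟩
    · rw [hZ t ht, encard_coe_eq_coe_finsetCard]
      exact_mod_cast hle t ht
    · rw [hdet t ht, hZ t ht, encard_coe_eq_coe_finsetCard]
      norm_cast

/-- Near a parameter for which the number of distinct roots in a disc is maximal, the roots are
holomorphic functions of the parameter. -/
theorem exists_local_sheets {h : E → ℂ → ℂ} {t₁ : E} {z : ℂ} {ρ : ℝ} {r : ℕ}
    (hh : ∀ ζ ∈ Metric.closedBall z ρ, AnalyticAt ℂ (Function.uncurry h) (t₁, ζ))
    (hle : ∀ᶠ t in 𝓝 t₁, {ζ ∈ Metric.ball z ρ | h t ζ = 0}.encard ≤ r)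
    (heq : {ζ ∈ Metric.ball z ρ | h t₁ ζ = 0}.encard = r) :
    ∃ b : ℂ → E → ℂ, (∀ β ∈ {ζ ∈ Metric.ball z ρ | h t₁ ζ = 0},
        AnalyticAt ℂ (b β) t₁ ∧ b β t₁ = β ∧
          ∀ᶠ p : E × ℂ in 𝓝 (t₁, β), (h p.1 p.2 = 0 ↔ p.2 = b β p.1)) ∧
      ∀ᶠ t in 𝓝 t₁, ∀ ζ ∈ {ζ ∈ Metric.ball z ρ | h t ζ = 0},
        ∃ β ∈ {ζ ∈ Metric.ball z ρ | h t₁ ζ = 0}, ζ = b β t := by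
  set Z : E → Set ℂ := fun t => {ζ ∈ Metric.ball z ρ | h t ζ = 0} with hZdef
  have hfin : (Z t₁).Finite := by
    apply Set.finite_of_encard_eq_coe heq
  obtain ⟨U, hU, hdisj⟩ := hfin.t2_separation
  have hδ : ∀ β ∈ Z t₁, ∃ δ > 0, Metric.closedBall β δ ⊆ U β ∩ Metric.ball z ρ := fun β hβ =>
    Metric.nhds_basis_closedBall.mem_iff.1
      (inter_mem ((hU β).2.mem_nhds (hU β).1) (Metric.isOpen_ball.mem_nhds hβ.1))
  choose! δ hδ0 hδU using hδ
  have hhβ : ∀ β ∈ Z t₁, ∀ ζ ∈ Metric.closedBall β (δ β),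
      AnalyticAt ℂ (Function.uncurry h) (t₁, ζ) := fun β hβ ζ hζ =>
    hh ζ (Metric.ball_subset_closedBall (hδU β hβ hζ).2)
  have hsβ : ∀ β ∈ Z t₁, ∀ ζ ∈ Metric.sphere β (δ β), h t₁ ζ ≠ 0 := by
    intro β hβ ζ hζ h0
    have h1 := hδU β hβ (Metric.sphere_subset_closedBall hζ)
    have h2 : ζ ∈ Z t₁ := ⟨h1.2, h0⟩
    have h3 : ζ = β := hdisj.elim_set h2 hβ ζ (hU ζ).1 h1.1
    rw [h3, mem_sphere_iff_norm, sub_self, norm_zero] at hζ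
    exact (hδ0 β hβ).ne hζ
  have hdata : ∀ β ∈ Z t₁, ∃ (n : ℕ) (S : E → ℂ), 0 < n ∧ AnalyticAt ℂ S t₁ ∧ ∀ᶠ t in 𝓝 t₁,
      (∃ R, IsRootMultiset (h t) β (δ β) R ∧ R.card = n ∧ S t = R.sum) ∧
      ∀ ζ ∈ Metric.closedBall β (δ β), AnalyticAt ℂ (Function.uncurry h) (t, ζ) := by
    intro β hβ
    obtain ⟨S, hS, hSev⟩ := exists_analyticAt_sum_roots (G := fun _ ζ => ζ) (hδ0 β hβ)
      (hhβ β hβ) (fun ζ _ => analyticAt_snd) (hsβ β hβ)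
    obtain ⟨⟨R₀, hR₀⟩, -⟩ := hSev.self_of_nhds
    refine ⟨R₀.card, S, ?_, hS, ?_⟩
    · refine Multiset.card_pos_iff_exists_mem.2 ⟨β, (hR₀.mem_iff ?_).2
        ⟨Metric.mem_ball_self (hδ0 β hβ), hβ.2⟩⟩
      exact fun ζ hζ => analyticAt_curry_right (hhβ β hβ ζ (Metric.ball_subset_closedBall hζ))
    · filter_upwards [hSev, eventually_card_roots_eq (hδ0 β hβ) (hhβ β hβ) (hsβ β hβ) hR₀,
        eventually_analyticAt_closedBall (hhβ β hβ)] with t h1 ⟨R, h2, h3⟩ h4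
      exact ⟨⟨R, h2, h3, by simpa using h1.2 R h2⟩, h4⟩
  choose! n S hn hS hSev using hdata
  have hall : ∀ᶠ t in 𝓝 t₁, ∀ β ∈ Z t₁,
      (∃ R, IsRootMultiset (h t) β (δ β) R ∧ R.card = n β ∧ S β t = R.sum) ∧
      ∀ ζ ∈ Metric.closedBall β (δ β), AnalyticAt ℂ (Function.uncurry h) (t, ζ) :=
    (Filter.eventually_all_finite hfin).2 hSev
  -- The only root near `β`, of multiplicity `n β`, is the mean of the roots in a small disc.
  set b : ℂ → E → ℂ := fun β t => S β t / n β with hb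
  -- By the count of distinct roots, each small disc contains exactly one of them.
  have key : ∀ᶠ t in 𝓝 t₁, (∀ β ∈ Z t₁, ∀ ζ ∈ Metric.ball β (δ β), (h t ζ = 0 ↔ ζ = b β t)) ∧
      ∀ ζ ∈ Z t, ∃ β ∈ Z t₁, ζ = b β t := by
    filter_upwards [hall, hle] with t ht hlet
    have han : ∀ β ∈ Z t₁, AnalyticOnNhd ℂ (h t) (Metric.ball β (δ β)) := fun β hβ ζ hζ =>
      analyticAt_curry_right ((ht β hβ).2 ζ (Metric.ball_subset_closedBall hζ))
    choose! R hR hRn hRS using fun β hβ => (ht β hβ).1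
    have hw : ∀ β ∈ Z t₁, ∃ w, w ∈ Metric.ball β (δ β) ∧ h t w = 0 := by
      intro β hβ
      have h1 : 0 < (R β).card := by rw [hRn β hβ]; exact hn β hβ
      obtain ⟨w, hw⟩ := Multiset.card_pos_iff_exists_mem.1 h1
      exact ⟨w, ((hR β hβ).mem_iff (han β hβ)).1 hw⟩
    choose! w hwb hw0 using hw
    have hsub : ∀ β ∈ Z t₁, Metric.ball β (δ β) ⊆ U β ∩ Metric.ball z ρ := fun β hβ =>
      Metric.ball_subset_closedBall.trans (hδU β hβ)
    have hinj : InjOn w (Z t₁) := fun β hβ β' hβ' hww =>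
      hdisj.elim_set hβ hβ' (w β) (hsub β hβ (hwb β hβ)).1
        (hww ▸ (hsub β' hβ' (hwb β' hβ')).1)
    have himg : w '' Z t₁ = Z t := by
      have h1 : w '' Z t₁ ⊆ Z t := by
        rintro _ ⟨β, hβ, rfl⟩
        exact ⟨(hsub β hβ (hwb β hβ)).2, hw0 β hβ⟩
      refine Set.Finite.eq_of_subset_of_encard_le' (finite_of_encard_le_coe hlet) h1 ?_
      rw [hinj.encard_image, heq]
      exact hlet
    have huniq : ∀ β ∈ Z t₁, ∀ ζ ∈ Metric.ball β (δ β), h t ζ = 0 → ζ = w β := by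
      intro β hβ ζ hζ h0
      have h1 : ζ ∈ Z t := ⟨(hsub β hβ hζ).2, h0⟩
      rw [← himg] at h1
      obtain ⟨β', hβ', rfl⟩ := h1
      rw [hdisj.elim_set hβ' hβ (w β') (hsub β' hβ' (hwb β' hβ')).1 (hsub β hβ hζ).1]
    have hbw : ∀ β ∈ Z t₁, b β t = w β := by
      intro β hβ
      have h1 : R β = Multiset.replicate (n β) (w β) := by
        rw [Multiset.eq_replicate]
        refine ⟨hRn β hβ, fun ζ hζ => ?_⟩
        have := ((hR β hβ).mem_iff (han β hβ)).1 hζ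
        exact huniq β hβ ζ this.1 this.2
      have h2 : (n β : ℂ) ≠ 0 := by exact_mod_cast (hn β hβ).ne'
      simp only [hb, hRS β hβ, h1, Multiset.sum_replicate, nsmul_eq_mul]
      field_simp
    refine ⟨fun β hβ ζ hζ => ⟨fun h0 => ?_, fun h0 => ?_⟩, fun ζ hζ => ?_⟩
    · rw [hbw β hβ]; exact huniq β hβ ζ hζ h0
    · rw [h0, hbw β hβ]; exact hw0 β hβ
    · rw [← himg] at hζ
      obtain ⟨β, hβ, rfl⟩ := hζ
      exact ⟨β, hβ, (hbw β hβ).symm⟩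
  refine ⟨b, fun β hβ => ⟨(hS β hβ).div_const, ?_, ?_⟩, key.mono fun t ht => ht.2⟩
  · exact ((key.self_of_nhds.1 β hβ β (Metric.mem_ball_self (hδ0 β hβ))).1 hβ.2).symm
  · rw [nhds_prod_eq]
    filter_upwards [key.prod_mk (Metric.ball_mem_nhds β (hδ0 β hβ))] with p hp
    exact hp.1.1 β hβ p.2 hp.2

end Sheets

/-! ### Connectedness of the regular part -/

/-- Removing a small subset `W \ D` from a connected set `W` does not disconnect it, as soon as it
does not do so locally. -/
theorem isPreconnected_of_locally {X : Type*} [TopologicalSpace X] {D W : Set X} (hDW : D ⊆ W)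
    (hW : IsPreconnected W)
    (hloc : ∀ y ∈ W, ∃ N : Set X, IsOpen N ∧ y ∈ N ∧ IsPreconnected (N ∩ D))
    (hcl : W ⊆ closure D) : IsPreconnected D := by
  rw [isPreconnected_iff_subset_of_disjoint]
  intro u v hu hv hDuv hdisj
  set U : Set X := ⋃₀ {N | IsOpen N ∧ N ∩ D ⊆ u} with hU
  set V : Set X := ⋃₀ {N | IsOpen N ∧ N ∩ D ⊆ v} with hV
  have hUo : IsOpen U := isOpen_sUnion fun N hN => hN.1
  have hVo : IsOpen V := isOpen_sUnion fun N hN => hN.1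
  have hWUV : W ⊆ U ∪ V := by
    intro y hy
    obtain ⟨N, hNo, hyN, hN⟩ := hloc y hy
    rcases isPreconnected_iff_subset_of_disjoint.1 hN u v hu hv (inter_subset_right.trans hDuv)
      (by rw [inter_assoc, hdisj, inter_empty]) with h | h
    · exact Or.inl ⟨N, ⟨hNo, h⟩, hyN⟩
    · exact Or.inr ⟨N, ⟨hNo, h⟩, hyN⟩
  have hempty : W ∩ (U ∩ V) = ∅ := by
    rw [eq_empty_iff_forall_notMem]
    rintro y ⟨hyW, ⟨N, ⟨hNo, hN⟩, hyN⟩, N', ⟨hNo', hN'⟩, hyN'⟩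
    obtain ⟨w, ⟨hw, hw'⟩, hwD⟩ := mem_closure_iff.1 (hcl hyW) (N ∩ N') (hNo.inter hNo') ⟨hyN, hyN'⟩
    have : w ∈ D ∩ (u ∩ v) := ⟨hwD, hN ⟨hw, hwD⟩, hN' ⟨hw', hwD⟩⟩
    rw [hdisj] at this
    exact this
  refine (isPreconnected_iff_subset_of_disjoint.1 hW U V hUo hVo hWUV hempty).imp ?_ ?_
  · intro h y hy
    obtain ⟨N, ⟨-, hN⟩, hyN⟩ := h (hDW hy)
    exact hN ⟨hyN, hy⟩
  · intro h y hy
    obtain ⟨N, ⟨-, hN⟩, hyN⟩ := h (hDW hy)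
    exact hN ⟨hyN, hy⟩

/-! ### Irreducible components of hypersurfaces -/

section Hypersurface

variable {k : ℕ} {M : Type*} [TopologicalSpace M] [ChartedSpace (EuclideanSpace ℂ (Fin k)) M]
  [IsManifold 𝓘(ℂ, EuclideanSpace ℂ (Fin k)) ω M]

/-- `A` is a nowhere dense closed set which is locally the zero set of one holomorphic function. -/
structure IsHypersurface (k : ℕ) {M : Type*} [TopologicalSpace M]
    [ChartedSpace (EuclideanSpace ℂ (Fin k)) M] (A : Set M) : Prop where
  interior_eq : interior A = ∅
  exists_equation : ∀ x, ∃ g : M → ℂ, ContMDiffAt 𝓘(ℂ, EuclideanSpace ℂ (Fin k)) 𝓘(ℂ, ℂ) ω g x ∧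
    ∀ᶠ y in 𝓝 x, y ∈ A ↔ g y = 0

theorem IsHypersurface.isClosed {A : Set M} (hA : IsHypersurface k A) : IsClosed A := by
  rw [← isOpen_compl_iff, isOpen_iff_mem_nhds]
  intro x hx
  obtain ⟨g, hg, hgA⟩ := hA.exists_equation x
  have h1 : g x ≠ 0 := fun h => hx (hgA.self_of_nhds.2 h)
  filter_upwards [hg.continuousAt.eventually_ne h1, hgA] with y hy1 hy2 hy3
  exact hy1 (hy2.1 hy3)

theorem frequently_notMem {X : Type*} [TopologicalSpace X] {A : Set X} (hA : interior A = ∅)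
    (x : X) : ∃ᶠ y in 𝓝 x, y ∉ A := by
  intro h
  have : x ∈ interior A := mem_interior_iff_mem_nhds.2 (by simpa using h)
  rw [hA] at this
  exact this

/-- Small neighbourhoods of a regular point of `A`, seen in a chart in which `A` is a hyperplane. -/
theorem IsHyperplaneAt.exists_ball {A : Set M} {x : M}
    {e : OpenPartialHomeomorph M (EuclideanSpace ℂ (Fin k))}
    {L : EuclideanSpace ℂ (Fin k) →L[ℂ] ℂ} {v : EuclideanSpace ℂ (Fin k)}
    (H : IsHyperplaneAt A x e L v) {p : EuclideanSpace ℂ (Fin k) → Prop}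
    (hp : ∀ᶠ z in 𝓝 (e x), p z) :
    ∃ r > 0, Metric.ball (e x) r ⊆ e.target ∧ (∀ z ∈ Metric.ball (e x) r, p z) ∧
      IsOpen (e.symm '' Metric.ball (e x) r) ∧ x ∈ e.symm '' Metric.ball (e x) r ∧
      e.symm '' Metric.ball (e x) r ∩ A = e.symm '' {z ∈ Metric.ball (e x) r | L z = 0} := by
  have h1 := (eventually_nhds_chart H.mem_source (p := fun y => y ∈ A ↔ L (e y) = 0)).2
    H.eventually_mem
  obtain ⟨r, hr, hrb⟩ := Metric.nhds_basis_ball.eventually_iff.1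
    ((hp.and h1).and (e.open_target.mem_nhds (e.map_source H.mem_source)))
  refine ⟨r, hr, fun z hz => (hrb hz).2, fun z hz => (hrb hz).1.1,
    e.isOpen_image_symm_of_subset_target Metric.isOpen_ball fun z hz => (hrb hz).2,
    ⟨e x, Metric.mem_ball_self hr, e.left_inv H.mem_source⟩, ?_⟩
  ext y
  constructor
  · rintro ⟨⟨z, hz, rfl⟩, hzA⟩
    refine ⟨z, ⟨hz, ?_⟩, rfl⟩
    have := (hrb hz).1.2.1 hzA
    rwa [e.right_inv (hrb hz).2] at this
  · rintro ⟨z, ⟨hz, hz0⟩, rfl⟩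
    refine ⟨⟨z, hz, rfl⟩, (hrb hz).1.2.2 ?_⟩
    rwa [e.right_inv (hrb hz).2]

/-- The connected components of the regular part of `A` are open in `A`. -/
theorem eventually_mem_connectedComponentIn {A : Set M} {x : M} (hx : x ∈ regularPart k A) :
    ∀ᶠ y in 𝓝 x, y ∈ A → y ∈ connectedComponentIn (regularPart k A) x := by
  obtain ⟨e, L, v, H⟩ := exists_isHyperplaneAt hx
  obtain ⟨r, hr, hrt, hrp, hNo, hxN, hNA⟩ := H.exists_ball
    (p := fun z => e.symm z ∈ A → e.symm z ∈ regularPart k A) ((eventually_nhds_chart H.mem_source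
      (p := fun y => y ∈ A → y ∈ regularPart k A)).2
      (H.eventually.mono fun y hy hyA => (hy hyA).mem_regularPart))
  have hpre : IsPreconnected (e.symm '' Metric.ball (e x) r ∩ A) := by
    rw [hNA]
    refine IsPreconnected.image ?_ _ (e.continuousOn_symm.mono fun z hz => hrt hz.1)
    have : Convex ℝ {z ∈ Metric.ball (e x) r | L z = 0} :=
      (convex_ball _ _).inter fun a ha b hb s t _ _ _ => by
        have ha' : L a = 0 := ha
        have hb' : L b = 0 := hb
        change L (s • a + t • b) = 0
        have h3 : L (s • a + t • b) = s • L a + t • L b :=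
          (L.restrictScalars ℝ).map_add (s • a) (t • b) |>.trans (by
            rw [map_smul, map_smul]; rfl)
        rw [h3, ha', hb', smul_zero, smul_zero, add_zero]
    exact this.isPreconnected
  have hsub : e.symm '' Metric.ball (e x) r ∩ A ⊆ regularPart k A := by
    rintro _ ⟨⟨z, hz, rfl⟩, hzA⟩
    exact hrp z hz hzA
  have := hpre.subset_connectedComponentIn ⟨hxN, hx.1⟩ hsub
  filter_upwards [hNo.mem_nhds hxN] with y hy hyA
  exact this ⟨hy, hyA⟩

/-- At a regular point of the hypersurface `A`, a hypersurface `E ⊆ A` through that point coincides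
with `A`. -/
theorem IsHyperplaneAt.of_subset {A E : Set M} {x : M} (hE : IsHypersurface k E)
    (hEA : E ⊆ A) {e : OpenPartialHomeomorph M (EuclideanSpace ℂ (Fin k))}
    {L : EuclideanSpace ℂ (Fin k) →L[ℂ] ℂ} {v : EuclideanSpace ℂ (Fin k)}
    (H : IsHyperplaneAt A x e L v) (hxE : x ∈ E) : IsHyperplaneAt E x e L v := by
  obtain ⟨g, hg, hgE⟩ := hE.exists_equation x
  obtain ⟨m, hm⟩ := H.exists_isTheta_pow hg (hgE.mono fun y hy h0 => hEA (hy.2 h0))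
    ((frequently_notMem hE.interior_eq x).mp (hgE.mono fun y hy h1 h2 => h1 (hy.2 h2)))
  have hm0 : m ≠ 0 := by
    rintro rfl
    have h1 : g x = 0 := hgE.self_of_nhds.1 hxE
    have h2 := hm.2.eq_zero_imp.self_of_nhds h1
    simp at h2
  refine ⟨H.mem_atlas, H.mem_source, H.apply_v, H.apply_x, ?_⟩
  filter_upwards [hgE, hm.1.eq_zero_imp, hm.2.eq_zero_imp] with y h1 h2 h3
  rw [h1]
  exact ⟨fun h => (pow_eq_zero_iff hm0).1 (h3 h), fun h => h2 (by rw [h, zero_pow hm0])⟩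

theorem eventually_mem_of_mem_regularPart {A E : Set M} {x : M} (hE : IsHypersurface k E)
    (hEA : E ⊆ A) (hx : x ∈ regularPart k A) (hxE : x ∈ E) : ∀ᶠ y in 𝓝 x, y ∈ A → y ∈ E := by
  obtain ⟨e, L, v, H⟩ := exists_isHyperplaneAt hx
  filter_upwards [H.eventually_mem, (H.of_subset hE hEA hxE).eventually_mem] with y h1 h2 h3
  exact h2.2 (h1.1 h3)

/-- Near a regular point of `E ⊆ A`, the points of `E` that are regular for `A` form a connected
dense set. -/
theorem exists_isPreconnected_inter_regularPart {A E : Set M} {x : M} (hA : IsHypersurface k A)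
    (hEA : E ⊆ A) (hx : x ∈ regularPart k E) {s : Set M} (hs : s ∈ 𝓝 x) :
    ∃ N ⊆ s, IsOpen N ∧ x ∈ N ∧ IsPreconnected (N ∩ (E ∩ regularPart k A)) ∧
      (N ∩ (E ∩ regularPart k A)).Nonempty := by
  obtain ⟨e, L, v, H⟩ := exists_isHyperplaneAt hx
  obtain ⟨g, hg, hgA⟩ := hA.exists_equation x
  have hga := (contMDiffAt_iff_analyticAt H.mem_atlas H.mem_source).1 hg
  have hgne : ∃ᶠ z in 𝓝 (e x), g (e.symm z) ≠ 0 := fun hcon =>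
    ((frequently_notMem hA.interior_eq x).mp (hgA.mono fun y hy h1 h2 => h1 (hy.2 h2)))
      ((eventually_nhds_chart H.mem_source (p := fun y => ¬ g y ≠ 0)).1 hcon)
  -- In the chart, the equation of `A` is `L ^ m * u`, and the points of the hyperplane `L = 0` at which
  -- `u` does not vanish are regular points of `A`.
  obtain ⟨m, u, hu, hgu, hune⟩ := exists_eventuallyEq_pow_mul hga H.apply_v H.apply_x hgne
  have hgA' := (eventually_nhds_chart H.mem_source (p := fun y => y ∈ A ↔ g y = 0)).2 hgA
  have hs' := (eventually_nhds_chart H.mem_source (p := fun y => y ∈ s)).2 hs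
  obtain ⟨r, hr, hrt, hrp, hNo, hxN, hNE⟩ := H.exists_ball
    ((hu.eventually_analyticAt.and hgu).and (hgA'.and hs'))
  set B := Metric.ball (e x) r with hB
  set K := L.ker with hK
  have hKL : ∀ w : K, L (e x + w) = 0 := fun w => by
    rw [map_add, H.apply_x, zero_add]; exact w.2
  set ψ : K → EuclideanSpace ℂ (Fin k) := fun w => e x + w with hψ
  have hψc : Continuous ψ := by fun_prop
  set B' : Set K := ψ ⁻¹' B with hB'
  have hB'o : IsOpen B' := Metric.isOpen_ball.preimage hψc
  have hB'c : Convex ℝ B' := by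
    intro a ha b hb p q hp hq hpq
    have h1 := convex_ball (e x) r ha hb hp hq hpq
    have h2 : ψ (p • a + q • b) = p • ψ a + q • ψ b := by
      simp only [hψ, smul_add]
      have : p • e x + q • e x = e x := by rw [← add_smul, hpq, one_smul]
      calc e x + ((p • a + q • b : K) : EuclideanSpace ℂ (Fin k))
          = (p • e x + q • e x) + (p • (a : EuclideanSpace ℂ (Fin k)) + q • (b : EuclideanSpace ℂ (Fin k))) := by
            rw [this]; rfl
        _ = _ := by abel
    change ψ (p • a + q • b) ∈ B
    rw [h2]; exact h1
  have hu' : AnalyticOnNhd ℂ (fun w : K => u (ψ w)) B' := by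
    intro w hw
    have h1 : AnalyticAt ℂ ψ w := by
      have : AnalyticAt ℂ (fun w : K => K.subtypeL w) w := K.subtypeL.analyticAt w
      exact analyticAt_const.add this
    exact AnalyticAt.comp (g := u) (f := ψ) (hrp _ hw).1.1 h1
  have hball : {z ∈ B | L z = 0} = ψ '' B' := by
    ext z
    constructor
    · rintro ⟨hz, hz0⟩
      have h1 : z - e x ∈ K := by
        change L (z - e x) = 0
        rw [map_sub, hz0, H.apply_x, sub_zero]
      refine ⟨⟨z - e x, h1⟩, ?_, ?_⟩
      · change e x + (z - e x) ∈ B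
        rwa [add_sub_cancel]
      · change e x + (z - e x) = z
        rw [add_sub_cancel]
    · rintro ⟨w, hw, rfl⟩
      exact ⟨hw, hKL w⟩
  have hB'0 : (0 : K) ∈ B' := by
    change e x + 0 ∈ B
    rw [add_zero]; exact Metric.mem_ball_self hr
  have hne : ∃ w ∈ B', u (ψ w) ≠ 0 := by
    obtain ⟨z, ⟨hz0, hzu⟩, hzB⟩ := (hune.and_eventually (Metric.ball_mem_nhds (e x) hr)).exists
    have : z ∈ {z ∈ B | L z = 0} := ⟨hzB, hz0⟩
    rw [hball] at this
    obtain ⟨w, hw, rfl⟩ := this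
    exact ⟨w, hw, hzu⟩
  set P : Set K := {w ∈ B' | u (ψ w) ≠ 0} with hP
  have hPpre : IsPreconnected P := isPreconnected_ne_zero hB'c hB'o hu'
  have hPdense : B' ⊆ closure P := by
    intro w hw
    rw [mem_closure_iff_frequently]
    exact ((frequently_ne_zero_of_exists_ne_zero hB'c.isPreconnected hu' hne hw).and_eventually
      (hB'o.mem_nhds hw)).mono fun y hy => ⟨hy.2, hy.1⟩
  have hmemE : ∀ w ∈ B', e.symm (ψ w) ∈ E := by
    intro w hw
    have h1 : e.symm (ψ w) ∈ e.symm '' {z ∈ B | L z = 0} := ⟨ψ w, ⟨hw, hKL w⟩, rfl⟩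
    rw [← hNE] at h1
    exact h1.2
  have hPreg : ∀ w ∈ P, e.symm (ψ w) ∈ regularPart k A := by
    intro w hw
    have hm0 : m ≠ 0 := by
      rintro rfl
      have h1 := (hrp _ hw.1).2.1.1 (hEA (hmemE w hw.1))
      have h2 := (hrp _ hw.1).1.2
      rw [h1, pow_zero, one_mul] at h2
      exact hw.2 h2.symm
    have hsrc : e.symm (ψ w) ∈ e.source := e.map_target (hrt hw.1)
    have hright := e.right_inv (hrt hw.1)
    refine IsHyperplaneAt.mem_regularPart (e := e) (L := L) (v := v)
      ⟨H.mem_atlas, hsrc, H.apply_v, by rw [hright]; exact hKL w, ?_⟩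
    rw [← eventually_nhds_chart hsrc, hright]
    filter_upwards [Metric.isOpen_ball.mem_nhds (show ψ w ∈ B from hw.1),
      (hrp _ hw.1).1.1.continuousAt.eventually_ne hw.2] with z hz hzu
    rw [(hrp z hz).2.1, (hrp z hz).1.2, e.right_inv (hrt hz)]
    simp [hzu, hm0]
  have hcont : ContinuousOn (fun w => e.symm (ψ w)) B' :=
    e.continuousOn_symm.comp hψc.continuousOn fun w hw => hrt hw
  set Q : Set M := (fun w => e.symm (ψ w)) '' P with hQ
  have hQsub : Q ⊆ e.symm '' B ∩ (E ∩ regularPart k A) := by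
    rintro _ ⟨w, hw, rfl⟩
    exact ⟨⟨ψ w, hw.1, rfl⟩, hmemE w hw.1, hPreg w hw⟩
  have hsubQ : e.symm '' B ∩ (E ∩ regularPart k A) ⊆ closure Q := by
    rintro y ⟨hyB, hyE, -⟩
    have h1 : y ∈ e.symm '' B ∩ E := ⟨hyB, hyE⟩
    rw [hNE, hball] at h1
    obtain ⟨_, ⟨w, hw, rfl⟩, rfl⟩ := h1
    exact mem_closure_image (hcont.continuousAt (hB'o.mem_nhds hw)) (hPdense hw)
  refine ⟨e.symm '' B, ?_, hNo, hxN, ?_, ?_⟩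
  · rintro _ ⟨z, hz, rfl⟩
    exact (hrp z hz).2.2
  · exact (hPpre.image _ (hcont.mono fun w hw => hw.1)).subset_closure hQsub hsubQ
  · obtain ⟨w, hw, hwu⟩ := hne
    exact ⟨_, hQsub ⟨w, ⟨hw, hwu⟩, rfl⟩⟩

/-- Let `E ⊆ A` be hypersurfaces. A component of `A` that meets `E` at a regular point of `A` is the
component of `E` at that point. -/
theorem closure_connectedComponentIn_regularPart_eq {A E : Set M} (hA : IsHypersurface k A)
    (hE : IsHypersurface k E) (hEA : E ⊆ A) {x : M} (hx : x ∈ regularPart k A) (hxE : x ∈ E) :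
    x ∈ regularPart k E ∧ closure (connectedComponentIn (regularPart k E) x) =
      closure (connectedComponentIn (regularPart k A) x) := by
  have hreg : ∀ y ∈ regularPart k A, y ∈ E → y ∈ regularPart k E := by
    intro y hy hyE
    obtain ⟨e, L, v, H⟩ := exists_isHyperplaneAt hy
    exact (H.of_subset hE hEA hyE).mem_regularPart
  set W := connectedComponentIn (regularPart k A) x
  set W' := connectedComponentIn (regularPart k E) x
  have hxE' := hreg x hx hxE
  -- Both `E` and its complement are open along the regular part of `A`.
  have hWE : W ⊆ E := by
    have h1 : ∀ y ∈ W, y ∈ E → ∀ᶠ z in 𝓝 y, z ∈ A → z ∈ E := fun y hy hyE =>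
      eventually_mem_of_mem_regularPart hE hEA (connectedComponentIn_subset _ _ hy) hyE
    have h2 : ∀ y ∈ W, (x ∈ E ↔ y ∈ E) := fun y hy =>
      (isPreconnected_connectedComponentIn (x := x) (F := regularPart k A)).induction₂
      (fun a b => a ∈ E ↔ b ∈ E) ?_ (fun a b c _ _ _ h1 h2 => h1.trans h2)
      (fun a b _ _ h => h.symm) (mem_connectedComponentIn hx) hy
    · exact fun y hy => (h2 y hy).1 hxE
    · intro y hy
      by_cases hyE : y ∈ E
      · filter_upwards [nhdsWithin_le_nhds (h1 y hy hyE), self_mem_nhdsWithin] with z h3 h4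
        exact ⟨fun _ => h3 (connectedComponentIn_subset _ _ h4).1, fun _ => hyE⟩
      · filter_upwards [nhdsWithin_le_nhds (hE.isClosed.isOpen_compl.mem_nhds hyE)] with z h3
        exact ⟨fun h => absurd h hyE, fun h => absurd h h3⟩
  have hWW' : W ⊆ W' := isPreconnected_connectedComponentIn.subset_connectedComponentIn
    (mem_connectedComponentIn hx) fun y hy => hreg y (connectedComponentIn_subset _ _ hy) (hWE hy)
  have hloc : ∀ y ∈ W', ∀ s ∈ 𝓝 y, ∃ N ⊆ s, IsOpen N ∧ y ∈ N ∧
      IsPreconnected (N ∩ (W' ∩ regularPart k A)) ∧ (N ∩ (W' ∩ regularPart k A)).Nonempty := by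
    intro y hy s hs
    have hyreg := connectedComponentIn_subset _ _ hy
    have h1 := eventually_mem_connectedComponentIn hyreg
    rw [← connectedComponentIn_eq hy] at h1
    obtain ⟨N, hNs, hNo, hyN, hN, hN'⟩ := exists_isPreconnected_inter_regularPart hA hEA hyreg
      (inter_mem hs h1)
    have h2 : N ∩ (W' ∩ regularPart k A) = N ∩ (E ∩ regularPart k A) := by
      ext z
      constructor
      · rintro ⟨hz1, hz2, hz3⟩
        exact ⟨hz1, (connectedComponentIn_subset _ _ hz2).1, hz3⟩
      · rintro ⟨hz1, hz2, hz3⟩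
        exact ⟨hz1, (hNs hz1).2 hz2, hz3⟩
    exact ⟨N, fun z hz => (hNs hz).1, hNo, hyN, h2 ▸ hN, h2 ▸ hN'⟩
  have hdense : W' ⊆ closure (W' ∩ regularPart k A) := by
    intro y hy
    rw [mem_closure_iff_nhds]
    intro s hs
    obtain ⟨N, hNs, -, -, -, hN⟩ := hloc y hy s hs
    exact hN.mono (inter_subset_inter_left _ hNs)
  have hconn : IsPreconnected (W' ∩ regularPart k A) := by
    refine isPreconnected_of_locally inter_subset_left isPreconnected_connectedComponentIn
      (fun y hy => ?_) hdense
    obtain ⟨N, -, hNo, hyN, hN, -⟩ := hloc y hy univ univ_mem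
    exact ⟨N, hNo, hyN, hN⟩
  have hsub : W' ∩ regularPart k A ⊆ W :=
    hconn.subset_connectedComponentIn ⟨mem_connectedComponentIn hxE', hx⟩ inter_subset_right
  exact ⟨hxE', subset_antisymm (closure_minimal (hdense.trans (closure_mono hsub)) isClosed_closure)
    (closure_mono hWW')⟩

/-- For hypersurfaces `E ⊆ A`, every component of `E` is a component of `A`. -/
theorem exists_mem_regularPart_of_mem_analyticComponents {A E : Set M} (hA : IsHypersurface k A)
    (hE : IsHypersurface k E) (hEA : E ⊆ A) {V : Set M} (hV : V ∈ analyticComponents k E) :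
    ∃ x ∈ regularPart k A, x ∈ E ∧ V = closure (connectedComponentIn (regularPart k A) x) := by
  obtain ⟨y, hy, rfl⟩ := hV
  obtain ⟨N, hNs, -, -, -, ⟨x, hxN, hxE, hxA⟩⟩ := exists_isPreconnected_inter_regularPart hA hEA hy
    (eventually_mem_connectedComponentIn hy)
  refine ⟨x, hxA, hxE, ?_⟩
  rw [← (closure_connectedComponentIn_regularPart_eq hA hE hEA hxA hxE).2,
    connectedComponentIn_eq (hNs hxN hxE)]

end Hypersurface

/-! ### Local finiteness of the irreducible components -/

/-- Continuity of roots. -/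
theorem eventually_exists_root {E : Type} [NormedAddCommGroup E] [NormedSpace ℂ E]
    {h : E → ℂ → ℂ} {t₀ : E} {z : ℂ} (hh : AnalyticAt ℂ (Function.uncurry h) (t₀, z))
    (h0 : h t₀ z = 0) (hne : ∃ᶠ ζ in 𝓝 z, h t₀ ζ ≠ 0) {s : Set ℂ} (hs : s ∈ 𝓝 z) :
    ∀ᶠ t in 𝓝 t₀, ∃ ζ ∈ s, h t ζ = 0 := by
  have hz := analyticAt_curry_right hh
  have h1 : ∀ᶠ ζ in 𝓝[≠] z, h t₀ ζ ≠ 0 := by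
    rcases hz.eventually_eq_zero_or_eventually_ne_zero with h | h
    · exact absurd (h.mono fun ζ hζ => not_not.2 hζ) hne
    · exact h
  rw [eventually_nhdsWithin_iff] at h1
  have h2 : ∀ᶠ ζ in 𝓝 z, AnalyticAt ℂ (Function.uncurry h) (t₀, ζ) := by
    have : ContinuousAt (fun ζ : ℂ => (t₀, ζ)) z := by fun_prop
    exact this.eventually hh.eventually_analyticAt
  obtain ⟨ρ, hρ, hρs⟩ := Metric.nhds_basis_closedBall.eventually_iff.1 ((h1.and h2).and hs)
  have hh' : ∀ ζ ∈ Metric.closedBall z ρ, AnalyticAt ℂ (Function.uncurry h) (t₀, ζ) :=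
    fun ζ hζ => (hρs hζ).1.2
  have hsph : ∀ ζ ∈ Metric.sphere z ρ, h t₀ ζ ≠ 0 := fun ζ hζ =>
    (hρs (Metric.sphere_subset_closedBall hζ)).1.1 (by
      rintro rfl
      rw [mem_sphere_iff_norm, sub_self, norm_zero] at hζ
      exact hρ.ne hζ)
  obtain ⟨R₀, q, b1, b2, b3, b4⟩ := exists_factorization_closedBall hρ
    (fun ζ hζ => analyticAt_curry_right (hh' ζ hζ)) hsph
  have hR₀ := isRootMultiset_of_factorization b1 b2 b3 b4
  have hz0 : z ∈ R₀ := (hR₀.mem_iff fun ζ hζ =>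
    analyticAt_curry_right (hh' ζ (Metric.ball_subset_closedBall hζ))).2
      ⟨Metric.mem_ball_self hρ, h0⟩
  filter_upwards [eventually_card_roots_eq hρ hh' hsph hR₀,
    eventually_analyticAt_closedBall hh'] with t ⟨R, hR, hcard⟩ hth
  have : 0 < R.card := by rw [hcard]; exact Multiset.card_pos_iff_exists_mem.2 ⟨z, hz0⟩
  obtain ⟨ζ, hζ⟩ := Multiset.card_pos_iff_exists_mem.1 this
  have h3 := (hR.mem_iff fun ζ hζ =>
    analyticAt_curry_right (hth ζ (Metric.ball_subset_closedBall hζ))).1 hζ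
  exact ⟨ζ, (hρs (Metric.ball_subset_closedBall h3.1)).2, h3.2⟩

/-- A holomorphic function that is not locally zero is not locally zero on some complex line. -/
theorem exists_direction {E : Type} [NormedAddCommGroup E] [NormedSpace ℂ E] {G : E → ℂ} {t₀ : E}
    (hG : AnalyticAt ℂ G t₀) (hne : ∃ᶠ t in 𝓝 t₀, G t ≠ 0) :
    ∃ v : E, ∀ᶠ ζ : ℂ in 𝓝[≠] 0, G (t₀ + ζ • v) ≠ 0 := by
  obtain ⟨r, hr, hrb⟩ := Metric.nhds_basis_ball.eventually_iff.1 hG.eventually_analyticAt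
  obtain ⟨z, hz, hzb⟩ := (hne.and_eventually (Metric.ball_mem_nhds t₀ hr)).exists
  refine ⟨z - t₀, ?_⟩
  set B : Set ℂ := {ζ | t₀ + ζ • (z - t₀) ∈ Metric.ball t₀ r} with hB
  have hBe : B = {ζ : ℂ | ‖ζ • (z - t₀)‖ < r} := by
    ext ζ; simp [hB]
  have hBc : Convex ℝ B := by
    have h1 : IsLinearMap ℝ fun ζ : ℂ => ζ • (z - t₀) :=
      ⟨fun a b => add_smul _ _ _, fun c a => smul_assoc _ _ _⟩
    have h2 : B = (h1.mk' _) ⁻¹' Metric.ball 0 r := by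
      rw [hBe]; ext ζ; simp [IsLinearMap.mk'_apply]
    rw [h2]
    exact (convex_ball _ _).linear_preimage _
  have han : ∀ ζ ∈ B, AnalyticAt ℂ (fun ζ : ℂ => G (t₀ + ζ • (z - t₀))) ζ := by
    intro ζ hζ
    exact AnalyticAt.comp (g := G) (f := fun ζ : ℂ => t₀ + ζ • (z - t₀)) (hrb hζ)
      (analyticAt_const.add (analyticAt_id.smul analyticAt_const))
  have h0 : (0 : ℂ) ∈ B := by simp [hBe, hr]
  have hfr := frequently_ne_zero_of_exists_ne_zero hBc.isPreconnected han
    ⟨1, by change t₀ + (1 : ℂ) • (z - t₀) ∈ Metric.ball t₀ r; rwa [one_smul, add_sub_cancel], by simpa using hz⟩ h0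
  rcases (han 0 h0).eventually_eq_zero_or_eventually_ne_zero with h | h
  · exact absurd (h.mono fun ζ hζ => not_not.2 hζ) hfr
  · exact h

theorem mem_connectedComponentIn_iff_of_mem {X : Type*} [TopologicalSpace X] {F : Set X} {x y z : X}
    (h : z ∈ connectedComponentIn F y) :
    z ∈ connectedComponentIn F x ↔ y ∈ connectedComponentIn F x := by
  have hy : y ∈ F := connectedComponentIn_nonempty_iff.1 ⟨z, h⟩
  have hz : z ∈ F := connectedComponentIn_subset _ _ h
  constructor
  · intro hzx
    rw [connectedComponentIn_eq hzx, ← connectedComponentIn_eq h]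
    exact mem_connectedComponentIn hy
  · intro hyx
    rw [connectedComponentIn_eq hyx]
    exact h

section LocallyFinite

variable {k : ℕ} {M : Type*} [TopologicalSpace M] [ChartedSpace (EuclideanSpace ℂ (Fin k)) M]
  [IsManifold 𝓘(ℂ, EuclideanSpace ℂ (Fin k)) ω M]

/-- The irreducible components of a hypersurface form a locally finite family. -/
theorem IsHypersurface.exists_nhds_finite_components {A : Set M} (hA : IsHypersurface k A) (x : M) :
    ∃ U ∈ 𝓝 x, {V ∈ analyticComponents k A | (V ∩ U).Nonempty}.Finite := by
  set e := chartAt (EuclideanSpace ℂ (Fin k)) x with he_def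
  have he : e ∈ holAtlas k M := IsManifold.chart_mem_maximalAtlas x
  have hx : x ∈ e.source := mem_chart_source _ x
  obtain ⟨g, hg, hgA⟩ := hA.exists_equation x
  set G : EuclideanSpace ℂ (Fin k) → ℂ := fun z => g (e.symm z) with hG_def
  have hG : AnalyticAt ℂ G (e x) := (contMDiffAt_iff_analyticAt he hx).1 hg
  have hGne : ∃ᶠ z in 𝓝 (e x), G z ≠ 0 := fun hcon =>
    ((frequently_notMem hA.interior_eq x).mp (hgA.mono fun y hy h1 h2 => h1 (hy.2 h2)))
      ((eventually_nhds_chart hx (p := fun y => ¬ g y ≠ 0)).1 hcon)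
  -- The hypersurface is seen as a branched covering along the direction `v`: the points of `A` over
  -- the parameter `t` are the `t + ζ • v`, where `ζ` is a zero of `h t`.
  obtain ⟨v, hv⟩ := exists_direction hG hGne
  set good : EuclideanSpace ℂ (Fin k) → Prop := fun z =>
    (AnalyticAt ℂ G z ∧ z ∈ e.target) ∧ (e.symm z ∈ A ↔ G z = 0) with hgood_def
  have hgood : ∀ᶠ z in 𝓝 (e x), good z :=
    (hG.eventually_analyticAt.and (e.open_target.mem_nhds (e.map_source hx))).and
      ((eventually_nhds_chart hx (p := fun y => y ∈ A ↔ g y = 0)).2 hgA)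
  set κ : EuclideanSpace ℂ (Fin k) × ℂ → EuclideanSpace ℂ (Fin k) := fun p => p.1 + p.2 • v
    with hκ
  have hκc : Continuous κ := by fun_prop
  have hκa : ∀ p, AnalyticAt ℂ κ p := fun p =>
    analyticAt_fst.add (analyticAt_snd.smul analyticAt_const)
  set h : EuclideanSpace ℂ (Fin k) → ℂ → ℂ := fun t ζ => G (t + ζ • v) with hh_def
  obtain ⟨ρ, hρ, hρb⟩ : ∃ ρ > 0, ∀ ζ ∈ Metric.closedBall (0 : ℂ) ρ,
      (ζ ≠ 0 → h (e x) ζ ≠ 0) ∧ ∀ᶠ z in 𝓝 (e x + ζ • v), good z := by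
    rw [eventually_nhdsWithin_iff] at hv
    have h1 : ContinuousAt (fun ζ : ℂ => e x + ζ • v) 0 := by fun_prop
    have h2 : ∀ᶠ ζ : ℂ in 𝓝 0, ∀ᶠ z in 𝓝 (e x + ζ • v), good z := by
      refine h1.eventually (p := fun y => ∀ᶠ z in 𝓝 y, good z) ?_
      simpa using hgood.eventually_nhds
    obtain ⟨ρ, hρ, hρb⟩ := Metric.nhds_basis_closedBall.eventually_iff.1 (hv.and h2)
    exact ⟨ρ, hρ, fun ζ hζ => hρb hζ⟩
  have hgood' : ∀ᶠ t in 𝓝 (e x), ∀ ζ ∈ Metric.closedBall (0 : ℂ) ρ, good (t + ζ • v) :=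
    (isCompact_closedBall (0 : ℂ) ρ).eventually_forall_of_forall_eventually fun ζ hζ =>
      (hκc.tendsto (e x, ζ)).eventually (p := good) (hρb ζ hζ).2
  have hhan : ∀ {t ζ}, good (t + ζ • v) → AnalyticAt ℂ (Function.uncurry h) (t, ζ) :=
    fun hgd => AnalyticAt.comp (g := G) (f := κ) hgd.1.1 (hκa _)
  obtain ⟨ε, hε, Δ, r, hΔ, hΔne, hΔr⟩ := exists_branch_function hρ
    (fun ζ hζ => hhan (hρb ζ hζ).2.self_of_nhds)
    (fun ζ hζ => (hρb ζ (Metric.sphere_subset_closedBall hζ)).1 (by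
      rintro rfl
      rw [mem_sphere_zero_iff_norm, norm_zero] at hζ
      exact hρ.ne hζ))
  obtain ⟨ε', hε', hεb⟩ := Metric.nhds_basis_ball.eventually_iff.1
    (hgood'.and (Metric.ball_mem_nhds (e x) hε))
  set B := Metric.ball (e x) ε' with hB
  have hBε : B ⊆ Metric.ball (e x) ε := fun t ht => (hεb ht).2
  have hΔB : AnalyticOnNhd ℂ Δ B := hΔ.mono hBε
  have hBx : e x ∈ B := Metric.mem_ball_self hε'
  have hΔB0 : ∃ t ∈ B, Δ t ≠ 0 := by
    obtain ⟨t, h1, h2⟩ := ((frequently_ne_zero_of_exists_ne_zero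
      (convex_ball (e x) ε).isPreconnected hΔ hΔne (Metric.mem_ball_self hε)).and_eventually
        (Metric.ball_mem_nhds (e x) hε')).exists
    exact ⟨t, h2, h1⟩
  have hΔfr : ∀ t ∈ B, ∃ᶠ t' in 𝓝 t, Δ t' ≠ 0 := fun t ht =>
    frequently_ne_zero_of_exists_ne_zero (convex_ball (e x) ε').isPreconnected hΔB hΔB0 ht
  set Ω : Set (EuclideanSpace ℂ (Fin k)) := {t ∈ B | Δ t ≠ 0} with hΩ
  have hΩpre : IsPreconnected Ω :=
    isPreconnected_ne_zero (convex_ball (e x) ε') Metric.isOpen_ball hΔB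
  set Z : EuclideanSpace ℂ (Fin k) → Set ℂ := fun t => {ζ ∈ Metric.ball 0 ρ | h t ζ = 0} with hZ
  have hgd : ∀ t ∈ B, ∀ ζ ∈ Metric.ball (0 : ℂ) ρ, good (t + ζ • v) := fun t ht ζ hζ =>
    (hεb ht).1 ζ (Metric.ball_subset_closedBall hζ)
  -- Over the unbranched locus, the sheets stay in the regular part of `A`, hence in one component.
  have hlocal : ∀ t₁ ∈ Ω, ∀ y₀ : M, ∀ᶠ t in 𝓝 t₁,
      ((∃ ζ ∈ Z t₁, e.symm (t₁ + ζ • v) ∈ connectedComponentIn (regularPart k A) y₀) ↔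
        ∃ ζ ∈ Z t, e.symm (t + ζ • v) ∈ connectedComponentIn (regularPart k A) y₀) := by
    rintro t₁ ⟨ht₁, ht₁Δ⟩ y₀
    have hΔt := hΔr t₁ (hBε ht₁)
    have hle : ∀ᶠ t in 𝓝 t₁, (Z t).encard ≤ r := by
      filter_upwards [Metric.isOpen_ball.mem_nhds (hBε ht₁)] with t ht
      exact (hΔr t ht).2.2.1
    have heq := hΔt.2.2.2.1 ht₁Δ
    obtain ⟨b, hb, hball⟩ := exists_local_sheets hΔt.1 hle heq
    have hreg : ∀ β ∈ Z t₁, e.symm (t₁ + β • v) ∈ regularPart k A := by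
      intro β hβ
      obtain ⟨hb1, hb2, hb3⟩ := hb β hβ
      have hgβ := hgd t₁ ht₁ β hβ.1
      have hright := e.right_inv hgβ.1.2
      have hsrc := e.map_target hgβ.1.2
      -- A sheet `ζ = b β t` is regular: its equation below has derivative `-1` in the direction `v`.
      have hψ : AnalyticAt ℂ (fun z => b β (z - β • v) - β) (t₁ + β • v) := by
        refine AnalyticAt.sub ?_ analyticAt_const
        refine AnalyticAt.fun_comp (g := b β) ?_ (analyticAt_id.sub analyticAt_const)
        simpa using hb1
      refine mem_regularPart_of_chart he hsrc (hgβ.2.2 hβ.2)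
        (ψ := fun z => b β (z - β • v) - β) (by rwa [hright]) ?_ ?_
      · rw [hright]
        intro h0
        have h1 : HasDerivAt (fun s : ℂ => b β (t₁ + β • v + s • v - β • v) - β)
            (fderiv ℂ (fun z => b β (z - β • v) - β) (t₁ + β • v) v) 0 := by
          have h2 : HasDerivAt (fun s : ℂ => t₁ + β • v + s • v) v 0 := by
            simpa using ((hasDerivAt_id (0 : ℂ)).smul_const v).const_add (t₁ + β • v)
          have h3 : HasFDerivAt (fun z => b β (z - β • v) - β)
              (fderiv ℂ (fun z => b β (z - β • v) - β) (t₁ + β • v))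
              (t₁ + β • v + (0 : ℂ) • v) := by
            rw [zero_smul, add_zero]; exact hψ.differentiableAt.hasFDerivAt
          exact h3.comp_hasDerivAt (0 : ℂ) h2
        have h2 : (fun s : ℂ => b β (t₁ + β • v + s • v - β • v) - β) =ᶠ[𝓝 0] fun s => -s := by
          have h3 : Tendsto (fun s : ℂ => (t₁ + s • v, β - s)) (𝓝 0) (𝓝 (t₁, β)) := by
            have : Continuous fun s : ℂ => (t₁ + s • v, β - s) := by fun_prop
            simpa using this.tendsto 0
          filter_upwards [h3.eventually hb3] with s hs
          have h4 : t₁ + s • v + (β - s) • v = t₁ + β • v := by rw [sub_smul]; abel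
          have h5 : β - s = b β (t₁ + s • v) := hs.1 (by
            simp only [hh_def, h4]; exact hβ.2)
          have h6 : t₁ + β • v + s • v - β • v = t₁ + s • v := by abel
          rw [h6, ← h5]; ring
        have h3 : HasDerivAt (fun s : ℂ => -s) (-1) 0 := (hasDerivAt_id (0 : ℂ)).neg
        have h4 := (h1.congr_of_eventuallyEq h2.symm).unique h3
        rw [h0] at h4
        simp at h4
      · rw [← eventually_nhds_chart hsrc, hright]
        have h3 : Tendsto (fun z => (z - β • v, β)) (𝓝 (t₁ + β • v)) (𝓝 (t₁, β)) := by
          have : Continuous fun z : EuclideanSpace ℂ (Fin k) => (z - β • v, β) := by fun_prop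
          simpa using this.tendsto (t₁ + β • v)
        have h4 : ∀ᶠ z in 𝓝 (t₁ + β • v), good z := by
          have h5 : Tendsto (fun z => z - β • v) (𝓝 (t₁ + β • v)) (𝓝 t₁) := by
            have : Continuous fun z : EuclideanSpace ℂ (Fin k) => z - β • v := by fun_prop
            simpa using this.tendsto (t₁ + β • v)
          filter_upwards [h5.eventually (Metric.isOpen_ball.mem_nhds ht₁)] with z hz
          simpa using hgd _ hz β hβ.1
        filter_upwards [h3.eventually hb3, h4] with z hz1 hz2
        rw [hz2.2, e.right_inv hz2.1.2]
        have h5 : h (z - β • v) β = G z := by simp [hh_def]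
        rw [← h5, hz1, sub_eq_zero, eq_comm]
    have hfin : (Z t₁).Finite := finite_of_encard_eq_coe heq
    have hall : ∀ᶠ t in 𝓝 t₁, ∀ β ∈ Z t₁, b β t ∈ Z t ∧
        e.symm (t + b β t • v) ∈ connectedComponentIn (regularPart k A) (e.symm (t₁ + β • v)) := by
      refine (Filter.eventually_all_finite hfin).2 fun β hβ => ?_
      obtain ⟨hb1, hb2, hb3⟩ := hb β hβ
      have hgβ := hgd t₁ ht₁ β hβ.1
      have h1 : Tendsto (fun t => (t, b β t)) (𝓝 t₁) (𝓝 (t₁, β)) := by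
        have := hb1.continuousAt.tendsto
        rw [hb2] at this
        exact tendsto_id.prodMk_nhds this
      have h2 : Tendsto (fun t => e.symm (t + b β t • v)) (𝓝 t₁) (𝓝 (e.symm (t₁ + β • v))) :=
        ((e.continuousAt_symm hgβ.1.2).tendsto.comp (hκc.tendsto (t₁, β))).comp h1
      have h3 := hb1.continuousAt.tendsto
      rw [hb2] at h3
      filter_upwards [h1.eventually hb3, h3.eventually (Metric.isOpen_ball.mem_nhds hβ.1),
        h2.eventually (eventually_mem_connectedComponentIn (hreg β hβ)),
        Metric.isOpen_ball.mem_nhds ht₁] with t h4 h5 h6 h7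
      have h8 : h t (b β t) = 0 := h4.2 rfl
      exact ⟨⟨h5, h8⟩, h6 ((hgd t h7 _ h5).2.2 h8)⟩
    filter_upwards [hall, hball] with t ht1 ht2
    constructor
    · rintro ⟨β, hβ, hβW⟩
      exact ⟨b β t, (ht1 β hβ).1, (mem_connectedComponentIn_iff_of_mem (ht1 β hβ).2).2 hβW⟩
    · rintro ⟨ζ, hζ, hζW⟩
      obtain ⟨β, hβ, rfl⟩ := ht2 ζ hζ
      exact ⟨β, hβ, (mem_connectedComponentIn_iff_of_mem (ht1 β hβ).2).1 hζW⟩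
  -- As the unbranched locus `Ω` is connected, a component that has a point over one of its elements
  -- has a point over each of them.
  have hglobal : ∀ y₀ : M, ∀ t ∈ Ω, ∀ t' ∈ Ω,
      ((∃ ζ ∈ Z t, e.symm (t + ζ • v) ∈ connectedComponentIn (regularPart k A) y₀) ↔
        ∃ ζ ∈ Z t', e.symm (t' + ζ • v) ∈ connectedComponentIn (regularPart k A) y₀) := by
    intro y₀ t ht t' ht'
    refine hΩpre.induction₂ (fun a b =>
      ((∃ ζ ∈ Z a, e.symm (a + ζ • v) ∈ connectedComponentIn (regularPart k A) y₀) ↔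
        ∃ ζ ∈ Z b, e.symm (b + ζ • v) ∈ connectedComponentIn (regularPart k A) y₀))
      (fun a ha => nhdsWithin_le_nhds (hlocal a ha y₀)) (fun a b c _ _ _ h1 h2 => h1.trans h2)
      (fun a b _ _ h => h.symm) ht ht'
  set U : Set M := e.source ∩ e ⁻¹' B with hU
  have hUo : IsOpen U := e.isOpen_inter_preimage Metric.isOpen_ball
  refine ⟨U, hUo.mem_nhds ⟨hx, hBx⟩, ?_⟩
  -- Each component that meets `U` has a point over `t₂`, and there are finitely many such points.
  obtain ⟨t₂, ht₂, ht₂Δ⟩ := hΔB0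
  have hfin : (Z t₂).Finite := finite_of_encard_le_coe (hΔr t₂ (hBε ht₂)).2.2.1
  refine (hfin.image fun ζ =>
    closure (connectedComponentIn (regularPart k A) (e.symm (t₂ + ζ • v)))).subset ?_
  rintro _ ⟨⟨y₀, hy₀, rfl⟩, hmeet⟩
  rw [closure_inter_open_nonempty_iff hUo] at hmeet
  obtain ⟨y, hyW, hys, hyB⟩ := hmeet
  have hyreg := connectedComponentIn_subset _ _ hyW
  have hycc := eventually_mem_connectedComponentIn hyreg
  have hgy : good (e y) := by
    have := hgd _ hyB 0 (Metric.mem_ball_self hρ)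
    rwa [zero_smul, add_zero] at this
  have hroot0 : h (e y) 0 = 0 := by
    simp only [hh_def, zero_smul, add_zero]
    exact hgy.2.1 (by rw [e.left_inv hys]; exact hyreg.1)
  have hany : AnalyticOnNhd ℂ (h (e y)) (Metric.closedBall 0 ρ) := fun ζ hζ =>
    analyticAt_curry_right ((hΔr _ (hBε hyB)).1 ζ hζ)
  have hney : ∃ᶠ ζ in 𝓝 (0 : ℂ), h (e y) ζ ≠ 0 := by
    intro hcon
    have hfinz := finite_zeros_closedBall hρ hany (hΔr _ (hBε hyB)).2.1
    have : {ζ ∈ Metric.closedBall (0 : ℂ) ρ | h (e y) ζ = 0} ∈ 𝓝 (0 : ℂ) := by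
      filter_upwards [Metric.closedBall_mem_nhds (0 : ℂ) hρ, hcon] with ζ h1 h2
      exact ⟨h1, not_not.1 h2⟩
    exact (infinite_of_mem_nhds (0 : ℂ) this) hfinz
  -- The point `y` may lie over a branch point; move it inside its component to the unbranched locus.
  have hpt : ∀ᶠ p : EuclideanSpace ℂ (Fin k) × ℂ in 𝓝 (e y, 0), e.symm (p.1 + p.2 • v) ∈ A →
      e.symm (p.1 + p.2 • v) ∈ connectedComponentIn (regularPart k A) y := by
    have h1 : Tendsto (fun p => e.symm (κ p)) (𝓝 (e y, 0)) (𝓝 y) := by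
      have h2 := (e.continuousAt_symm (e.map_source hys)).tendsto
      rw [e.left_inv hys] at h2
      have h3 := hκc.tendsto (e y, 0)
      have h4 : κ (e y, 0) = e y := by simp [hκ]
      rw [h4] at h3
      exact h2.comp h3
    exact h1.eventually hycc
  rw [nhds_prod_eq] at hpt
  obtain ⟨P, hP, Q, hQ, hPQ⟩ := Filter.eventually_prod_iff.1 hpt
  have hroots := eventually_exists_root ((hΔr _ (hBε hyB)).1 0 (Metric.mem_closedBall_self hρ.le))
    hroot0 hney (inter_mem hQ (Metric.ball_mem_nhds 0 hρ))
  obtain ⟨t, ⟨htΔ, ⟨ζ, ⟨hζQ, hζρ⟩, hζ⟩, htP⟩, htB⟩ :=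
    (((hΔfr _ hyB).and_eventually (hroots.and hP)).and_eventually
      (Metric.isOpen_ball.mem_nhds hyB)).exists
  have h1 : e.symm (t + ζ • v) ∈ connectedComponentIn (regularPart k A) y₀ :=
    (mem_connectedComponentIn_iff_of_mem (hPQ htP hζQ ((hgd t htB ζ hζρ).2.2 hζ))).2 hyW
  obtain ⟨ζ', hζ', hζW⟩ := (hglobal y₀ t ⟨htB, htΔ⟩ t₂ ⟨ht₂, ht₂Δ⟩).1 ⟨ζ, ⟨hζρ, hζ⟩, h1⟩
  exact ⟨ζ', hζ', by simp only [connectedComponentIn_eq hζW]⟩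

end LocallyFinite

/-! ### Divisors and their currents -/

section Divisors

variable {k : ℕ} {M : Type*} [TopologicalSpace M] [ChartedSpace (EuclideanSpace ℂ (Fin k)) M]
  [IsManifold 𝓘(ℂ, EuclideanSpace ℂ (Fin k)) ω M]

/-- Near each point, `A` is the zero set of a holomorphic function whose order of vanishing at the
points of `A` is `ord`. -/
def IsDivisorOrder (k : ℕ) {M : Type*} [TopologicalSpace M]
    [ChartedSpace (EuclideanSpace ℂ (Fin k)) M] (A : Set M) (ord : M → ℕ∞) : Prop :=
  ∀ x, ∃ g : M → ℂ, ContMDiffAt 𝓘(ℂ, EuclideanSpace ℂ (Fin k)) 𝓘(ℂ, ℂ) ω g x ∧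
    (∀ᶠ y in 𝓝 x, y ∈ A ↔ g y = 0) ∧ ∀ᶠ y in 𝓝 x, y ∈ A → ord y = ordAt k g y

theorem eventually_isTheta_nhds {X : Type*} [TopologicalSpace X] {f g : X → ℂ} {x : X}
    (h : f =Θ[𝓝 x] g) : ∀ᶠ y in 𝓝 x, f =Θ[𝓝 y] g := by
  obtain ⟨C, hC⟩ := h.1.bound
  obtain ⟨C', hC'⟩ := h.2.bound
  filter_upwards [hC.eventually_nhds, hC'.eventually_nhds] with y h1 h2
  exact ⟨Asymptotics.IsBigO.of_bound C h1, Asymptotics.IsBigO.of_bound C' h2⟩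

/-- Along a regular part, the order of vanishing of a holomorphic function is locally constant. -/
theorem IsHyperplaneAt.eventually_ordAt_eq {A : Set M} {x : M}
    {e : OpenPartialHomeomorph M (EuclideanSpace ℂ (Fin k))}
    {L : EuclideanSpace ℂ (Fin k) →L[ℂ] ℂ} {v : EuclideanSpace ℂ (Fin k)}
    (H : IsHyperplaneAt A x e L v) {h : M → ℂ}
    (hh : ContMDiffAt 𝓘(ℂ, EuclideanSpace ℂ (Fin k)) 𝓘(ℂ, ℂ) ω h x) {m : ℕ}
    (hm : h =Θ[𝓝 x] fun y => L (e y) ^ m) : ∀ᶠ y in 𝓝 x, y ∈ A → ordAt k h y = m := by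
  filter_upwards [H.eventually, eventually_contMDiffAt hh, eventually_isTheta_nhds hm]
    with y h1 h2 h3 hy
  exact (h1 hy).ordAt_eq h2 h3

theorem IsDivisorOrder.eventually_eq {A : Set M} {ord : M → ℕ∞} (hA : interior A = ∅)
    (hord : IsDivisorOrder k A ord) {x : M} (hx : x ∈ regularPart k A) :
    ∀ᶠ y in 𝓝 x, y ∈ A → ord y = ord x := by
  obtain ⟨e, L, v, H⟩ := exists_isHyperplaneAt hx
  obtain ⟨g, hg, hgA, hgo⟩ := hord x
  obtain ⟨m, hm⟩ := H.exists_isTheta_pow hg (hgA.mono fun y hy h0 => hy.2 h0)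
    ((frequently_notMem hA x).mp (hgA.mono fun y hy h1 h2 => h1 (hy.2 h2)))
  have h1 := H.eventually_ordAt_eq hg hm
  filter_upwards [h1, hgo] with y h2 h3 hy
  rw [h3 hy, h2 hy, hgo.self_of_nhds hx.1, h1.self_of_nhds hx.1]

/-- Orders of vanishing are upper semicontinuous. -/
theorem IsDivisorOrder.le_of_mem_closure {A W : Set M} {ord : M → ℕ∞} (hA : IsClosed A)
    (hord : IsDivisorOrder k A ord) (hW : W ⊆ A) {n : ℕ∞} (hn : ∀ y ∈ W, n ≤ ord y) {x : M}
    (hx : x ∈ closure W) : n ≤ ord x := by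
  obtain ⟨g, hg, hgA, hgo⟩ := hord x
  have hxA : x ∈ A := closure_minimal hW hA hx
  set e := chartAt (EuclideanSpace ℂ (Fin k)) x
  have he : e ∈ holAtlas k M := IsManifold.chart_mem_maximalAtlas x
  have hxs : x ∈ e.source := mem_chart_source _ x
  rw [hgo.self_of_nhds hxA]
  refine ENat.forall_natCast_le_iff_le.1 fun m hm => ?_
  rw [le_ordAt_iff_iteratedFDeriv he hxs hg]
  intro i hi
  have han := (contMDiffAt_iff_analyticAt he hxs).1 hg
  have hcont : ContinuousAt (fun y => iteratedFDeriv ℂ i (fun z => g (e.symm z)) (e y)) x := by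
    have h1 : ContinuousAt (iteratedFDeriv ℂ i fun z => g (e.symm z)) (e x) :=
      (han.contDiffAt (n := ω)).continuousAt_iteratedFDeriv (by simp)
    exact ContinuousAt.comp (g := iteratedFDeriv ℂ i fun z => g (e.symm z)) (f := e) h1
      (e.continuousAt hxs)
  by_contra hne
  have h1 := hcont.eventually_ne hne
  obtain ⟨y, hyW, ⟨⟨h2, h3⟩, h4⟩, h5⟩ := ((mem_closure_iff_frequently.1 hx).and_eventually
    (((h1.and hgo).and (e.open_source.mem_nhds hxs)).and (eventually_contMDiffAt hg))).exists
  have h6 : (m : ℕ∞) ≤ ordAt k g y := by rw [← h3 (hW hyW)]; exact hm.trans (hn y hyW)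
  exact h2 ((le_ordAt_iff_iteratedFDeriv he h4 h5).1 h6 i hi)

/-- The generic order along a component is the order at any of its regular points. -/
theorem IsDivisorOrder.orderAlong_eq {A : Set M} {ord : M → ℕ∞} (hA : IsHypersurface k A)
    (hord : IsDivisorOrder k A ord) {x : M} (hx : x ∈ regularPart k A) :
    orderAlong ord (closure (connectedComponentIn (regularPart k A) x)) = (ord x).toNat := by
  set W := connectedComponentIn (regularPart k A) x
  have hxW : x ∈ W := mem_connectedComponentIn hx
  have hWreg : W ⊆ regularPart k A := connectedComponentIn_subset _ _
  have hconst : ∀ y ∈ W, ord x = ord y := fun y hy =>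
    (isPreconnected_connectedComponentIn (x := x) (F := regularPart k A)).induction₂
      (fun a b => ord a = ord b) (fun a ha => by
        filter_upwards [nhdsWithin_le_nhds (hord.eventually_eq hA.interior_eq (hWreg ha)),
          self_mem_nhdsWithin] with b h1 h2
        exact (h1 (hWreg h2).1).symm)
      (fun a b c _ _ _ h1 h2 => h1.trans h2) (fun a b _ _ h => h.symm) hxW hy
  rw [orderAlong]
  congr 1
  refine le_antisymm (iInf₂_le x (subset_closure hxW)) (le_iInf₂ fun y hy => ?_)
  exact hord.le_of_mem_closure hA.isClosed (fun z hz => (hWreg hz).1)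
    (fun z hz => (hconst z hz).le) hy

theorem isCompact_support (φ : TestForm k M) : IsCompact φ.support :=
  φ.form.hasCompactSupport.isCompact.image_of_continuousOn
    (φ.chart.continuousOn_symm.mono φ.form.tsupport_subset)

theorem integrationCurrent_eq_zero {V : Set M} {φ : TestForm k M} (h : ¬ (V ∩ φ.support).Nonempty) :
    integrationCurrent V φ = 0 := by
  refine setIntegral_eq_zero_of_forall_eq_zero fun y hy => ?_
  have h1 : φ.form y = 0 := by
    by_contra hne
    exact h ⟨φ.chart.symm y, hy.1.2, y, subset_tsupport _ hne, rfl⟩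
  rw [h1]; rfl

/-- Only finitely many components of a hypersurface contribute to the value of a current on a given
test form. -/
theorem IsHypersurface.finite_integrationCurrent_ne_zero {A : Set M} (hA : IsHypersurface k A)
    (φ : TestForm k M) : {V ∈ analyticComponents k A | integrationCurrent V φ ≠ 0}.Finite := by
  choose U hU hUf using hA.exists_nhds_finite_components
  obtain ⟨t, -, ht⟩ := (isCompact_support φ).elim_nhds_subcover U fun x _ => hU x
  refine (t.finite_toSet.biUnion fun x _ => hUf x).subset ?_
  rintro V ⟨hV, hV0⟩
  have h1 : (V ∩ φ.support).Nonempty := by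
    by_contra hcon
    exact hV0 (integrationCurrent_eq_zero hcon)
  obtain ⟨y, hyV, hys⟩ := h1
  obtain ⟨x, hx, hyU⟩ := mem_iUnion₂.1 (ht hys)
  exact mem_iUnion₂.2 ⟨x, hx, hV, y, hyV, hyU⟩

/-- If a hypersurface is locally defined by a function comparable to the product of functions
defining hypersurfaces `E j`, then its divisor is the sum of the divisors of the `E j`. -/
theorem divisorCurrent_eq_sum {ι : Type*} [Fintype ι] {A : Set M} {E : ι → Set M} {ordA : M → ℕ∞}
    {ord : ι → M → ℕ∞} (hA : interior A = ∅)
    (H : ∀ x, ∃ (g : M → ℂ) (h : ι → M → ℂ),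
      ContMDiffAt 𝓘(ℂ, EuclideanSpace ℂ (Fin k)) 𝓘(ℂ, ℂ) ω g x ∧
      (∀ j, ContMDiffAt 𝓘(ℂ, EuclideanSpace ℂ (Fin k)) 𝓘(ℂ, ℂ) ω (h j) x) ∧
      (∀ᶠ y in 𝓝 x, y ∈ A ↔ g y = 0) ∧ (∀ j, ∀ᶠ y in 𝓝 x, y ∈ E j ↔ h j y = 0) ∧
      (g =Θ[𝓝 x] fun y => ∏ j, h j y) ∧ (∀ᶠ y in 𝓝 x, y ∈ A → ordA y = ordAt k g y) ∧
      ∀ j, ∀ᶠ y in 𝓝 x, y ∈ E j → ord j y = ordAt k (h j) y) (φ : TestForm k M) :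
    divisorCurrent A ordA φ = ∑ j, divisorCurrent (E j) (ord j) φ := by
  classical
  have hEA : ∀ j, E j ⊆ A := by
    intro j y hy
    obtain ⟨g, h, -, -, h1, h2, h3, -⟩ := H y
    refine h1.self_of_nhds.2 (h3.1.eq_zero_imp.self_of_nhds ?_)
    exact Finset.prod_eq_zero (Finset.mem_univ j) ((h2 j).self_of_nhds.1 hy)
  have hAH : IsHypersurface k A := ⟨hA, fun x => by
    obtain ⟨g, h, h0, -, h1, -⟩ := H x
    exact ⟨g, h0, h1⟩⟩
  have hEH : ∀ j, IsHypersurface k (E j) := fun j =>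
    ⟨subset_empty_iff.1 (hA ▸ interior_mono (hEA j)), fun x => by
      obtain ⟨g, h, -, h0, -, h1, -⟩ := H x
      exact ⟨h j, h0 j, h1 j⟩⟩
  have hAO : IsDivisorOrder k A ordA := fun x => by
    obtain ⟨g, h, h0, -, h1, -, -, h2, -⟩ := H x
    exact ⟨g, h0, h1, h2⟩
  have hEO : ∀ j, IsDivisorOrder k (E j) (ord j) := fun j x => by
    obtain ⟨g, h, -, h0, -, h1, -, -, h2⟩ := H x
    exact ⟨h j, h0 j, h1 j, h2 j⟩
  -- At a regular point, each function is comparable to a power of the local equation of `A`.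
  have hsum : ∀ x ∈ regularPart k A,
      (ordA x).toNat = ∑ j, if x ∈ E j then (ord j x).toNat else 0 := by
    intro x hx
    obtain ⟨e, L, v, HP⟩ := exists_isHyperplaneAt hx
    obtain ⟨g, h, hg, hh, hgA, hhE, hgh, hgo, hho⟩ := H x
    have hm : ∀ j, ∃ m : ℕ, h j =Θ[𝓝 x] fun y => L (e y) ^ m := fun j =>
      HP.exists_isTheta_pow (hh j) ((hhE j).mono fun y hy h0 => hEA j (hy.2 h0))
        ((frequently_notMem (hEH j).interior_eq x).mp ((hhE j).mono fun y hy h1 h2 => h1 (hy.2 h2)))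
    choose m hm using hm
    have hgm : g =Θ[𝓝 x] fun y => L (e y) ^ ∑ j, m j := by
      refine hgh.trans ?_
      simp only [← Finset.prod_pow_eq_pow_sum]
      exact ⟨Asymptotics.IsBigO.finsetProd fun j _ => (hm j).1,
        Asymptotics.IsBigO.finsetProd fun j _ => (hm j).2⟩
    rw [hgo.self_of_nhds hx.1, HP.ordAt_eq hg hgm, ENat.toNat_natCast]
    refine Finset.sum_congr rfl fun j _ => ?_
    split_ifs with hj
    · rw [(hho j).self_of_nhds hj, HP.ordAt_eq (hh j) (hm j), ENat.toNat_natCast]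
    · by_contra hmj
      apply hj
      rw [(hhE j).self_of_nhds]
      refine (hm j).1.eq_zero_imp.self_of_nhds ?_
      rw [HP.apply_x, zero_pow hmj]
  set T := (hAH.finite_integrationCurrent_ne_zero φ).toFinset with hT
  have hcomp : ∀ j, analyticComponents k (E j) ⊆ analyticComponents k A := by
    intro j V hV
    obtain ⟨x, hx, -, rfl⟩ :=
      exists_mem_regularPart_of_mem_analyticComponents hAH (hEH j) (hEA j) hV
    exact ⟨x, hx, rfl⟩
  -- On the test form `φ`, all the currents are finite sums over the same set of components of `A`.
  have htsum : ∀ (B : Set M) (o : M → ℕ∞), analyticComponents k B ⊆ analyticComponents k A →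
      divisorCurrent B o φ = ∑ V ∈ T, (if V ∈ analyticComponents k B then
        (orderAlong o V : ℂ) else 0) * integrationCurrent V φ := by
    intro B o hB
    have h1 : divisorCurrent B o φ = ∑' V : Set M, (analyticComponents k B).indicator
        (fun V => (orderAlong o V : ℂ) * integrationCurrent V φ) V :=
      tsum_subtype (analyticComponents k B)
        (fun V => (orderAlong o V : ℂ) * integrationCurrent V φ)
    rw [h1, tsum_eq_sum (s := T)]
    · refine Finset.sum_congr rfl fun V _ => ?_
      by_cases hV : V ∈ analyticComponents k B <;> simp [hV]
    · intro V hV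
      by_cases hVB : V ∈ analyticComponents k B
      · rw [indicator_of_mem hVB]
        have : integrationCurrent V φ = 0 := by
          by_contra hne
          exact hV ((hAH.finite_integrationCurrent_ne_zero φ).mem_toFinset.2 ⟨hB hVB, hne⟩)
        rw [this, mul_zero]
      · rw [indicator_of_notMem hVB]
  rw [htsum A ordA subset_rfl, Finset.sum_congr rfl fun j _ => htsum (E j) (ord j) (hcomp j),
    Finset.sum_comm]
  refine Finset.sum_congr rfl fun V hV => ?_
  have hVA : V ∈ analyticComponents k A :=
    ((hAH.finite_integrationCurrent_ne_zero φ).mem_toFinset.1 hV).1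
  rw [← Finset.sum_mul, if_pos hVA]
  congr 1
  obtain ⟨x, hx, rfl⟩ := hVA
  -- A component of `A` is a component of `E j` as soon as it has a regular point in `E j`.
  have hmem : ∀ j, (closure (connectedComponentIn (regularPart k A) x) ∈
      analyticComponents k (E j) ↔ x ∈ E j) := by
    intro j
    constructor
    · rintro ⟨y, hy, hxy⟩
      have h1 : closure (connectedComponentIn (regularPart k (E j)) y) ⊆ E j :=
        closure_minimal (fun z hz => (connectedComponentIn_subset _ _ hz).1) (hEH j).isClosed
      rw [← hxy] at h1
      exact h1 (subset_closure (mem_connectedComponentIn hx))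
    · intro hxj
      obtain ⟨h1, h2⟩ := closure_connectedComponentIn_regularPart_eq hAH (hEH j) (hEA j) hx hxj
      exact ⟨x, h1, h2.symm⟩
  rw [hAO.orderAlong_eq hAH hx, hsum x hx, Nat.cast_sum]
  refine Finset.sum_congr rfl fun j _ => ?_
  simp only [hmem j]
  split_ifs with hj
  · obtain ⟨h1, h2⟩ := closure_connectedComponentIn_regularPart_eq hAH (hEH j) (hEA j) hx hj
    rw [← h2, (hEO j).orderAlong_eq (hEH j) h1]
  · simp

end Divisors

/-! ### Multiplicities of fixed points -/

section FixedPointMultiplicity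

theorem tendsto_div_pow_of_analyticOrderAt_eq {f : ℂ → ℂ} {x : ℂ} (hf : AnalyticAt ℂ f x) {s : ℕ}
    (hs : analyticOrderAt f x = s) :
    ∃ v : ℂ → ℂ, AnalyticAt ℂ v x ∧ v x ≠ 0 ∧ (∀ᶠ y in 𝓝 x, f y = (y - x) ^ s * v y) ∧
      Tendsto (fun y => f y / (y - x) ^ s) (𝓝[≠] x) (𝓝 (v x)) := by
  obtain ⟨v, hv, hvx, hfv⟩ := hf.analyticOrderAt_eq_natCast.1 hs
  refine ⟨v, hv, hvx, by simpa using hfv, ?_⟩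
  refine (hv.continuousAt.tendsto.mono_left nhdsWithin_le_nhds).congr' ?_
  filter_upwards [nhdsWithin_le_nhds hfv, self_mem_nhdsWithin] with y h1 h2
  rw [h1, smul_eq_mul, mul_div_cancel_left₀ _ (pow_ne_zero _ (sub_ne_zero.2 h2))]

theorem analyticOrderAt_eq_of_tendsto {f : ℂ → ℂ} {x c : ℂ} (hf : AnalyticAt ℂ f x) {s : ℕ}
    (hc : c ≠ 0) (h : Tendsto (fun y => f y / (y - x) ^ s) (𝓝[≠] x) (𝓝 c)) :
    analyticOrderAt f x = s := by
  have hpow : ∀ n : ℕ, n ≠ 0 → Tendsto (fun y : ℂ => (y - x) ^ n) (𝓝[≠] x) (𝓝 0) := by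
    intro n hn
    have : Tendsto (fun y : ℂ => (y - x) ^ n) (𝓝 x) (𝓝 ((x - x) ^ n)) :=
      (Continuous.tendsto (by fun_prop) x)
    rw [sub_self, zero_pow hn] at this
    exact this.mono_left nhdsWithin_le_nhds
  have hne : analyticOrderAt f x ≠ ⊤ := by
    intro htop
    rw [analyticOrderAt_eq_top] at htop
    have h1 : Tendsto (fun y => f y / (y - x) ^ s) (𝓝[≠] x) (𝓝 0) := by
      refine tendsto_const_nhds.congr' ?_
      filter_upwards [nhdsWithin_le_nhds htop] with y hy
      rw [hy, zero_div]
    exact hc (tendsto_nhds_unique h h1)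
  obtain ⟨n, hn⟩ := ENat.ne_top_iff_exists.1 hne
  obtain ⟨v, -, hvx, -, hv⟩ := tendsto_div_pow_of_analyticOrderAt_eq hf hn.symm
  rw [← hn]
  rcases lt_trichotomy n s with hlt | heq | hgt
  · exfalso
    have h1 := h.mul (hpow (s - n) (by omega))
    rw [mul_zero] at h1
    refine hvx (tendsto_nhds_unique (hv.congr' ?_) h1)
    filter_upwards [self_mem_nhdsWithin] with y hy
    have hy0 : y - x ≠ 0 := sub_ne_zero.2 hy
    have h2 : (y - x) ^ s = (y - x) ^ n * (y - x) ^ (s - n) := by rw [← pow_add]; congr 1; omega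
    rw [h2]
    field_simp
  · rw [heq]
  · exfalso
    have h1 := hv.mul (hpow (n - s) (by omega))
    rw [mul_zero] at h1
    refine hc (tendsto_nhds_unique (h.congr' ?_) h1)
    filter_upwards [self_mem_nhdsWithin] with y hy
    have hy0 : y - x ≠ 0 := sub_ne_zero.2 hy
    have h2 : (y - x) ^ n = (y - x) ^ s * (y - x) ^ (n - s) := by rw [← pow_add]; congr 1; omega
    rw [h2]
    field_simp

/-- The leading coefficient of `φ ∘ G - φ` at a fixed point of `G` is that of `G - id`, multiplied by
the derivative of `φ`. -/
theorem tendsto_comp_sub_div_pow {φ G : ℂ → ℂ} {x c : ℂ} {s : ℕ} (hφ : AnalyticAt ℂ φ x)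
    (hG : ContinuousAt G x) (hGx : G x = x)
    (h : Tendsto (fun y => (G y - y) / (y - x) ^ s) (𝓝[≠] x) (𝓝 c)) :
    Tendsto (fun y => (φ (G y) - φ y) / (y - x) ^ s) (𝓝[≠] x) (𝓝 (deriv φ x * c)) := by
  have h1 : (fun p : ℂ × ℂ => φ p.1 - φ p.2 - (p.1 - p.2) * deriv φ x) =o[𝓝 (x, x)]
      fun p => p.1 - p.2 := by
    simpa [mul_comm] using hφ.hasStrictDerivAt.isLittleO
  have h2 : Tendsto (fun y => (G y, y)) (𝓝[≠] x) (𝓝 (x, x)) := by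
    have := hG.tendsto
    rw [hGx] at this
    exact (this.prodMk_nhds tendsto_id).mono_left nhdsWithin_le_nhds
  have h3 := h1.comp_tendsto h2
  have h4 : (fun y => G y - y) =O[𝓝[≠] x] fun y => (y - x) ^ s := by
    have h5 := h.isBigO_one ℂ
    have h6 := h5.mul (Asymptotics.isBigO_refl (fun y => (y - x) ^ s) (𝓝[≠] x))
    refine h6.congr' ?_ (by simp)
    filter_upwards [self_mem_nhdsWithin] with y hy
    rw [div_mul_cancel₀ _ (pow_ne_zero _ (sub_ne_zero.2 hy))]
  have h5 := (h3.trans_isBigO h4).tendsto_div_nhds_zero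
  have h6 := h5.add (h.mul_const (deriv φ x))
  rw [zero_add, mul_comm] at h6
  refine h6.congr fun y => ?_
  simp only [Function.comp]
  ring

theorem analyticAt_iterate {g : ℂ → ℂ} {x : ℂ} (hg : AnalyticAt ℂ g x) (hx : g x = x) (j : ℕ) :
    AnalyticAt ℂ g^[j] x := by
  induction j with
  | zero => exact analyticAt_id
  | succ j ih => rw [Function.iterate_succ]; exact AnalyticAt.comp (by rwa [hx]) hg

theorem deriv_iterate {g : ℂ → ℂ} {x : ℂ} (hg : AnalyticAt ℂ g x) (hx : g x = x) (j : ℕ) :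
    deriv g^[j] x = deriv g x ^ j :=
  (hg.differentiableAt.hasDerivAt.iterate x hx j).deriv

/-- A fixed point whose multiplier is not `1` is simple. -/
theorem analyticOrderAt_sub_id_eq_one {g : ℂ → ℂ} {x : ℂ} (hg : AnalyticAt ℂ g x) (hx : g x = x)
    (h : deriv g x ≠ 1) : analyticOrderAt (fun y => g y - y) x = 1 := by
  refine AnalyticAt.analyticOrderAt_eq_one_of_zero_deriv_ne_zero (hg.sub analyticAt_id) (by simp [hx]) ?_
  have h1 : HasDerivAt (fun y => g y - y) (deriv g x - 1) x :=
    hg.differentiableAt.hasDerivAt.sub (hasDerivAt_id x)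
  rw [h1.deriv]
  exact sub_ne_zero.2 h

/-- Iterating a germ tangent to the identity does not change its multiplicity as a fixed point. -/
theorem analyticOrderAt_iterate_sub_id {G : ℂ → ℂ} {x : ℂ} (hG : AnalyticAt ℂ G x) (hx : G x = x)
    (h1 : deriv G x = 1) {s : ℕ} (hs : analyticOrderAt (fun y => G y - y) x = s) {j : ℕ}
    (hj : j ≠ 0) : analyticOrderAt (fun y => G^[j] y - y) x = s := by
  obtain ⟨v, hv, hvx, -, hlim⟩ :=
    tendsto_div_pow_of_analyticOrderAt_eq (hG.sub analyticAt_id) hs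
  have key : ∀ i : ℕ, Tendsto (fun y => (G^[i] y - y) / (y - x) ^ s) (𝓝[≠] x) (𝓝 (i * v x)) := by
    intro i
    induction i with
    | zero => simp
    | succ i ih =>
      have h2 := tendsto_comp_sub_div_pow (analyticAt_iterate hG hx i) hG.continuousAt hx hlim
      rw [deriv_iterate hG hx, h1, one_pow, one_mul] at h2
      have h3 := h2.add ih
      have h4 : v x + i * v x = ((i + 1 : ℕ) : ℂ) * v x := by push_cast; ring
      rw [h4] at h3
      refine h3.congr fun y => ?_
      rw [Function.iterate_succ_apply]
      ring
  exact analyticOrderAt_eq_of_tendsto ((analyticAt_iterate hG hx j).sub analyticAt_id)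
    (mul_ne_zero (by exact_mod_cast hj) hvx) (key j)

/-- If `g` commutes with a germ `G ≠ id` tangent to the identity, then the multiplier of `g` is a
root of unity, of order dividing the excess multiplicity of `G`. -/
theorem deriv_pow_eq_of_commute {g G : ℂ → ℂ} {x : ℂ} (hg : AnalyticAt ℂ g x) (hgx : g x = x)
    (hG : AnalyticAt ℂ G x) (hGx : G x = x) (hcomm : ∀ᶠ y in 𝓝 x, g (G y) = G (g y)) {s : ℕ}
    (hs : analyticOrderAt (fun y => G y - y) x = s) : deriv g x ^ s = deriv g x := by
  obtain ⟨v, hv, hvx, hfac, hlim⟩ :=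
    tendsto_div_pow_of_analyticOrderAt_eq (hG.sub analyticAt_id) hs
  have h1 := tendsto_comp_sub_div_pow hg hG.continuousAt hGx hlim
  have h2 : Tendsto (fun y => ((g y - x) / (y - x)) ^ s * v (g y)) (𝓝[≠] x)
      (𝓝 (deriv g x ^ s * v x)) := by
    have h3 : Tendsto (fun y => (g y - x) / (y - x)) (𝓝[≠] x) (𝓝 (deriv g x)) := by
      have := hasDerivAt_iff_tendsto_slope.1 hg.differentiableAt.hasDerivAt
      refine this.congr fun y => ?_
      rw [slope_def_field, hgx]
    have h4 : Tendsto (fun y => v (g y)) (𝓝[≠] x) (𝓝 (v x)) := by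
      have h5 := hg.continuousAt.tendsto
      rw [hgx] at h5
      exact (hv.continuousAt.tendsto.comp h5).mono_left nhdsWithin_le_nhds
    exact (h3.pow s).mul h4
  -- The leading coefficient of `g ∘ G - g = (G - id) ∘ g` computed in two ways.
  have h3 : deriv g x * v x = deriv g x ^ s * v x := by
    refine tendsto_nhds_unique h1 (h2.congr' ?_)
    have h5 := hg.continuousAt.tendsto
    rw [hgx] at h5
    filter_upwards [nhdsWithin_le_nhds hcomm, nhdsWithin_le_nhds (h5.eventually hfac)] with y h6 h7
    simp only [Pi.sub_apply, id_eq] at h7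
    rw [h6, h7, div_pow]
    ring
  exact (mul_right_cancel₀ hvx h3).symm

/-- The multiplicity of a fixed point is invariant under conjugacy. -/
theorem analyticOrderAt_sub_id_of_semiconj {φ G H : ℂ → ℂ} {x : ℂ} (hφ : AnalyticAt ℂ φ x)
    (hφ' : deriv φ x ≠ 0) (hG : AnalyticAt ℂ G x) (hGx : G x = x)
    (hconj : ∀ᶠ y in 𝓝 x, H (φ y) = φ (G y)) {s : ℕ}
    (hs : analyticOrderAt (fun y => G y - y) x = s) :
    analyticOrderAt (fun y => H y - y) (φ x) = s := by
  obtain ⟨v, hv, hvx, -, hlim⟩ :=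
    tendsto_div_pow_of_analyticOrderAt_eq (hG.sub analyticAt_id) hs
  have h1 := tendsto_comp_sub_div_pow hφ hG.continuousAt hGx hlim
  have h2 : analyticOrderAt (fun y => φ (G y) - φ y) x = s :=
    analyticOrderAt_eq_of_tendsto ((AnalyticAt.fun_comp (by rwa [hGx]) hG).sub hφ)
      (mul_ne_zero hφ' hvx) h1
  rw [← h2, ← analyticOrderAt_comp_of_deriv_ne_zero (f := fun y => H y - y) hφ hφ']
  refine analyticOrderAt_congr ?_
  filter_upwards [hconj] with y hy
  simp [hy]

/-- The multiplicities of a fixed point of `g`, as a fixed point of the iterates of `g`. They jump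
only along the multiples of the order `r` of the multiplier in the group of roots of unity. -/
theorem exists_analyticOrderAt_iterate_sub_id_eq {g : ℂ → ℂ} {x : ℂ} (hg : AnalyticAt ℂ g x)
    (hgx : g x = x) {N : ℕ} (hN : N ≠ 0)
    (hne : ∀ j, j ∣ N → analyticOrderAt (fun y => g^[j] y - y) x ≠ ⊤) :
    ∃ r e : ℕ, r ∣ e ∧ (deriv g x = 0 → e = 0) ∧ ∀ j, j ∣ N →
      analyticOrderAt (fun y => g^[j] y - y) x = ((1 + e * if r ∣ j then 1 else 0 : ℕ) : ℕ∞) := by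
  have hsimple : ∀ j, deriv g x ^ j ≠ 1 → analyticOrderAt (fun y => g^[j] y - y) x = 1 := by
    intro j hj
    exact analyticOrderAt_sub_id_eq_one (analyticAt_iterate hg hgx j)
      (Function.iterate_fixed hgx j) (by rwa [deriv_iterate hg hgx])
  -- If no `g^j` with `j ∣ N` is tangent to the identity, then `x` is a simple fixed point of all of
  -- them. Otherwise `g^r` is the first one, where `r` is the order of the multiplier.
  by_cases h : orderOf (deriv g x) ∣ N
  · set r := orderOf (deriv g x) with hr
    have hr0 : r ≠ 0 := fun h0 => hN (zero_dvd_iff.1 (h0 ▸ h))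
    have hr1 : deriv g x ^ r = 1 := pow_orderOf_eq_one _
    obtain ⟨s, hs⟩ := ENat.ne_top_iff_exists.1 (hne r h)
    have hGa := analyticAt_iterate hg hgx r
    have hGx : g^[r] x = x := Function.iterate_fixed hgx r
    have hs0 : s ≠ 0 := by
      rintro rfl
      rw [Nat.cast_zero, eq_comm, AnalyticAt.analyticOrderAt_eq_zero (f := fun y => g^[r] y - y)
        (hGa.sub analyticAt_id)] at hs
      exact hs (by simp [hGx])
    have hpow : deriv g x ^ s = deriv g x := deriv_pow_eq_of_commute hg hgx hGa hGx
      (Eventually.of_forall fun y =>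
        (Function.iterate_succ_apply' g r y).symm.trans (Function.iterate_succ_apply g r y)) hs.symm
    have hd0 : deriv g x ≠ 0 := by
      intro h0
      rw [h0, zero_pow hr0] at hr1
      exact zero_ne_one hr1
    refine ⟨r, s - 1, ?_, fun h0 => absurd h0 hd0, fun j hj => ?_⟩
    · apply orderOf_dvd_of_pow_eq_one
      have : deriv g x ^ (s - 1) * deriv g x = 1 * deriv g x := by
        rw [← pow_succ, Nat.sub_add_cancel (Nat.pos_of_ne_zero hs0), hpow, one_mul]
      exact mul_right_cancel₀ hd0 this
    · by_cases hrj : r ∣ j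
      · have hj0 : j ≠ 0 := ne_zero_of_dvd_ne_zero hN hj
        obtain ⟨i, rfl⟩ := hrj
        rw [if_pos (dvd_mul_right _ _), Function.iterate_mul,
          analyticOrderAt_iterate_sub_id hGa hGx (by rw [deriv_iterate hg hgx, hr1]) hs.symm
            (right_ne_zero_of_mul hj0)]
        congr 1
        omega
      · rw [if_neg hrj, hsimple j fun h1 => hrj (orderOf_dvd_of_pow_eq_one h1)]
        simp
  · refine ⟨1, 0, one_dvd _, fun _ => rfl, fun j hj => ?_⟩
    rw [hsimple j fun h1 => h ((orderOf_dvd_of_pow_eq_one h1).trans hj)]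
    simp

end FixedPointMultiplicity

/-! ### Möbius sums -/

section Moebius

open ArithmeticFunction in
theorem sum_moebius_dvd {n l : ℕ} (hn : n ≠ 0) :
    ∑ m ∈ n.divisors, moebius (n / m) * (if l ∣ m then 1 else 0) = if n = l then 1 else 0 := by
  by_cases hl : l ∣ n
  · obtain ⟨q, rfl⟩ := hl
    have hl0 : l ≠ 0 := left_ne_zero_of_mul hn
    have hq0 : q ≠ 0 := right_ne_zero_of_mul hn
    have h1 : ∑ m ∈ q.divisors, moebius (q / m) = if q = 1 then 1 else 0 := by
      rw [Nat.sum_div_divisors q (fun m => moebius m), ← coe_mul_zeta_apply, moebius_mul_coe_zeta,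
        one_apply]
    have h2 : (l * q = l) ↔ q = 1 := by
      rw [Nat.mul_eq_left hl0]
    simp only [h2, ← h1, mul_ite, mul_one, mul_zero]
    rw [← Finset.sum_filter]
    refine Finset.sum_nbij' (fun m => m / l) (fun m => l * m) ?_ ?_ ?_ ?_ ?_
    · rintro m hm
      obtain ⟨hm1, c, rfl⟩ := Finset.mem_filter.1 hm
      rw [Nat.mul_div_cancel_left c (Nat.pos_of_ne_zero hl0), Nat.mem_divisors]
      exact ⟨Nat.dvd_of_mul_dvd_mul_left (Nat.pos_of_ne_zero hl0) (Nat.dvd_of_mem_divisors hm1), hq0⟩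
    · intro m hm
      rw [Finset.mem_filter, Nat.mem_divisors]
      exact ⟨⟨Nat.mul_dvd_mul_left l (Nat.dvd_of_mem_divisors hm), hn⟩, dvd_mul_right _ _⟩
    · rintro m hm
      exact Nat.mul_div_cancel' (Finset.mem_filter.1 hm).2
    · intro m hm
      exact Nat.mul_div_cancel_left m (Nat.pos_of_ne_zero hl0)
    · rintro m hm
      obtain ⟨hm1, c, rfl⟩ := Finset.mem_filter.1 hm
      rw [Nat.mul_div_cancel_left c (Nat.pos_of_ne_zero hl0),
        Nat.mul_div_mul_left _ _ (Nat.pos_of_ne_zero hl0)]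
  · have h1 : n ≠ l := by rintro rfl; exact hl dvd_rfl
    rw [if_neg h1]
    refine Finset.sum_eq_zero fun m hm => ?_
    rw [if_neg fun h => hl (h.trans (Nat.dvd_of_mem_divisors hm)), mul_zero]

open ArithmeticFunction in
/-- Möbius inversion for the multiplicities of a point of period `l` under the iterates, when they jump
by `e` along the multiples of `p`. -/
theorem sum_moebius_mul_of_eq {n l p : ℕ} (hn : n ≠ 0) {e : ℕ} {a : ℕ → ℕ}
    (ha : ∀ m ∈ n.divisors, a m = (if l ∣ m then 1 else 0) + e * (if p ∣ m then 1 else 0)) :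
    ∑ m ∈ n.divisors, moebius (n / m) * (a m : ℤ) =
      (if n = l then 1 else 0) + e * (if n = p then 1 else 0) := by
  rw [← sum_moebius_dvd hn, ← sum_moebius_dvd (l := p) hn, Finset.mul_sum, ← Finset.sum_add_distrib]
  refine Finset.sum_congr rfl fun m hm => ?_
  rw [ha m hm]
  push_cast
  ring

end Moebius

/-! ### Coordinates on the Riemann sphere -/

section Coordinates

/-- A parametrization of the complement of `a` in the Riemann sphere by `ℂ`. -/
noncomputable def par (a ζ : ℂ) : OnePoint ℂ := proj ![a * ζ + 1, ζ]

/-- The coordinate `1 / (z - a)` on the Riemann sphere, inverse to `par a`. Its value at `a` is `0`. -/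
noncomputable def coord (a : ℂ) (z : OnePoint ℂ) : ℂ := z.elim 0 fun w => (w - a)⁻¹

theorem proj_eq_coe_iff {p : Fin 2 → ℂ} (hp : p ≠ 0) {a : ℂ} :
    proj p = (a : OnePoint ℂ) ↔ p 0 - a * p 1 = 0 := by
  by_cases h1 : p 1 = 0
  · have h0 : p 0 ≠ 0 := fun h0 => hp (by ext i; fin_cases i <;> simp [h0, h1])
    simp [proj, h1, h0]
  · simp only [proj, h1, if_false, OnePoint.coe_eq_coe]
    rw [div_eq_iff h1, sub_eq_zero]

theorem coord_proj (p : Fin 2 → ℂ) (a : ℂ) :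
    coord a (proj p) = p 1 / (p 0 - a * p 1) := by
  by_cases h1 : p 1 = 0
  · simp [proj, h1, coord]
  · have : coord a (proj p) = (p 0 / p 1 - a)⁻¹ := by simp [proj, h1, coord]
    have h2 : p 0 / p 1 - a = (p 0 - a * p 1) / p 1 := by field_simp
    rw [this, h2, inv_div]

theorem lineVec_ne_zero (a ζ : ℂ) : (![a * ζ + 1, ζ] : Fin 2 → ℂ) ≠ 0 := by
  intro h
  have h1 : ζ = 0 := congrFun h 1
  have h0 : a * ζ + 1 = 0 := congrFun h 0
  rw [h1, mul_zero, zero_add] at h0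
  exact one_ne_zero h0

@[simp] theorem coord_par (a ζ : ℂ) : coord a (par a ζ) = ζ := by
  rw [par, coord_proj]; simp

theorem par_ne (a ζ : ℂ) : par a ζ ≠ (a : OnePoint ℂ) := by
  rw [par, Ne, proj_eq_coe_iff (lineVec_ne_zero a ζ)]
  simp

theorem par_coord {a : ℂ} {z : OnePoint ℂ} (hz : z ≠ a) : par a (coord a z) = z := by
  induction z using OnePoint.rec with
  | infty => simp [par, proj, coord]
  | coe w =>
    have hw : w - a ≠ 0 := sub_ne_zero.2 fun h => hz (by rw [h])
    have : coord a (w : OnePoint ℂ) = (w - a)⁻¹ := rfl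
    rw [this, par, proj]
    simp only [Matrix.cons_val_zero, Matrix.cons_val_one, inv_eq_zero, hw, if_false,
      OnePoint.coe_eq_coe]
    field_simp
    ring

theorem coord_injOn {a : ℂ} {z z' : OnePoint ℂ} (hz : z ≠ a) (hz' : z' ≠ a)
    (h : coord a z = coord a z') : z = z' := by
  rw [← par_coord hz, h, par_coord hz']

theorem affineChart_mem_maximalAtlas :
    affineChart ∈ IsManifold.maximalAtlas 𝓘(ℂ, ℂ) ω (OnePoint ℂ) :=
  IsManifold.subset_maximalAtlas (Or.inl rfl)

theorem infinityChart_mem_maximalAtlas :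
    infinityChart ∈ IsManifold.maximalAtlas 𝓘(ℂ, ℂ) ω (OnePoint ℂ) :=
  IsManifold.subset_maximalAtlas (Or.inr rfl)

theorem contMDiff_coe : ContMDiff 𝓘(ℂ, ℂ) 𝓘(ℂ, ℂ) ω ((↑) : ℂ → OnePoint ℂ) := fun w => by
  have h := contMDiffAt_symm_of_mem_maximalAtlas affineChart_mem_maximalAtlas
    (x := w) (by simp [affineChart])
  exact h

theorem contMDiff_sphereInv_coe :
    ContMDiff 𝓘(ℂ, ℂ) 𝓘(ℂ, ℂ) ω (fun w : ℂ => sphereInv (w : OnePoint ℂ)) := fun w => by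
  have h := contMDiffAt_symm_of_mem_maximalAtlas infinityChart_mem_maximalAtlas
    (x := w) (by simp [infinityChart, affineChart])
  exact h

theorem contMDiff_par (a : ℂ) : ContMDiff 𝓘(ℂ, ℂ) 𝓘(ℂ, ℂ) ω (par a) := by
  intro ζ
  by_cases hζ : ζ = 0
  · subst hζ
    have h1 : ContDiffAt ℂ ω (fun ζ : ℂ => ζ / (a * ζ + 1)) 0 :=
      contDiffAt_id.div ((contDiffAt_const.mul contDiffAt_id).add contDiffAt_const) (by simp)
    refine ((contMDiff_sphereInv_coe _).comp (0 : ℂ) h1.contMDiffAt).congr_of_eventuallyEq ?_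
    have h2 : ∀ᶠ ζ : ℂ in 𝓝 0, a * ζ + 1 ≠ 0 :=
      ContinuousAt.eventually_ne (by fun_prop) (by simp)
    filter_upwards [h2] with ζ hζ
    by_cases h0 : ζ = 0
    · simp [par, proj, h0, sphereInv_zero]
    · simp only [Function.comp]
      rw [sphereInv_coe (div_ne_zero h0 hζ)]
      simp [par, proj, h0]
  · have h1 : ContDiffAt ℂ ω (fun ζ : ℂ => (a * ζ + 1) / ζ) ζ :=
      ((contDiffAt_const.mul contDiffAt_id).add contDiffAt_const).div contDiffAt_id hζ
    refine ((contMDiff_coe _).comp ζ h1.contMDiffAt).congr_of_eventuallyEq ?_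
    filter_upwards [isOpen_ne.mem_nhds hζ] with ζ hζ
    have hζ' : ζ ≠ 0 := hζ
    simp [par, proj, hζ']

theorem contMDiffAt_coord {a : ℂ} {z : OnePoint ℂ} (hz : z ≠ a) :
    ContMDiffAt 𝓘(ℂ, ℂ) 𝓘(ℂ, ℂ) ω (coord a) z := by
  induction z using OnePoint.rec with
  | infty =>
    have hs : (OnePoint.infty : OnePoint ℂ) ∈ infinityChart.source := by
      rw [mem_infinityChart_source, sphereInv_infty]; exact OnePoint.coe_ne_infty 0
    have h0 : infinityChart OnePoint.infty = 0 := by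
      rw [infinityChart_apply, sphereInv_infty, affineChart_coe]
    have h1 : ContDiffAt ℂ ω (fun u : ℂ => u / (1 - a * u)) 0 :=
      contDiffAt_id.div (contDiffAt_const.sub (contDiffAt_const.mul contDiffAt_id)) (by simp)
    have h2 := contMDiffAt_of_mem_maximalAtlas infinityChart_mem_maximalAtlas hs
    refine (ContMDiffAt.comp_of_eq h1.contMDiffAt h2 h0).congr_of_eventuallyEq ?_
    filter_upwards [infinityChart.open_source.mem_nhds hs] with z hz
    simp only [Function.comp]
    induction z using OnePoint.rec with
    | infty => simp [coord, h0]
    | coe w =>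
      have hw : w ≠ 0 := by
        rintro rfl
        exact (mem_infinityChart_source.1 hz) sphereInv_zero
      rw [infinityChart_apply, sphereInv_coe hw, affineChart_coe]
      change (w - a)⁻¹ = _
      have : (1 : ℂ) - a * w⁻¹ = (w - a) * w⁻¹ := by field_simp
      rw [this, div_mul_eq_div_div, div_right_comm, div_self (inv_ne_zero hw), one_div]
  | coe w =>
    have hs : (w : OnePoint ℂ) ∈ affineChart.source :=
      mem_affineChart_source.2 (OnePoint.coe_ne_infty w)
    have hw : w - a ≠ 0 := sub_ne_zero.2 fun h => hz (by rw [h])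
    have h1 : ContDiffAt ℂ ω (fun u : ℂ => (u - a)⁻¹) w :=
      (contDiffAt_id.sub contDiffAt_const).inv hw
    have h2 := contMDiffAt_of_mem_maximalAtlas affineChart_mem_maximalAtlas hs
    refine (ContMDiffAt.comp_of_eq h1.contMDiffAt h2 (affineChart_coe w)).congr_of_eventuallyEq ?_
    filter_upwards [affineChart.open_source.mem_nhds hs] with z hz
    obtain ⟨u, rfl⟩ := OnePoint.ne_infty_iff_exists.1 (mem_affineChart_source.1 hz)
    simp [coord, affineChart_coe]

/-- A self-map `g` of the sphere, in the coordinate `1 / (z - a)`. -/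
noncomputable def inCoord (a : ℂ) (g : OnePoint ℂ → OnePoint ℂ) (ζ : ℂ) : ℂ := coord a (g (par a ζ))

theorem analyticAt_inCoord {a ζ : ℂ} {g : OnePoint ℂ → OnePoint ℂ}
    (hg : ContMDiffAt 𝓘(ℂ, ℂ) 𝓘(ℂ, ℂ) ω g (par a ζ)) (h : g (par a ζ) ≠ a) :
    AnalyticAt ℂ (inCoord a g) ζ := by
  have h1 := ContMDiffAt.comp ζ (contMDiffAt_coord h) (hg.comp ζ (contMDiff_par a ζ))
  exact (contMDiffAt_iff_contDiffAt.1 h1).analyticAt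

/-- A chart of the sphere is a local coordinate, comparable to `coord a`. -/
theorem exists_transition {χ : OpenPartialHomeomorph (OnePoint ℂ) ℂ}
    (hχ : χ ∈ IsManifold.maximalAtlas 𝓘(ℂ, ℂ) ω (OnePoint ℂ)) {a : ℂ} {z : OnePoint ℂ}
    (hz : z ≠ a) (hzχ : z ∈ χ.source) :
    AnalyticAt ℂ (fun u => coord a (χ.symm u)) (χ z) ∧
    AnalyticAt ℂ (fun ζ => χ (par a ζ)) (coord a z) ∧
    deriv (fun u => coord a (χ.symm u)) (χ z) * deriv (fun ζ => χ (par a ζ)) (coord a z) = 1 := by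
  have h1 : AnalyticAt ℂ (fun u => coord a (χ.symm u)) (χ z) := by
    have h2 := contMDiffAt_symm_of_mem_maximalAtlas hχ (χ.map_source hzχ)
    have h3 := ContMDiffAt.comp_of_eq (f := χ.symm) (contMDiffAt_coord hz) h2 (χ.left_inv hzχ)
    exact (contMDiffAt_iff_contDiffAt.1 h3).analyticAt
  have h2 : AnalyticAt ℂ (fun ζ => χ (par a ζ)) (coord a z) := by
    have h3 := contMDiffAt_of_mem_maximalAtlas hχ hzχ
    have h4 := ContMDiffAt.comp_of_eq (f := par a) h3 (contMDiff_par a (coord a z)) (par_coord hz)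
    exact (contMDiffAt_iff_contDiffAt.1 h4).analyticAt
  refine ⟨h1, h2, ?_⟩
  have hχz : χ (par a (coord a z)) = χ z := by rw [par_coord hz]
  have h3 : HasDerivAt (fun ζ => coord a (χ.symm (χ (par a ζ))))
      (deriv (fun u => coord a (χ.symm u)) (χ z) * deriv (fun ζ => χ (par a ζ)) (coord a z))
      (coord a z) := by
    have h4 := h1.differentiableAt.hasDerivAt
    rw [← hχz] at h4
    have := HasDerivAt.comp (coord a z) h4 h2.differentiableAt.hasDerivAt
    rwa [hχz] at this
  have h4 : (fun ζ => coord a (χ.symm (χ (par a ζ)))) =ᶠ[𝓝 (coord a z)] fun ζ => ζ := by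
    have h5 : Tendsto (par a) (𝓝 (coord a z)) (𝓝 z) := by
      have := (contMDiff_par a (coord a z)).continuousAt.tendsto
      rwa [par_coord hz] at this
    filter_upwards [h5.eventually (χ.open_source.mem_nhds hzχ)] with ζ hζ
    rw [χ.left_inv hζ, coord_par]
  exact (h3.congr_of_eventuallyEq h4.symm).unique (hasDerivAt_id (coord a z))

theorem inCoord_eventuallyEq {χ χ' : OpenPartialHomeomorph (OnePoint ℂ) ℂ} {a : ℂ}
    {z : OnePoint ℂ} (hz : z ≠ a) (hzχ : z ∈ χ.source) {g : OnePoint ℂ → OnePoint ℂ}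
    (hg : ContinuousAt g z) (hgχ' : g z ∈ χ'.source) :
    inCoord a g =ᶠ[𝓝 (coord a z)] fun ζ =>
      coord a (χ'.symm (χ' (g (χ.symm (χ (par a ζ)))))) := by
  have h5 : Tendsto (par a) (𝓝 (coord a z)) (𝓝 z) := by
    have := (contMDiff_par a (coord a z)).continuousAt.tendsto
    rwa [par_coord hz] at this
  filter_upwards [h5.eventually (χ.open_source.mem_nhds hzχ),
    (hg.tendsto.comp h5).eventually (χ'.open_source.mem_nhds hgχ')] with ζ h1 h2
  have h2' : g (par a ζ) ∈ χ'.source := h2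
  rw [χ.left_inv h1, χ'.left_inv h2']
  rfl

theorem chart_mem_maximalAtlas_sphere (z : OnePoint ℂ) :
    chartAt ℂ z ∈ IsManifold.maximalAtlas 𝓘(ℂ, ℂ) ω (OnePoint ℂ) :=
  IsManifold.chart_mem_maximalAtlas z

theorem analyticAt_chart {g : OnePoint ℂ → OnePoint ℂ} {z : OnePoint ℂ}
    (hg : ContMDiffAt 𝓘(ℂ, ℂ) 𝓘(ℂ, ℂ) ω g z) :
    AnalyticAt ℂ (fun u => chartAt ℂ (g z) (g ((chartAt ℂ z).symm u))) (chartAt ℂ z z) := by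
  have h1 := contMDiffAt_symm_of_mem_maximalAtlas (chart_mem_maximalAtlas_sphere z)
    ((chartAt ℂ z).map_source (mem_chart_source ℂ z))
  have h2 := ContMDiffAt.comp_of_eq (f := (chartAt ℂ z).symm) hg h1
    ((chartAt ℂ z).left_inv (mem_chart_source ℂ z))
  have h3 := contMDiffAt_of_mem_maximalAtlas (chart_mem_maximalAtlas_sphere (g z))
    (mem_chart_source ℂ (g z))
  have h4 := ContMDiffAt.comp_of_eq (f := g ∘ (chartAt ℂ z).symm) h3 h2 (by
    simp [(chartAt ℂ z).left_inv (mem_chart_source ℂ z)])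
  exact (contMDiffAt_iff_contDiffAt.1 h4).analyticAt

/-- The multiplier of a fixed point does not depend on the coordinate. -/
theorem chartDeriv_eq {g : OnePoint ℂ → OnePoint ℂ} {z : OnePoint ℂ} {a : ℂ} (hz : z ≠ a)
    (hg : ContMDiffAt 𝓘(ℂ, ℂ) 𝓘(ℂ, ℂ) ω g z) (hgz : g z = z) :
    chartDeriv g z = deriv (inCoord a g) (coord a z) := by
  set χ := chartAt ℂ z with hχ
  have hs : z ∈ χ.source := mem_chart_source ℂ z
  obtain ⟨h1, h2, h3⟩ := exists_transition (chart_mem_maximalAtlas_sphere z) hz hs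
  have h4 := analyticAt_chart hg
  rw [hgz] at h4
  rw [(inCoord_eventuallyEq hz hs hg.continuousAt (χ' := χ) (by rwa [hgz])).deriv_eq]
  have hW : chartDeriv g z = deriv (fun u => χ (g (χ.symm u))) (χ z) := by
    simp only [chartDeriv, writtenInExtChartAt, hgz]
    rfl
  have e1 : χ (par a (coord a z)) = χ z := by rw [par_coord hz]
  have e2 : χ (g (χ.symm (χ (par a (coord a z))))) = χ z := by rw [e1, χ.left_inv hs, hgz]
  have d2 := h2.differentiableAt.hasDerivAt
  have d4 := h4.differentiableAt.hasDerivAt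
  have d1 := h1.differentiableAt.hasDerivAt
  have d24 : HasDerivAt (fun ζ => χ (g (χ.symm (χ (par a ζ)))))
      (deriv (fun u => χ (g (χ.symm u))) (χ z) * deriv (fun ζ => χ (par a ζ)) (coord a z))
      (coord a z) := HasDerivAt.comp_of_eq (coord a z) d4 d2 e1.symm
  have d := HasDerivAt.comp_of_eq (coord a z) d1 d24 e2.symm
  have := d.deriv
  simp only [Function.comp_def] at this
  rw [this, hW]
  linear_combination (-(deriv (fun u => χ (g (χ.symm u))) (χ z))) * h3

/-- The order of vanishing of a derivative is invariant under changes of coordinates in the source and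
in the target. -/
theorem analyticOrderAt_deriv_comp {U W V : ℂ → ℂ} {x : ℂ} (hV : AnalyticAt ℂ V x)
    (hV' : deriv V x ≠ 0) (hW : AnalyticAt ℂ W (V x)) (hU : AnalyticAt ℂ U (W (V x)))
    (hU' : deriv U (W (V x)) ≠ 0) :
    analyticOrderAt (deriv fun y => U (W (V y))) x = analyticOrderAt (deriv W) (V x) := by
  have hWV : AnalyticAt ℂ (fun y => W (V y)) x := hW.fun_comp hV
  have h1 : (deriv fun y => U (W (V y))) =ᶠ[𝓝 x]
      (fun y => deriv U (W (V y))) * ((fun y => deriv W (V y)) * deriv V) := by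
    have e1 := hV.eventually_analyticAt
    have e2 := hV.continuousAt.eventually hW.eventually_analyticAt
    have e3 := hWV.continuousAt.eventually hU.eventually_analyticAt
    filter_upwards [e1, e2, e3] with y h1 h2 h3
    have d1 := h1.differentiableAt.hasDerivAt
    have d2 := HasDerivAt.comp y h2.differentiableAt.hasDerivAt d1
    have d3 := HasDerivAt.comp y (h₂ := U) h3.differentiableAt.hasDerivAt d2
    exact d3.deriv
  rw [analyticOrderAt_congr h1]
  have a1 : AnalyticAt ℂ (fun y => deriv U (W (V y))) x := AnalyticAt.fun_comp hU.deriv hWV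
  have a2 : AnalyticAt ℂ (fun y => deriv W (V y)) x := AnalyticAt.fun_comp hW.deriv hV
  rw [analyticOrderAt_mul a1 (a2.mul hV.deriv), analyticOrderAt_mul a2 hV.deriv,
    a1.analyticOrderAt_eq_zero.2 hU', hV.deriv.analyticOrderAt_eq_zero.2 hV', zero_add, add_zero]
  exact analyticOrderAt_comp_of_deriv_ne_zero (f := deriv W) hV hV'

/-- The critical multiplicity does not depend on the coordinates. -/
theorem criticalMultiplicity_eq {g : OnePoint ℂ → OnePoint ℂ} {z : OnePoint ℂ} {a : ℂ}
    (hz : z ≠ a) (hg : ContMDiffAt 𝓘(ℂ, ℂ) 𝓘(ℂ, ℂ) ω g z) (hgz : g z ≠ a) :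
    criticalMultiplicity g z = analyticOrderAt (deriv (inCoord a g)) (coord a z) := by
  set χ := chartAt ℂ z with hχ
  set χ' := chartAt ℂ (g z) with hχ'
  have hs : z ∈ χ.source := mem_chart_source ℂ z
  have hs' : g z ∈ χ'.source := mem_chart_source ℂ (g z)
  obtain ⟨h1, h2, h3⟩ := exists_transition (chart_mem_maximalAtlas_sphere z) hz hs
  obtain ⟨h1', h2', h3'⟩ := exists_transition (chart_mem_maximalAtlas_sphere (g z)) hgz hs'
  have h4 := analyticAt_chart hg
  rw [analyticOrderAt_congr (inCoord_eventuallyEq hz hs hg.continuousAt hs').deriv]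
  have e1 : χ (par a (coord a z)) = χ z := by rw [par_coord hz]
  have e2 : χ' (g (χ.symm (χ (par a (coord a z))))) = χ' (g z) := by rw [e1, χ.left_inv hs]
  have key := analyticOrderAt_deriv_comp (U := fun u => coord a (χ'.symm u))
    (W := fun u => χ' (g (χ.symm u))) (V := fun ζ => χ (par a ζ)) (x := coord a z) h2
    (right_ne_zero_of_mul_eq_one h3) (by simp only [e1]; exact h4) (by simp only [e2]; exact h1')
    (by simp only [e2]; exact left_ne_zero_of_mul_eq_one h3')
  rw [key]
  simp only [e1]
  rfl

end Coordinates

/-! ### Binary forms -/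

section BinaryForms

open MvPolynomial

theorem isHomogeneous_degree_eq {H : MvPolynomial (Fin 2) ℂ} {N : ℕ} (hH : H.IsHomogeneous N)
    {s : Fin 2 →₀ ℕ} (hs : s ∈ H.support) : s 0 + s 1 = N := by
  have h := hH (mem_support_iff.1 hs)
  rw [Finsupp.weight_apply, Finsupp.sum_fintype _ _ (by simp)] at h
  simpa using h

theorem eval_eq_sum (H : MvPolynomial (Fin 2) ℂ) (p : Fin 2 → ℂ) :
    eval p H = ∑ s ∈ H.support, H.coeff s * (p 0 ^ s 0 * p 1 ^ s 1) := by
  rw [eval_eq']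
  simp

theorem isHomogeneous_eval_smul {H : MvPolynomial (Fin 2) ℂ} {N : ℕ} (hH : H.IsHomogeneous N)
    (c : ℂ) (p : Fin 2 → ℂ) : eval (c • p) H = c ^ N * eval p H := by
  rw [eval_eq_sum, eval_eq_sum, Finset.mul_sum]
  refine Finset.sum_congr rfl fun s hs => ?_
  rw [← isHomogeneous_degree_eq hH hs, pow_add]
  simp only [Pi.smul_apply, smul_eq_mul, mul_pow]
  ring

/-- The restriction of a binary form to the affine line `ζ ↦ (a ζ + 1, ζ)`. -/
noncomputable def restr (a : ℂ) : MvPolynomial (Fin 2) ℂ →ₐ[ℂ] Polynomial ℂ :=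
  aeval ![Polynomial.C a * Polynomial.X + 1, Polynomial.X]

theorem eval_restr (a ζ : ℂ) (H : MvPolynomial (Fin 2) ℂ) :
    (restr a H).eval ζ = eval ![a * ζ + 1, ζ] H := by
  induction H using MvPolynomial.induction_on with
  | C c => simp [restr]
  | add p q hp hq => rw [map_add, Polynomial.eval_add, hp, hq, map_add]
  | mul_X p i hp =>
    rw [map_mul, Polynomial.eval_mul, hp, map_mul]
    congr 1
    fin_cases i <;> simp [restr]

theorem restr_eq_sum (a : ℂ) (H : MvPolynomial (Fin 2) ℂ) :
    restr a H = ∑ s ∈ H.support, Polynomial.C (H.coeff s) *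
      ((Polynomial.C a * Polynomial.X + 1) ^ s 0 * Polynomial.X ^ s 1) := by
  refine Polynomial.funext fun ζ => ?_
  rw [eval_restr, eval_eq_sum, Polynomial.eval_finsetSum]
  simp

theorem natDegree_restr_le {H : MvPolynomial (Fin 2) ℂ} {N : ℕ} (hH : H.IsHomogeneous N) (a : ℂ) :
    (restr a H).natDegree ≤ N := by
  rw [restr_eq_sum]
  refine Polynomial.natDegree_sum_le_of_forall_le _ _ fun s hs => ?_
  rw [← isHomogeneous_degree_eq hH hs]
  compute_degree

theorem coeff_restr {H : MvPolynomial (Fin 2) ℂ} {N : ℕ} (hH : H.IsHomogeneous N) (a : ℂ) :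
    (restr a H).coeff N = eval ![a, 1] H := by
  rw [restr_eq_sum, eval_eq_sum, Polynomial.finsetSum_coeff]
  refine Finset.sum_congr rfl fun s hs => ?_
  rw [Polynomial.coeff_C_mul, ← isHomogeneous_degree_eq hH hs, Polynomial.coeff_mul_X_pow]
  have h1 : (Polynomial.C a * Polynomial.X + 1 : Polynomial ℂ).natDegree ≤ 1 := by compute_degree
  have h2 := Polynomial.coeff_pow_of_natDegree_le (m := s 0) h1
  rw [mul_one] at h2
  rw [h2]
  simp [Polynomial.coeff_one]

theorem restr_ne_zero {H : MvPolynomial (Fin 2) ℂ} {N : ℕ} (hH : H.IsHomogeneous N) {a : ℂ}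
    (ha : eval ![a, 1] H ≠ 0) : restr a H ≠ 0 := by
  intro h0
  rw [← coeff_restr hH, h0] at ha
  exact ha rfl

theorem card_roots_restr {H : MvPolynomial (Fin 2) ℂ} {N : ℕ} (hH : H.IsHomogeneous N) {a : ℂ}
    (ha : eval ![a, 1] H ≠ 0) : (restr a H).roots.card = N := by
  rw [IsAlgClosed.card_roots_eq_natDegree]
  refine le_antisymm (natDegree_restr_le hH a) (Polynomial.le_natDegree_of_ne_zero ?_)
  rwa [coeff_restr hH]

theorem eval_wedgeForm (p q : Fin 2 → ℂ) : eval p (wedgeForm q) = p 0 * q 1 - p 1 * q 0 := by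
  simp [wedgeForm]

/-- A binary form is a product of linear forms. -/
theorem eq_prod_wedgeForm {H : MvPolynomial (Fin 2) ℂ} {N : ℕ} (hH : H.IsHomogeneous N) {a : ℂ}
    (ha : eval ![a, 1] H ≠ 0) :
    H = C (eval ![a, 1] H) *
      ((restr a H).roots.map fun ζ => -wedgeForm ![a * ζ + 1, ζ]).prod := by
  have hcard := card_roots_restr hH ha
  set c := eval ![a, 1] H with hc
  have hlead : (restr a H).leadingCoeff = c := by
    rw [Polynomial.leadingCoeff, ← IsAlgClosed.card_roots_eq_natDegree, hcard, coeff_restr hH]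
  have hfac : ∀ ζ : ℂ, eval ![a * ζ + 1, ζ] H = c * ((restr a H).roots.map (ζ - ·)).prod := by
    intro ζ
    rw [← eval_restr]
    conv_lhs => rw [(IsAlgClosed.splits (restr a H)).eq_prod_roots, hlead]
    rw [Polynomial.eval_mul, Polynomial.eval_C, Polynomial.eval_multiset_prod, Multiset.map_map]
    simp
  refine MvPolynomial.funext fun p => ?_
  rw [map_mul, eval_C, map_multiset_prod, Multiset.map_map]
  have hw : ∀ ζ : ℂ, eval p (-wedgeForm ![a * ζ + 1, ζ]) = p 1 - ζ * (p 0 - a * p 1) := by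
    intro ζ
    rw [map_neg, eval_wedgeForm]
    simp only [Matrix.cons_val_zero, Matrix.cons_val_one]
    ring
  simp only [Function.comp_def, hw]
  -- The points of the line `p 0 = a * p 1` are not multiples of points `(a ζ + 1, ζ)`; there the
  -- equality is the definition of the constant.
  by_cases hu : p 0 - a * p 1 = 0
  · have hp : p = p 1 • ![a, 1] := by
      ext i; fin_cases i
      · simpa [mul_comm, sub_eq_zero] using hu
      · simp
    have h1 : eval p H = p 1 ^ N * c := by
      conv_lhs => rw [hp]
      rw [isHomogeneous_eval_smul hH]
    rw [h1, hu]
    simp [hcard, mul_comm]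
  · set u := p 0 - a * p 1 with hu_def
    have hp : p = u • ![a * (p 1 / u) + 1, p 1 / u] := by
      ext i; fin_cases i
      · simp only [Fin.zero_eta, Pi.smul_apply, Matrix.cons_val_zero, smul_eq_mul]
        field_simp
        rw [hu_def]; ring
      · change p 1 = u * (p 1 / u)
        field_simp
    have h1 : eval p H = u ^ N * (c * ((restr a H).roots.map (p 1 / u - ·)).prod) := by
      conv_lhs => rw [hp]
      rw [isHomogeneous_eval_smul hH, hfac]
    rw [h1, ← hcard]
    have h2 : (restr a H).roots.map (fun ζ => p 1 - ζ * u) =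
        (restr a H).roots.map (fun ζ => u * (p 1 / u - ζ)) :=
      Multiset.map_congr rfl fun ζ _ => by field_simp
    rw [h2, Multiset.prod_map_mul]
    simp only [Multiset.map_const', Multiset.prod_replicate]
    ring

end BinaryForms

/-! ### Homogeneous lifts and fixed points -/

section Lifts

open MvPolynomial

variable {d : ℕ} {F : Fin 2 → MvPolynomial (Fin 2) ℂ} {g : OnePoint ℂ → OnePoint ℂ}

theorem eval_iterLift_succ (F : Fin 2 → MvPolynomial (Fin 2) ℂ) (m : ℕ) (p : Fin 2 → ℂ)
    (i : Fin 2) :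
    eval p (iterLift F (m + 1) i) = eval (fun j => eval p (iterLift F m j)) (F i) := by
  change eval p (bind₁ (iterLift F m) (F i)) = _
  generalize F i = G
  induction G using MvPolynomial.induction_on with
  | C c => simp
  | add p q hp hq => rw [map_add, map_add, hp, hq, map_add]
  | mul_X p i hp => rw [map_mul, map_mul, hp, map_mul, bind₁_X_right, eval_X]

theorem IsLift.iterate (h : IsLift d F g) (m : ℕ) : IsLift (d ^ m) (iterLift F m) g^[m] := by
  induction m with
  | zero =>
    refine ⟨fun i => by simpa [iterLift] using isHomogeneous_X ℂ i, fun p hp => ?_⟩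
    have : (fun i => eval p (iterLift F 0 i)) = p := by ext i; simp [iterLift]
    rw [this]
    exact ⟨hp, rfl⟩
  | succ m ih =>
    refine ⟨fun i => ?_, fun p hp => ?_⟩
    · rw [pow_succ]
      exact (h.1 i).aeval (iterLift F m) ih.1
    · obtain ⟨h1, h2⟩ := ih.2 p hp
      obtain ⟨h3, h4⟩ := h.2 _ h1
      have : (fun i => eval p (iterLift F (m + 1) i)) =
          fun i => eval (fun j => eval p (iterLift F m j)) (F i) := by
        ext i; exact eval_iterLift_succ F m p i
      rw [this, Function.iterate_succ_apply', h2]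
      exact ⟨h3, h4⟩

theorem IsLift.isHomogeneous_periodPoly (h : IsLift d F g) (m : ℕ) :
    (periodPoly F m).IsHomogeneous (d ^ m + 1) :=
  (((h.iterate m).1 0).mul (isHomogeneous_X ℂ 1)).sub (((h.iterate m).1 1).mul (isHomogeneous_X ℂ 0))

theorem proj_eq_proj_iff {p q : Fin 2 → ℂ} (hp : p ≠ 0) (hq : q ≠ 0) :
    proj p = proj q ↔ p 0 * q 1 - p 1 * q 0 = 0 := by
  by_cases h1 : q 1 = 0
  · have h0 : q 0 ≠ 0 := fun h0 => hq (by ext i; fin_cases i <;> simp [h0, h1])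
    have h2 : proj q = OnePoint.infty := by simp [proj, h1]
    rw [h2, h1]
    by_cases h3 : p 1 = 0 <;> simp [proj, h3, h0]
  · have h2 : proj q = ((q 0 / q 1 : ℂ) : OnePoint ℂ) := by simp [proj, h1]
    rw [h2, proj_eq_coe_iff hp]
    constructor
    · intro h
      field_simp at h
      linear_combination h
    · intro h
      field_simp
      linear_combination h

theorem IsLift.eval_periodPoly_eq_zero_iff (h : IsLift d F g) (m : ℕ) {p : Fin 2 → ℂ}
    (hp : p ≠ 0) : eval p (periodPoly F m) = 0 ↔ g^[m] (proj p) = proj p := by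
  obtain ⟨h1, h2⟩ := (h.iterate m).2 p hp
  rw [h2, proj_eq_proj_iff h1 hp]
  simp [periodPoly]

theorem proj_vec_one (a : ℂ) : proj ![a, 1] = (a : OnePoint ℂ) := by simp [proj]

theorem vec_one_ne_zero (a : ℂ) : (![a, 1] : Fin 2 → ℂ) ≠ 0 := fun h => one_ne_zero (congrFun h 1)

theorem IsLift.eval_periodPoly_ne_zero (h : IsLift d F g) {m : ℕ} {a : ℂ}
    (ha : g^[m] (a : OnePoint ℂ) ≠ a) : eval ![a, 1] (periodPoly F m) ≠ 0 := by
  rw [Ne, h.eval_periodPoly_eq_zero_iff m (vec_one_ne_zero a), proj_vec_one]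
  exact ha

/-- The fixed points of `g^m`, with multiplicity, in the coordinate `1 / (z - a)`. -/
noncomputable def fixedRoots (F : Fin 2 → MvPolynomial (Fin 2) ℂ) (a : ℂ) (m : ℕ) : Multiset ℂ :=
  (restr a (periodPoly F m)).roots

theorem IsLift.mem_fixedRoots (h : IsLift d F g) {m : ℕ} {a : ℂ}
    (ha : g^[m] (a : OnePoint ℂ) ≠ a) {ζ : ℂ} :
    ζ ∈ fixedRoots F a m ↔ g^[m] (par a ζ) = par a ζ := by
  rw [fixedRoots, Polynomial.mem_roots
    (restr_ne_zero (h.isHomogeneous_periodPoly m) (h.eval_periodPoly_ne_zero ha)),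
    Polynomial.IsRoot, eval_restr, h.eval_periodPoly_eq_zero_iff m (lineVec_ne_zero a ζ)]
  rfl

theorem IsLift.card_fixedRoots (h : IsLift d F g) {m : ℕ} {a : ℂ}
    (ha : g^[m] (a : OnePoint ℂ) ≠ a) : (fixedRoots F a m).card = d ^ m + 1 :=
  card_roots_restr (h.isHomogeneous_periodPoly m) (h.eval_periodPoly_ne_zero ha)

theorem analyticOrderAt_eval {q : Polynomial ℂ} (hq : q ≠ 0) (ζ : ℂ) :
    analyticOrderAt (fun y => q.eval y) ζ = q.roots.count ζ := by
  have h1 : (fun y => q.eval y) = (fun _ => q.leadingCoeff) * fun y => (q.roots.map (y - ·)).prod := by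
    funext y
    conv_lhs => rw [(IsAlgClosed.splits q).eq_prod_roots]
    rw [Polynomial.eval_mul, Polynomial.eval_C, Polynomial.eval_multiset_prod, Multiset.map_map]
    simp
  rw [h1, analyticOrderAt_mul analyticAt_const (analyticAt_multiset_prod_sub _ _),
    analyticOrderAt_multiset_prod_sub, (analyticAt_const).analyticOrderAt_eq_zero.2
      (Polynomial.leadingCoeff_ne_zero.2 hq), zero_add]

/-- The multiplicity of a fixed point is the order of vanishing of `g^m - id`. -/
theorem IsLift.count_fixedRoots (h : IsLift d F g) {m : ℕ} {a : ℂ}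
    (ha : g^[m] (a : OnePoint ℂ) ≠ a) {ζ : ℂ} (hζ : g^[m] (par a ζ) ≠ a) :
    analyticOrderAt (fun y => inCoord a g^[m] y - y) ζ = (fixedRoots F a m).count ζ := by
  set q := restr a (periodPoly F m) with hq
  set s := restr a (iterLift F m 0) - Polynomial.C a * restr a (iterLift F m 1) with hs
  have hlift := (h.iterate m).2 _ (lineVec_ne_zero a ζ)
  have hs0 : s.eval ζ ≠ 0 := by
    intro h0
    apply hζ
    rw [par, hlift.2, proj_eq_coe_iff hlift.1]
    simpa [hs, eval_restr] using h0
  have hfun : (fun y => inCoord a g^[m] y - y) =ᶠ[𝓝 ζ]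
      (fun y => q.eval y) * fun y => -(s.eval y)⁻¹ := by
    have hcont : ContinuousAt (fun y => s.eval y) ζ := s.continuous.continuousAt
    filter_upwards [hcont.eventually_ne hs0] with y hy
    have h1 := (h.iterate m).2 _ (lineVec_ne_zero a y)
    simp only [inCoord, par, h1.2, coord_proj, Pi.mul_apply]
    have e1 : s.eval y = eval ![a * y + 1, y] (iterLift F m 0) -
        a * eval ![a * y + 1, y] (iterLift F m 1) := by simp [hs, eval_restr]
    have e2 : q.eval y = eval ![a * y + 1, y] (iterLift F m 0) * y -
        eval ![a * y + 1, y] (iterLift F m 1) * (a * y + 1) := by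
      rw [hq, eval_restr]; simp [periodPoly]
    rw [← e1, e2]
    field_simp
    rw [e1]
    ring
  have hsa : AnalyticAt ℂ (fun y => -(s.eval y)⁻¹) ζ := ((AnalyticOnNhd.eval_polynomial s ζ trivial).fun_inv hs0).fun_neg
  rw [analyticOrderAt_congr hfun, analyticOrderAt_mul (AnalyticOnNhd.eval_polynomial q ζ trivial) hsa,
    hsa.analyticOrderAt_eq_zero.2 (neg_ne_zero.2 (inv_ne_zero hs0)), add_zero]
  exact analyticOrderAt_eval
    (restr_ne_zero (h.isHomogeneous_periodPoly m) (h.eval_periodPoly_ne_zero ha)) ζ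

/-- A rational map of degree at least two has finitely many finite fixed points. -/
theorem IsLift.finite_fixed (h : IsLift d F g) (hd : 2 ≤ d) :
    {a : ℂ | g (a : OnePoint ℂ) = a}.Finite := by
  set A : Fin 2 → Polynomial ℂ := fun i => aeval ![Polynomial.X, 1] (F i) with hA
  have hAe : ∀ (i : Fin 2) (a : ℂ), (A i).eval a = eval ![a, 1] (F i) := by
    intro i a
    simp only [hA]
    generalize F i = G
    induction G using MvPolynomial.induction_on with
    | C c => simp
    | add p q hp hq => rw [map_add, Polynomial.eval_add, hp, hq, map_add]
    | mul_X p i hp =>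
      rw [map_mul, Polynomial.eval_mul, hp, map_mul]
      congr 1
      fin_cases i <;> simp
  set q := A 0 - Polynomial.X * A 1 with hq
  have hfix : ∀ a : ℂ, g (a : OnePoint ℂ) = a ↔ q.eval a = 0 := by
    intro a
    obtain ⟨h1, h2⟩ := h.2 ![a, 1] (vec_one_ne_zero a)
    rw [← proj_vec_one a, h2, proj_vec_one, proj_eq_coe_iff h1, ← hAe, ← hAe]
    simp [hq]
  -- If each finite point were fixed, then `F 0` and `F 1` would both vanish at `(1, 0)`.
  have hq0 : q ≠ 0 := by
    intro hq0
    have h01 : ∀ a, (A 0).eval a = a * (A 1).eval a := by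
      intro a
      have : q.eval a = 0 := by rw [hq0]; simp
      simpa [hq, sub_eq_zero] using this
    -- A zero of `A 1` would be a common zero of the two components.
    have hconst : (A 1).degree ≤ 0 := by
      by_contra hcon
      obtain ⟨a, ha⟩ := IsAlgClosed.exists_root (A 1) (by
        intro h0; rw [h0] at hcon; exact hcon le_rfl)
      have ha' : (A 1).eval a = 0 := ha
      refine (h.2 ![a, 1] (vec_one_ne_zero a)).1 ?_
      ext i
      fin_cases i
      · simp only [Fin.zero_eta, Pi.zero_apply]; rw [← hAe, h01, ha', mul_zero]
      · simp only [Fin.mk_one, Pi.zero_apply]; rw [← hAe, ha']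
    set c := (A 1).coeff 0 with hc
    have hc1 : ∀ a, (A 1).eval a = c := fun a => by
      rw [Polynomial.eq_C_of_degree_le_zero hconst]; simp [hc]
    have hy : ∀ y : ℂ, y ≠ 0 → eval ![1, y] (F 1) = y ^ d * c ∧
        eval ![1, y] (F 0) = y ^ (d - 1) * c := by
      intro y hy
      have e : (![1, y] : Fin 2 → ℂ) = y • ![y⁻¹, 1] := by
        ext i; fin_cases i <;> simp [hy]
      rw [e, isHomogeneous_eval_smul (h.1 1), isHomogeneous_eval_smul (h.1 0), ← hAe, ← hAe, h01,
        hc1]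
      refine ⟨rfl, ?_⟩
      obtain ⟨k, rfl⟩ : ∃ k, d = k + 1 := ⟨d - 1, by omega⟩
      rw [Nat.add_sub_cancel, pow_succ]
      field_simp
    have hlim : ∀ (i : Fin 2) (k : ℕ), k ≠ 0 → (∀ y : ℂ, y ≠ 0 → eval ![1, y] (F i) = y ^ k * c) →
        eval ![1, 0] (F i) = 0 := by
      intro i k hk hik
      have hcont : Continuous fun y : ℂ => eval ![1, y] (F i) := by
        refine (MvPolynomial.continuous_eval (F i)).comp ?_
        refine continuous_pi fun j => ?_
        fin_cases j
        · exact continuous_const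
        · exact continuous_id
      have h1 : Tendsto (fun y : ℂ => eval ![1, y] (F i)) (𝓝[≠] 0) (𝓝 (eval ![1, 0] (F i))) :=
        (hcont.tendsto 0).mono_left nhdsWithin_le_nhds
      have h2 : Tendsto (fun y : ℂ => y ^ k * c) (𝓝[≠] 0) (𝓝 0) := by
        have : Continuous fun y : ℂ => y ^ k * c := by fun_prop
        have h3 := this.tendsto 0
        rw [zero_pow hk, zero_mul] at h3
        exact h3.mono_left nhdsWithin_le_nhds
      refine tendsto_nhds_unique h1 (h2.congr' ?_)
      filter_upwards [self_mem_nhdsWithin] with y hy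
      exact (hik y hy).symm
    refine (h.2 ![1, 0] (fun h0 => one_ne_zero (congrFun h0 0))).1 ?_
    ext i
    fin_cases i
    · exact hlim 0 (d - 1) (by omega) fun y hy' => (hy y hy').2
    · exact hlim 1 d (by omega) fun y hy' => (hy y hy').1
  refine (q.roots.toFinset.finite_toSet).subset fun a ha => ?_
  rw [Finset.mem_coe, Multiset.mem_toFinset, Polynomial.mem_roots hq0]
  exact (hfix a).1 ha

end Lifts

/-! ### Multiplicities along cycles -/

section Cycles

variable {d : ℕ} {F : Fin 2 → MvPolynomial (Fin 2) ℂ} {g : OnePoint ℂ → OnePoint ℂ}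

theorem contMDiff_iterate (hg : ContMDiff 𝓘(ℂ, ℂ) 𝓘(ℂ, ℂ) ω g) (m : ℕ) :
    ContMDiff 𝓘(ℂ, ℂ) 𝓘(ℂ, ℂ) ω g^[m] := by
  induction m with
  | zero => exact contMDiff_id
  | succ m ih => rw [Function.iterate_succ]; exact ih.comp hg

theorem iterate_ne_of_dvd {X : Type*} {g : X → X} {a : X} {n m : ℕ} (ha : g^[n] a ≠ a)
    (hm : m ∣ n) : g^[m] a ≠ a := fun h =>
  ha (Function.IsPeriodicPt.trans_dvd (f := g) h hm)

theorem iterate_ne_of_isPeriodicPt {X : Type*} {g : X → X} {a z : X} {n : ℕ} (ha : g^[n] a ≠ a)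
    (hz : Function.IsPeriodicPt g n z) (i : ℕ) : g^[i] z ≠ a := by
  rintro rfl
  exact ha (hz.apply_iterate i)

theorem inCoord_comp {a ζ : ℂ} {g₁ g₂ : OnePoint ℂ → OnePoint ℂ} (h : g₂ (par a ζ) ≠ a) :
    inCoord a (g₁ ∘ g₂) ζ = inCoord a g₁ (inCoord a g₂ ζ) := by
  simp only [inCoord, Function.comp, par_coord h]

theorem inCoord_comp_eventually {a ζ : ℂ} {g₁ g₂ : OnePoint ℂ → OnePoint ℂ}
    (hg₂ : Continuous g₂) (h : g₂ (par a ζ) ≠ a) :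
    inCoord a (g₁ ∘ g₂) =ᶠ[𝓝 ζ] fun y => inCoord a g₁ (inCoord a g₂ y) := by
  have hc : Continuous fun y => g₂ (par a y) := hg₂.comp (contMDiff_par a).continuous
  filter_upwards [hc.continuousAt.eventually_ne h] with y hy
  exact inCoord_comp hy

theorem analyticAt_inCoord_iterate (hg : ContMDiff 𝓘(ℂ, ℂ) 𝓘(ℂ, ℂ) ω g) {a ζ : ℂ} {m : ℕ}
    (h : g^[m] (par a ζ) ≠ a) : AnalyticAt ℂ (inCoord a g^[m]) ζ :=
  analyticAt_inCoord (contMDiff_iterate hg m _) h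

theorem inCoord_iterate_eventuallyEq (hg : ContMDiff 𝓘(ℂ, ℂ) 𝓘(ℂ, ℂ) ω g) {a ζ : ℂ}
    (h : g (par a ζ) = par a ζ) (j : ℕ) : inCoord a g^[j] =ᶠ[𝓝 ζ] (inCoord a g)^[j] := by
  induction j with
  | zero => exact Eventually.of_forall fun y => by simp [inCoord]
  | succ j ih =>
    have hne : g (par a ζ) ≠ a := by rw [h]; exact par_ne a ζ
    have h1 := inCoord_comp_eventually (g₁ := g^[j]) hg.continuous hne
    have h2 : Tendsto (inCoord a g) (𝓝 ζ) (𝓝 ζ) := by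
      have := (analyticAt_inCoord (hg _) hne).continuousAt.tendsto
      have e : inCoord a g ζ = ζ := by rw [inCoord, h, coord_par]
      rwa [e] at this
    filter_upwards [h1, h2.eventually ih] with y h3 h4
    rw [Function.iterate_succ, h3, h4, Function.iterate_succ_apply]

/-- The multiplicity of a periodic point as a fixed point of the iterates. -/
theorem IsLift.exists_count_fixedRoots_eq (h : IsLift d F g)
    (hg : ContMDiff 𝓘(ℂ, ℂ) 𝓘(ℂ, ℂ) ω g) {n : ℕ} (hn : n ≠ 0) {a : ℂ}
    (ha : g^[n] (a : OnePoint ℂ) ≠ a) {ζ : ℂ} (hζ : Function.IsPeriodicPt g n (par a ζ)) :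
    ∃ r e : ℕ, r ∣ e ∧ (deriv (inCoord a g^[n]) ζ = 0 → e = 0) ∧ ∀ m ∈ n.divisors,
      (fixedRoots F a m).count ζ = (if Function.minimalPeriod g (par a ζ) ∣ m then 1 else 0) +
        e * (if Function.minimalPeriod g (par a ζ) * r ∣ m then 1 else 0) := by
  set l := Function.minimalPeriod g (par a ζ) with hl
  obtain ⟨N, hN⟩ : l ∣ n := hζ.minimalPeriod_dvd
  have hl0 : l ≠ 0 := left_ne_zero_of_mul (hN ▸ hn)
  have hN0 : N ≠ 0 := right_ne_zero_of_mul (hN ▸ hn)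
  have hlz : g^[l] (par a ζ) = par a ζ := Function.isPeriodicPt_minimalPeriod g (par a ζ)
  set γ := inCoord a g^[l] with hγ
  have hγa : AnalyticAt ℂ γ ζ := analyticAt_inCoord_iterate hg (by rw [hlz]; exact par_ne a ζ)
  have hγζ : γ ζ = ζ := by rw [hγ, inCoord, hlz, coord_par]
  have hiter : ∀ j, inCoord a g^[l * j] =ᶠ[𝓝 ζ] γ^[j] := fun j => by
    rw [Function.iterate_mul]
    exact inCoord_iterate_eventuallyEq (contMDiff_iterate hg l) hlz j
  have hord : ∀ j, j ∣ N →
      analyticOrderAt (fun y => γ^[j] y - y) ζ = (fixedRoots F a (l * j)).count ζ := by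
    intro j hj
    have hdvd : l * j ∣ n := hN ▸ Nat.mul_dvd_mul_left l hj
    have hper : g^[l * j] (par a ζ) = par a ζ :=
      Function.IsPeriodicPt.mul_const (f := g) hlz j
    rw [← h.count_fixedRoots (iterate_ne_of_dvd ha hdvd) (by rw [hper]; exact par_ne a ζ)]
    refine analyticOrderAt_congr ?_
    filter_upwards [hiter j] with y hy
    rw [hy]
  obtain ⟨r, e, hre, he0, hre'⟩ := exists_analyticOrderAt_iterate_sub_id_eq hγa hγζ hN0
    (fun j hj => by rw [hord j hj]; exact ENat.natCast_ne_top _)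
  refine ⟨r, e, hre, fun h0 => he0 ?_, fun m hm => ?_⟩
  · rw [hN, (hiter N).deriv_eq, deriv_iterate hγa hγζ] at h0
    exact pow_eq_zero_iff hN0 |>.1 h0
  · by_cases hlm : l ∣ m
    · obtain ⟨j, rfl⟩ := hlm
      have hj : j ∣ N := Nat.dvd_of_mul_dvd_mul_left (Nat.pos_of_ne_zero hl0)
        (hN ▸ Nat.dvd_of_mem_divisors hm)
      have h1 := (hord j hj).symm.trans (hre' j hj)
      simp only [dvd_mul_right, if_true, Nat.mul_dvd_mul_iff_left (Nat.pos_of_ne_zero hl0)]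
      exact_mod_cast h1
    · rw [if_neg hlm, if_neg fun h1 => hlm ((dvd_mul_right _ _).trans h1), mul_zero, add_zero,
        Multiset.count_eq_zero,
        h.mem_fixedRoots (iterate_ne_of_dvd ha (Nat.dvd_of_mem_divisors hm))]
      exact fun h1 => hlm (Function.IsPeriodicPt.minimalPeriod_dvd (f := g) h1)

/-- The multiplier is constant along a cycle. -/
theorem deriv_inCoord_iterate_apply (hg : ContMDiff 𝓘(ℂ, ℂ) 𝓘(ℂ, ℂ) ω g) {n : ℕ} {a : ℂ}
    (ha : g^[n] (a : OnePoint ℂ) ≠ a) {ζ : ℂ} (hζ : Function.IsPeriodicPt g n (par a ζ)) {m : ℕ}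
    (hm0 : m ≠ 0) (hm : Function.IsPeriodicPt g m (par a ζ)) :
    deriv (inCoord a g^[m]) (inCoord a g ζ) = deriv (inCoord a g^[m]) ζ := by
  obtain ⟨i, rfl⟩ := Nat.exists_eq_succ_of_ne_zero hm0
  have horb := iterate_ne_of_isPeriodicPt ha hζ
  have h1 : g (par a ζ) ≠ a := horb 1
  have hφ : AnalyticAt ℂ (inCoord a g) ζ := analyticAt_inCoord (hg _) h1
  have hpar : par a (inCoord a g ζ) = g (par a ζ) := par_coord h1
  have h2 : g^[i] (par a (inCoord a g ζ)) ≠ a := by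
    rw [hpar, ← Function.iterate_succ_apply]; exact horb (i + 1)
  have hψ : AnalyticAt ℂ (inCoord a g^[i]) (inCoord a g ζ) := analyticAt_inCoord_iterate hg h2
  have hψζ : inCoord a g^[i] (inCoord a g ζ) = ζ := by
    rw [inCoord, hpar, ← Function.iterate_succ_apply, show g^[i.succ] (par a ζ) = par a ζ from hm,
      coord_par]
  have e1 : deriv (inCoord a g^[i.succ]) ζ =
      deriv (inCoord a g^[i]) (inCoord a g ζ) * deriv (inCoord a g) ζ := by
    rw [Function.iterate_succ, (inCoord_comp_eventually hg.continuous h1).deriv_eq]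
    exact (HasDerivAt.comp ζ hψ.differentiableAt.hasDerivAt hφ.differentiableAt.hasDerivAt).deriv
  have e2 : deriv (inCoord a g^[i.succ]) (inCoord a g ζ) =
      deriv (inCoord a g) ζ * deriv (inCoord a g^[i]) (inCoord a g ζ) := by
    rw [Function.iterate_succ',
      (inCoord_comp_eventually (contMDiff_iterate hg i).continuous h2).deriv_eq]
    exact (HasDerivAt.comp_of_eq _ hφ.differentiableAt.hasDerivAt hψ.differentiableAt.hasDerivAt
      hψζ.symm).deriv
  rw [e1, e2, mul_comm]

/-- The multiplicities are constant along a cycle. -/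
theorem IsLift.count_fixedRoots_apply (h : IsLift d F g) (hg : ContMDiff 𝓘(ℂ, ℂ) 𝓘(ℂ, ℂ) ω g)
    {n : ℕ} {a : ℂ} (ha : g^[n] (a : OnePoint ℂ) ≠ a) {ζ : ℂ}
    (hζ : Function.IsPeriodicPt g n (par a ζ)) {m : ℕ} (hm : m ∈ n.divisors) :
    (fixedRoots F a m).count (inCoord a g ζ) = (fixedRoots F a m).count ζ := by
  have hmn := Nat.dvd_of_mem_divisors hm
  have hn0 : n ≠ 0 := (Nat.mem_divisors.1 hm).2
  have hm0 : m ≠ 0 := ne_zero_of_dvd_ne_zero hn0 hmn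
  have horb := iterate_ne_of_isPeriodicPt ha hζ
  have h1 : g (par a ζ) ≠ a := horb 1
  have ham := iterate_ne_of_dvd ha hmn
  have hpar : par a (inCoord a g ζ) = g (par a ζ) := par_coord h1
  by_cases hper : Function.IsPeriodicPt g m (par a ζ)
  · have hper' : Function.IsPeriodicPt g m (g (par a ζ)) := hper.apply_iterate 1
    have hGa : AnalyticAt ℂ (inCoord a g^[m]) ζ := analyticAt_inCoord_iterate hg (horb m)
    have hne' : g^[m] (par a (inCoord a g ζ)) ≠ a := by
      rw [hpar, show g^[m] (g (par a ζ)) = g (par a ζ) from hper']; exact h1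
    have hHa : AnalyticAt ℂ (inCoord a g^[m]) (inCoord a g ζ) := analyticAt_inCoord_iterate hg hne'
    have hGζ : inCoord a g^[m] ζ = ζ := by
      rw [inCoord, show g^[m] (par a ζ) = par a ζ from hper, coord_par]
    have hHζ : inCoord a g^[m] (inCoord a g ζ) = inCoord a g ζ := by
      rw [inCoord, hpar, show g^[m] (g (par a ζ)) = g (par a ζ) from hper']; rfl
    have c1 := h.count_fixedRoots ham (horb m)
    have c2 := h.count_fixedRoots ham hne'
    have hmult := deriv_inCoord_iterate_apply hg ha hζ hm0 hper
    have key : analyticOrderAt (fun y => inCoord a g^[m] y - y) (inCoord a g ζ) =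
        (fixedRoots F a m).count ζ := by
      -- If the multiplier is not `1`, both points are simple. If it is `1`, then `g` is a local conjugacy
      -- between the germs of `g^m` at the two points.
      by_cases hone : deriv (inCoord a g^[m]) ζ = 1
      · have hφ : AnalyticAt ℂ (inCoord a g) ζ := analyticAt_inCoord (hg _) h1
        have e1 := inCoord_comp_eventually (g₁ := g^[m]) hg.continuous h1
        have e2 := inCoord_comp_eventually (g₁ := g) (contMDiff_iterate hg m).continuous (horb m)
        have hφ' : deriv (inCoord a g) ζ ≠ 0 := by
          intro h0
          obtain ⟨i, rfl⟩ := Nat.exists_eq_succ_of_ne_zero hm0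
          have h2 : g^[i] (par a (inCoord a g ζ)) ≠ a := by
            rw [hpar, ← Function.iterate_succ_apply]; exact horb (i + 1)
          have hψ : AnalyticAt ℂ (inCoord a g^[i]) (inCoord a g ζ) :=
            analyticAt_inCoord_iterate hg h2
          rw [Function.iterate_succ, (inCoord_comp_eventually hg.continuous h1).deriv_eq] at hone
          have := (HasDerivAt.comp ζ hψ.differentiableAt.hasDerivAt
            hφ.differentiableAt.hasDerivAt).deriv
          simp only [Function.comp_def] at this
          rw [this, h0, mul_zero] at hone
          exact zero_ne_one hone
        refine analyticOrderAt_sub_id_of_semiconj hφ hφ' hGa hGζ ?_ c1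
        filter_upwards [e1, e2] with y h3 h4
        rw [← h3, ← h4, ← Function.iterate_succ, ← Function.iterate_succ']
      · rw [analyticOrderAt_sub_id_eq_one hHa hHζ (by rwa [hmult]), ← c1,
          analyticOrderAt_sub_id_eq_one hGa hGζ hone]
    rw [c2] at key
    exact_mod_cast key
  · have e1 : (fixedRoots F a m).count ζ = 0 := by
      rw [Multiset.count_eq_zero, h.mem_fixedRoots ham]; exact hper
    rw [e1, Multiset.count_eq_zero, h.mem_fixedRoots ham, hpar]
    intro h2
    apply hper
    have h3 : Function.IsPeriodicPt g m (g^[n - 1] (g (par a ζ))) :=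
      Function.IsPeriodicPt.apply_iterate (f := g) h2 (n - 1)
    rw [← Function.iterate_succ_apply, Nat.succ_eq_add_one,
      Nat.sub_add_cancel (Nat.pos_of_ne_zero hn0), show g^[n] (par a ζ) = par a ζ from hζ] at h3
    exact h3

/-- Summing an invariant weight over a union of cycles. -/
theorem dvd_sum_of_isPeriodicPt {X : Type*} [DecidableEq X] {σ : X → X} {n : ℕ} (hn : n ≠ 0)
    {w : X → ℕ} : ∀ {T : Finset X}, (∀ x ∈ T, σ x ∈ T) → (∀ x ∈ T, Function.IsPeriodicPt σ n x) →
      (∀ x ∈ T, w (σ x) = w x) → (∀ x ∈ T, n ∣ Function.minimalPeriod σ x * w x) →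
      n ∣ ∑ x ∈ T, w x := by
  intro T
  induction T using Finset.strongInduction with
  | H T ih =>
    intro hσ hper hw hdvd
    rcases T.eq_empty_or_nonempty with rfl | ⟨x, hx⟩
    · simp
    set l := Function.minimalPeriod σ x with hl
    have hl0 : 0 < l := Function.minimalPeriod_pos_of_mem_periodicPts ⟨n, Nat.pos_of_ne_zero hn, hper x hx⟩
    have hmem : ∀ i, σ^[i] x ∈ T := fun i => by
      induction i with
      | zero => exact hx
      | succ i ih' => rw [Function.iterate_succ_apply']; exact hσ _ ih'
    have hwi : ∀ i, w (σ^[i] x) = w x := fun i => by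
      induction i with
      | zero => rfl
      | succ i ih' => rw [Function.iterate_succ_apply', hw _ (hmem i), ih']
    set O := (Finset.range l).image fun i => σ^[i] x with hO
    have hOT : O ⊆ T := by
      intro y hy
      obtain ⟨i, -, rfl⟩ := Finset.mem_image.1 hy
      exact hmem i
    have hmemO : ∀ i, σ^[i] x ∈ O := fun i => by
      rw [← Function.iterate_mod_minimalPeriod_eq]
      exact Finset.mem_image_of_mem _ (Finset.mem_range.2 (Nat.mod_lt _ hl0))
    have hsumO : ∑ y ∈ O, w y = l * w x := by
      rw [hO, Finset.sum_image]
      · simp [hwi]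
      · intro i hi j hj hij
        exact Function.iterate_injOn_Iio_minimalPeriod (Finset.mem_range.1 hi)
          (Finset.mem_range.1 hj) hij
    have hlt : T \ O ⊂ T := by
      refine Finset.sdiff_ssubset hOT ⟨x, hmemO 0⟩
    have hrest : n ∣ ∑ y ∈ T \ O, w y := by
      refine ih _ hlt ?_ (fun y hy => hper y (Finset.mem_sdiff.1 hy).1)
        (fun y hy => hw y (Finset.mem_sdiff.1 hy).1) fun y hy => hdvd y (Finset.mem_sdiff.1 hy).1
      intro y hy
      obtain ⟨hyT, hyO⟩ := Finset.mem_sdiff.1 hy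
      refine Finset.mem_sdiff.2 ⟨hσ y hyT, fun h1 => hyO ?_⟩
      obtain ⟨i, -, hi⟩ := Finset.mem_image.1 h1
      have h2 : σ^[n - 1] (σ y) = y := by
        rw [← Function.iterate_succ_apply, Nat.succ_eq_add_one,
          Nat.sub_add_cancel (Nat.pos_of_ne_zero hn)]
        exact hper y hyT
      rw [← h2, ← hi, ← Function.iterate_add_apply]
      exact hmemO _
    rw [← Finset.sum_sdiff hOT, hsumO]
    exact dvd_add hrest (hdvd x hx)

end Cycles

/-! ### The zeros of the dynatomic polynomial -/

section Dynatomic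

variable {d : ℕ} {F : Fin 2 → MvPolynomial (Fin 2) ℂ} {g : OnePoint ℂ → OnePoint ℂ}

/-- The divisors `m` of `n` with `μ(n / m) = s`. -/
def signedDivisors (n : ℕ) (s : ℤ) : Finset ℕ :=
  n.divisors.filter fun m => ArithmeticFunction.moebius (n / m) = s

theorem prod_moebius {G : Type*} [DivisionCommMonoid G] (n : ℕ) (u : ℕ → G) :
    ∏ m ∈ n.divisors, u m ^ ArithmeticFunction.moebius (n / m) =
      (∏ m ∈ signedDivisors n 1, u m) / ∏ m ∈ signedDivisors n (-1), u m := by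
  rw [signedDivisors, signedDivisors, Finset.prod_filter, Finset.prod_filter,
    ← Finset.prod_div_distrib]
  refine Finset.prod_congr rfl fun m _ => ?_
  rcases ArithmeticFunction.moebius_eq_or (n / m) with h | h | h <;> simp [h]

theorem sum_moebius_eq_sub (n : ℕ) (u : ℕ → ℤ) :
    ∑ m ∈ n.divisors, ArithmeticFunction.moebius (n / m) * u m =
      (∑ m ∈ signedDivisors n 1, u m) - ∑ m ∈ signedDivisors n (-1), u m := by
  rw [signedDivisors, signedDivisors, Finset.sum_filter, Finset.sum_filter,
    ← Finset.sum_sub_distrib]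
  refine Finset.sum_congr rfl fun m _ => ?_
  rcases ArithmeticFunction.moebius_eq_or (n / m) with h | h | h <;> simp [h]

theorem self_mem_signedDivisors {n : ℕ} (hn : n ≠ 0) : n ∈ signedDivisors n 1 := by
  simp [signedDivisors, hn, Nat.div_self (Nat.pos_of_ne_zero hn)]

theorem dvd_of_mem_signedDivisors {n m : ℕ} {s : ℤ} (h : m ∈ signedDivisors n s) : m ∣ n :=
  Nat.dvd_of_mem_divisors (Finset.mem_filter.1 h).1

theorem signedDivisors_neg_one_subset (n : ℕ) : signedDivisors n (-1) ⊆ n.properDivisors := by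
  intro m hm
  obtain ⟨h1, h2⟩ := Finset.mem_filter.1 hm
  obtain ⟨h3, h4⟩ := Nat.mem_divisors.1 h1
  refine Nat.mem_properDivisors.2 ⟨h3, lt_of_le_of_ne (Nat.le_of_dvd (Nat.pos_of_ne_zero h4) h3) ?_⟩
  rintro rfl
  rw [Nat.div_self (Nat.pos_of_ne_zero h4)] at h2
  simp at h2

/-- The zeros of the dynatomic polynomial, with multiplicity, in the coordinate `1 / (z - a)`: the
alternating union `∑_{m ∣ n} μ(n/m) Fix(g^m)`, truncated where it would be negative. For a rational
map `g` of degree at least two with `g^n a ≠ a` no truncation takes place. -/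
noncomputable def dynatomicRoots (F : Fin 2 → MvPolynomial (Fin 2) ℂ) (a : ℂ) (n : ℕ) :
    Multiset ℂ :=
  (∑ m ∈ signedDivisors n 1, fixedRoots F a m) - ∑ m ∈ signedDivisors n (-1), fixedRoots F a m

theorem IsLift.sum_fixedRoots_le (h : IsLift d F g)
    (hg : ContMDiff 𝓘(ℂ, ℂ) 𝓘(ℂ, ℂ) ω g) {n : ℕ} (hn : n ≠ 0) {a : ℂ}
    (ha : g^[n] (a : OnePoint ℂ) ≠ a) :
    ∑ m ∈ signedDivisors n (-1), fixedRoots F a m ≤ ∑ m ∈ signedDivisors n 1, fixedRoots F a m := by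
  classical
  rw [Multiset.le_iff_count]
  intro ζ
  rw [Multiset.count_sum', Multiset.count_sum']
  by_cases hζ : Function.IsPeriodicPt g n (par a ζ)
  · obtain ⟨r, e, -, -, h1⟩ := h.exists_count_fixedRoots_eq hg hn ha hζ
    have h2 := sum_moebius_mul_of_eq hn h1
    rw [sum_moebius_eq_sub n fun m => ((fixedRoots F a m).count ζ : ℤ)] at h2
    have h3 : (0 : ℤ) ≤ (if n = Function.minimalPeriod g (par a ζ) then 1 else 0) +
        (e : ℤ) * (if n = Function.minimalPeriod g (par a ζ) * r then 1 else 0) := by positivity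
    rw [← h2] at h3
    have h4 := sub_nonneg.1 h3
    exact_mod_cast h4
  · refine (Finset.sum_eq_zero fun m hm => ?_).trans_le (Nat.zero_le _)
    have hm' := dvd_of_mem_signedDivisors hm
    rw [Multiset.count_eq_zero, h.mem_fixedRoots (iterate_ne_of_dvd ha hm')]
    exact fun h1 => hζ (Function.IsPeriodicPt.trans_dvd (f := g) h1 hm')

theorem IsLift.dynatomicRoots_add (h : IsLift d F g)
    (hg : ContMDiff 𝓘(ℂ, ℂ) 𝓘(ℂ, ℂ) ω g) {n : ℕ} (hn : n ≠ 0) {a : ℂ}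
    (ha : g^[n] (a : OnePoint ℂ) ≠ a) :
    dynatomicRoots F a n + ∑ m ∈ signedDivisors n (-1), fixedRoots F a m =
      ∑ m ∈ signedDivisors n 1, fixedRoots F a m :=
  tsub_add_cancel_of_le (h.sum_fixedRoots_le hg hn ha)

theorem IsLift.count_dynatomicRoots (h : IsLift d F g)
    (hg : ContMDiff 𝓘(ℂ, ℂ) 𝓘(ℂ, ℂ) ω g) {n : ℕ} (hn : n ≠ 0) {a : ℂ}
    (ha : g^[n] (a : OnePoint ℂ) ≠ a) (ζ : ℂ) :
    ((dynatomicRoots F a n).count ζ : ℤ) =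
      ∑ m ∈ n.divisors, ArithmeticFunction.moebius (n / m) * ((fixedRoots F a m).count ζ : ℤ) := by
  have h1 := congrArg (Multiset.count ζ) (h.dynatomicRoots_add hg hn ha)
  rw [Multiset.count_add, Multiset.count_sum', Multiset.count_sum'] at h1
  rw [sum_moebius_eq_sub n fun m => ((fixedRoots F a m).count ζ : ℤ), eq_sub_iff_add_eq]
  exact_mod_cast h1

theorem IsLift.prod_map_dynatomicRoots_mul {G : Type*} [CommMonoid G] (h : IsLift d F g)
    (hg : ContMDiff 𝓘(ℂ, ℂ) 𝓘(ℂ, ℂ) ω g) {n : ℕ} (hn : n ≠ 0) {a : ℂ}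
    (ha : g^[n] (a : OnePoint ℂ) ≠ a) (u : ℂ → G) :
    ((dynatomicRoots F a n).map u).prod *
        ∏ m ∈ signedDivisors n (-1), ((fixedRoots F a m).map u).prod =
      ∏ m ∈ signedDivisors n 1, ((fixedRoots F a m).map u).prod := by
  have h1 := congrArg (fun s : Multiset ℂ => (s.map u).prod) (h.dynatomicRoots_add hg hn ha)
  have h2 : ∀ s : Finset ℕ, ((∑ m ∈ s, fixedRoots F a m).map u).prod =
      ∏ m ∈ s, ((fixedRoots F a m).map u).prod := fun s => by
    have := map_sum (Multiset.mapAddMonoidHom u) (fixedRoots F a) s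
    simp only [Multiset.coe_mapAddMonoidHom] at this
    rw [this, Multiset.prod_sum]
  simpa only [Multiset.map_add, Multiset.prod_add, h2] using h1

theorem IsLift.sum_map_dynatomicRoots (h : IsLift d F g)
    (hg : ContMDiff 𝓘(ℂ, ℂ) 𝓘(ℂ, ℂ) ω g) {n : ℕ} (hn : n ≠ 0) {a : ℂ}
    (ha : g^[n] (a : OnePoint ℂ) ≠ a) (u : ℂ → ℂ) :
    ((dynatomicRoots F a n).map u).sum =
      (∑ m ∈ signedDivisors n 1, ((fixedRoots F a m).map u).sum) -
        ∑ m ∈ signedDivisors n (-1), ((fixedRoots F a m).map u).sum := by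
  have h1 := congrArg (fun s : Multiset ℂ => (s.map u).sum) (h.dynatomicRoots_add hg hn ha)
  have h2 : ∀ s : Finset ℕ, ((∑ m ∈ s, fixedRoots F a m).map u).sum =
      ∑ m ∈ s, ((fixedRoots F a m).map u).sum := fun s => by
    have := map_sum (Multiset.mapAddMonoidHom u) (fixedRoots F a) s
    simp only [Multiset.coe_mapAddMonoidHom] at this
    rw [this, Multiset.sum_sum]
  rw [eq_sub_iff_add_eq]
  simpa only [Multiset.map_add, Multiset.sum_add, h2] using h1

theorem IsLift.isPeriodicPt_of_mem_dynatomicRoots (h : IsLift d F g) {n : ℕ} {a : ℂ}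
    (ha : g^[n] (a : OnePoint ℂ) ≠ a) {ζ : ℂ} (hζ : ζ ∈ dynatomicRoots F a n) :
    Function.IsPeriodicPt g n (par a ζ) := by
  have h1 := Multiset.mem_of_le tsub_le_self hζ
  obtain ⟨m, hm, h2⟩ := Multiset.mem_sum.1 h1
  have hm' := dvd_of_mem_signedDivisors hm
  rw [h.mem_fixedRoots (iterate_ne_of_dvd ha hm')] at h2
  exact Function.IsPeriodicPt.trans_dvd (f := g) h2 hm'

/-- A zero of the dynatomic polynomial is of exact period `n`, or its multiplicity is divisible
by the quotient of `n` by its exact period. -/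
theorem IsLift.exists_count_dynatomicRoots_eq (h : IsLift d F g)
    (hg : ContMDiff 𝓘(ℂ, ℂ) 𝓘(ℂ, ℂ) ω g) {n : ℕ} (hn : n ≠ 0) {a : ℂ}
    (ha : g^[n] (a : OnePoint ℂ) ≠ a) {ζ : ℂ} (hζ : Function.IsPeriodicPt g n (par a ζ)) :
    ∃ r e : ℕ, r ∣ e ∧ (deriv (inCoord a g^[n]) ζ = 0 → e = 0) ∧
      (dynatomicRoots F a n).count ζ = (if n = Function.minimalPeriod g (par a ζ) then 1 else 0) +
        e * (if n = Function.minimalPeriod g (par a ζ) * r then 1 else 0) := by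
  obtain ⟨r, e, h1, h2, h3⟩ := h.exists_count_fixedRoots_eq hg hn ha hζ
  refine ⟨r, e, h1, h2, ?_⟩
  have h4 := h.count_dynatomicRoots hg hn ha ζ
  rw [sum_moebius_mul_of_eq hn h3] at h4
  exact_mod_cast h4

theorem IsLift.count_dynatomicRoots_of_deriv_eq_zero (h : IsLift d F g)
    (hg : ContMDiff 𝓘(ℂ, ℂ) 𝓘(ℂ, ℂ) ω g) {n : ℕ} (hn : n ≠ 0) {a : ℂ}
    (ha : g^[n] (a : OnePoint ℂ) ≠ a) {ζ : ℂ} (hζ : Function.IsPeriodicPt g n (par a ζ))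
    (h0 : deriv (inCoord a g^[n]) ζ = 0) :
    (dynatomicRoots F a n).count ζ = if n = Function.minimalPeriod g (par a ζ) then 1 else 0 := by
  obtain ⟨r, e, -, h2, h3⟩ := h.exists_count_dynatomicRoots_eq hg hn ha hζ
  rw [h3, h2 h0, zero_mul, add_zero]

theorem par_iterate_inCoord {n : ℕ} {a : ℂ} (ha : g^[n] (a : OnePoint ℂ) ≠ a) {ζ : ℂ}
    (hζ : Function.IsPeriodicPt g n (par a ζ)) (i : ℕ) :
    par a ((inCoord a g)^[i] ζ) = g^[i] (par a ζ) := by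
  induction i with
  | zero => rfl
  | succ i ih =>
    rw [Function.iterate_succ_apply', Function.iterate_succ_apply', inCoord, ih, par_coord]
    rw [← Function.iterate_succ_apply' g]
    exact iterate_ne_of_isPeriodicPt ha hζ _

theorem par_injective (a : ℂ) : Function.Injective (par a) := fun x y h => by
  rw [← coord_par a x, h, coord_par]

theorem isPeriodicPt_inCoord_iff {n : ℕ} {a : ℂ} (ha : g^[n] (a : OnePoint ℂ) ≠ a) {ζ : ℂ}
    (hζ : Function.IsPeriodicPt g n (par a ζ)) (i : ℕ) :
    Function.IsPeriodicPt (inCoord a g) i ζ ↔ Function.IsPeriodicPt g i (par a ζ) := by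
  rw [Function.IsPeriodicPt, Function.IsFixedPt, Function.IsPeriodicPt, Function.IsFixedPt,
    ← par_iterate_inCoord ha hζ, (par_injective a).eq_iff]

theorem IsLift.count_dynatomicRoots_apply (h : IsLift d F g)
    (hg : ContMDiff 𝓘(ℂ, ℂ) 𝓘(ℂ, ℂ) ω g) {n : ℕ} (hn : n ≠ 0) {a : ℂ}
    (ha : g^[n] (a : OnePoint ℂ) ≠ a) {ζ : ℂ} (hζ : Function.IsPeriodicPt g n (par a ζ)) :
    (dynatomicRoots F a n).count (inCoord a g ζ) = (dynatomicRoots F a n).count ζ := by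
  have h1 := h.count_dynatomicRoots hg hn ha ζ
  have h2 := h.count_dynatomicRoots hg hn ha (inCoord a g ζ)
  rw [Finset.sum_congr rfl fun m hm => by rw [h.count_fixedRoots_apply hg ha hζ hm], ← h1] at h2
  exact_mod_cast h2

/-- The zeros of the dynatomic polynomial form a union of cycles. -/
theorem IsLift.map_dynatomicRoots (h : IsLift d F g)
    (hg : ContMDiff 𝓘(ℂ, ℂ) 𝓘(ℂ, ℂ) ω g) {n : ℕ} (hn : n ≠ 0) {a : ℂ}
    (ha : g^[n] (a : OnePoint ℂ) ≠ a) :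
    (dynatomicRoots F a n).map (inCoord a g) = dynatomicRoots F a n := by
  have hper := fun ζ => h.isPeriodicPt_of_mem_dynatomicRoots (ζ := ζ) ha
  refine Multiset.eq_of_le_of_card_le (Multiset.le_iff_count.2 fun y => ?_) (by simp)
  by_cases hy : y ∈ (dynatomicRoots F a n).map (inCoord a g)
  · obtain ⟨x, hx, rfl⟩ := Multiset.mem_map.1 hy
    rw [Multiset.count_map_eq_count _ _ _ x hx, h.count_dynatomicRoots_apply hg hn ha (hper x hx)]
    intro x₁ hx₁ x₂ hx₂ h12
    have e : ∀ x ∈ dynatomicRoots F a n, (inCoord a g)^[n - 1] (inCoord a g x) = x := fun x hx => by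
      rw [← Function.iterate_succ_apply, Nat.succ_eq_add_one,
        Nat.sub_add_cancel (Nat.pos_of_ne_zero hn)]
      exact (isPeriodicPt_inCoord_iff ha (hper x hx) n).2 (hper x hx)
    rw [← e x₁ hx₁, h12, e x₂ hx₂]
  · rw [Multiset.count_eq_zero.2 hy]
    exact Nat.zero_le _

/-- The multipliers at the zeros of the dynatomic polynomial come in groups of `n`. -/
theorem IsLift.exists_nsmul_eq_map_deriv (h : IsLift d F g)
    (hg : ContMDiff 𝓘(ℂ, ℂ) 𝓘(ℂ, ℂ) ω g) {n : ℕ} (hn : n ≠ 0) {a : ℂ}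
    (ha : g^[n] (a : OnePoint ℂ) ≠ a) :
    ∃ C : Multiset ℂ, (dynatomicRoots F a n).map (deriv (inCoord a g^[n])) = n • C := by
  classical
  refine Multiset.exists_smul_of_dvd_count _ fun v _ => ?_
  set D := dynatomicRoots F a n with hD
  have hper : ∀ ζ ∈ D, Function.IsPeriodicPt g n (par a ζ) :=
    fun ζ hζ => h.isPeriodicPt_of_mem_dynatomicRoots ha hζ
  rw [Multiset.count_map, ← Multiset.toFinset_sum_count_eq]
  set T := (D.filter fun ζ => v = deriv (inCoord a g^[n]) ζ).toFinset with hT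
  have hmemT : ∀ ζ, ζ ∈ T ↔ ζ ∈ D ∧ v = deriv (inCoord a g^[n]) ζ := fun ζ => by
    rw [hT, Multiset.mem_toFinset, Multiset.mem_filter]
  rw [Finset.sum_congr rfl fun ζ hζ => Multiset.count_filter_of_pos
    (p := fun ζ => v = deriv (inCoord a g^[n]) ζ) ((hmemT ζ).1 hζ).2]
  refine dvd_sum_of_isPeriodicPt (σ := inCoord a g) hn (fun ζ hζ => ?_) (fun ζ hζ => ?_)
    (fun ζ hζ => ?_) fun ζ hζ => ?_
  all_goals
    obtain ⟨h1, h2⟩ := (hmemT ζ).1 hζ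
    have h3 := hper ζ h1
  · rw [hmemT, deriv_inCoord_iterate_apply hg ha h3 hn h3, ← Multiset.count_pos, hD,
      h.count_dynatomicRoots_apply hg hn ha h3, Multiset.count_pos]
    exact ⟨h1, h2⟩
  · exact (isPeriodicPt_inCoord_iff ha h3 n).2 h3
  · exact h.count_dynatomicRoots_apply hg hn ha h3
  · obtain ⟨r, e, ⟨s, rfl⟩, -, h4⟩ := h.exists_count_dynatomicRoots_eq hg hn ha h3
    rw [Function.minimalPeriod_eq_minimalPeriod_iff.2 (isPeriodicPt_inCoord_iff ha h3), h4, mul_add]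
    refine dvd_add ?_ ?_
    · split_ifs with h5
      · rw [← h5, mul_one]
      · simp
    · split_ifs with h5
      · exact ⟨s, by rw [h5]; ring⟩
      · simp

theorem deriv_inCoord_iterate_eq_prod (hg : ContMDiff 𝓘(ℂ, ℂ) 𝓘(ℂ, ℂ) ω g) {n : ℕ} {a : ℂ}
    (ha : g^[n] (a : OnePoint ℂ) ≠ a) {ζ : ℂ} (hζ : Function.IsPeriodicPt g n (par a ζ)) (i : ℕ) :
    deriv (inCoord a g^[i]) ζ =
      ∏ j ∈ Finset.range i, deriv (inCoord a g) ((inCoord a g)^[j] ζ) := by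
  have horb := iterate_ne_of_isPeriodicPt ha hζ
  induction i with
  | zero =>
    have : inCoord a g^[0] = id := funext fun y => by simp [inCoord]
    rw [this, Finset.prod_range_zero, deriv_id]
  | succ i ih =>
    have e : inCoord a g^[i] ζ = (inCoord a g)^[i] ζ := by
      rw [inCoord, ← par_iterate_inCoord ha hζ, coord_par]
    have h1 : AnalyticAt ℂ (inCoord a g^[i]) ζ := analyticAt_inCoord_iterate hg (horb i)
    have h2 : AnalyticAt ℂ (inCoord a g) (inCoord a g^[i] ζ) := by
      refine analyticAt_inCoord (hg _) ?_
      rw [e, par_iterate_inCoord ha hζ, ← Function.iterate_succ_apply' g]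
      exact horb _
    rw [Function.iterate_succ', (inCoord_comp_eventually (contMDiff_iterate hg i).continuous
      (horb i)).deriv_eq, Finset.prod_range_succ, ← ih, ← e, mul_comm]
    exact (HasDerivAt.comp ζ h2.differentiableAt.hasDerivAt h1.differentiableAt.hasDerivAt).deriv

/-- By the chain rule, the multiplier of a point is the product of the derivatives along its orbit; as
the zeros form a union of cycles, each derivative is counted `n` times in the product of all the
multipliers. -/
theorem IsLift.prod_map_deriv_iterate (h : IsLift d F g)
    (hg : ContMDiff 𝓘(ℂ, ℂ) 𝓘(ℂ, ℂ) ω g) {n : ℕ} (hn : n ≠ 0) {a : ℂ}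
    (ha : g^[n] (a : OnePoint ℂ) ≠ a) :
    ((dynatomicRoots F a n).map (deriv (inCoord a g^[n]))).prod =
      ((dynatomicRoots F a n).map (deriv (inCoord a g))).prod ^ n := by
  have hmap : ∀ j, (dynatomicRoots F a n).map (inCoord a g)^[j] = dynatomicRoots F a n := fun j => by
    induction j with
    | zero => simp
    | succ j ih => rw [Function.iterate_succ, ← Multiset.map_map, h.map_dynatomicRoots hg hn ha, ih]
  rw [Multiset.map_congr rfl fun ζ hζ => deriv_inCoord_iterate_eq_prod hg ha
    (h.isPeriodicPt_of_mem_dynatomicRoots ha hζ) n, Multiset.prod_map_prod]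
  rw [Finset.prod_congr rfl fun j _ => ?_, Finset.prod_const, Finset.card_range]
  conv_rhs => rw [← hmap j, Multiset.map_map]
  rfl

theorem sum_range_pow_add_one_le (hd : 2 ≤ d) (j : ℕ) :
    ∑ m ∈ Finset.Icc 1 j, (d ^ m + 1) ≤ d ^ (2 * j) := by
  induction j with
  | zero => simp
  | succ j ih =>
    rw [Finset.sum_Icc_succ_top (by omega)]
    have h1 : d ^ (j + 1) ≤ d ^ (2 * j + 1) := Nat.pow_le_pow_right (by omega) (by omega)
    have h2 : 1 ≤ d ^ (2 * j) := Nat.one_le_pow _ _ (by omega)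
    have h3 : d ^ (2 * (j + 1)) = d * d * d ^ (2 * j) := by ring
    have h4 : d ^ (2 * j + 1) = d * d ^ (2 * j) := by ring
    rw [h3]
    nlinarith [Nat.mul_le_mul_right (d ^ (2 * j)) (show 2 + d ≤ d * d by nlinarith)]

/-- The `d ^ n + 1` fixed points of `g^n` are not exhausted by the fixed points of the `g^m` for the
proper divisors `m` of `n`, which are at most `n / 2`. -/
theorem IsLift.dynatomicRoots_ne_zero (h : IsLift d F g) (hd : 2 ≤ d)
    (hg : ContMDiff 𝓘(ℂ, ℂ) 𝓘(ℂ, ℂ) ω g) {n : ℕ} (hn : n ≠ 0) {a : ℂ}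
    (ha : g^[n] (a : OnePoint ℂ) ≠ a) : dynatomicRoots F a n ≠ 0 := by
  intro h0
  have h1 := congrArg Multiset.card (h.dynatomicRoots_add hg hn ha)
  rw [h0, zero_add, Multiset.card_sum, Multiset.card_sum] at h1
  have hc : ∀ s : ℤ, ∑ m ∈ signedDivisors n s, (fixedRoots F a m).card =
      ∑ m ∈ signedDivisors n s, (d ^ m + 1) := fun s => Finset.sum_congr rfl fun m hm =>
    h.card_fixedRoots (iterate_ne_of_dvd ha (dvd_of_mem_signedDivisors hm))
  rw [hc, hc] at h1
  have h2 : d ^ n + 1 ≤ ∑ m ∈ signedDivisors n 1, (d ^ m + 1) :=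
    Finset.single_le_sum (f := fun m => d ^ m + 1) (fun _ _ => Nat.zero_le _)
      (self_mem_signedDivisors hn)
  have h3 : ∑ m ∈ signedDivisors n (-1), (d ^ m + 1) ≤ ∑ m ∈ Finset.Icc 1 (n / 2), (d ^ m + 1) := by
    refine Finset.sum_le_sum_of_subset fun m hm => ?_
    obtain ⟨h4, h5⟩ := Nat.mem_properDivisors.1 (signedDivisors_neg_one_subset n hm)
    obtain ⟨q, rfl⟩ := h4
    have hm0 : 0 < m := Nat.pos_of_ne_zero (left_ne_zero_of_mul hn)
    have hq : 2 ≤ q := by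
      by_contra hq
      interval_cases q <;> omega
    rw [Finset.mem_Icc, Nat.le_div_iff_mul_le (by norm_num)]
    exact ⟨hm0, Nat.mul_le_mul_left m hq⟩
  have h4 := sum_range_pow_add_one_le hd (n / 2)
  have h5 : d ^ (2 * (n / 2)) ≤ d ^ n := Nat.pow_le_pow_right (by omega) (by omega)
  omega

/-- The multiplicities of the fixed points do not depend on the lift. -/
theorem IsLift.fixedRoots_eq {d' : ℕ} {F' : Fin 2 → MvPolynomial (Fin 2) ℂ} (h : IsLift d F g)
    (h' : IsLift d' F' g) {m : ℕ} {a : ℂ} (ha : g^[m] (a : OnePoint ℂ) ≠ a) :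
    fixedRoots F' a m = fixedRoots F a m := by
  ext ζ
  by_cases hζ : g^[m] (par a ζ) = par a ζ
  · have h1 := h.count_fixedRoots ha (by rw [hζ]; exact par_ne a ζ)
    have h2 := h'.count_fixedRoots ha (by rw [hζ]; exact par_ne a ζ)
    rw [h1] at h2
    exact_mod_cast h2.symm
  · rw [Multiset.count_eq_zero.2 (by rwa [h'.mem_fixedRoots ha]),
      Multiset.count_eq_zero.2 (by rwa [h.mem_fixedRoots ha])]

theorem IsLift.dynatomicRoots_eq {d' : ℕ} {F' : Fin 2 → MvPolynomial (Fin 2) ℂ} (h : IsLift d F g)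
    (h' : IsLift d' F' g) {n : ℕ} {a : ℂ} (ha : g^[n] (a : OnePoint ℂ) ≠ a) :
    dynatomicRoots F' a n = dynatomicRoots F a n := by
  have e : ∀ s : ℤ, ∑ m ∈ signedDivisors n s, fixedRoots F' a m =
      ∑ m ∈ signedDivisors n s, fixedRoots F a m := fun s => Finset.sum_congr rfl fun m hm =>
    h.fixedRoots_eq h' (iterate_ne_of_dvd ha (dvd_of_mem_signedDivisors hm))
  rw [dynatomicRoots, dynatomicRoots, e, e]

/-- The dynatomic polynomial is, up to a constant, the product of the linear forms defining its
zeros. -/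
theorem IsLift.exists_dynatomic_eq (h : IsLift d F g)
    (hg : ContMDiff 𝓘(ℂ, ℂ) 𝓘(ℂ, ℂ) ω g) {n : ℕ} (hn : n ≠ 0) {a : ℂ}
    (ha : g^[n] (a : OnePoint ℂ) ≠ a) :
    ∃ c : ℂ, c ≠ 0 ∧ dynatomic F n = algebraMap (MvPolynomial (Fin 2) ℂ)
      (FractionRing (MvPolynomial (Fin 2) ℂ)) (MvPolynomial.C c *
        ((dynatomicRoots F a n).map fun ζ => -wedgeForm ![a * ζ + 1, ζ]).prod) := by
  set K := FractionRing (MvPolynomial (Fin 2) ℂ)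
  set ι := algebraMap (MvPolynomial (Fin 2) ℂ) K with hι
  have hinj : Function.Injective ι := IsFractionRing.injective _ _
  set e : ℕ → ℂ := fun m => MvPolynomial.eval ![a, 1] (periodPoly F m) with he
  have hne : ∀ m ∈ n.divisors, e m ≠ 0 := fun m hm =>
    h.eval_periodPoly_ne_zero (iterate_ne_of_dvd ha (Nat.dvd_of_mem_divisors hm))
  set u : ℂ → MvPolynomial (Fin 2) ℂ := fun ζ => -wedgeForm ![a * ζ + 1, ζ] with hu
  have hu0 : ∀ ζ, u ζ ≠ 0 := fun ζ h0 => by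
    have := congrArg (MvPolynomial.eval ![a, 1]) h0
    simp only [hu, map_neg, eval_wedgeForm, map_zero] at this
    simp at this
  have hper : ∀ m ∈ n.divisors, ι (periodPoly F m) =
      (ι.comp MvPolynomial.C) (e m) * ι ((fixedRoots F a m).map u).prod := fun m hm => by
    conv_lhs => rw [eq_prod_wedgeForm (h.isHomogeneous_periodPoly m) (hne m hm), map_mul]
    rfl
  refine ⟨∏ m ∈ n.divisors, e m ^ ArithmeticFunction.moebius (n / m),
    Finset.prod_ne_zero_iff.2 fun m hm => zpow_ne_zero _ (hne m hm), ?_⟩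
  rw [dynatomic, Finset.prod_congr rfl fun m hm => by rw [hper m hm, mul_zpow],
    Finset.prod_mul_distrib, map_mul]
  congr 1
  · change _ = (ι.comp MvPolynomial.C) _
    rw [map_prod]
    exact Finset.prod_congr rfl fun m _ => (map_zpow₀ _ _ _).symm
  · rw [prod_moebius n fun m => ι ((fixedRoots F a m).map u).prod, div_eq_iff,
      ← map_prod, ← map_prod, ← map_mul, h.prod_map_dynatomicRoots_mul hg hn ha]
    refine Finset.prod_ne_zero_iff.2 fun m _ h0 => ?_
    rw [map_eq_zero_iff ι hinj, Multiset.prod_eq_zero_iff] at h0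
    obtain ⟨ζ, -, hζ⟩ := Multiset.mem_map.1 h0
    exact hu0 ζ hζ

theorem wedgeForm_smul (c : ℂ) (q : Fin 2 → ℂ) :
    wedgeForm (c • q) = MvPolynomial.C c * wedgeForm q := by
  simp only [wedgeForm, Pi.smul_apply, smul_eq_mul, map_mul]
  ring

theorem IsLift.exists_isDynatomicFactorization (h : IsLift d F g) (hd : 2 ≤ d)
    (hg : ContMDiff 𝓘(ℂ, ℂ) 𝓘(ℂ, ℂ) ω g) {n : ℕ} (hn : n ≠ 0) {a : ℂ}
    (ha : g^[n] (a : OnePoint ℂ) ≠ a) : ∃ Z, IsDynatomicFactorization F n Z := by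
  obtain ⟨c, hc, hdyn⟩ := h.exists_dynatomic_eq hg hn ha
  obtain ⟨ζ₀, hζ₀⟩ := Multiset.exists_mem_of_ne_zero (h.dynatomicRoots_ne_zero hd hg hn ha)
  obtain ⟨D, hD⟩ := Multiset.exists_cons_of_mem hζ₀
  rw [hD] at hdyn
  -- the constant is absorbed in one of the linear forms
  refine ⟨((-c) • ![a * ζ₀ + 1, ζ₀]) ::ₘ D.map fun ζ => (-1 : ℂ) • ![a * ζ + 1, ζ], ?_, ?_⟩
  · intro q hq
    rcases Multiset.mem_cons.1 hq with rfl | hq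
    · exact smul_ne_zero (neg_ne_zero.2 hc) (lineVec_ne_zero a ζ₀)
    · obtain ⟨ζ, -, rfl⟩ := Multiset.mem_map.1 hq
      exact smul_ne_zero (neg_ne_zero.2 one_ne_zero) (lineVec_ne_zero a ζ)
  · rw [hdyn, Multiset.map_cons, Multiset.map_cons, Multiset.prod_cons, Multiset.prod_cons,
      Multiset.map_map]
    simp only [Function.comp_def, wedgeForm_smul, map_neg, neg_mul, mul_neg, map_one, one_mul,
      mul_assoc]

/-- Any factorization of the dynatomic polynomial into linear forms has the zeros
`dynatomicRoots`. -/
theorem IsDynatomicFactorization.map_coord_proj {F' : Fin 2 → MvPolynomial (Fin 2) ℂ}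
    {d' : ℕ} {n : ℕ} {Z : Multiset (Fin 2 → ℂ)}
    (hZ : IsDynatomicFactorization F' n Z) (h' : IsLift d' F' g) (h : IsLift d F g)
    (hg : ContMDiff 𝓘(ℂ, ℂ) 𝓘(ℂ, ℂ) ω g) (hn : n ≠ 0) {a : ℂ}
    (ha : g^[n] (a : OnePoint ℂ) ≠ a) :
    (∀ q ∈ Z, proj q ≠ a) ∧ Z.map (fun q => coord a (proj q)) = dynatomicRoots F a n := by
  obtain ⟨c, hc, hdyn⟩ := h'.exists_dynatomic_eq hg hn ha
  rw [h.dynatomicRoots_eq h' ha, hZ.2] at hdyn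
  have hprod := IsFractionRing.injective (MvPolynomial (Fin 2) ℂ) _ hdyn
  -- The dynatomic polynomial does not vanish at `(a, 1)`, so none of its linear factors does.
  have hq : ∀ q ∈ Z, q 0 - a * q 1 ≠ 0 := by
    have h1 := congrArg (MvPolynomial.eval ![a, 1]) hprod
    rw [map_mul, MvPolynomial.eval_C, map_multiset_prod, map_multiset_prod, Multiset.map_map,
      Multiset.map_map] at h1
    have h2 : (Multiset.map (⇑(MvPolynomial.eval ![a, 1]) ∘ fun ζ => -wedgeForm ![a * ζ + 1, ζ])
        (dynatomicRoots F a n)).prod = 1 := by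
      refine Multiset.prod_eq_one fun x hx => ?_
      obtain ⟨ζ, -, rfl⟩ := Multiset.mem_map.1 hx
      simp [eval_wedgeForm]
    rw [h2, mul_one] at h1
    intro q hq h0
    refine hc (h1.symm.trans (Multiset.prod_eq_zero (Multiset.mem_map.2 ⟨q, hq, ?_⟩)))
    simp only [Function.comp_def, eval_wedgeForm]
    simpa using sub_eq_zero.2 (sub_eq_zero.1 h0).symm
  refine ⟨fun q hqZ => by rw [Ne, proj_eq_coe_iff (hZ.1 q hqZ)]; exact hq q hqZ, ?_⟩
  have h1 := congrArg (fun H => (restr a H).roots) hprod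
  have hl : ∀ q ∈ Z, restr a (wedgeForm q) = Polynomial.C (-(q 0 - a * q 1)) *
      (Polynomial.X - Polynomial.C (coord a (proj q))) := fun q hqZ => by
    refine Polynomial.funext fun y => ?_
    rw [eval_restr, eval_wedgeForm, coord_proj]
    have := hq q hqZ
    simp
    field_simp
    ring
  have hr : ∀ ζ : ℂ, restr a (-wedgeForm ![a * ζ + 1, ζ]) = Polynomial.X - Polynomial.C ζ :=
    fun ζ => by
      refine Polynomial.funext fun y => ?_
      rw [eval_restr, map_neg, eval_wedgeForm]
      simp
      ring
  have hC : restr a (MvPolynomial.C c) = Polynomial.C c := by simp [restr]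
  simp only [map_mul, map_multiset_prod, Multiset.map_map, Function.comp_def, hr, hC] at h1
  rw [Multiset.map_congr rfl hl, Multiset.prod_map_mul, Polynomial.roots_C_mul _ hc,
    Polynomial.roots_multiset_prod_X_sub_C] at h1
  rw [← h1]
  have hC' : (Z.map fun q => (Polynomial.C (-(q 0 - a * q 1)) : Polynomial ℂ)).prod =
      Polynomial.C (Z.map fun q => -(q 0 - a * q 1)).prod := by
    rw [map_multiset_prod, Multiset.map_map]; rfl
  have hne : (Z.map fun q => -(q 0 - a * q 1)).prod ≠ 0 := by
    rw [Ne, Multiset.prod_eq_zero_iff]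
    intro h0
    obtain ⟨q, hqZ, h2⟩ := Multiset.mem_map.1 h0
    exact hq q hqZ (neg_eq_zero.1 h2)
  rw [hC', Polynomial.roots_C_mul _ hne]
  have := Polynomial.roots_multiset_prod_X_sub_C (Z.map fun q => coord a (proj q))
  rw [Multiset.map_map] at this
  exact this.symm

theorem IsDynatomicFactorization.map_chartDeriv {F' : Fin 2 → MvPolynomial (Fin 2) ℂ}
    {d' : ℕ} {n : ℕ} {Z : Multiset (Fin 2 → ℂ)}
    (hZ : IsDynatomicFactorization F' n Z) (h' : IsLift d' F' g) (h : IsLift d F g)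
    (hg : ContMDiff 𝓘(ℂ, ℂ) 𝓘(ℂ, ℂ) ω g) (hn : n ≠ 0) {a : ℂ}
    (ha : g^[n] (a : OnePoint ℂ) ≠ a) :
    Z.map (fun q => chartDeriv g^[n] (proj q)) =
      (dynatomicRoots F a n).map (deriv (inCoord a g^[n])) := by
  obtain ⟨h1, h2⟩ := hZ.map_coord_proj h' h hg hn ha
  rw [← h2, Multiset.map_map]
  refine Multiset.map_congr rfl fun q hq => ?_
  have h3 : coord a (proj q) ∈ dynatomicRoots F a n := h2 ▸ Multiset.mem_map_of_mem _ hq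
  have h4 := h.isPeriodicPt_of_mem_dynatomicRoots ha h3
  rw [par_coord (h1 q hq)] at h4
  exact chartDeriv_eq (h1 q hq) (contMDiff_iterate hg n _) h4

end Dynatomic

/-! ### Holomorphic families of rational maps -/

section Families

variable {k : ℕ} {M : Type*} [TopologicalSpace M] [ChartedSpace (EuclideanSpace ℂ (Fin k)) M]
  {d : ℕ} {f : M → OnePoint ℂ → OnePoint ℂ}

theorem IsHolomorphicFamily.contMDiff_iterate (hf : IsHolomorphicFamily k d f) (m : ℕ) :
    ContMDiff (𝓘(ℂ, EuclideanSpace ℂ (Fin k)).prod 𝓘(ℂ, ℂ)) 𝓘(ℂ, ℂ) ω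
      (fun p : M × OnePoint ℂ => (f p.1)^[m] p.2) := by
  induction m with
  | zero => exact contMDiff_snd
  | succ m ih =>
    simp only [Function.iterate_succ_apply']
    exact hf.1.comp (contMDiff_fst.prodMk ih)

theorem IsHolomorphicFamily.contMDiff_apply (hf : IsHolomorphicFamily k d f) (t : M) :
    ContMDiff 𝓘(ℂ, ℂ) 𝓘(ℂ, ℂ) ω (f t) :=
  hf.1.comp (contMDiff_const.prodMk contMDiff_id)

/-- A homogeneous lift of each member of the family. -/
noncomputable def IsHolomorphicFamily.lift (hf : IsHolomorphicFamily k d f) (t : M) :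
    Fin 2 → MvPolynomial (Fin 2) ℂ :=
  (hf.2 t).choose

theorem IsHolomorphicFamily.isLift (hf : IsHolomorphicFamily k d f) (t : M) :
    IsLift d (hf.lift t) (f t) :=
  (hf.2 t).choose_spec

theorem IsHolomorphicFamily.contMDiffAt_inCoord (hf : IsHolomorphicFamily k d f) {m : ℕ} {a : ℂ}
    {t : M} {ζ : ℂ} (h : (f t)^[m] (par a ζ) ≠ a) :
    ContMDiffAt (𝓘(ℂ, EuclideanSpace ℂ (Fin k)).prod 𝓘(ℂ, ℂ)) 𝓘(ℂ, ℂ) ω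
      (fun p : M × ℂ => inCoord a (f p.1)^[m] p.2) (t, ζ) := by
  have h1 : ContMDiffAt (𝓘(ℂ, EuclideanSpace ℂ (Fin k)).prod 𝓘(ℂ, ℂ)) 𝓘(ℂ, ℂ) ω
      (fun p : M × ℂ => (f p.1)^[m] (par a p.2)) (t, ζ) :=
    ((hf.contMDiff_iterate m).comp
      (contMDiff_fst.prodMk ((contMDiff_par a).comp contMDiff_snd))).contMDiffAt
  exact ContMDiffAt.comp (t, ζ) (contMDiffAt_coord h) h1

theorem IsHolomorphicFamily.continuous_iterate_par (hf : IsHolomorphicFamily k d f) (m : ℕ)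
    (a : ℂ) : Continuous fun p : M × ℂ => (f p.1)^[m] (par a p.2) :=
  (hf.contMDiff_iterate m).continuous.comp
    (continuous_fst.prodMk ((contMDiff_par a).continuous.comp continuous_snd))

theorem IsHolomorphicFamily.eventually_iterate_ne (hf : IsHolomorphicFamily k d f) {m : ℕ} {a : ℂ}
    {t : M} (h : (f t)^[m] (a : OnePoint ℂ) ≠ a) :
    ∀ᶠ s in 𝓝 t, (f s)^[m] (a : OnePoint ℂ) ≠ a :=
  (((hf.contMDiff_iterate m).continuous.comp
    (Continuous.prodMk_left (a : OnePoint ℂ))).continuousAt.eventually_ne h)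

/-- Periodic points move continuously: for parameters close to `t`, they stay close to those
of `f t`. -/
theorem IsHolomorphicFamily.eventually_forall_isPeriodicPt (hf : IsHolomorphicFamily k d f)
    {m : ℕ} {a : ℂ} {t : M} (ha : (f t)^[m] (a : OnePoint ℂ) ≠ a) {Q : M × ℂ → Prop}
    (hQ : ∀ ζ, (f t)^[m] (par a ζ) = par a ζ → ∀ᶠ p in 𝓝 (t, ζ), Q p) :
    ∀ᶠ s in 𝓝 t, ∀ ζ, (f s)^[m] (par a ζ) = par a ζ → Q (s, ζ) := by
  have h1 : ∀ᶠ s in 𝓝 t, ∀ z ∈ (univ : Set (OnePoint ℂ)), (f s)^[m] z = z → Q (s, coord a z) := by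
    refine isCompact_univ.eventually_forall_of_forall_eventually fun z _ => ?_
    by_cases hz : (f t)^[m] z = z
    · have hza : z ≠ a := fun h => ha (by rw [← h]; exact hz)
      have h2 : Tendsto (fun p : M × OnePoint ℂ => (p.1, coord a p.2)) (𝓝 (t, z))
          (𝓝 (t, coord a z)) :=
        (continuousAt_fst.prodMk
          (ContinuousAt.comp_of_eq (contMDiffAt_coord hza).continuousAt continuousAt_snd rfl)).tendsto
      have h3 := h2.eventually (hQ (coord a z) (by rw [par_coord hza]; exact hz))
      filter_upwards [h3] with p hp _ using hp
    · have h2 : ∀ᶠ p : M × OnePoint ℂ in 𝓝 (t, z), (f p.1)^[m] p.2 ≠ p.2 :=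
        (isClosed_eq (hf.contMDiff_iterate m).continuous continuous_snd).isOpen_compl.mem_nhds hz
      filter_upwards [h2] with p hp hp' using absurd hp' hp
  filter_upwards [h1] with s hs ζ hζ
  simpa using hs (par a ζ) (mem_univ _) hζ

variable [IsManifold 𝓘(ℂ, EuclideanSpace ℂ (Fin k)) ω M]

/-- A holomorphic function on `M × ℂ` is analytic in any chart of `M`. -/
theorem analyticAt_of_contMDiffAt_prod {G : M × ℂ → ℂ}
    {e : OpenPartialHomeomorph M (EuclideanSpace ℂ (Fin k))} (he : e ∈ holAtlas k M) {t : M}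
    (ht : t ∈ e.source) {ζ : ℂ}
    (hG : ContMDiffAt (𝓘(ℂ, EuclideanSpace ℂ (Fin k)).prod 𝓘(ℂ, ℂ)) 𝓘(ℂ, ℂ) ω G (t, ζ)) :
    AnalyticAt ℂ (fun p : EuclideanSpace ℂ (Fin k) × ℂ => G (e.symm p.1, p.2)) (e t, ζ) := by
  have h1 : ContMDiffAt (𝓘(ℂ, EuclideanSpace ℂ (Fin k)).prod 𝓘(ℂ, ℂ))
      (𝓘(ℂ, EuclideanSpace ℂ (Fin k)).prod 𝓘(ℂ, ℂ)) ω
      (fun p : EuclideanSpace ℂ (Fin k) × ℂ => (e.symm p.1, p.2)) (e t, ζ) :=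
    (ContMDiffAt.comp_of_eq (g := e.symm) (f := Prod.fst)
      (contMDiffAt_symm_of_mem_maximalAtlas he (e.map_source ht)) contMDiffAt_fst rfl).prodMk
      contMDiffAt_snd
  have h2 := ContMDiffAt.comp_of_eq hG h1 (by simp [e.left_inv ht])
  rw [← modelWithCornersSelf_prod, chartedSpaceSelf_prod] at h2
  exact (contMDiffAt_iff_contDiffAt.1 h2).analyticAt

theorem IsHolomorphicFamily.analyticAt_inCoord (hf : IsHolomorphicFamily k d f) {m : ℕ} {a : ℂ}
    {e : OpenPartialHomeomorph M (EuclideanSpace ℂ (Fin k))} (he : e ∈ holAtlas k M) {t : M}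
    (ht : t ∈ e.source) {ζ : ℂ} (h : (f t)^[m] (par a ζ) ≠ a) :
    AnalyticAt ℂ (Function.uncurry fun x y => inCoord a (f (e.symm x))^[m] y) (e t, ζ) :=
  analyticAt_of_contMDiffAt_prod he ht (hf.contMDiffAt_inCoord h)

theorem sum_map_ite {α : Type*} (R : Multiset α) (p : α → Prop) [DecidablePred p] (G : α → ℂ) :
    (R.map fun y => if p y then G y else 0).sum = ((R.filter p).map G).sum := by
  induction R using Multiset.induction_on with
  | empty => simp
  | cons y R ih => by_cases hy : p y <;> simp [hy, ih]

/-- Sums of a holomorphic function over the fixed points of an iterate depend holomorphically on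
the parameter. -/
theorem IsHolomorphicFamily.contMDiffAt_sum_fixedRoots (hf : IsHolomorphicFamily k d f) {m : ℕ}
    {a : ℂ} {e : OpenPartialHomeomorph M (EuclideanSpace ℂ (Fin k))} (he : e ∈ holAtlas k M)
    {t : M} (ht : t ∈ e.source) (ha : (f t)^[m] (a : OnePoint ℂ) ≠ a) {G : M → ℂ → ℂ}
    (hG : ∀ ζ, (f t)^[m] (par a ζ) = par a ζ →
      AnalyticAt ℂ (Function.uncurry fun x y => G (e.symm x) y) (e t, ζ)) :
    ContMDiffAt 𝓘(ℂ, EuclideanSpace ℂ (Fin k)) 𝓘(ℂ, ℂ) ω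
      (fun s => ((fixedRoots (hf.lift s) a m).map (G s)).sum) t := by
  classical
  set R : M → Multiset ℂ := fun s => fixedRoots (hf.lift s) a m with hR
  set h : EuclideanSpace ℂ (Fin k) → ℂ → ℂ :=
    fun x y => inCoord a (f (e.symm x))^[m] y - y with hh
  set T := (R t).toFinset with hT
  have hmemT : ∀ ζ, ζ ∈ T ↔ (f t)^[m] (par a ζ) = par a ζ := fun ζ => by
    rw [hT, Multiset.mem_toFinset, hR, (hf.isLift t).mem_fixedRoots ha]
  have hne : ∀ ζ ∈ T, (f t)^[m] (par a ζ) ≠ a := fun ζ hζ => by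
    rw [(hmemT ζ).1 hζ]; exact par_ne a ζ
  have hball : ∀ {Q : ℂ → Prop} {ζ : ℂ}, (∀ᶠ y in 𝓝 ζ, Q y) →
      ∀ᶠ ρ in 𝓝[>] (0 : ℝ), ∀ y ∈ Metric.closedBall ζ ρ, Q y := fun {Q ζ} hQ => by
    obtain ⟨ε, hε, h1⟩ := Metric.nhds_basis_closedBall.eventually_iff.1 hQ
    filter_upwards [Ioo_mem_nhdsGT hε] with ρ hρ y hy
    exact h1 (Metric.closedBall_subset_closedBall hρ.2.le hy)
  have hpair : ∀ ζ : ℂ, Tendsto (fun y : ℂ => (e t, y)) (𝓝 ζ) (𝓝 (e t, ζ)) := fun ζ =>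
    (Continuous.prodMk_right (e t)).tendsto ζ
  -- the radius of small disjoint discs around the fixed points of the given parameter
  have hev : ∀ᶠ ρ in 𝓝[>] (0 : ℝ), ∀ ζ ∈ T,
      (∀ y ∈ Metric.closedBall ζ ρ, (f t)^[m] (par a y) ≠ a) ∧
      (∀ y ∈ Metric.closedBall ζ ρ, AnalyticAt ℂ (Function.uncurry fun x y => G (e.symm x) y)
        (e t, y)) ∧ ∀ ζ' ∈ T, ζ' ≠ ζ → 2 * ρ < dist ζ' ζ := by
    refine (Filter.eventually_all_finset T).2 fun ζ hζ => ?_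
    refine (hball ?_).and ((hball ?_).and ((Filter.eventually_all_finset T).2 fun ζ' _ => ?_))
    · exact (((hf.continuous_iterate_par m a).comp
        (Continuous.prodMk_right t)).continuousAt.eventually_ne (hne ζ hζ))
    · exact (hpair ζ).eventually (hG ζ ((hmemT ζ).1 hζ)).eventually_analyticAt
    · by_cases hζζ' : ζ' = ζ
      · exact Eventually.of_forall fun _ h0 => absurd hζζ' h0
      · have hpos : 0 < dist ζ' ζ / 2 := half_pos (dist_pos.2 hζζ')
        filter_upwards [Ioo_mem_nhdsGT hpos] with ρ hρ _
        linarith [hρ.2]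
  obtain ⟨ρ, hρT, hρ⟩ := (hev.and self_mem_nhdsWithin).exists
  have hhan : ∀ ζ ∈ T, ∀ y ∈ Metric.closedBall ζ ρ, AnalyticAt ℂ (Function.uncurry h) (e t, y) :=
    fun ζ hζ y hy => (hf.analyticAt_inCoord he ht ((hρT ζ hζ).1 y hy)).sub analyticAt_snd
  have hsph : ∀ ζ ∈ T, ∀ y ∈ Metric.sphere ζ ρ, h (e t) y ≠ 0 := by
    intro ζ hζ y hy h0
    simp only [hh, e.left_inv ht] at h0
    have h1 := (hρT ζ hζ).1 y (Metric.sphere_subset_closedBall hy)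
    have h2 : (f t)^[m] (par a y) = par a y := by
      rw [← par_coord h1]; exact congrArg (par a) (sub_eq_zero.1 h0)
    have h3 : dist y ζ = ρ := hy
    have h4 := (hρT ζ hζ).2.2 y ((hmemT y).2 h2) (by rintro rfl; rw [dist_self] at h3; linarith)
    linarith
  have hS : ∀ ζ : T, ∃ S : EuclideanSpace ℂ (Fin k) → ℂ, AnalyticAt ℂ S (e t) ∧
      ∀ᶠ x in 𝓝 (e t), (∃ R, IsRootMultiset (h x) ζ ρ R) ∧
        ∀ R, IsRootMultiset (h x) ζ ρ R → S x = (R.map (G (e.symm x))).sum := fun ζ =>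
    exists_analyticAt_sum_roots hρ (hhan ζ ζ.2) (hρT ζ ζ.2).2.1 (hsph ζ ζ.2)
  choose S hSan hSeq using hS
  have hSsum : ContMDiffAt 𝓘(ℂ, EuclideanSpace ℂ (Fin k)) 𝓘(ℂ, ℂ) ω
      (fun s => ∑ ζ : T, S ζ (e s)) t := by
    refine (contMDiffAt_iff_analyticAt he ht).2 ?_
    refine (Finset.univ.analyticAt_fun_sum fun ζ _ => hSan ζ).congr ?_
    filter_upwards [e.open_target.mem_nhds (e.map_source ht)] with x hx
    simp [e.right_inv hx]
  refine hSsum.congr_of_eventuallyEq ?_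
  have e1 : ∀ᶠ s in 𝓝 t, ∀ ζ : T, ∀ R, IsRootMultiset (h (e s)) ζ ρ R →
      S ζ (e s) = (R.map (G (e.symm (e s)))).sum := by
    refine Filter.eventually_all.2 fun ζ => ?_
    have h9 := (hSeq ζ).mono fun x hx => hx.2
    exact (e.continuousAt ht).eventually h9
  have e2 : ∀ᶠ s in 𝓝 t, ∀ ζ ∈ T, ∀ y ∈ Metric.closedBall ζ ρ, (f s)^[m] (par a y) ≠ a :=
    (Filter.eventually_all_finset T).2 fun ζ hζ =>
      (isCompact_closedBall ζ ρ).eventually_forall_of_forall_eventually fun y hy =>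
        (hf.continuous_iterate_par m a).continuousAt.eventually_ne ((hρT ζ hζ).1 y hy)
  have e3 : ∀ᶠ s in 𝓝 t, ∀ y, (f s)^[m] (par a y) = par a y → ∃ ζ ∈ T, y ∈ Metric.ball ζ ρ := by
    refine hf.eventually_forall_isPeriodicPt (Q := fun p => ∃ ζ ∈ T, p.2 ∈ Metric.ball ζ ρ) ha
      fun ζ hζ => ?_
    filter_upwards [continuousAt_snd.eventually (Metric.ball_mem_nhds ζ hρ)] with p hp
    exact ⟨ζ, (hmemT ζ).2 hζ, hp⟩
  filter_upwards [e1, e2, e3, hf.eventually_iterate_ne ha, e.open_source.mem_nhds ht]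
    with s h1 h2 h3 h4 h5
  have hmemR : ∀ y, y ∈ R s ↔ (f s)^[m] (par a y) = par a y := fun y =>
    (hf.isLift s).mem_fixedRoots h4
  have hroot : ∀ ζ ∈ T, IsRootMultiset (h (e s)) ζ ρ ((R s).filter (· ∈ Metric.ball ζ ρ)) := by
    refine fun ζ hζ => ⟨fun r hr => (Multiset.mem_filter.1 hr).2, fun r hr => ?_⟩
    rw [Multiset.count_filter_of_pos (p := (· ∈ Metric.ball ζ ρ)) hr, hR,
      ← (hf.isLift s).count_fixedRoots h4 (h2 ζ hζ r (Metric.ball_subset_closedBall hr))]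
    simp only [hh, e.left_inv h5]
  have hone : ∀ y ∈ R s, (∑ ζ : T, if y ∈ Metric.ball (ζ : ℂ) ρ then G s y else 0) = G s y := by
    intro y hy
    obtain ⟨ζ, hζ, hyζ⟩ := h3 y ((hmemR y).1 hy)
    rw [Finset.sum_eq_single (⟨ζ, hζ⟩ : T) (fun ζ' _ h0 => if_neg fun hy' => ?_) (by simp),
      if_pos hyζ]
    have h6 := (hρT ζ hζ).2.2 ζ' ζ'.2 fun h7 => h0 (Subtype.ext h7)
    have h7 := dist_triangle_left (ζ' : ℂ) ζ y
    rw [Metric.mem_ball] at hyζ hy'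
    linarith
  change ((R s).map (G s)).sum = _
  rw [← Multiset.map_congr rfl hone, Multiset.sum_map_sum]
  refine Finset.sum_congr rfl fun ζ _ => ?_
  rw [sum_map_ite, h1 ζ _ (hroot ζ ζ.2), e.left_inv h5]

/-- Sums of a holomorphic function over the zeros of the dynatomic polynomial depend
holomorphically on the parameter. -/
theorem IsHolomorphicFamily.contMDiffAt_sum_dynatomicRoots (hf : IsHolomorphicFamily k d f) {n : ℕ}
    (hn : n ≠ 0) {a : ℂ} {e : OpenPartialHomeomorph M (EuclideanSpace ℂ (Fin k))}
    (he : e ∈ holAtlas k M)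
    {t : M} (ht : t ∈ e.source) (ha : (f t)^[n] (a : OnePoint ℂ) ≠ a) {G : M → ℂ → ℂ}
    (hG : ∀ ζ, (f t)^[n] (par a ζ) = par a ζ →
      AnalyticAt ℂ (Function.uncurry fun x y => G (e.symm x) y) (e t, ζ)) :
    ContMDiffAt 𝓘(ℂ, EuclideanSpace ℂ (Fin k)) 𝓘(ℂ, ℂ) ω
      (fun s => ((dynatomicRoots (hf.lift s) a n).map (G s)).sum) t := by
  have h1 : ∀ m, m ∣ n → ContMDiffAt 𝓘(ℂ, EuclideanSpace ℂ (Fin k)) 𝓘(ℂ, ℂ) ω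
      (fun s => ((fixedRoots (hf.lift s) a m).map (G s)).sum) t := fun m hm =>
    hf.contMDiffAt_sum_fixedRoots he ht (iterate_ne_of_dvd ha hm) fun ζ hζ =>
      hG ζ (Function.IsPeriodicPt.trans_dvd (f := f t) hζ hm)
  have h2 := (contMDiffAt_finsetSum (t := signedDivisors n 1) fun m hm =>
    h1 m (dvd_of_mem_signedDivisors hm)).sub (contMDiffAt_finsetSum (t := signedDivisors n (-1))
      fun m hm => h1 m (dvd_of_mem_signedDivisors hm))
  refine h2.congr_of_eventuallyEq ?_
  filter_upwards [hf.eventually_iterate_ne ha] with s hs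
  exact (hf.isLift s).sum_map_dynatomicRoots (hf.contMDiff_apply s) hn hs (G s)

end Families

/-! ### The multiplier polynomial -/

section Multipliers

variable {k : ℕ} {M : Type*} [TopologicalSpace M] [ChartedSpace (EuclideanSpace ℂ (Fin k)) M]
  {d : ℕ} {f : M → OnePoint ℂ → OnePoint ℂ}

/-- Almost every `a` is suitable as the centre of the coordinate `1 / (z - a)`. -/
theorem IsHolomorphicFamily.exists_iterate_ne (hf : IsHolomorphicFamily k d f) (hd : 2 ≤ d) {n : ℕ}
    (hn : n ≠ 0) (t : M) {ι : Type*} [Finite ι] (c : ι → OnePoint ℂ) :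
    ∃ a : ℂ, (f t)^[n] (a : OnePoint ℂ) ≠ a ∧ ∀ j, c j ≠ a := by
  have h1 := ((hf.isLift t).iterate n).finite_fixed (hd.trans (Nat.le_self_pow hn d))
  have h2 : {a : ℂ | ∃ j, c j = a}.Finite :=
    (Set.finite_range c).preimage (f := ((↑) : ℂ → OnePoint ℂ)) (OnePoint.coe_injective.injOn)
  obtain ⟨a, ha⟩ := (h1.union h2).exists_notMem
  exact ⟨a, fun h => ha (Or.inl h), fun j h => ha (Or.inr ⟨j, h⟩)⟩

theorem IsLift.card_dynatomicRoots {F : Fin 2 → MvPolynomial (Fin 2) ℂ}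
    {g : OnePoint ℂ → OnePoint ℂ} (h : IsLift d F g)
    (hg : ContMDiff 𝓘(ℂ, ℂ) 𝓘(ℂ, ℂ) ω g) {n : ℕ} (hn : n ≠ 0) {a : ℂ}
    (ha : g^[n] (a : OnePoint ℂ) ≠ a) :
    (dynatomicRoots F a n).card =
      (∑ m ∈ signedDivisors n 1, (d ^ m + 1)) - ∑ m ∈ signedDivisors n (-1), (d ^ m + 1) := by
  have h1 := congrArg Multiset.card (h.dynatomicRoots_add hg hn ha)
  have hc : ∀ s : ℤ, ∑ m ∈ signedDivisors n s, (fixedRoots F a m).card =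
      ∑ m ∈ signedDivisors n s, (d ^ m + 1) := fun s => Finset.sum_congr rfl fun m hm =>
    h.card_fixedRoots (iterate_ne_of_dvd ha (dvd_of_mem_signedDivisors hm))
  rw [Multiset.card_add, Multiset.card_sum, Multiset.card_sum, hc, hc] at h1
  omega

/-- One multiplier for each `n` zeros of the dynatomic polynomial, for each parameter. -/
theorem IsHolomorphicFamily.exists_nsmul_eq_map_deriv (hf : IsHolomorphicFamily k d f) (hd : 2 ≤ d)
    {n : ℕ} (hn : n ≠ 0) : ∃ C : M → Multiset ℂ, ∀ (t : M) (a : ℂ),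
      (f t)^[n] (a : OnePoint ℂ) ≠ a →
      (dynatomicRoots (hf.lift t) a n).map (deriv (inCoord a (f t)^[n])) = n • C t := by
  have H : ∀ t : M, ∃ C : Multiset ℂ, ∀ a : ℂ, (f t)^[n] (a : OnePoint ℂ) ≠ a →
      (dynatomicRoots (hf.lift t) a n).map (deriv (inCoord a (f t)^[n])) = n • C := by
    intro t
    obtain ⟨a₀, ha₀, -⟩ := hf.exists_iterate_ne hd hn t (fun i : Empty => i.elim)
    have hl := hf.isLift t
    have hg := hf.contMDiff_apply t
    obtain ⟨Z, hZ⟩ := hl.exists_isDynatomicFactorization hd hg hn ha₀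
    obtain ⟨C, hC⟩ := hl.exists_nsmul_eq_map_deriv hg hn ha₀
    refine ⟨C, fun a ha => ?_⟩
    rw [← hC, ← hZ.map_chartDeriv hl hl hg hn ha, ← hZ.map_chartDeriv hl hl hg hn ha₀]
  choose C hC using H
  exact ⟨C, hC⟩

theorem prod_map_sub_eq_sum (s : Multiset ℂ) (w : ℂ) :
    (s.map (· - w)).prod =
      ∑ j ∈ Finset.range (s.card + 1), s.esymm j * (-w) ^ (s.card - j) := by
  have h := congrArg (Polynomial.eval (-w)) s.prod_X_add_C_eq_sum_esymm
  rw [Polynomial.eval_multiset_prod, Multiset.map_map, Polynomial.eval_finsetSum] at h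
  simp only [Function.comp_def, Polynomial.eval_add, Polynomial.eval_X, Polynomial.eval_C,
    Polynomial.eval_mul, Polynomial.eval_pow] at h
  rw [← h]
  congr 1
  exact Multiset.map_congr rfl fun c _ => by ring

/-- The value `P t 0 ^ n` is the product of the multipliers, which is the `n`-th power of the product of
the derivatives. Only the absolute value of `P t 0` does not depend on the choice of `P`. -/
theorem IsMultiplierPoly.norm_apply_zero (hf : IsHolomorphicFamily k d f) {n : ℕ} (hn : n ≠ 0)
    {P : M → ℂ → ℂ} (hP : IsMultiplierPoly k d f n P) {t : M} {a : ℂ}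
    (ha : (f t)^[n] (a : OnePoint ℂ) ≠ a) :
    ‖P t 0‖ = ‖((dynatomicRoots (hf.lift t) a n).map (deriv (inCoord a (f t)))).prod‖ := by
  obtain ⟨F, Z, hF, hZ, h1⟩ := hP.2 t
  have hl := hf.isLift t
  have hg := hf.contMDiff_apply t
  have h2 := h1 0
  have h3 := prod_map_sub_eq_sum (Z.map fun q => chartDeriv (f t)^[n] (proj q)) 0
  rw [Multiset.card_map] at h3
  rw [← h3, hZ.map_chartDeriv hF hl hg hn ha] at h2
  simp only [sub_zero, Multiset.map_id'] at h2
  rw [hl.prod_map_deriv_iterate hg hn ha] at h2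
  have h4 := congrArg norm h2
  rw [norm_pow, norm_pow] at h4
  exact (pow_left_inj₀ (norm_nonneg _) (norm_nonneg _) hn).1 h4

/-- The holomorphic functions at a point form an algebra. -/
def contMDiffAtSubalgebra (k : ℕ) {M : Type*} [TopologicalSpace M]
    [ChartedSpace (EuclideanSpace ℂ (Fin k)) M] (t : M) : Subalgebra ℂ (M → ℂ) where
  carrier := {g | ContMDiffAt 𝓘(ℂ, EuclideanSpace ℂ (Fin k)) 𝓘(ℂ, ℂ) ω g t}
  mul_mem' h₁ h₂ := ContMDiffAt.mul h₁ h₂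
  add_mem' h₁ h₂ := ContMDiffAt.add h₁ h₂
  algebraMap_mem' _ := contMDiffAt_const

variable [IsManifold 𝓘(ℂ, EuclideanSpace ℂ (Fin k)) ω M]

/-- The multiplier polynomial is `∏ (μ - w)`, where each group of `n` equal multipliers `μ` contributes
one factor. -/
theorem IsHolomorphicFamily.exists_isMultiplierPoly (hf : IsHolomorphicFamily k d f) (hd : 2 ≤ d)
    {n : ℕ} (hn : n ≠ 0) : ∃ P, IsMultiplierPoly k d f n P := by
  obtain ⟨C, hC⟩ := hf.exists_nsmul_eq_map_deriv hd hn
  -- The power sums of the reduced multiset of multipliers are holomorphic.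
  have hpsum : ∀ j t, ContMDiffAt 𝓘(ℂ, EuclideanSpace ℂ (Fin k)) 𝓘(ℂ, ℂ) ω
      (fun s => ((C s).map (· ^ j)).sum) t := by
    intro j t
    obtain ⟨a, ha, -⟩ := hf.exists_iterate_ne hd hn t (fun i : Empty => i.elim)
    set e := chartAt (EuclideanSpace ℂ (Fin k)) t with he
    have he' : e ∈ holAtlas k M := IsManifold.chart_mem_maximalAtlas t
    have ht : t ∈ e.source := mem_chart_source _ t
    have h1 := hf.contMDiffAt_sum_dynatomicRoots hn he' ht ha
      (G := fun s ζ => deriv (inCoord a (f s)^[n]) ζ ^ j) fun ζ hζ =>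
        (analyticAt_deriv_snd (hf.analyticAt_inCoord he' ht (m := n)
          (by rw [hζ]; exact par_ne a ζ))).pow j
    refine ((contMDiffAt_const (c := (n : ℂ)⁻¹)).mul h1).congr_of_eventuallyEq ?_
    filter_upwards [hf.eventually_iterate_ne ha] with s hs
    have h2 := congrArg (fun R : Multiset ℂ => (R.map (· ^ j)).sum) (hC s a hs)
    simp only [Multiset.map_map, Multiset.map_nsmul, Multiset.sum_nsmul, Function.comp_def] at h2
    change _ = (n : ℂ)⁻¹ * (Multiset.map (fun ζ => deriv (inCoord a (f s)^[n]) ζ ^ j) _).sum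
    rw [h2, nsmul_eq_mul, inv_mul_cancel_left₀ (Nat.cast_ne_zero.2 hn)]
  have hesymm : ∀ j, ContMDiff 𝓘(ℂ, EuclideanSpace ℂ (Fin k)) 𝓘(ℂ, ℂ) ω
      (fun s => (C s).esymm j) := fun j t =>
    esymm_mem_of_psum_mem (contMDiffAtSubalgebra k t) C (fun j => hpsum j t) j
  have hcard : ∃ l, ∀ t, (C t).card = l := by
    refine ⟨((∑ m ∈ signedDivisors n 1, (d ^ m + 1)) -
      ∑ m ∈ signedDivisors n (-1), (d ^ m + 1)) / n, fun t => ?_⟩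
    obtain ⟨a, ha, -⟩ := hf.exists_iterate_ne hd hn t (fun i : Empty => i.elim)
    have h2 := congrArg Multiset.card (hC t a ha)
    rw [Multiset.card_map, (hf.isLift t).card_dynatomicRoots (hf.contMDiff_apply t) hn ha,
      Multiset.card_nsmul] at h2
    rw [h2, Nat.mul_div_cancel_left _ (Nat.pos_of_ne_zero hn)]
  obtain ⟨l, hl⟩ := hcard
  refine ⟨fun t w => ((C t).map (· - w)).prod, ?_, fun t => ?_⟩
  · have h1 : Function.uncurry (fun t w => ((C t).map (· - w)).prod) = fun p : M × ℂ =>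
        ∑ j ∈ Finset.range (l + 1), (C p.1).esymm j * (-p.2) ^ (l - j) := by
      funext p
      rw [Function.uncurry, prod_map_sub_eq_sum, hl]
    rw [h1]
    refine contMDiff_finsetSum fun j _ => ((hesymm j).comp contMDiff_fst).mul ?_
    have h2 : ContMDiff 𝓘(ℂ, ℂ) 𝓘(ℂ, ℂ) ω fun w : ℂ => (-w) ^ (l - j) :=
      (contDiff_neg.pow _).contMDiff
    exact h2.comp contMDiff_snd
  · obtain ⟨a, ha, -⟩ := hf.exists_iterate_ne hd hn t (fun i : Empty => i.elim)
    have hlt := hf.isLift t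
    have hg := hf.contMDiff_apply t
    obtain ⟨Z, hZ⟩ := hlt.exists_isDynatomicFactorization hd hg hn ha
    refine ⟨hf.lift t, Z, hlt, hZ, fun w => ?_⟩
    have h3 := prod_map_sub_eq_sum (Z.map fun q => chartDeriv (f t)^[n] (proj q)) w
    rw [Multiset.card_map] at h3
    rw [← h3, hZ.map_chartDeriv hlt hlt hg hn ha, hC t a ha, Multiset.map_nsmul,
      Multiset.prod_nsmul]

theorem IsHolomorphicFamily.isMultiplierPoly (hf : IsHolomorphicFamily k d f) (hd : 2 ≤ d)
    {n : ℕ} (hn : n ≠ 0) : IsMultiplierPoly k d f n (multiplierPoly k d f n) := by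
  have h := hf.exists_isMultiplierPoly hd hn
  rw [multiplierPoly, dif_pos h]
  exact h.choose_spec

end Multipliers

/-! ### Products over the zeros of the dynatomic polynomial -/

section Comparison

open Asymptotics

variable {k : ℕ} {M : Type*} [TopologicalSpace M] [ChartedSpace (EuclideanSpace ℂ (Fin k)) M]
  {d : ℕ} {f : M → OnePoint ℂ → OnePoint ℂ}

theorem norm_prod_map_le {b : ℝ} (hb : 0 ≤ b) {u v : ℂ → ℂ} (R : Multiset ℂ)
    (h : ∀ ζ ∈ R, ‖u ζ‖ ≤ b * ‖v ζ‖) : ‖(R.map u).prod‖ ≤ b ^ R.card * ‖(R.map v).prod‖ := by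
  induction R using Multiset.induction_on with
  | empty => simp
  | cons ζ R ih =>
    simp only [Multiset.map_cons, Multiset.prod_cons, norm_mul, Multiset.card_cons, pow_succ']
    calc ‖u ζ‖ * ‖(R.map u).prod‖
        ≤ (b * ‖v ζ‖) * (b ^ R.card * ‖(R.map v).prod‖) := by
          gcongr
          · exact h ζ (Multiset.mem_cons_self ζ R)
          · exact ih fun y hy => h y (Multiset.mem_cons_of_mem hy)
      _ = _ := by ring

theorem IsHolomorphicFamily.isBigO_prod_dynatomicRoots (hf : IsHolomorphicFamily k d f) {n : ℕ}
    (hn : n ≠ 0) {a : ℂ} {t : M} (ha : (f t)^[n] (a : OnePoint ℂ) ≠ a) {u v : M → ℂ → ℂ}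
    (huv : ∀ ζ, (f t)^[n] (par a ζ) = par a ζ →
      (fun p : M × ℂ => u p.1 p.2) =O[𝓝 (t, ζ)] fun p => v p.1 p.2) :
    (fun s => ((dynatomicRoots (hf.lift s) a n).map (u s)).prod) =O[𝓝 t]
      fun s => ((dynatomicRoots (hf.lift s) a n).map (v s)).prod := by
  classical
  set T := (fixedRoots (hf.lift t) a n).toFinset with hT
  have hmemT : ∀ ζ, ζ ∈ T ↔ (f t)^[n] (par a ζ) = par a ζ := fun ζ => by
    rw [hT, Multiset.mem_toFinset, (hf.isLift t).mem_fixedRoots ha]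
  have h1 : ∀ ζ : T, ∃ b : ℝ, ∀ᶠ p : M × ℂ in 𝓝 (t, (ζ : ℂ)), ‖u p.1 p.2‖ ≤ b * ‖v p.1 p.2‖ :=
    fun ζ => (huv ζ ((hmemT ζ).1 ζ.2)).bound
  choose b hb using h1
  obtain ⟨B, hB⟩ := (insert 0 (Finset.univ.image b)).exists_le
  have hB0 : 0 ≤ B := hB 0 (Finset.mem_insert_self _ _)
  have h2 := hf.eventually_forall_isPeriodicPt (Q := fun p => ‖u p.1 p.2‖ ≤ B * ‖v p.1 p.2‖) ha
    fun ζ hζ => by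
      filter_upwards [hb ⟨ζ, (hmemT ζ).2 hζ⟩] with p hp
      refine hp.trans (mul_le_mul_of_nonneg_right (hB _ ?_) (norm_nonneg _))
      exact Finset.mem_insert_of_mem (Finset.mem_image_of_mem b (Finset.mem_univ _))
  refine IsBigO.of_bound (B ^ ((∑ m ∈ signedDivisors n 1, (d ^ m + 1)) -
    ∑ m ∈ signedDivisors n (-1), (d ^ m + 1))) ?_
  filter_upwards [h2, hf.eventually_iterate_ne ha] with s hs has
  rw [← (hf.isLift s).card_dynatomicRoots (hf.contMDiff_apply s) hn has]
  exact norm_prod_map_le hB0 _ fun ζ hζ =>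
    hs ζ ((hf.isLift s).isPeriodicPt_of_mem_dynatomicRoots has hζ)

/-- Comparable functions have comparable products over the zeros of the dynatomic polynomial. -/
theorem IsHolomorphicFamily.isTheta_prod_dynatomicRoots (hf : IsHolomorphicFamily k d f) {n : ℕ}
    (hn : n ≠ 0) {a : ℂ} {t : M} (ha : (f t)^[n] (a : OnePoint ℂ) ≠ a) {u v : M → ℂ → ℂ}
    (huv : ∀ ζ, (f t)^[n] (par a ζ) = par a ζ →
      (fun p : M × ℂ => u p.1 p.2) =Θ[𝓝 (t, ζ)] fun p => v p.1 p.2) :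
    (fun s => ((dynatomicRoots (hf.lift s) a n).map (u s)).prod) =Θ[𝓝 t]
      fun s => ((dynatomicRoots (hf.lift s) a n).map (v s)).prod :=
  ⟨hf.isBigO_prod_dynatomicRoots hn ha fun ζ hζ => (huv ζ hζ).1,
    hf.isBigO_prod_dynatomicRoots hn ha fun ζ hζ => (huv ζ hζ).2⟩

end Comparison

/-! ### The multiplier polynomial at zero and the critical points -/

section Comparison

open Asymptotics

variable {k : ℕ} {M : Type*} [TopologicalSpace M] [ChartedSpace (EuclideanSpace ℂ (Fin k)) M]
  {d : ℕ} {f : M → OnePoint ℂ → OnePoint ℂ}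

theorem frequently_ne_zero_of_analyticOrderAt_ne_top {g : ℂ → ℂ} {z : ℂ}
    (h : analyticOrderAt g z ≠ ⊤) : ∃ᶠ ζ in 𝓝 z, g ζ ≠ 0 := by
  intro h0
  exact h (analyticOrderAt_eq_top.2 (h0.mono fun ζ h1 => not_not.1 h1))

theorem IsHolomorphicFamily.eventually_iterate_par_ne (hf : IsHolomorphicFamily k d f) {m : ℕ}
    {a : ℂ} {t : M} {ζ : ℂ} (h : (f t)^[m] (par a ζ) ≠ a) :
    ∀ᶠ p : M × ℂ in 𝓝 (t, ζ), (f p.1)^[m] (par a p.2) ≠ a :=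
  (hf.continuous_iterate_par m a).continuousAt.eventually_ne h

/-- The displacement `f_t^m - id` is comparable to the monic polynomial with the same zeros. -/
theorem IsHolomorphicFamily.isTheta_prod_fixedRoots (hf : IsHolomorphicFamily k d f) {m : ℕ}
    {a : ℂ} {t : M} {z : ℂ} (ha : (f t)^[m] (a : OnePoint ℂ) ≠ a)
    (hz : (f t)^[m] (par a z) ≠ a) :
    (fun p : M × ℂ => inCoord a (f p.1)^[m] p.2 - p.2) =Θ[𝓝 (t, z)]
      fun p => ((fixedRoots (hf.lift p.1) a m).map (p.2 - ·)).prod := by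
  classical
  have hne := hf.eventually_iterate_par_ne hz
  obtain ⟨K, hK⟩ := ((fixedRoots (hf.lift t) a m).toFinset.image fun r => ‖r‖).exists_le
  refine isTheta_prod_roots (h := fun s y => inCoord a (f s)^[m] y - y)
    (R := fun s => fixedRoots (hf.lift s) a m) (B := d ^ m + 1) (K := K + 1) ?_ ?_ ?_ ?_ ?_ ?_
  · filter_upwards [hne] with p hp
    exact (hf.contMDiffAt_inCoord (t := p.1) (ζ := p.2) hp).continuousAt.sub continuousAt_snd
  · filter_upwards [hne] with p hp
    exact (analyticAt_inCoord_iterate (hf.contMDiff_apply p.1) hp).sub analyticAt_id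
  · refine frequently_ne_zero_of_analyticOrderAt_ne_top ?_
    rw [(hf.isLift t).count_fixedRoots ha hz]
    exact ENat.natCast_ne_top _
  · filter_upwards [hf.eventually_iterate_ne ha] with s hs
    exact ((hf.isLift s).card_fixedRoots hs).le
  · have h1 := hf.eventually_forall_isPeriodicPt (Q := fun p => ‖p.2‖ ≤ K + 1) ha fun ζ hζ => by
      have h2 : ‖ζ‖ < K + 1 := (hK _ (Finset.mem_image_of_mem _ (Multiset.mem_toFinset.2
        (((hf.isLift t).mem_fixedRoots ha).2 hζ)))).trans_lt (lt_add_one K)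
      have h3 : ContinuousAt (fun p : M × ℂ => ‖p.2‖) (t, ζ) := continuousAt_snd.norm
      exact (h3.eventually_lt_const h2).mono fun p hp => hp.le
    filter_upwards [h1, hf.eventually_iterate_ne ha] with s hs has r hr
    exact hs r (((hf.isLift s).mem_fixedRoots has).1 hr)
  · have h1 : ∀ᶠ p : M × ℂ in 𝓝 (t, z), (f p.1)^[m] (a : OnePoint ℂ) ≠ a :=
      continuousAt_fst.eventually (hf.eventually_iterate_ne ha)
    filter_upwards [hne, h1] with p hp hp1
    exact ((hf.isLift p.1).count_fixedRoots hp1 hp).symm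

theorem isTheta_one_of_continuousAt {X : Type*} [TopologicalSpace X] {u : X → ℂ} {x : X}
    (h : ContinuousAt u x) (h0 : u x ≠ 0) : u =Θ[𝓝 x] fun _ => (1 : ℂ) :=
  ((isEquivalent_const_iff_tendsto h0).2 h.tendsto).isTheta.trans
    (isTheta_const_const h0 one_ne_zero)

theorem isTheta_prod_one {X ι : Type*} {l : Filter X} {s : Finset ι} {u : ι → X → ℂ}
    (h : ∀ i ∈ s, u i =Θ[l] fun _ => (1 : ℂ)) :
    (fun x => ∏ i ∈ s, u i x) =Θ[l] fun _ => (1 : ℂ) := by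
  have h1 := IsTheta.finsetProd h
  simpa only [Finset.prod_const_one] using h1

/-- At a point of exact period `n`, the polynomial with the zeros of the dynatomic polynomial is
comparable to the displacement `f_t^n - id`. -/
theorem IsHolomorphicFamily.isTheta_prod_dynatomicRoots_sub (hf : IsHolomorphicFamily k d f)
    {n : ℕ} (hn : n ≠ 0) {a : ℂ} {t : M} (ha : (f t)^[n] (a : OnePoint ℂ) ≠ a) {θ : M → ℂ}
    (hθ : ContinuousAt θ t) (hper : Function.minimalPeriod (f t) (par a (θ t)) = n) :
    (fun s => ((dynatomicRoots (hf.lift s) a n).map (θ s - ·)).prod) =Θ[𝓝 t]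
      fun s => inCoord a (f s)^[n] (θ s) - θ s := by
  have hpern : Function.IsPeriodicPt (f t) n (par a (θ t)) :=
    hper ▸ Function.isPeriodicPt_minimalPeriod (f t) _
  have horb := iterate_ne_of_isPeriodicPt ha hpern
  have hpair : Tendsto (fun s => (s, θ s)) (𝓝 t) (𝓝 (t, θ t)) := continuousAt_id.prodMk hθ
  have hA : ∀ m, m ∣ n → (fun s => ((fixedRoots (hf.lift s) a m).map (θ s - ·)).prod) =Θ[𝓝 t]
      fun s => inCoord a (f s)^[m] (θ s) - θ s := fun m hm => by
    have h1 := hf.isTheta_prod_fixedRoots (iterate_ne_of_dvd ha hm) (horb m)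
    have h2 := h1.1.comp_tendsto hpair
    have h3 := h1.2.comp_tendsto hpair
    simp only [Function.comp_def] at h2 h3
    exact ⟨h3, h2⟩
  -- The factors with `m ≠ n` do not vanish at `t`, so only the factor `m = n` contributes.
  have hone : ∀ m, m ∣ n → m ≠ n →
      (fun s => ((fixedRoots (hf.lift s) a m).map (θ s - ·)).prod) =Θ[𝓝 t] fun _ => (1 : ℂ) := by
    intro m hm hmn
    refine (hA m hm).trans ?_
    have h1 : ContinuousAt (fun s => inCoord a (f s)^[m] (θ s) - θ s) t :=
      (ContinuousAt.comp_of_eq (hf.contMDiffAt_inCoord (horb m)).continuousAt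
        (continuousAt_id.prodMk hθ) rfl).sub hθ
    have h2 : inCoord a (f t)^[m] (θ t) - θ t ≠ 0 := by
      intro h0
      have h3 : Function.IsPeriodicPt (f t) m (par a (θ t)) := by
        change (f t)^[m] _ = _
        conv_rhs => rw [← sub_eq_zero.1 h0]
        rw [inCoord, par_coord (horb m)]
      exact hmn (Nat.dvd_antisymm hm (hper ▸ h3.minimalPeriod_dvd))
    exact isTheta_one_of_continuousAt h1 h2
  have hneg : (fun s => ∏ m ∈ signedDivisors n (-1),
      ((fixedRoots (hf.lift s) a m).map (θ s - ·)).prod) =Θ[𝓝 t] fun _ => (1 : ℂ) := by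
    refine isTheta_prod_one fun m hm => hone m (dvd_of_mem_signedDivisors hm) ?_
    exact (Nat.mem_properDivisors.1 (signedDivisors_neg_one_subset n hm)).2.ne
  have hpos : (fun s => ∏ m ∈ signedDivisors n 1,
      ((fixedRoots (hf.lift s) a m).map (θ s - ·)).prod) =Θ[𝓝 t]
      fun s => inCoord a (f s)^[n] (θ s) - θ s := by
    have h1 : (fun s => ∏ m ∈ (signedDivisors n 1).erase n,
        ((fixedRoots (hf.lift s) a m).map (θ s - ·)).prod) =Θ[𝓝 t] fun _ => (1 : ℂ) := by
      exact isTheta_prod_one fun m hm => hone m (dvd_of_mem_signedDivisors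
        (Finset.mem_erase.1 hm).2) (Finset.mem_erase.1 hm).1
    have h2 := (hA n dvd_rfl).mul h1
    simp only [mul_one] at h2
    refine IsTheta.trans (EventuallyEq.isTheta (Eventually.of_forall fun s => ?_)) h2
    exact (Finset.mul_prod_erase _ _ (self_mem_signedDivisors hn)).symm
  have h1 := (isTheta_refl (fun s => ((dynatomicRoots (hf.lift s) a n).map (θ s - ·)).prod)
    (𝓝 t)).mul hneg
  simp only [mul_one] at h1
  refine h1.symm.trans (IsTheta.trans (EventuallyEq.isTheta ?_) hpos)
  filter_upwards [hf.eventually_iterate_ne ha] with s hs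
  exact (hf.isLift s).prod_map_dynatomicRoots_mul (hf.contMDiff_apply s) hn hs _

/-- A periodic critical point is a zero of the dynatomic polynomial only if its exact period is `n`: the
multiplier of the cycle is zero, hence not a root of unity. -/
theorem IsLift.mem_dynatomicRoots_iff {F : Fin 2 → MvPolynomial (Fin 2) ℂ}
    {g : OnePoint ℂ → OnePoint ℂ} (h : IsLift d F g)
    (hg : ContMDiff 𝓘(ℂ, ℂ) 𝓘(ℂ, ℂ) ω g) {n : ℕ} (hn : n ≠ 0) {a : ℂ}
    (ha : g^[n] (a : OnePoint ℂ) ≠ a) {ζ : ℂ} (hζ : deriv (inCoord a g) ζ = 0) :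
    ζ ∈ dynatomicRoots F a n ↔ Function.minimalPeriod g (par a ζ) = n := by
  have key : Function.IsPeriodicPt g n (par a ζ) → (ζ ∈ dynatomicRoots F a n ↔
      Function.minimalPeriod g (par a ζ) = n) := fun hper => by
    have h0 : deriv (inCoord a g^[n]) ζ = 0 := by
      rw [deriv_inCoord_iterate_eq_prod hg ha hper]
      exact Finset.prod_eq_zero (Finset.mem_range.2 (Nat.pos_of_ne_zero hn)) hζ
    rw [← Multiset.count_pos, h.count_dynatomicRoots_of_deriv_eq_zero hg hn ha hper h0]
    split_ifs with h1
    · exact iff_of_true one_pos h1.symm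
    · exact iff_of_false (lt_irrefl 0) fun h2 => h1 h2.symm
  constructor
  · intro h1
    exact (key (h.isPeriodicPt_of_mem_dynatomicRoots ha h1)).1 h1
  · intro h1
    exact (key (h1 ▸ Function.isPeriodicPt_minimalPeriod g _)).2 h1

variable [IsManifold 𝓘(ℂ, EuclideanSpace ℂ (Fin k)) ω M]

/-- By Newton's identities, the coefficients of the polynomial with the zeros `dynatomicRoots` are
holomorphic. -/
theorem IsHolomorphicFamily.continuousAt_prod_dynatomicRoots (hf : IsHolomorphicFamily k d f)
    {n : ℕ} (hn : n ≠ 0) {a : ℂ} {t : M} (ha : (f t)^[n] (a : OnePoint ℂ) ≠ a) {θ : M → ℂ}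
    (hθ : ContinuousAt θ t) :
    ContinuousAt (fun s => ((dynatomicRoots (hf.lift s) a n).map (θ s - ·)).prod) t := by
  set e := chartAt (EuclideanSpace ℂ (Fin k)) t with he
  have he' : e ∈ holAtlas k M := IsManifold.chart_mem_maximalAtlas t
  have ht : t ∈ e.source := mem_chart_source _ t
  set l := (dynatomicRoots (hf.lift t) a n).card with hl
  have hesymm : ∀ j, ContinuousAt (fun s => (dynatomicRoots (hf.lift s) a n).esymm j) t := fun j =>
    (esymm_mem_of_psum_mem (contMDiffAtSubalgebra k t) (fun s => dynatomicRoots (hf.lift s) a n)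
      (fun j => hf.contMDiffAt_sum_dynatomicRoots hn he' ht ha (G := fun _ ζ => ζ ^ j)
        fun ζ _ => analyticAt_snd.pow j) j).continuousAt
  have h1 : ContinuousAt (fun s => ∑ j ∈ Finset.range (l + 1),
      (-1) ^ j * ((dynatomicRoots (hf.lift s) a n).esymm j * θ s ^ (l - j))) t :=
    tendsto_finsetSum _ fun j _ => continuousAt_const.mul ((hesymm j).mul (hθ.pow _))
  refine h1.congr ?_
  filter_upwards [hf.eventually_iterate_ne ha] with s hs
  have h2 := congrArg (Polynomial.eval (θ s)) (dynatomicRoots (hf.lift s) a n).prod_X_sub_X_eq_sum_esymm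
  rw [Polynomial.eval_multiset_prod, Multiset.map_map, Polynomial.eval_finsetSum,
    (hf.isLift s).card_dynatomicRoots (hf.contMDiff_apply s) hn hs,
    ← (hf.isLift t).card_dynatomicRoots (hf.contMDiff_apply t) hn ha, ← hl] at h2
  simpa [Function.comp_def] using h2.symm

variable {ι : Type*} [Fintype ι] {c : ι → M → OnePoint ℂ}

theorem MarksCriticalPoints.continuousAt_coord (hc : MarksCriticalPoints k f c) {a : ℂ} {t : M}
    {j : ι} (h : c j t ≠ a) : ContinuousAt (fun s => coord a (c j s)) t :=
  ContinuousAt.comp_of_eq (contMDiffAt_coord h).continuousAt (hc.1 j).continuous.continuousAt rfl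

/-- In the coordinate `1 / (z - a)`, the marked critical points are the zeros of the derivative, with
multiplicity. -/
theorem MarksCriticalPoints.count_eq (hc : MarksCriticalPoints k f c)
    (hf : IsHolomorphicFamily k d f) {a : ℂ} {t : M} {ζ : ℂ} (hζ : f t (par a ζ) ≠ a)
    (hca : ∀ j, c j t ≠ a) :
    ((Finset.univ.val.map fun j => coord a (c j t)).count ζ : ℕ∞) =
      analyticOrderAt (deriv (inCoord a (f t))) ζ := by
  classical
  have h1 := criticalMultiplicity_eq (par_ne a ζ) (hf.contMDiff_apply t _) hζ
  rw [coord_par, ← hc.2 t] at h1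
  rw [← h1, Multiset.count_map]
  have h2 : {j | c j t = par a ζ} = ((Finset.univ.filter fun j => ζ = coord a (c j t) : Finset ι) : Set ι) := by
    ext j
    simp only [mem_ofPred_eq, Finset.coe_filter, Finset.mem_univ, true_and]
    constructor
    · intro h; rw [h, coord_par]
    · intro h; rw [h, par_coord (hca j)]
  rw [h2, Set.encard_coe_eq_coe_finsetCard]
  rfl

theorem MarksCriticalPoints.deriv_eq_zero (hc : MarksCriticalPoints k f c)
    (hf : IsHolomorphicFamily k d f) {a : ℂ} {t : M} (hca : ∀ j, c j t ≠ a) {j : ι}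
    (hj : f t (c j t) ≠ a) : deriv (inCoord a (f t)) (coord a (c j t)) = 0 := by
  have h1 := hc.count_eq hf (ζ := coord a (c j t)) (by rwa [par_coord (hca j)]) hca
  refine apply_eq_zero_of_analyticOrderAt_ne_zero ?_
  rw [← h1]
  have : 0 < (Finset.univ.val.map fun j => coord a (c j t)).count (coord a (c j t)) :=
    Multiset.count_pos.2 (Multiset.mem_map.2 ⟨j, Finset.mem_univ j, rfl⟩)
  exact_mod_cast this.ne'

/-- The derivative of `f_t` is comparable to the polynomial whose zeros are the critical points. -/
theorem MarksCriticalPoints.isTheta_deriv (hc : MarksCriticalPoints k f c)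
    (hf : IsHolomorphicFamily k d f) {a : ℂ} {t : M} {ζ : ℂ} (hζ : f t (par a ζ) ≠ a)
    (hca : ∀ j, c j t ≠ a) :
    (fun p : M × ℂ => deriv (inCoord a (f p.1)) p.2) =Θ[𝓝 (t, ζ)]
      fun p => ∏ j, (p.2 - coord a (c j p.1)) := by
  classical
  have hne := hf.eventually_iterate_par_ne (m := 1) hζ
  have hcne : ∀ᶠ s in 𝓝 t, ∀ j, c j s ≠ a := Filter.eventually_all.2 fun j =>
    (hc.1 j).continuous.continuousAt.eventually_ne (hca j)
  obtain ⟨K, hK⟩ := (Finset.univ.image fun j => ‖coord a (c j t)‖).exists_le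
  have h0 := isTheta_prod_roots (h := fun s y => deriv (inCoord a (f s)) y)
    (R := fun s => Finset.univ.val.map fun j => coord a (c j s)) (B := Fintype.card ι) (K := K + 1)
    (x₁ := t) (z := ζ) ?_ ?_ ?_ ?_ ?_ ?_
  · simpa only [Multiset.map_map, Function.comp_def, Finset.prod_map_val] using h0
  · filter_upwards [hne] with p hp
    set e := chartAt (EuclideanSpace ℂ (Fin k)) p.1 with he
    have he' : e ∈ holAtlas k M := IsManifold.chart_mem_maximalAtlas p.1
    have ht : p.1 ∈ e.source := mem_chart_source _ p.1
    have h1 := (analyticAt_deriv_snd (hf.analyticAt_inCoord he' ht hp)).continuousAt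
    have h2 : ContinuousAt (fun q : M × ℂ => (e q.1, q.2)) p :=
      (ContinuousAt.comp_of_eq (e.continuousAt ht) continuousAt_fst rfl).prodMk continuousAt_snd
    refine (ContinuousAt.comp_of_eq h1 h2 rfl).congr ?_
    have h3 : ∀ᶠ q : M × ℂ in 𝓝 p, q.1 ∈ e.source :=
      continuousAt_fst.eventually (e.open_source.mem_nhds ht)
    filter_upwards [h3] with q hq
    simp [Function.uncurry, e.left_inv hq]
  · filter_upwards [hne] with p hp
    exact (analyticAt_inCoord (hf.contMDiff_apply p.1 _) hp).deriv
  · refine frequently_ne_zero_of_analyticOrderAt_ne_top ?_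
    rw [← hc.count_eq hf hζ hca]
    exact ENat.natCast_ne_top _
  · exact Eventually.of_forall fun s => by simp [Finset.card_univ]
  · have h1 : ∀ᶠ s in 𝓝 t, ∀ j, ‖coord a (c j s)‖ < K + 1 := Filter.eventually_all.2 fun j =>
      (hc.continuousAt_coord (hca j)).norm.eventually_lt_const
        ((hK _ (Finset.mem_image_of_mem _ (Finset.mem_univ j))).trans_lt (lt_add_one K))
    filter_upwards [h1] with s hs r hr
    obtain ⟨j, -, rfl⟩ := Multiset.mem_map.1 hr
    exact (hs j).le
  · have h1 : ∀ᶠ p : M × ℂ in 𝓝 (t, ζ), ∀ j, c j p.1 ≠ a :=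
      (continuousAt_fst : Tendsto Prod.fst (𝓝 (t, ζ)) (𝓝 t)).eventually hcne
    filter_upwards [hne, h1] with p hp hp1
    exact hc.count_eq hf hp hp1

/-- The value at zero of the multiplier polynomial is comparable to the product of the values at
the critical points of the polynomial with the zeros of the dynatomic polynomial. -/
theorem MarksCriticalPoints.isTheta_multiplierPoly (hc : MarksCriticalPoints k f c)
    (hf : IsHolomorphicFamily k d f) {n : ℕ} (hn : n ≠ 0) {P : M → ℂ → ℂ}
    (hP : IsMultiplierPoly k d f n P) {a : ℂ} {t : M}
    (ha : (f t)^[n] (a : OnePoint ℂ) ≠ a) (hca : ∀ j, c j t ≠ a) :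
    (fun s => P s 0) =Θ[𝓝 t] fun s =>
      ∏ j, ((dynatomicRoots (hf.lift s) a n).map (coord a (c j s) - ·)).prod := by
  have h1 := hf.isTheta_prod_dynatomicRoots hn ha (u := fun s ζ => deriv (inCoord a (f s)) ζ)
    (v := fun s ζ => ∏ j, (coord a (c j s) - ζ)) fun ζ hζ => by
      have hζ1 : f t (par a ζ) ≠ a := iterate_ne_of_isPeriodicPt ha hζ 1
      refine (hc.isTheta_deriv hf hζ1 hca).trans (IsTheta.of_norm_eventuallyEq_norm ?_)
      refine Eventually.of_forall fun p => ?_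
      simp only [norm_prod]
      exact Finset.prod_congr rfl fun j _ => norm_sub_rev _ _
  simp only [Multiset.prod_map_prod] at h1
  refine IsTheta.trans (IsTheta.of_norm_eventuallyEq_norm ?_) h1
  filter_upwards [hf.eventually_iterate_ne ha] with s hs
  exact hP.norm_apply_zero hf hn hs

/-- The parameters for which a critical point has exact period `n` are the zeros of the
polynomial with the zeros of the dynatomic polynomial, evaluated at the critical point. -/
theorem MarksCriticalPoints.prod_dynatomicRoots_eq_zero_iff (hc : MarksCriticalPoints k f c)
    (hf : IsHolomorphicFamily k d f) {n : ℕ} (hn : n ≠ 0) {a : ℂ} {t : M}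
    (ha : (f t)^[n] (a : OnePoint ℂ) ≠ a) (hca : ∀ j, c j t ≠ a) (j : ι) :
    ((dynatomicRoots (hf.lift t) a n).map (coord a (c j t) - ·)).prod = 0 ↔
      Function.minimalPeriod (f t) (c j t) = n := by
  have hl := hf.isLift t
  have hg := hf.contMDiff_apply t
  have h1 : ((dynatomicRoots (hf.lift t) a n).map (coord a (c j t) - ·)).prod = 0 ↔
      coord a (c j t) ∈ dynatomicRoots (hf.lift t) a n := by
    rw [Multiset.prod_eq_zero_iff, Multiset.mem_map]
    exact ⟨fun ⟨ζ, hζ, h0⟩ => by rwa [sub_eq_zero.1 h0], fun h => ⟨_, h, sub_self _⟩⟩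
  have h2 : Function.IsPeriodicPt (f t) n (c j t) →
      deriv (inCoord a (f t)) (coord a (c j t)) = 0 := fun h =>
    hc.deriv_eq_zero hf hca (iterate_ne_of_isPeriodicPt ha h 1)
  rw [h1]
  constructor
  · intro h
    have h3 := hl.isPeriodicPt_of_mem_dynatomicRoots ha h
    rw [par_coord (hca j)] at h3
    have h4 := (hl.mem_dynatomicRoots_iff hg hn ha (h2 h3)).1 h
    rwa [par_coord (hca j)] at h4
  · intro h
    have h3 : Function.IsPeriodicPt (f t) n (c j t) := h ▸ Function.isPeriodicPt_minimalPeriod _ _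
    exact (hl.mem_dynatomicRoots_iff hg hn ha (h2 h3)).2 (by rwa [par_coord (hca j)])

end Comparison

/-! ### The loci of exact period -/

section Loci

open Asymptotics

variable {k : ℕ} {M : Type*} [TopologicalSpace M] [ChartedSpace (EuclideanSpace ℂ (Fin k)) M]
  {d : ℕ} {f : M → OnePoint ℂ → OnePoint ℂ}

theorem exists_coe_ne (z : OnePoint ℂ) : ∃ a : ℂ, z ≠ a := by
  by_cases h : z = ((0 : ℂ) : OnePoint ℂ)
  · exact ⟨1, fun h1 => zero_ne_one (OnePoint.coe_injective (h.symm.trans h1))⟩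
  · exact ⟨0, h⟩

theorem contMDiffAt_coord_comp {F : M → OnePoint ℂ} {x : M} {a : ℂ}
    (hF : ContMDiffAt 𝓘(ℂ, EuclideanSpace ℂ (Fin k)) 𝓘(ℂ, ℂ) ω F x) (ha : F x ≠ a) :
    ContMDiffAt 𝓘(ℂ, EuclideanSpace ℂ (Fin k)) 𝓘(ℂ, ℂ) ω (fun y => coord a (F y)) x :=
  ContMDiffAt.comp x (contMDiffAt_coord ha) hF

/-- Differences computed in a chart of the sphere and in the coordinate `1 / (z - a)` are
comparable. -/
theorem isTheta_chart_sub_coord_sub {X : Type*} [TopologicalSpace X] {F G : X → OnePoint ℂ} {x : X}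
    (hF : ContinuousAt F x) (hG : ContinuousAt G x) (h : F x = G x)
    {χ : OpenPartialHomeomorph (OnePoint ℂ) ℂ}
    (hχ : χ ∈ IsManifold.maximalAtlas 𝓘(ℂ, ℂ) ω (OnePoint ℂ)) (hs : G x ∈ χ.source) {a : ℂ}
    (ha : G x ≠ a) :
    (fun y => χ (F y) - χ (G y)) =Θ[𝓝 x] fun y => coord a (F y) - coord a (G y) := by
  obtain ⟨h1, h2, -⟩ := exists_transition hχ ha hs
  have hFa : ∀ᶠ y in 𝓝 x, F y ≠ a := hF.eventually_ne (h ▸ ha)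
  have hGa : ∀ᶠ y in 𝓝 x, G y ≠ a := hG.eventually_ne ha
  have hFs : ∀ᶠ y in 𝓝 x, F y ∈ χ.source := hF.eventually (χ.open_source.mem_nhds (h ▸ hs))
  have hGs : ∀ᶠ y in 𝓝 x, G y ∈ χ.source := hG.eventually (χ.open_source.mem_nhds hs)
  have hcoord : Tendsto (fun y => (coord a (F y), coord a (G y))) (𝓝 x)
      (𝓝 (coord a (G x), coord a (G x))) := by
    refine Tendsto.prodMk_nhds ?_ ?_
    · have := ContinuousAt.comp_of_eq (contMDiffAt_coord ha).continuousAt hF h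
      rwa [ContinuousAt, Function.comp_apply, h] at this
    · exact ContinuousAt.comp_of_eq (contMDiffAt_coord ha).continuousAt hG rfl
  have hchart : Tendsto (fun y => (χ (F y), χ (G y))) (𝓝 x) (𝓝 (χ (G x), χ (G x))) := by
    refine Tendsto.prodMk_nhds ?_ ?_
    · have := ContinuousAt.comp_of_eq (χ.continuousAt hs) hF h
      rwa [ContinuousAt, Function.comp_apply, h] at this
    · exact ContinuousAt.comp_of_eq (χ.continuousAt hs) hG rfl
  constructor
  · have h3 := (h2.hasStrictDerivAt.hasStrictFDerivAt.isBigO_sub).comp_tendsto hcoord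
    refine h3.congr' ?_ (Eventually.of_forall fun _ => rfl)
    filter_upwards [hFa, hGa] with y hy hy'
    simp only [Function.comp, par_coord hy, par_coord hy']
  · have h3 := (h1.hasStrictDerivAt.hasStrictFDerivAt.isBigO_sub).comp_tendsto hchart
    refine h3.congr' ?_ (Eventually.of_forall fun _ => rfl)
    filter_upwards [hFs, hGs] with y hy hy'
    simp only [Function.comp, χ.left_inv hy, χ.left_inv hy']

theorem coincidenceOrder_zero {g : M → ℂ} {x : M} (h : g x = 0) :
    coincidenceOrder k g (fun _ => (0 : ℂ)) x = ordAt k g x := by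
  rw [coincidenceOrder, if_pos h]
  refine congrArg (fun u => vanishingOrder u _) (funext fun y => ?_)
  simp [chartAt_self_eq]

theorem IsHolomorphicFamily.contMDiff_orbitMap (hf : IsHolomorphicFamily k d f)
    {c : M → OnePoint ℂ} (hc : ContMDiff 𝓘(ℂ, EuclideanSpace ℂ (Fin k)) 𝓘(ℂ, ℂ) ω c) (n : ℕ) :
    ContMDiff 𝓘(ℂ, EuclideanSpace ℂ (Fin k)) 𝓘(ℂ, ℂ) ω (orbitMap f c n) :=
  (hf.contMDiff_iterate n).comp (contMDiff_id.prodMk hc)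

/-- The parameters for which `c` is a periodic point of exact period `n`. -/
def exactPeriodSet {X Y : Type*} (f : X → Y → Y) (c : X → Y) (n : ℕ) : Set X :=
  {t | Function.minimalPeriod (f t) (c t) = n}

theorem orbitMap_eq_of_mem_exactPeriodSet {c : M → OnePoint ℂ} {n : ℕ} {t : M}
    (h : t ∈ exactPeriodSet f c n) : orbitMap f c n t = c t := by
  have h1 : Function.minimalPeriod (f t) (c t) = n := h
  rw [orbitMap, ← h1]
  exact Function.isPeriodicPt_minimalPeriod (f t) (c t)

variable [IsManifold 𝓘(ℂ, EuclideanSpace ℂ (Fin k)) ω M]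

/-- Orders of coincidence can be computed in the coordinate `1 / (z - a)`. -/
theorem coincidenceOrder_eq_ordAt {F G : M → OnePoint ℂ} {x : M}
    (hF : ContMDiffAt 𝓘(ℂ, EuclideanSpace ℂ (Fin k)) 𝓘(ℂ, ℂ) ω F x)
    (hG : ContMDiffAt 𝓘(ℂ, EuclideanSpace ℂ (Fin k)) 𝓘(ℂ, ℂ) ω G x) (h : F x = G x) {a : ℂ}
    (ha : G x ≠ a) :
    coincidenceOrder k F G x = ordAt k (fun y => coord a (F y) - coord a (G y)) x := by
  have hs : G x ∈ (chartAt ℂ (G x)).source := mem_chart_source ℂ (G x)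
  have hχ := chart_mem_maximalAtlas_sphere (G x)
  have hχ' := contMDiffAt_of_mem_maximalAtlas hχ hs
  rw [coincidenceOrder, if_pos h]
  refine ordAt_eq_of_isTheta (h₁ := fun y => chartAt ℂ (G x) (F y) - chartAt ℂ (G x) (G y))
    ((ContMDiffAt.comp_of_eq hχ' hF h).sub (ContMDiffAt.comp_of_eq hχ' hG rfl))
    ((contMDiffAt_coord_comp hF (h ▸ ha)).sub (contMDiffAt_coord_comp hG ha)) ?_
  exact isTheta_chart_sub_coord_sub hF.continuousAt hG.continuousAt h hχ hs ha

/-- Holomorphic maps to the sphere that agree on an open set are equal. -/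
theorem eq_of_nonempty_interior [PreconnectedSpace M] {F G : M → OnePoint ℂ}
    (hF : ContMDiff 𝓘(ℂ, EuclideanSpace ℂ (Fin k)) 𝓘(ℂ, ℂ) ω F)
    (hG : ContMDiff 𝓘(ℂ, EuclideanSpace ℂ (Fin k)) 𝓘(ℂ, ℂ) ω G)
    (h : (interior {x | F x = G x}).Nonempty) : F = G := by
  have hclosed : IsClosed (interior {x | F x = G x}) := by
    refine isClosed_of_closure_subset fun x hx => ?_
    have hx' : F x = G x :=
      (isClosed_eq hF.continuous hG.continuous).closure_interior_subset hx
    obtain ⟨a, ha⟩ := exists_coe_ne (G x)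
    set u : M → ℂ := fun y => coord a (F y) - coord a (G y) with hu
    have huan := (contMDiffAt_coord_comp (hF x) (hx' ▸ ha)).sub (contMDiffAt_coord_comp (hG x) ha)
    set e := chartAt (EuclideanSpace ℂ (Fin k)) x with he
    have he' : e ∈ holAtlas k M := IsManifold.chart_mem_maximalAtlas x
    have hxe : x ∈ e.source := mem_chart_source _ x
    have h1 : AnalyticAt ℂ (fun z => u (e.symm z)) (e x) := (contMDiffAt_iff_analyticAt he' hxe).1 huan
    obtain ⟨ε, hε, hB⟩ := Metric.eventually_nhds_iff_ball.1
      (h1.eventually_analyticAt.and (e.open_target.mem_nhds (e.map_source hxe)))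
    have hzero : ∀ z ∈ Metric.ball (e x) ε, u (e.symm z) = 0 := by
      by_contra! hne
      have hmem : e.source ∩ e ⁻¹' Metric.ball (e x) ε ∈ 𝓝 x :=
        inter_mem (e.open_source.mem_nhds hxe)
          ((e.continuousAt hxe).preimage_mem_nhds (Metric.ball_mem_nhds _ hε))
      obtain ⟨y, ⟨hys, hyB⟩, hyW⟩ := mem_closure_iff_nhds.1 hx _ hmem
      refine frequently_ne_zero_of_exists_ne_zero (convex_ball (e x) ε).isPreconnected
        (fun z hz => (hB z hz).1) hne hyB ?_
      refine (eventually_nhds_chart hys (p := fun y => ¬ u y ≠ 0)).2 ?_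
      filter_upwards [isOpen_interior.mem_nhds hyW] with y' hy'
      have h2 : F y' = G y' := interior_subset (s := {x | F x = G x}) hy'
      simp [hu, h2]
    have h2 : ∀ᶠ y in 𝓝 x, u y = 0 := by
      rw [← eventually_nhds_chart hxe]
      exact Metric.eventually_nhds_iff_ball.2 ⟨ε, hε, hzero⟩
    rw [mem_interior_iff_mem_nhds]
    filter_upwards [h2, hF.continuous.continuousAt.eventually_ne (hx' ▸ ha : F x ≠ a),
      hG.continuous.continuousAt.eventually_ne ha] with y hy hyF hyG
    exact coord_injOn hyF hyG (sub_eq_zero.1 hy)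
  have huniv := IsClopen.eq_univ ⟨hclosed, isOpen_interior⟩ h
  funext x
  have hx : x ∈ interior {x | F x = G x} := huniv ▸ mem_univ x
  exact interior_subset (s := {x | F x = G x}) hx

variable {ι : Type*} [Fintype ι] {c : ι → M → OnePoint ℂ}

theorem MarksCriticalPoints.eventually_mem_exactPeriodSet_iff (hc : MarksCriticalPoints k f c)
    (hf : IsHolomorphicFamily k d f) {n : ℕ} (hn : n ≠ 0) {a : ℂ} {t : M}
    (ha : (f t)^[n] (a : OnePoint ℂ) ≠ a) (hca : ∀ j, c j t ≠ a) (j : ι) :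
    ∀ᶠ s in 𝓝 t, s ∈ exactPeriodSet f (c j) n ↔
      ((dynatomicRoots (hf.lift s) a n).map (coord a (c j s) - ·)).prod = 0 := by
  have h1 : ∀ᶠ s in 𝓝 t, ∀ i, c i s ≠ a := Filter.eventually_all.2 fun i =>
    (hc.1 i).continuous.continuousAt.eventually_ne (hca i)
  filter_upwards [h1, hf.eventually_iterate_ne ha] with s hs has
  exact (hc.prod_dynatomicRoots_eq_zero_iff hf hn has hs j).symm

/-- A critical point that is a limit of points of exact period `n` has exact period `n`, since it
is a simple fixed point of the limit of the `n`-th iterates. -/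
theorem MarksCriticalPoints.isClosed_exactPeriodSet (hc : MarksCriticalPoints k f c)
    (hf : IsHolomorphicFamily k d f) (hd : 2 ≤ d) {n : ℕ} (hn : n ≠ 0) (j : ι) :
    IsClosed (exactPeriodSet f (c j) n) := by
  rw [← isOpen_compl_iff, isOpen_iff_mem_nhds]
  intro t ht
  obtain ⟨a, ha, hca⟩ := hf.exists_iterate_ne hd hn t (fun j => c j t)
  have h1 := hc.eventually_mem_exactPeriodSet_iff hf hn ha hca j
  have h2 := hf.continuousAt_prod_dynatomicRoots hn ha (hc.continuousAt_coord (hca j))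
  filter_upwards [h1, h2.eventually_ne fun h0 => ht (h1.self_of_nhds.2 h0)] with s hs hs0 hsE
  exact hs0 (hs.1 hsE)

/-- The locus defined by the divisors of the equations `f_t^m(c) = c` is the set of parameters for
which `c` has exact period `n`, as soon as `n` exceeds a persistent period of `c`. -/
theorem MarksCriticalPoints.exists_exactPeriodLocus_eq [PreconnectedSpace M]
    (hc : MarksCriticalPoints k f c) (hf : IsHolomorphicFamily k d f) (hd : 2 ≤ d) (j : ι) :
    ∃ N : ℕ, ∀ n, N < n → interior (exactPeriodSet f (c j) n) = ∅ ∧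
      exactPeriodLocus f (c j) n = exactPeriodSet f (c j) n := by
  -- Take for `N` a persistent period of `c j` if there is one, and `0` otherwise.
  have key : ∃ N : ℕ, ∀ n, N < n → interior (exactPeriodSet f (c j) n) = ∅ ∧
      (orbitMap f (c j) n = c j → exactPeriodSet f (c j) n = ∅) := by
    by_cases hper : ∃ m, 0 < m ∧ orbitMap f (c j) m = c j
    · obtain ⟨m, hm, h1⟩ := hper
      refine ⟨m, fun n hn => ?_⟩
      have h2 : exactPeriodSet f (c j) n = ∅ := by
        refine eq_empty_of_forall_notMem fun t ht => ?_
        have h3 : Function.IsPeriodicPt (f t) m (c j t) := congrFun h1 t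
        have h4 : Function.minimalPeriod (f t) (c j t) = n := ht
        have h5 := h3.minimalPeriod_le hm
        omega
      exact ⟨by rw [h2, interior_empty], fun _ => h2⟩
    · refine ⟨0, fun n hn => ⟨?_, fun h => absurd ⟨n, hn, h⟩ hper⟩⟩
      by_contra hne
      refine hper ⟨n, hn, eq_of_nonempty_interior (hf.contMDiff_orbitMap (hc.1 j) n) (hc.1 j) ?_⟩
      exact (nonempty_iff_ne_empty.2 hne).mono
        (interior_mono fun t ht => orbitMap_eq_of_mem_exactPeriodSet ht)
  obtain ⟨N, hN⟩ := key
  refine ⟨N, fun n hn => ⟨(hN n hn).1, ?_⟩⟩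
  have hn0 : 0 < n := (Nat.zero_le N).trans_lt hn
  rw [exactPeriodLocus, ← (hc.isClosed_exactPeriodSet hf hd hn0.ne' j).closure_eq]
  congr 1
  ext t
  simp only [Set.mem_sdiff, mem_iUnion, not_exists, coincidenceSupport, mem_ofPred_eq, not_and]
  constructor
  · rintro ⟨⟨hne, ht⟩, h1⟩
    have hper : Function.IsPeriodicPt (f t) n (c j t) := ht
    by_contra hl
    refine h1 (Function.minimalPeriod (f t) (c j t)) (Nat.mem_properDivisors.2
      ⟨hper.minimalPeriod_dvd, lt_of_le_of_ne (hper.minimalPeriod_le hn0) hl⟩) (fun h2 => hne ?_)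
      (Function.isPeriodicPt_minimalPeriod (f t) (c j t))
    funext s
    have h3 : Function.IsPeriodicPt (f s) (Function.minimalPeriod (f t) (c j t)) (c j s) :=
      congrFun h2 s
    exact h3.trans_dvd hper.minimalPeriod_dvd
  · intro ht
    refine ⟨⟨fun h => ?_, orbitMap_eq_of_mem_exactPeriodSet ht⟩, fun m hm _ h1 => ?_⟩
    · rw [(hN n hn).2 h] at ht
      exact ht
    · obtain ⟨h2, h3⟩ := Nat.mem_properDivisors.1 hm
      have h4 : Function.IsPeriodicPt (f t) m (c j t) := h1
      have h5 := h4.minimalPeriod_le (Nat.pos_of_dvd_of_pos h2 hn0)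
      have h6 : Function.minimalPeriod (f t) (c j t) = n := ht
      omega

theorem interior_iUnion_eq_empty {X κ : Type*} [TopologicalSpace X] [Finite κ] {E : κ → Set X}
    (hE : ∀ j, IsClosed (E j)) (h : ∀ j, interior (E j) = ∅) : interior (⋃ j, E j) = ∅ := by
  classical
  have := Fintype.ofFinite κ
  have H : ∀ s : Finset κ, IsClosed (⋃ j ∈ s, E j) ∧ interior (⋃ j ∈ s, E j) = ∅ := by
    intro s
    induction s using Finset.induction_on with
    | empty => simp
    | insert j s _ ih =>
      rw [Finset.set_biUnion_insert]
      exact ⟨(hE j).union ih.1,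
        (interior_union_isClosed_of_interior_empty (hE j) ih.2).trans (h j)⟩
  simpa using (H Finset.univ).2

/-- Locally, the value at zero of the multiplier polynomial is comparable to the product of the
functions defining the divisors of the marked critical points. -/
theorem MarksCriticalPoints.exists_local_equations (hc : MarksCriticalPoints k f c)
    (hf : IsHolomorphicFamily k d f) (hd : 2 ≤ d) {n : ℕ} (hn : n ≠ 0) {P : M → ℂ → ℂ}
    (hP : IsMultiplierPoly k d f n P) (t : M) :
    ∃ h : ι → M → ℂ,
      (∀ j, ContMDiffAt 𝓘(ℂ, EuclideanSpace ℂ (Fin k)) 𝓘(ℂ, ℂ) ω (h j) t) ∧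
      (∀ j, ∀ᶠ s in 𝓝 t, s ∈ exactPeriodSet f (c j) n ↔ h j s = 0) ∧
      ((fun s => P s 0) =Θ[𝓝 t] fun s => ∏ j, h j s) ∧
      ∀ j, ∀ᶠ s in 𝓝 t, s ∈ exactPeriodSet f (c j) n →
        coincidenceOrder k (orbitMap f (c j) n) (c j) s = ordAt k (h j) s := by
  classical
  obtain ⟨a, ha, hca⟩ := hf.exists_iterate_ne hd hn t (fun j => c j t)
  set u : ι → M → ℂ := fun j s =>
    ((dynatomicRoots (hf.lift s) a n).map (coord a (c j s) - ·)).prod with hu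
  have huE : ∀ j, ∀ᶠ s in 𝓝 t, s ∈ exactPeriodSet f (c j) n ↔ u j s = 0 := fun j =>
    hc.eventually_mem_exactPeriodSet_iff hf hn ha hca j
  have hj : ∀ j, ∃ h : M → ℂ, ContMDiffAt 𝓘(ℂ, EuclideanSpace ℂ (Fin k)) 𝓘(ℂ, ℂ) ω h t ∧
      u j =Θ[𝓝 t] h ∧ ∀ᶠ s in 𝓝 t, s ∈ exactPeriodSet f (c j) n →
        coincidenceOrder k (orbitMap f (c j) n) (c j) s = ordAt k h s := by
    intro j
    have hθ := hc.continuousAt_coord (hca j)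
    have hcne : ∀ᶠ s in 𝓝 t, c j s ≠ a := (hc.1 j).continuous.continuousAt.eventually_ne (hca j)
    by_cases ht : t ∈ exactPeriodSet f (c j) n
    · have h0 := orbitMap_eq_of_mem_exactPeriodSet ht
      refine ⟨fun s => coord a (orbitMap f (c j) n s) - coord a (c j s),
        (contMDiffAt_coord_comp (hf.contMDiff_orbitMap (hc.1 j) n t) (h0 ▸ hca j)).sub
          (contMDiffAt_coord_comp (hc.1 j t) (hca j)), ?_, ?_⟩
      · refine (hf.isTheta_prod_dynatomicRoots_sub hn ha hθ ?_).trans (EventuallyEq.isTheta ?_)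
        · rw [par_coord (hca j)]; exact ht
        · filter_upwards [hcne] with s hs
          simp only [inCoord, par_coord hs, orbitMap]
      · filter_upwards [hcne] with s hs hsE
        exact coincidenceOrder_eq_ordAt (hf.contMDiff_orbitMap (hc.1 j) n s) (hc.1 j s)
          (orbitMap_eq_of_mem_exactPeriodSet hsE) hs
    · refine ⟨fun _ => 1, contMDiffAt_const, isTheta_one_of_continuousAt
        (hf.continuousAt_prod_dynatomicRoots hn ha hθ) fun h0 => ht ((huE j).self_of_nhds.2 h0), ?_⟩
      filter_upwards [(hc.isClosed_exactPeriodSet hf hd hn j).isOpen_compl.mem_nhds ht]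
        with s hs hsE using absurd hsE hs
  choose h h1 h2 h3 using hj
  refine ⟨h, h1, fun j => ?_, ?_, h3⟩
  · filter_upwards [huE j, (h2 j).1.eq_zero_imp, (h2 j).2.eq_zero_imp] with s h4 h5 h6
    exact h4.trans ⟨h6, h5⟩
  · exact (hc.isTheta_multiplierPoly hf hn hP ha hca).trans (IsTheta.finsetProd fun j _ => h2 j)

end Loci

end HolDyn

theorem mainTheorem4 {k : ℕ} {Λ : Type*} [TopologicalSpace Λ] [T2Space Λ] [ConnectedSpace Λ]
    [ChartedSpace (EuclideanSpace ℂ (Fin k)) Λ]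
    [IsManifold 𝓘(ℂ, EuclideanSpace ℂ (Fin k)) ω Λ]
    {d : ℕ} (hd : 1 < d) (f : Λ → OnePoint ℂ → OnePoint ℂ)
    (hf : IsHolomorphicFamily k d f)
    (c : Fin (2 * d - 2) → Λ → OnePoint ℂ)
    (hc : MarksCriticalPoints k f c) (t₀ : Λ) :
    ∃ U : Set Λ, IsOpen U ∧ t₀ ∈ U ∧ ∃ N₀ : ℕ, ∀ n : ℕ, N₀ < n →
      Current.EqualOn U (perMultiplier (k := k) d f n 0) (∑ j, perCritical f (c j) n) := by
  choose N hN using fun j => hc.exists_exactPeriodLocus_eq hf hd j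
  obtain ⟨N₀, hN₀⟩ := (Finset.univ.image N).exists_le
  -- the equality holds on the whole parameter space
  refine ⟨univ, isOpen_univ, mem_univ t₀, N₀, fun n hn φ _ => ?_⟩
  have hn0 : n ≠ 0 := (Nat.zero_le N₀).trans_lt hn |>.ne'
  have hE : ∀ j, interior (exactPeriodSet f (c j) n) = ∅ ∧
      exactPeriodLocus f (c j) n = exactPeriodSet f (c j) n := fun j =>
    hN j n ((hN₀ _ (Finset.mem_image_of_mem N (Finset.mem_univ j))).trans_lt hn)
  set P := multiplierPoly k d f n with hPdef
  have hP : IsMultiplierPoly k d f n P := hf.isMultiplierPoly hd hn0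
  have hPan : ContMDiff 𝓘(ℂ, EuclideanSpace ℂ (Fin k)) 𝓘(ℂ, ℂ) ω fun t => P t 0 :=
    hP.1.comp (contMDiff_id.prodMk contMDiff_const)
  choose h h1 h2 h3 h4 using hc.exists_local_equations hf hd hn0 hP
  have hA : {t | P t 0 = 0} = ⋃ j, exactPeriodSet f (c j) n := by
    ext t
    have h5 : P t 0 = 0 ↔ ∏ j, h t j t = 0 :=
      ⟨(h3 t).2.eq_zero_imp.self_of_nhds, (h3 t).1.eq_zero_imp.self_of_nhds⟩
    rw [mem_ofPred_eq, h5, Finset.prod_eq_zero_iff, mem_iUnion]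
    exact ⟨fun ⟨j, _, h6⟩ => ⟨j, (h2 t j).self_of_nhds.2 h6⟩,
      fun ⟨j, h6⟩ => ⟨j, Finset.mem_univ j, (h2 t j).self_of_nhds.1 h6⟩⟩
  have hint : interior {t | P t 0 = 0} = ∅ := by
    rw [hA]
    exact interior_iUnion_eq_empty (fun j => hc.isClosed_exactPeriodSet hf hd hn0 j) fun j => (hE j).1
  have hne : (fun t => P t 0) ≠ fun _ => 0 := by
    intro h0
    have h5 : {t | P t 0 = 0} = univ := eq_univ_of_forall fun t => congrFun h0 t
    rw [h5, interior_univ] at hint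
    exact (hint ▸ mem_univ t₀ : t₀ ∈ (∅ : Set Λ))
  have hsupp : coincidenceSupport (fun t => P t 0) (fun _ => (0 : ℂ)) = {t | P t 0 = 0} := by
    ext t
    exact ⟨fun h5 => h5.2, fun h5 => ⟨hne, h5⟩⟩
  rw [perMultiplier, coincidenceCurrent, ← hPdef, hsupp, Finset.sum_apply]
  simp only [perCritical, (hE _).2]
  refine divisorCurrent_eq_sum hint (fun x => ⟨fun t => P t 0, h x, hPan x, h1 x,
    Eventually.of_forall fun y => Iff.rfl, h2 x, h3 x, Eventually.of_forall fun y hy => ?_, h4 x⟩) φ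
  exact coincidenceOrder_zero hy
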